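/- Setting. Let $p\neq 2$ be prime and let $K$ be a division algebra of finite dimension $n$ over $\mathbb Q_p$ (e.g. a local field with $n\le 3$ or the quaternion algebra with $n=4$), with normalized absolute value $\|\cdot\|$, prime element $\beta$, $q=\|\beta\|^{-1}$, Haar measure $dx$ giving the unit ball measure $1$, and an additive character $\chi$ of rank zero; $Ff(\xi)=\int_K\chi(\xi x)f(x)\,dx$. Let $h$ be an anisotropic quadratic form on the $\mathbb Q_p$-vector space $K$, $\alpha\ge n/2$, $m>0$, $a(\xi)=|h(\xi)|_p^{\alpha}$, $\mathbb A=F^{-1}M_aF$ ($M_a$ is multiplication by $a$). For $\Pi\subset K$ compact and open let $\mathcal D(\Pi)$ be the space of real locally constant functions vanishing outside $\Pi$, and let $\mathbb A_\Pi u=(\mathbb Au)|_\Pi$ for $u\in\mathcal D(\Pi)$. For a Gaussian variable with variance $c$ under the free Gaussian measure (mean zero, covariance $(f,(\mathbb A+m^2)^{-1}g)$), Wick powers are always taken with respect to that free measure: $$:t^k:\;=\sum_{j\le k/2}\frac{(-1)^jk!}{2^jj!(k-2j)!}\,t^{k-2j}c^j ,\qquad :P(t):\;=\sum_j a_j:t^j:\quad\text{for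 } P=\sum_j a_jX^j .$$ Lattice Schwinger functions. Let $\Pi$ be the disjoint union of balls $O_i$, $i=1,\dots,\eta$, of radius $\delta=q^l$ ($l\in\mathbb Z$) with chosen centres $x_i$. Put $e_i=q^{-l/2}1_{O_i}$ and let $(\varphi_\delta(e_i))_i$ be centred Gaussian with covariance $(e_i,(\mathbb A_\Pi+m^2)^{-1}e_j)$ and law $\mu_\delta^\Pi$. Put $\varphi_\delta(f)=\sum_i f(x_i)\varphi_\delta(e_i)$, $:P(\varphi_\delta):(g)=\sum_i g(x_i):P(\varphi_\delta(e_i)):$ and $$S_{\delta,g}^{(\Pi)}(h_1,\dots,h_r)=\frac{\int\varphi_\delta(h_1)\cdots\varphi_\delta(h_r)\,e^{-:P(\varphi_\delta):(g)}\,d\mu_\delta^\Pi}{\int e^{-:P(\varphi_\delta):(g)}\,d\mu_\delta^\Pi}.$$ Half-Dirichlet Schwinger functions. Let $\mu_0^\Pi$ be the centred Gaussian measure on $\mathcal D'(\Pi)$ with covariance $(f,(\mathbb A_\Pi+m^2)^{-1}g)$. Let $\delta_\kappa$ be $q^{\kappa}$ times the indicator of the ball of radius $q^{-\kappa}$ about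 $0$, and $\varphi_\kappa=\varphi*\delta_\kappa$. Let $:P(\varphi):(g)$ be the limit in $L_2(\mu_0^\Pi)$, as $\kappa\to\infty$, of $\int :P(\varphi_\kappa(x)):g(x)\,dx$, and $$S_{g}^{(\Pi)}(h_1,\dots,h_r)=\frac{\int\varphi(h_1)\cdots\varphi(h_r)\,e^{-:P(\varphi):(g)}\,d\mu_0^\Pi}{\int e^{-:P(\varphi):(g)}\,d\mu_0^\Pi}.$$ Theorem 4.2. Let $P(X)=Q(X)-\lambda X$, where $Q$ is an even real polynomial with positive leading coefficient and $\lambda\ge 0$. Let $\Pi\subset\Pi'$ be disjoint unions of finitely many balls of radius $\delta=q^l$, the chosen centres of the balls of $\Pi$ being among those for $\Pi'$. Let $g,h_1,\dots,h_r\in\mathcal D(\Pi)$ be nonnegative. Then the integrals defining the lattice Schwinger functions converge absolutely and $$S_{\delta,g}^{(\Pi)}(h_1,\dots,h_r)\le S_{\delta,g}^{(\Pi')}(h_1,\dots,h_r).$$ Moreover the half-Dirichlet Schwinger functions are well defined (the Gaussian measures and the $L_2$-limits exist and the integrals converge absolutely) and $$S_{g}^{(\Pi)}(h_1,\dots,h_r)\le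 S_{g}^{(\Pi')}(h_1,\dots,h_r).$$ -/

import Mathlib

open MeasureTheory ProbabilityTheory Filter Topology Polynomial

/-- The normalized absolute value `‖x‖` of a finite-dimensional division algebra `K` over `ℚ_p`:
the factor by which multiplication by `x` changes Haar measure, i.e. the `p`-adic absolute value of
the determinant of left multiplication by `x`. -/
noncomputable def absK (p : ℕ) [Fact p.Prime] {K : Type*} [DivisionRing K] [Algebra ℚ_[p] K]
    (x : K) : ℝ :=
  ‖Algebra.norm ℚ_[p] x‖

/-- The real test functions on `U`: locally constant real functions on `K` that vanish
outside `U`. It is used for compact open `U`, where this is the (real) Bruhat-Schwartz space. -/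
def TestFun {K : Type*} [TopologicalSpace K] (U : Set K) : Submodule ℝ (K → ℝ) where
  carrier := {f | IsLocallyConstant f ∧ ∀ x, x ∉ U → f x = 0}
  add_mem' := by
    rintro f g ⟨hf, hf0⟩ ⟨hg, hg0⟩
    exact ⟨hf.add hg, fun x hx => by simp [hf0 x hx, hg0 x hx]⟩
  zero_mem' := ⟨IsLocallyConstant.const 0, fun _ _ => rfl⟩
  smul_mem' := by
    rintro c f ⟨hf, hf0⟩
    exact ⟨hf.comp (fun t : ℝ => c • t), fun x hx => by simp [hf0 x hx]⟩

/-- The real distributions on `U`. For compact open `U` the space of test functions is an inductive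
limit of finite-dimensional spaces, so that every linear functional on it is continuous. -/
abbrev Distr {K : Type*} [TopologicalSpace K] (U : Set K) : Type _ :=
  Module.Dual ℝ (TestFun U)

/-- The cylindrical `σ`-algebra. -/
instance Distr.instMeasurableSpace {K : Type*} [TopologicalSpace K] (U : Set K) :
    MeasurableSpace (Distr U) :=
  ⨆ f : TestFun U, MeasurableSpace.comap (fun φ : Distr U => φ f) inferInstance

open Classical in
/-- The value `φ(f)`, where `f` is given as a function on `K` (and `0` if `f` is not a test function
on `U`). -/
noncomputable def Distr.eval {K : Type*} [TopologicalSpace K] {U : Set K} (φ : Distr U)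
    (f : K → ℝ) : ℝ :=
  if hf : f ∈ TestFun U then φ ⟨f, hf⟩ else 0

/-- The Wick power `:t^k:` of a centred Gaussian variable, the renormalization being taken with
respect to a Gaussian measure under which this variable has variance `c`. -/
noncomputable def wickPow (k : ℕ) (c t : ℝ) : ℝ :=
  ∑ j ∈ Finset.range (k / 2 + 1),
    (-1) ^ j * (k.factorial : ℝ) / (2 ^ j * (j.factorial : ℝ) * ((k - 2 * j).factorial : ℝ)) *
      t ^ (k - 2 * j) * c ^ j

/-- The Wick polynomial `:P(t): = ∑ a_j :t^j:`, with variance `c`. -/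
noncomputable def wickPoly (P : ℝ[X]) (c t : ℝ) : ℝ :=
  P.sum fun j a => a * wickPow j c t

/-- The data of the model: the normalized Haar measure and a rank zero additive character of `K`, a
prime element, an anisotropic quadratic form on `K` as a vector space over `ℚ_p`, the
exponent `α` and the mass `m`.

The identification of `ℚ_p^n` with `K` is a linear isomorphism, so a quadratic form on `ℚ_p^n`
is the same as one on `K`. An anisotropic form exists only if `n = [K : ℚ_p] ≤ 4`. The cases in view
are a field `K` with `n ≤ 3`, the quaternion division algebra with `n = 4`, and forms with
`|h(βξ)|_p = ‖β‖^{2/n} |h(ξ)|_p`, for which the symbol `|h(ξ)|_p^α` is `‖ξ‖^{2α/n} γ(u_ξ)`; nothing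
below needs these restrictions. -/
structure PadicModel (p : ℕ) [Fact p.Prime] (K : Type*) [DivisionRing K] [Algebra ℚ_[p] K]
    [TopologicalSpace K] [MeasurableSpace K] where
  /-- Haar measure, `dx` -/
  vol : Measure K
  isAddHaar : vol.IsAddHaarMeasure
  vol_unitBall : vol {x : K | absK p x ≤ 1} = 1
  /-- a prime element -/
  β : K
  β_lt_one : absK p β < 1
  β_max : ∀ x : K, absK p x < 1 → absK p x ≤ absK p β
  /-- the additive character; it has rank zero: it is trivial on the unit ball and on no larger
  ball -/
  χ : AddChar K Circle
  continuous_χ : Continuous χ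
  χ_trivial : ∀ x : K, absK p x ≤ 1 → χ x = 1
  χ_nontrivial : ∃ x : K, absK p x ≤ (absK p β)⁻¹ ∧ χ x ≠ 1
  /-- the elliptic quadratic form -/
  h : QuadraticForm ℚ_[p] K
  anisotropic : h.Anisotropic
  α : ℝ
  le_α : (Module.finrank ℚ_[p] K : ℝ) / 2 ≤ α
  m : ℝ
  m_pos : 0 < m

namespace PadicModel

variable {p : ℕ} [Fact p.Prime] {K : Type*} [DivisionRing K] [Algebra ℚ_[p] K]
  [TopologicalSpace K] [MeasurableSpace K] (D : PadicModel p K)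

/-- `q = ‖β‖⁻¹`, the cardinality of the residue field of `K`. -/
noncomputable def q : ℝ := (absK p D.β)⁻¹

/-- The ball `O_l(c)` of radius `q^l`. -/
def ball (l : ℤ) (c : K) : Set K := {x | absK p (x - c) ≤ D.q ^ l}

/-- The union of the balls of radius `q^l` with centres in `C`. -/
def region (l : ℤ) (C : Finset K) : Set K := ⋃ c ∈ C, D.ball l c

/-- The symbol `a(ξ) = |h(ξ)|_p^α`. -/
noncomputable def symbol (ξ : K) : ℝ := ‖D.h ξ‖ ^ D.α

/-- Fourier transform. -/
noncomputable def fourier (f : K → ℂ) (ξ : K) : ℂ :=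
  ∫ x, (D.χ (ξ * x) : ℂ) * f x ∂D.vol

/-- The Fourier multiplier `F⁻¹ M_b F`. -/
noncomputable def multiplier (b : K → ℝ) (f : K → ℂ) (x : K) : ℂ :=
  ∫ ξ, (starRingEnd ℂ) (D.χ (ξ * x) : ℂ) * ((b ξ : ℂ) * D.fourier f ξ) ∂D.vol

/-- The elliptic operator `𝔸 = F⁻¹ M_a F`. -/
noncomputable def opA (f : K → ℂ) : K → ℂ := D.multiplier D.symbol f

/-- The variance `(f, (𝔸 + m²)⁻¹ f)` of `φ(f)` under the free measure. -/
noncomputable def freeVariance (f : K → ℝ) : ℝ :=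
  (∫ x, (f x : ℂ) * D.multiplier (fun ξ => (D.symbol ξ + D.m ^ 2)⁻¹) (fun y => (f y : ℂ)) x
    ∂D.vol).re

open Classical in
/-- `(𝔸_U + m²)⁻¹ f` for a test function `f` on `U`. Here `𝔸_U u` is the restriction to `U` of
`𝔸 u`, `u` a test function on `U`; `𝔸_U + m²` is injective (even after closure) and maps the test
functions on a compact open `U` onto themselves, so that `u` exists and is unique. -/
noncomputable def resolvent (U : Set K) (f : K → ℝ) : K → ℝ :=
  if hu : ∃ u ∈ TestFun U, ∀ x ∈ U,
      D.opA (fun y => (u y : ℂ)) x + (D.m : ℂ) ^ 2 * (u x : ℂ) = (f x : ℂ)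
  then hu.choose else 0

/-- The covariance `(f, (𝔸_U + m²)⁻¹ g)`. -/
noncomputable def greenForm (U : Set K) (f g : K → ℝ) : ℝ :=
  ∫ x, f x * D.resolvent U g x ∂D.vol

/-! ### Lattice approximation -/

/-- The normalized indicator `q^{-l/2} 1_{O_l(c)}`. -/
noncomputable def e (l : ℤ) (c : K) : K → ℝ :=
  (D.ball l c).indicator fun _ => (√(D.q ^ l))⁻¹

/-- The covariance matrix `M^{(U,l)}`, `U` being the union of the balls `O_l(c)`, `c ∈ C`. -/
noncomputable def covMatrix (l : ℤ) (C : Finset K) : Matrix C C ℝ :=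
  Matrix.of fun i j => D.greenForm (D.region l C) (D.e l i) (D.e l j)

open Classical in
/-- The joint law of the variables `φ_δ(e_c)`, `c ∈ C`: the centred Gaussian measure with covariance
matrix `M^{(U,l)}`. -/
noncomputable def latticeMeasure (l : ℤ) (C : Finset K) : Measure (EuclideanSpace ℝ C) :=
  multivariateGaussian 0 (D.covMatrix l C)

/-- `φ_δ(f) = ∑ f(c) φ_δ(e_c)`, the variable `φ_δ(e_c)` being the coordinate `t c`. -/
noncomputable def latticeField {C : Finset K} (f : K → ℝ) (t : EuclideanSpace ℝ C) : ℝ :=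
  ∑ c : C, f c * t c

/-- `exp (-:P(φ_δ):(g))`, where `:P(φ_δ):(g) = ∑ g(c) :P(φ_δ(e_c)):`, the renormalization being with
respect to the free measure. -/
noncomputable def latticeWeight (l : ℤ) (C : Finset K) (P : ℝ[X]) (g : K → ℝ)
    (t : EuclideanSpace ℝ C) : ℝ :=
  Real.exp (-∑ c : C, g c * wickPoly P (D.freeVariance (D.e l c)) (t c))

/-- The integrals defining the lattice Schwinger function converge absolutely. -/
def LatticeConverges (l : ℤ) (C : Finset K) (P : ℝ[X]) (g : K → ℝ) {r : ℕ}
    (f : Fin r → K → ℝ) : Prop :=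
  Integrable (D.latticeWeight l C P g) (D.latticeMeasure l C) ∧
  Integrable (fun t => (∏ i, latticeField (f i) t) * D.latticeWeight l C P g t)
    (D.latticeMeasure l C)

/-- The lattice approximation `S_{δ,g}^{(U)}(f_1,…,f_r)`, `δ = q^l`. -/
noncomputable def latticeSchwinger (l : ℤ) (C : Finset K) (P : ℝ[X]) (g : K → ℝ) {r : ℕ}
    (f : Fin r → K → ℝ) : ℝ :=
  (∫ t, (∏ i, latticeField (f i) t) * D.latticeWeight l C P g t ∂D.latticeMeasure l C) /
    ∫ t, D.latticeWeight l C P g t ∂D.latticeMeasure l C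

/-! ### The half-Dirichlet (mixed) state -/

/-- `ν` is the Gaussian measure `μ_0^U` on the distributions on `U`, with mean zero and
covariance `(f, (𝔸_U + m²)⁻¹ g)`. -/
def IsDirichletField (U : Set K) (ν : Measure (Distr U)) : Prop :=
  IsProbabilityMeasure ν ∧ ∀ f : TestFun U,
    ∫ φ, Complex.exp (Complex.I * (φ f : ℂ)) ∂ν =
      Complex.exp (-(D.greenForm U f f : ℂ) / 2)

/-- `δ_κ(· - x)`, where `δ_κ` is `q^κ` times the indicator of the ball of radius `q^{-κ}`. -/
noncomputable def deltaFun (κ : ℕ) (x : K) : K → ℝ :=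
  (D.ball (-(κ : ℤ)) x).indicator fun _ => D.q ^ κ

/-- The regularized interaction `:P(φ_κ):(g) = ∫ :P(φ_κ(x)): g(x) dx` with `φ_κ = φ * δ_κ`, the
renormalization being with respect to the free measure. -/
noncomputable def regInteraction {U : Set K} (P : ℝ[X]) (g : K → ℝ) (κ : ℕ) (φ : Distr U) : ℝ :=
  ∫ x, wickPoly P (D.freeVariance (D.deltaFun κ x)) (φ.eval (D.deltaFun κ x)) * g x ∂D.vol

/-- `W` is (a version of) the interaction `:P(φ):(g)`, the limit in `L²(ν)` of the regularized
interactions as `κ → ∞`. -/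
def IsInteraction {U : Set K} (ν : Measure (Distr U)) (P : ℝ[X]) (g : K → ℝ)
    (W : Distr U → ℝ) : Prop :=
  MemLp W 2 ν ∧ Tendsto (fun κ => eLpNorm (D.regInteraction P g κ - W) 2 ν) atTop (𝓝 0)

end PadicModel

/-- The integrals defining the Schwinger function with interaction `W` converge absolutely. -/
def SchwingerConverges {K : Type*} [TopologicalSpace K] {U : Set K} (ν : Measure (Distr U))
    (W : Distr U → ℝ) {r : ℕ} (f : Fin r → K → ℝ) : Prop :=
  Integrable (fun φ => Real.exp (-W φ)) ν ∧
  Integrable (fun φ => (∏ i, φ.eval (f i)) * Real.exp (-W φ)) ν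

/-- `Z⁻¹ ∫ φ(f_1) ⋯ φ(f_r) e^{-W} dν`, `Z = ∫ e^{-W} dν`. -/
noncomputable def schwinger {K : Type*} [TopologicalSpace K] {U : Set K} (ν : Measure (Distr U))
    (W : Distr U → ℝ) {r : ℕ} (f : Fin r → K → ℝ) : ℝ :=
  (∫ φ, (∏ i, φ.eval (f i)) * Real.exp (-W φ) ∂ν) / ∫ φ, Real.exp (-W φ) ∂ν

/-! On step functions of scale `q^j` living on a union of balls, `𝔸_Π + m²` is a finite matrix,
`precision`: its entries are `q^j k(c - d)`, plus `m²` on the diagonal, where `k` is the Fourier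
transform of the symbol `a` cut off to the dual ball. The lattice field is Gaussian with this
precision matrix, so the theorem rests on the sign of its off-diagonal entries.

Ferromagnetism. For `p ≠ 2` an anisotropic form satisfies the strong triangle inequality, since
otherwise Hensel's lemma would produce an isotropic vector in the span of `x` and `y`. Hence every
set `{a < t}` is a subgroup. Off the diagonal the constant `M` in `M - a` does not matter, and `M -
a` is an integral over `t` of indicators of such subgroups. The real part of a character has
nonnegative integral over a bounded subgroup, so the kernel is nonpositive there
(`kern_symbol_nonpos`).

Monotonicity. The entries do not depend on the region, so the matrix of `Π` is a block of the matrix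
of `Π'`. Cutting all couplings of `Π'` that are not inside `Π` (`decoupled`) keeps the diagonal,
raises the other entries to zero, and makes the sites outside `Π` independent of those inside. As
`g` and the `h_i` vanish there, the decoupled theory has the Schwinger functions of `Π`. Wick
ordering uses the free variance, which is translation invariant, so both theories carry the same
even potentials, bounded below, and the same external field `λ g ≥ 0`. Griffiths' second inequality,
proved by Ginibre's method (`griffiths_second`), yields `lattice_correlation_le`.

Passage to the limit. Once `g` and the `h_i` are constant on balls of radius `q^{-κ}`, the theory
with interaction `:P(φ_κ):(g)` is itself such a lattice theory in the variables `φ(δ_κ(· - c))`. The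
inequality therefore holds at every large cutoff, and the cutoff has to be removed. The symbol is
constant on balls of relative radius `q^{-i}` away from zero; hence `(𝔸_Π + m²)⁻¹` applied to a
difference of consecutive approximate deltas is the free response, supported within distance
`q^{i-κ}`. Two consequences follow: the difference of the Dirichlet and the free variances at a
point stops depending on `κ`, and covariances at separated points stop changing. Changing the
variance in the Wick powers (`wickX_eq_sum_wickX`) expresses an increment in `κ` through Wick powers
for the Dirichlet covariance, and only pairs at distance at most `q^{i-κ}` contribute to its second
moment. Since `α ≥ n/2`, variances grow at most linearly in `κ`, so these second moments are at most
a polynomial in `κ` times `q^{-κ}`. Hypercontractivity (`gaussExp_pow_le`) extends this to all even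
moments, and Nelson's argument (`exists_integral_exp_neg_le`) bounds the exponential moments
uniformly, which gives convergence of the Schwinger functions. The Gaussian measure itself is the
law of a random series along a Gram-Schmidt sequence, a finite sum on each test function. -/

set_option linter.unusedSectionVars false

/-! ### Wick powers -/

/-- The coefficient of `t ^ (k - 2 * j) * (-c) ^ j` in the Wick power `:t^k:`. -/
noncomputable def wickCoeff (k j : ℕ) : ℝ :=
  (k.choose (2 * j) : ℝ) * ((2 * j).factorial / (2 ^ j * j.factorial))

theorem wickCoeff_eq_zero {k j : ℕ} (h : k < 2 * j) : wickCoeff k j = 0 := by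
  simp [wickCoeff, Nat.choose_eq_zero_of_lt h]

theorem wickCoeff_eq {k j : ℕ} (h : 2 * j ≤ k) :
    wickCoeff k j = k.factorial / (2 ^ j * j.factorial * (k - 2 * j).factorial) := by
  have h1 : (k.factorial : ℝ) = k.choose (2 * j) * (2 * j).factorial * (k - 2 * j).factorial := by
    exact_mod_cast (Nat.choose_mul_factorial_mul_factorial h).symm
  have h2 : ((k - 2 * j).factorial : ℝ) ≠ 0 := by positivity
  have h3 : (j.factorial : ℝ) ≠ 0 := by positivity
  rw [wickCoeff, h1]
  field_simp

@[simp] theorem wickCoeff_zero_right (k : ℕ) : wickCoeff k 0 = 1 := by simp [wickCoeff]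

/-- `wickCoeff k j` counts the sets of `j` disjoint pairs among `k` points. An additional point is
either unpaired or paired with one of the `k` others. -/
theorem wickCoeff_succ_succ (k j : ℕ) :
    wickCoeff (k + 1) (j + 1) = wickCoeff k (j + 1) + k * wickCoeff (k - 1) j := by
  have key : ((k.choose (2 * j + 1) : ℕ) : ℝ) * (2 * j + 1) = k * ((k - 1).choose (2 * j) : ℕ) := by
    cases k with
    | zero => simp
    | succ k =>
      have := Nat.add_one_mul_choose_eq k (2 * j)
      simp only [Nat.add_sub_cancel]
      exact_mod_cast this.symm
  have hf : (((2 * (j + 1)).factorial : ℕ) : ℝ) / (2 ^ (j + 1) * ((j + 1).factorial : ℕ)) =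
      (2 * j + 1) * (((2 * j).factorial : ℕ) / (2 ^ j * (j.factorial : ℕ))) := by
    rw [show 2 * (j + 1) = 2 * j + 1 + 1 by ring, Nat.factorial_succ, Nat.factorial_succ,
      Nat.factorial_succ]
    have h3 : (j.factorial : ℝ) ≠ 0 := by positivity
    push_cast
    field_simp
    ring
  have hc : (((k + 1).choose (2 * (j + 1)) : ℕ) : ℝ) =
      (k.choose (2 * j + 1) : ℕ) + (k.choose (2 * (j + 1)) : ℕ) := by
    rw [show 2 * (j + 1) = 2 * j + 1 + 1 by ring, Nat.choose_succ_succ]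
    push_cast
    ring
  unfold wickCoeff
  rw [hf, hc]
  linear_combination (((2 * j).factorial : ℕ) / (2 ^ j * (j.factorial : ℕ)) : ℝ) * key

/-- Choosing `j` pairs and then `i` further pairs amounts to choosing `j + i` pairs and marking `j`
of them. -/
theorem wickCoeff_mul_wickCoeff {k i j : ℕ} :
    wickCoeff k j * wickCoeff (k - 2 * j) i = wickCoeff k (j + i) * ((j + i).choose j : ℝ) := by
  by_cases h : 2 * (j + i) ≤ k
  · have h1 : 2 * j ≤ k := by omega
    have h2 : 2 * i ≤ k - 2 * j := by omega
    rw [wickCoeff_eq h, wickCoeff_eq h1, wickCoeff_eq h2,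
      show k - 2 * j - 2 * i = k - 2 * (j + i) by omega]
    have e : ((j + i).factorial : ℝ) = (j + i).choose j * j.factorial * i.factorial := by
      rw [Nat.choose_symm_add]
      exact_mod_cast (Nat.add_choose_mul_factorial_mul_factorial j i).symm
    have h3 : ((k - 2 * j).factorial : ℝ) ≠ 0 := by positivity
    have h4 : ((j + i).choose j : ℝ) ≠ 0 := by
      exact_mod_cast (Nat.choose_pos (Nat.le_add_right j i)).ne'
    rw [e, pow_add]
    field_simp
  · have h3 : wickCoeff k (j + i) = 0 := wickCoeff_eq_zero (by omega)
    rw [h3, zero_mul]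
    by_cases h1 : 2 * j ≤ k
    · rw [wickCoeff_eq_zero (k := k - 2 * j) (by omega), mul_zero]
    · rw [wickCoeff_eq_zero (by omega), zero_mul]

/-- The Wick power as a polynomial in the field. -/
noncomputable def wickX (k : ℕ) (c : ℝ) : ℝ[X] :=
  ∑ j ∈ Finset.range (k + 1), Polynomial.C (wickCoeff k j * (-c) ^ j) * X ^ (k - 2 * j)

/-- The range of summation is immaterial: the coefficient vanishes exactly where the truncated
exponent `k - 2 * j` would be wrong. This lets Wick powers of different orders be compared term by
term. -/
theorem wickX_eq_sum_range {k N : ℕ} (c : ℝ) (h : k ≤ 2 * N + 1) :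
    wickX k c =
      ∑ j ∈ Finset.range (N + 1), Polynomial.C (wickCoeff k j * (-c) ^ j) * X ^ (k - 2 * j) := by
  have aux : ∀ M : ℕ, k ≤ 2 * M + 1 →
      ∑ j ∈ Finset.range (M + 1), Polynomial.C (wickCoeff k j * (-c) ^ j) * X ^ (k - 2 * j) =
      ∑ j ∈ Finset.range (k / 2 + 1), Polynomial.C (wickCoeff k j * (-c) ^ j) * X ^ (k - 2 * j) := by
    intro M hM
    symm
    apply Finset.sum_subset
    · intro j hj
      simp only [Finset.mem_range] at *
      omega
    · intro j _ hj
      simp only [Finset.mem_range] at hj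
      rw [wickCoeff_eq_zero (by omega)]
      simp
  rw [wickX, aux k (by omega), aux N h]

theorem eval_wickX (k : ℕ) (c t : ℝ) : (wickX k c).eval t = wickPow k c t := by
  rw [wickX_eq_sum_range (N := k / 2) c (by omega), wickPow, eval_finsetSum]
  refine Finset.sum_congr rfl fun j hj => ?_
  have : 2 * j ≤ k := by simp only [Finset.mem_range] at hj; omega
  rw [wickCoeff_eq this, neg_pow]
  simp
  ring

@[simp] theorem wickX_zero (c : ℝ) : wickX 0 c = 1 := by simp [wickX]

@[simp] theorem wickX_one (c : ℝ) : wickX 1 c = X := by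
  rw [wickX_eq_sum_range (N := 0) c (by omega)]; simp

/-- The Hermite recursion. At `k = 0` the truncated index `k - 1` is harmless because its factor is
zero. -/
theorem wickX_succ (k : ℕ) (c : ℝ) :
    wickX (k + 1) c = X * wickX k c - Polynomial.C (c * k) * wickX (k - 1) c := by
  rw [wickX_eq_sum_range (k := k + 1) (N := k + 1) c (by omega),
    wickX_eq_sum_range (k := k) (N := k + 1) c (by omega),
    wickX_eq_sum_range (k := k - 1) (N := k) c (by omega),
    Finset.sum_range_succ', Finset.sum_range_succ' _ (k + 1), mul_add, Finset.mul_sum,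
    Finset.mul_sum]
  simp only [wickCoeff_succ_succ]
  have e : ∀ j ∈ Finset.range (k + 1),
      Polynomial.C ((wickCoeff k (j + 1) + k * wickCoeff (k - 1) j) * (-c) ^ (j + 1)) *
        (X : ℝ[X]) ^ (k + 1 - 2 * (j + 1)) =
      X * (Polynomial.C (wickCoeff k (j + 1) * (-c) ^ (j + 1)) * X ^ (k - 2 * (j + 1))) -
      Polynomial.C (c * k) * (Polynomial.C (wickCoeff (k - 1) j * (-c) ^ j) * X ^ (k - 1 - 2 * j)) := by
    intro j _
    have e1 : X * (Polynomial.C (wickCoeff k (j + 1) * (-c) ^ (j + 1)) * X ^ (k - 2 * (j + 1))) =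
        Polynomial.C (wickCoeff k (j + 1) * (-c) ^ (j + 1)) * (X : ℝ[X]) ^ (k + 1 - 2 * (j + 1)) := by
      by_cases h : 2 * (j + 1) ≤ k
      · rw [show k + 1 - 2 * (j + 1) = (k - 2 * (j + 1)) + 1 by omega, pow_succ]; ring
      · rw [wickCoeff_eq_zero (by omega)]; simp
    rw [e1, show k - 1 - 2 * j = k + 1 - 2 * (j + 1) by omega]
    simp only [map_mul, map_add, map_pow, map_neg]
    ring
  rw [Finset.sum_congr rfl e, Finset.sum_sub_distrib]
  simp [pow_succ]
  ring

theorem derivative_wickX (k : ℕ) (c : ℝ) :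
    derivative (wickX k c) = Polynomial.C (k : ℝ) * wickX (k - 1) c := by
  induction k using Nat.strong_induction_on with
  | _ k ih =>
    cases k with
    | zero => simp
    | succ k =>
      rw [wickX_succ, derivative_sub, derivative_mul, derivative_mul, derivative_C, derivative_X,
        ih k (by omega), ih (k - 1) (by omega)]
      cases k with
      | zero => simp
      | succ k =>
        simp only [Nat.add_sub_cancel]
        rw [wickX_succ k]
        simp only [Nat.cast_add, Nat.cast_one, map_mul, map_add, map_one]
        ring

theorem wickX_comp_neg (k : ℕ) (c : ℝ) : (wickX k c).comp (-X) = (-1) ^ k * wickX k c := by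
  induction k using Nat.strong_induction_on with
  | _ k ih =>
    cases k with
    | zero => simp
    | succ k =>
      rw [wickX_succ, sub_comp, mul_comp, mul_comp, C_comp, X_comp, ih k (by omega),
        ih (k - 1) (by omega)]
      cases k with
      | zero => simp
      | succ k =>
        simp only [Nat.add_sub_cancel, pow_succ]
        ring

theorem wickPow_neg (k : ℕ) (c t : ℝ) : wickPow k c (-t) = (-1) ^ k * wickPow k c t := by
  have := congrArg (Polynomial.eval t) (wickX_comp_neg k c)
  simpa [eval_comp, eval_wickX] using this

/-- Change of the variance in a Wick power. -/
theorem wickX_eq_sum_wickX (k : ℕ) (c d : ℝ) :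
    wickX k c = ∑ j ∈ Finset.range (k + 1),
      Polynomial.C (wickCoeff k j * d ^ j) * wickX (k - 2 * j) (c + d) := by
  have e : ∀ j ∈ Finset.range (k + 1),
      Polynomial.C (wickCoeff k j * d ^ j) * wickX (k - 2 * j) (c + d) =
      ∑ i ∈ Finset.range (k + 1), Polynomial.C (wickCoeff k (j + i) * ((j + i).choose j : ℝ) *
        (d ^ j * (-(c + d)) ^ i)) * X ^ (k - 2 * (j + i)) := by
    intro j _
    rw [wickX_eq_sum_range (N := k) _ (by omega), Finset.mul_sum]
    refine Finset.sum_congr rfl fun i _ => ?_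
    rw [← wickCoeff_mul_wickCoeff, show k - 2 * j - 2 * i = k - 2 * (j + i) by omega, ← mul_assoc,
      ← map_mul]
    congr 2
    ring
  rw [Finset.sum_congr rfl e]
  set F : ℕ → ℕ → ℝ[X] := fun j i => Polynomial.C (wickCoeff k (j + i) * ((j + i).choose j : ℝ) *
        (d ^ j * (-(c + d)) ^ i)) * X ^ (k - 2 * (j + i)) with hF
  -- Terms are regrouped by `s = j + i`, since the inner sums are then binomial expansions of `(d -
  -- (c + d)) ^ s`. Pairs of the square with `j + i > k` carry a vanishing coefficient.
  have h1 : ∑ j ∈ Finset.range (k + 1), ∑ i ∈ Finset.range (k + 1), F j i =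
      ∑ s ∈ Finset.range (k + 1), ∑ x ∈ Finset.HasAntidiagonal.antidiagonal s, F x.1 x.2 := by
    rw [← Finset.sum_product', Finset.sum_sigma']
    symm
    apply Finset.sum_of_injOn (fun x => x.2)
    · rintro ⟨s, a, b⟩ h1 ⟨s', a', b'⟩ h2 h
      simp only [Finset.coe_sigma, Set.mem_sigma_iff, Finset.mem_coe, Finset.HasAntidiagonal.mem_antidiagonal] at *
      simp only [Prod.mk.injEq] at h
      obtain ⟨rfl, rfl⟩ := h
      obtain ⟨_, rfl⟩ := h1
      obtain ⟨_, rfl⟩ := h2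
      rfl
    · rintro ⟨s, a, b⟩ h
      simp only [Finset.coe_sigma, Set.mem_sigma_iff, Finset.mem_coe, Finset.HasAntidiagonal.mem_antidiagonal,
        Finset.mem_range, Finset.coe_product, Set.mem_prod] at *
      omega
    · rintro ⟨a, b⟩ h1 h2
      have : k < 2 * (a + b) := by
        by_contra hcon
        apply h2
        refine ⟨⟨a + b, a, b⟩, ?_, rfl⟩
        simp only [Finset.coe_sigma, Set.mem_sigma_iff, Finset.mem_coe, Finset.HasAntidiagonal.mem_antidiagonal,
          Finset.mem_range, and_true]
        omega
      simp [hF, wickCoeff_eq_zero this]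
    · rintro ⟨s, a, b⟩ h
      rfl
  rw [h1, wickX]
  refine Finset.sum_congr rfl fun s _ => ?_
  have h2 : ∀ x ∈ Finset.HasAntidiagonal.antidiagonal s, F x.1 x.2 =
      Polynomial.C (wickCoeff k s * (d ^ x.1 * (-(c + d)) ^ x.2 * (s.choose x.1 : ℝ))) *
        X ^ (k - 2 * s) := by
    rintro ⟨a, b⟩ hx
    rw [Finset.HasAntidiagonal.mem_antidiagonal] at hx
    simp only at hx
    simp only [hF, hx]
    congr 2
    ring
  rw [Finset.sum_congr rfl h2, ← Finset.sum_mul, ← map_sum, ← Finset.mul_sum]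
  congr 3
  rw [show -c = d + -(c + d) by ring, add_pow, Finset.Nat.sum_antidiagonal_eq_sum_range_succ_mk]

/-- The Wick polynomial `:P(t):` as a polynomial in the field. -/
noncomputable def wickPolyX (P : ℝ[X]) (c : ℝ) : ℝ[X] :=
  P.sum fun j a => Polynomial.C a * wickX j c

theorem eval_wickPolyX (P : ℝ[X]) (c t : ℝ) : (wickPolyX P c).eval t = wickPoly P c t := by
  simp [wickPolyX, wickPoly, Polynomial.sum_def, eval_finsetSum, eval_wickX]

theorem wickPoly_eq_sum_range {P : ℝ[X]} {N : ℕ} (h : P.natDegree ≤ N) (c t : ℝ) :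
    wickPoly P c t = ∑ k ∈ Finset.range (N + 1), P.coeff k * wickPow k c t :=
  Polynomial.sum_over_range' _ (by simp) _ (by omega)

theorem wickPoly_sub (P R : ℝ[X]) (c t : ℝ) :
    wickPoly (P - R) c t = wickPoly P c t - wickPoly R c t := by
  rw [wickPoly_eq_sum_range (N := max P.natDegree R.natDegree) (natDegree_sub_le _ _),
    wickPoly_eq_sum_range (N := max P.natDegree R.natDegree) (le_max_left _ _),
    wickPoly_eq_sum_range (N := max P.natDegree R.natDegree) (le_max_right _ _),
    ← Finset.sum_sub_distrib]
  simp [sub_mul]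

theorem wickPoly_C_mul_X (a c t : ℝ) : wickPoly (Polynomial.C a * X) c t = a * t := by
  rw [wickPoly, C_mul_X_eq_monomial, Polynomial.sum_monomial_index _ _ (by simp), ← eval_wickX,
    wickX_one, eval_X]

theorem wickPoly_neg_of_even {Q : ℝ[X]} (hQ : ∀ k, Odd k → Q.coeff k = 0) (c t : ℝ) :
    wickPoly Q c (-t) = wickPoly Q c t := by
  rw [wickPoly_eq_sum_range le_rfl, wickPoly_eq_sum_range le_rfl]
  refine Finset.sum_congr rfl fun k _ => ?_
  rcases Nat.even_or_odd k with hk | hk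
  · rw [wickPow_neg, hk.neg_one_pow, one_mul]
  · simp [hQ k hk]

theorem continuous_wickPoly (P : ℝ[X]) (c : ℝ) : Continuous (wickPoly P c) := by
  have : wickPoly P c = fun t => (wickPolyX P c).eval t := by
    ext t; rw [eval_wickPolyX]
  rw [this]
  exact (wickPolyX P c).continuous

theorem natDegree_even_of_even {Q : ℝ[X]} (hQ : ∀ k, Odd k → Q.coeff k = 0)
    (h0 : 0 < Q.leadingCoeff) : Even Q.natDegree := by
  by_contra h
  rw [Nat.not_even_iff_odd] at h
  have := hQ _ h
  rw [leadingCoeff] at h0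
  exact h0.ne' this

/-- The variance is tracked explicitly because it diverges with the cutoff; a common exponent `N`
serves all orders up to the degree. -/
theorem abs_wickPow_sub_pow_le {k N : ℕ} (hk : k ≤ N) {c : ℝ} (hc : 0 ≤ c) (t : ℝ) :
    |wickPow k c t - t ^ k| ≤
      (∑ j ∈ Finset.range (k + 1), |wickCoeff k j|) * (1 + c) ^ N * (1 + |t|) ^ (k - 1) := by
  rw [← eval_wickX, wickX, eval_finsetSum, Finset.sum_range_succ']
  simp only [eval_mul, eval_C, eval_pow, eval_X, wickCoeff_zero_right, pow_zero, mul_one, mul_zero,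
    Nat.sub_zero, one_mul, add_sub_cancel_right]
  calc |∑ j ∈ Finset.range k, wickCoeff k (j + 1) * (-c) ^ (j + 1) * t ^ (k - 2 * (j + 1))|
      ≤ ∑ j ∈ Finset.range k, |wickCoeff k (j + 1) * (-c) ^ (j + 1) * t ^ (k - 2 * (j + 1))| :=
        Finset.abs_sum_le_sum_abs _ _
    _ ≤ ∑ j ∈ Finset.range k, |wickCoeff k (j + 1)| * ((1 + c) ^ N * (1 + |t|) ^ (k - 1)) := by
        refine Finset.sum_le_sum fun j hj => ?_
        rw [Finset.mem_range] at hj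
        rw [abs_mul, abs_mul, abs_pow, abs_pow, abs_neg, abs_of_nonneg hc, mul_assoc]
        refine mul_le_mul_of_nonneg_left ?_ (abs_nonneg _)
        refine mul_le_mul ?_ ?_ (by positivity) (by positivity)
        · exact (pow_le_pow_left₀ hc (by linarith) _).trans
            (pow_le_pow_right₀ (by linarith) (by omega))
        · exact (pow_le_pow_left₀ (abs_nonneg _) (by linarith) _).trans
            (pow_le_pow_right₀ (by linarith [abs_nonneg t]) (by omega))
    _ ≤ _ := by
        rw [← Finset.sum_mul, ← mul_assoc, mul_assoc, mul_assoc, Finset.sum_range_succ']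
        refine mul_le_mul_of_nonneg_right ?_ (by positivity)
        linarith [abs_nonneg (wickCoeff k 0)]

/-- A Wick polynomial of even degree with positive leading coefficient is bounded below, with at
most polynomial growth of the bound in the variance. -/
theorem exists_wickPoly_ge {Q : ℝ[X]} (hdeg : Even Q.natDegree) (hlead : 0 < Q.leadingCoeff) :
    ∃ A : ℝ, ∃ m : ℕ, 0 ≤ A ∧ ∀ c : ℝ, 0 ≤ c → ∀ t : ℝ, -(A * (1 + c) ^ m) ≤ wickPoly Q c t := by
  set n := Q.natDegree with hn
  set b : ℝ := Q.leadingCoeff with hb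
  set s : ℕ → ℝ := fun k => ∑ j ∈ Finset.range (k + 1), |wickCoeff k j| with hs
  set M : ℝ := ∑ k ∈ Finset.range (n + 1), |Q.coeff k| * (s k + 1) with hM
  have hM0 : 0 ≤ M := by positivity
  have key : ∀ c : ℝ, 0 ≤ c → ∀ t : ℝ,
      |wickPoly Q c t - b * t ^ n| ≤ M * (1 + c) ^ n * (1 + |t|) ^ (n - 1) := by
    intro c hc t
    have h1c : 1 ≤ (1 + c) ^ n := one_le_pow₀ (by linarith)
    have e : wickPoly Q c t - b * t ^ n =
        ∑ k ∈ Finset.range (n + 1), (Q.coeff k * wickPow k c t - if k = n then b * t ^ n else 0) := by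
      rw [wickPoly_eq_sum_range le_rfl, Finset.sum_sub_distrib]
      simp [hn]
    rw [e, hM, Finset.sum_mul, Finset.sum_mul]
    refine (Finset.abs_sum_le_sum_abs _ _).trans (Finset.sum_le_sum fun k hk => ?_)
    have hkn : k ≤ n := by rw [Finset.mem_range] at hk; omega
    have h1 := abs_wickPow_sub_pow_le hkn hc t
    have h2 : |wickPow k c t - t ^ k| ≤ s k * ((1 + c) ^ n * (1 + |t|) ^ (n - 1)) := by
      refine h1.trans ?_
      rw [mul_assoc]
      have : (1 + |t|) ^ (k - 1) ≤ (1 + |t|) ^ (n - 1) :=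
        pow_le_pow_right₀ (by linarith [abs_nonneg t]) (by omega)
      gcongr
    have hpos : 0 ≤ (1 + c) ^ n * (1 + |t|) ^ (n - 1) := by positivity
    split_ifs with hkeq
    · subst hkeq
      have hbq : b = Q.coeff n := rfl
      rw [hbq, ← mul_sub, abs_mul, mul_assoc, mul_assoc]
      gcongr
      linarith
    · rw [sub_zero, abs_mul, mul_assoc, mul_assoc]
      gcongr
      have h3 : |t ^ k| ≤ (1 + c) ^ n * (1 + |t|) ^ (n - 1) := by
        rw [abs_pow]
        calc |t| ^ k ≤ (1 + |t|) ^ k := pow_le_pow_left₀ (abs_nonneg _) (by linarith) _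
          _ ≤ (1 + |t|) ^ (n - 1) :=
            pow_le_pow_right₀ (by linarith [abs_nonneg t]) (by omega)
          _ ≤ _ := le_mul_of_one_le_left (by positivity) h1c
      calc |wickPow k c t| = |(wickPow k c t - t ^ k) + t ^ k| := by ring_nf
        _ ≤ |wickPow k c t - t ^ k| + |t ^ k| := abs_add_le _ _
        _ ≤ _ := by linarith
  -- Chosen so that `M * 2 ^ n ≤ b * R`: beyond `R * (1 + c) ^ n` the leading term beats the error.
  set R : ℝ := 1 + M * 2 ^ n / b with hR
  have hR1 : 1 ≤ R := by
    have : 0 ≤ M * 2 ^ n / b := by positivity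
    linarith
  -- One factor `(1 + c) ^ n` comes from the error bound, the factor `(1 + c) ^ (n * n)` from `|t| <
  -- R * (1 + c) ^ n` inserted into it.
  refine ⟨M * (1 + R) ^ n, n + n * n, by positivity, fun c hc t => ?_⟩
  have h1 := (abs_le.1 (key c hc t)).1
  have ht0 : 0 ≤ b * t ^ n := mul_nonneg hlead.le (hdeg.pow_nonneg t)
  have h1c : 1 ≤ (1 + c) ^ n := one_le_pow₀ (by linarith)
  have hcn : 0 ≤ M * (1 + c) ^ n := by positivity
  have hneg : -(M * (1 + R) ^ n * (1 + c) ^ (n + n * n)) ≤ 0 := by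
    have : 0 ≤ M * (1 + R) ^ n * (1 + c) ^ (n + n * n) := by positivity
    linarith
  by_cases hbig : R * (1 + c) ^ n ≤ |t|
  · -- the leading term dominates
    have ht1 : 1 ≤ |t| := by nlinarith
    rcases Nat.eq_zero_or_pos n with h0 | h0
    · have h00 := wickPoly_eq_sum_range (P := Q) (N := 0) (by omega) c t
      simp only [zero_add, Finset.range_one, Finset.sum_singleton] at h00
      have h01 : wickPow 0 c t = 1 := by rw [← eval_wickX]; simp
      have h02 : Q.coeff 0 = b := by rw [hb, leadingCoeff, ← hn, h0]
      rw [h00, h01, h02]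
      linarith
    refine hneg.trans ?_
    have h2 : (1 + |t|) ^ (n - 1) ≤ 2 ^ n * |t| ^ (n - 1) := by
      calc (1 + |t|) ^ (n - 1) ≤ (2 * |t|) ^ (n - 1) := by gcongr; linarith
        _ = 2 ^ (n - 1) * |t| ^ (n - 1) := mul_pow _ _ _
        _ ≤ _ := by gcongr <;> norm_num
    have h3 : M * (1 + c) ^ n * 2 ^ n ≤ b * |t| := by
      have : M * 2 ^ n ≤ b * R := by
        rw [hR, mul_add, mul_div_cancel₀ _ hlead.ne']
        linarith
      calc M * (1 + c) ^ n * 2 ^ n = (M * 2 ^ n) * (1 + c) ^ n := by ring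
        _ ≤ (b * R) * (1 + c) ^ n := by gcongr
        _ = b * (R * (1 + c) ^ n) := by ring
        _ ≤ _ := by gcongr
    have h4 : t ^ n = |t| * |t| ^ (n - 1) := by
      rw [← pow_succ', Nat.sub_add_cancel h0, hdeg.pow_abs]
    have h5 : M * (1 + c) ^ n * (1 + |t|) ^ (n - 1) ≤ b * t ^ n := by
      calc M * (1 + c) ^ n * (1 + |t|) ^ (n - 1) ≤ M * (1 + c) ^ n * (2 ^ n * |t| ^ (n - 1)) := by
            gcongr
        _ = (M * (1 + c) ^ n * 2 ^ n) * |t| ^ (n - 1) := by ring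
        _ ≤ (b * |t|) * |t| ^ (n - 1) := by gcongr
        _ = _ := by rw [h4]; ring
    linarith
  · push Not at hbig
    have h2 : (1 + |t|) ^ (n - 1) ≤ (1 + R) ^ n * (1 + c) ^ (n * n) := by
      calc (1 + |t|) ^ (n - 1) ≤ (1 + |t|) ^ n :=
            pow_le_pow_right₀ (by linarith [abs_nonneg t]) (by omega)
        _ ≤ ((1 + R) * (1 + c) ^ n) ^ n := by gcongr; linarith
        _ = _ := by rw [mul_pow, ← pow_mul]
    have : M * (1 + c) ^ n * (1 + |t|) ^ (n - 1) ≤ M * (1 + R) ^ n * (1 + c) ^ (n + n * n) := by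
      calc _ ≤ M * (1 + c) ^ n * ((1 + R) ^ n * (1 + c) ^ (n * n)) := by gcongr
        _ = _ := by rw [pow_add]; ring
    linarith

universe u

/-! ### Polynomials of independent standard Gaussian variables -/

theorem integrable_pow_gaussianReal (k : ℕ) (v : NNReal) :
    Integrable (fun x : ℝ => x ^ k) (gaussianReal 0 v) := by
  have h : MemLp (id : ℝ → ℝ) (k : ENNReal) (gaussianReal 0 v) :=
    memLp_id_gaussianReal' _ (by simp)
  have := h.integrable_norm_pow'
  refine this.congr' (by fun_prop) ?_
  exact Eventually.of_forall fun x => by simp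

/-- Integration by parts: `x` times the Gaussian density is the derivative of minus the density. -/
theorem integral_mul_pow_gaussianReal (k : ℕ) :
    ∫ x : ℝ, x * x ^ k ∂gaussianReal 0 1 = k * ∫ x : ℝ, x ^ (k - 1) ∂gaussianReal 0 1 := by
  have hd : ∀ x : ℝ, HasDerivAt (fun x => -gaussianPDFReal 0 1 x) (x * gaussianPDFReal 0 1 x) x := by
    intro x
    simp only [gaussianPDFReal_def, NNReal.coe_one, mul_one, sub_zero]
    have h1 : HasDerivAt (fun x : ℝ => -x ^ 2 / 2) (-x) x := by
      refine (((hasDerivAt_pow 2 x).neg).div_const 2).congr_deriv ?_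
      norm_num
      ring
    have h2 := ((h1.exp).const_mul (√(2 * Real.pi))⁻¹).neg
    exact h2.congr_deriv (by ring)
  have hint : ∀ j : ℕ, Integrable (fun x : ℝ => x ^ j * gaussianPDFReal 0 1 x) := by
    intro j
    have h := integrable_pow_gaussianReal j 1
    rw [gaussianReal_of_var_ne_zero _ (by simp),
      integrable_withDensity_iff (measurable_gaussianPDF _ _)
        (Eventually.of_forall fun x => gaussianPDF_lt_top)] at h
    simpa [toReal_gaussianPDF] using h
  rw [integral_gaussianReal_eq_integral_smul (by simp),
    integral_gaussianReal_eq_integral_smul (by simp)]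
  have := integral_mul_deriv_eq_deriv_mul_of_integrable (u := fun x : ℝ => x ^ k)
    (u' := fun x => (k : ℝ) * x ^ (k - 1)) (v := fun x => -gaussianPDFReal 0 1 x)
    (v' := fun x => x * gaussianPDFReal 0 1 x) (fun x _ => hasDerivAt_pow k x) (fun x _ => hd x)
    ?_ ?_ ?_
  · simp only [smul_eq_mul]
    calc ∫ x : ℝ, gaussianPDFReal 0 1 x * (x * x ^ k) = ∫ x : ℝ, x ^ k * (x * gaussianPDFReal 0 1 x) := by
          congr 1; ext x; ring
      _ = _ := by
          rw [this, ← integral_const_mul, ← integral_neg]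
          congr 1; ext x; ring
  · refine (hint (k + 1)).congr (Eventually.of_forall fun x => ?_)
    simp only [Pi.mul_apply]; ring
  · refine ((hint (k - 1)).const_mul (-(k : ℝ))).congr (Eventually.of_forall fun x => ?_)
    simp only [Pi.mul_apply]; ring
  · refine ((hint k).const_mul (-1)).congr (Eventually.of_forall fun x => ?_)
    simp only [Pi.mul_apply]; ring

section GaussianPolynomials

variable {σ : Type*} [Fintype σ]

/-- The law of a family of independent standard Gaussian variables. -/
noncomputable def stdGaussianPi (σ : Type*) [Fintype σ] : Measure (σ → ℝ) :=
  Measure.pi fun _ => gaussianReal 0 1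

instance : IsProbabilityMeasure (stdGaussianPi σ) := by
  unfold stdGaussianPi; infer_instance

theorem integrable_eval_stdGaussianPi (F : MvPolynomial σ ℝ) :
    Integrable (fun x => MvPolynomial.eval x F) (stdGaussianPi σ) := by
  induction F using MvPolynomial.induction_on' with
  | monomial u a =>
    have : (fun x : σ → ℝ => MvPolynomial.eval x (MvPolynomial.monomial u a)) =
        fun x => a * ∏ i, x i ^ u i := by
      ext x
      rw [MvPolynomial.eval_monomial, Finsupp.prod_fintype _ _ (by simp)]
    rw [this]
    exact (Integrable.fintype_prod (f := fun i x => x ^ u i)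
      (fun i => integrable_pow_gaussianReal (u i) 1)).const_mul a
  | add p q hp hq =>
    simp only [map_add]
    exact hp.add hq

/-- The Gaussian expectation of a polynomial. -/
noncomputable def gaussExp : MvPolynomial σ ℝ →ₗ[ℝ] ℝ where
  toFun F := ∫ x, MvPolynomial.eval x F ∂stdGaussianPi σ
  map_add' F G := by
    simp only [map_add]
    exact integral_add (integrable_eval_stdGaussianPi F) (integrable_eval_stdGaussianPi G)
  map_smul' c F := by
    simp only [MvPolynomial.smul_eval, RingHom.id_apply, smul_eq_mul]
    exact integral_const_mul _ _

theorem gaussExp_apply (F : MvPolynomial σ ℝ) :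
    gaussExp F = ∫ x, MvPolynomial.eval x F ∂stdGaussianPi σ := rfl

theorem gaussExp_mono {F G : MvPolynomial σ ℝ}
    (h : ∀ x, MvPolynomial.eval x F ≤ MvPolynomial.eval x G) : gaussExp F ≤ gaussExp G :=
  integral_mono (integrable_eval_stdGaussianPi F) (integrable_eval_stdGaussianPi G) h

theorem gaussExp_C (c : ℝ) : gaussExp (MvPolynomial.C c : MvPolynomial σ ℝ) = c := by
  simp [gaussExp_apply]

theorem gaussExp_C_mul (c : ℝ) (F : MvPolynomial σ ℝ) :
    gaussExp (MvPolynomial.C c * F) = c * gaussExp F := by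
  rw [MvPolynomial.C_mul', map_smul, smul_eq_mul]

/-- Gaussian integration by parts. -/
theorem gaussExp_X_mul (i : σ) (F : MvPolynomial σ ℝ) :
    gaussExp (MvPolynomial.X i * F) = gaussExp (MvPolynomial.pderiv i F) := by
  classical
  induction F using MvPolynomial.induction_on' with
  | monomial u a =>
    have h1 : ∀ x : σ → ℝ, MvPolynomial.eval x (MvPolynomial.X i * MvPolynomial.monomial u a) =
        a * ∏ j, (if j = i then x j * x j ^ u j else x j ^ u j) := by
      intro x
      rw [map_mul, MvPolynomial.eval_X, MvPolynomial.eval_monomial,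
        Finsupp.prod_fintype _ _ (by simp), ← Finset.mul_prod_erase Finset.univ _ (Finset.mem_univ i),
        ← Finset.mul_prod_erase Finset.univ (fun j => if j = i then x j * x j ^ u j else x j ^ u j)
          (Finset.mem_univ i), if_pos rfl]
      have : ∏ j ∈ Finset.univ.erase i, (if j = i then x j * x j ^ u j else x j ^ u j) =
          ∏ j ∈ Finset.univ.erase i, x j ^ u j :=
        Finset.prod_congr rfl fun j hj => if_neg (Finset.ne_of_mem_erase hj)
      rw [this]; ring
    have h2 : ∀ x : σ → ℝ, MvPolynomial.eval x (MvPolynomial.pderiv i (MvPolynomial.monomial u a)) =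
        a * ∏ j, (if j = i then u j * x j ^ (u j - 1) else x j ^ u j) := by
      intro x
      rw [MvPolynomial.pderiv_monomial, MvPolynomial.eval_monomial,
        Finsupp.prod_fintype _ _ (by simp), ← Finset.mul_prod_erase Finset.univ _ (Finset.mem_univ i),
        ← Finset.mul_prod_erase Finset.univ
          (fun j => if j = i then (u j : ℝ) * x j ^ (u j - 1) else x j ^ u j)
          (Finset.mem_univ i), if_pos rfl]
      have : ∏ j ∈ Finset.univ.erase i, (if j = i then (u j : ℝ) * x j ^ (u j - 1) else x j ^ u j) =
          ∏ j ∈ Finset.univ.erase i, x j ^ ((u - Finsupp.single i 1 : σ →₀ ℕ) j) := by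
        refine Finset.prod_congr rfl fun j hj => ?_
        have hji := Finset.ne_of_mem_erase hj
        rw [if_neg hji]
        simp [Ne.symm hji]
      rw [this]
      simp
      ring
    rw [gaussExp_apply, gaussExp_apply]
    simp_rw [h1, h2]
    rw [integral_const_mul, integral_const_mul]
    congr 1
    have e1 := integral_fintype_prod_eq_prod (𝕜 := ℝ) (μ := fun _ : σ => gaussianReal 0 1)
      (fun (j : σ) (y : ℝ) => if j = i then y * y ^ u j else y ^ u j)
    have e2 := integral_fintype_prod_eq_prod (𝕜 := ℝ) (μ := fun _ : σ => gaussianReal 0 1)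
      (fun (j : σ) (y : ℝ) => if j = i then (u j : ℝ) * y ^ (u j - 1) else y ^ u j)
    unfold stdGaussianPi
    rw [e1, e2]
    refine Finset.prod_congr rfl fun j _ => ?_
    split_ifs with hj
    · rw [integral_mul_pow_gaussianReal, integral_const_mul]
    · rfl
  | add p q hp hq =>
    rw [mul_add, map_add, map_add, map_add, hp, hq]

/-- The number operator. -/
noncomputable def numberOp (F : MvPolynomial σ ℝ) : MvPolynomial σ ℝ :=
  ∑ i, (MvPolynomial.X i * MvPolynomial.pderiv i F -
    MvPolynomial.pderiv i (MvPolynomial.pderiv i F))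

/-- Integration by parts in each variable turns the number operator into the Dirichlet form. -/
theorem gaussExp_mul_numberOp (G F : MvPolynomial σ ℝ) :
    gaussExp (G * numberOp F) =
      ∑ i, gaussExp (MvPolynomial.pderiv i G * MvPolynomial.pderiv i F) := by
  rw [numberOp, Finset.mul_sum, map_sum]
  refine Finset.sum_congr rfl fun i _ => ?_
  have : G * (MvPolynomial.X i * MvPolynomial.pderiv i F -
      MvPolynomial.pderiv i (MvPolynomial.pderiv i F)) =
      MvPolynomial.X i * (G * MvPolynomial.pderiv i F) -
        G * MvPolynomial.pderiv i (MvPolynomial.pderiv i F) := by ring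
  rw [this, map_sub, gaussExp_X_mul, MvPolynomial.pderiv_mul, map_add]
  ring

/-- `IsChaos k F`: the polynomial `F` belongs to the homogeneous chaos of order `k`. -/
def IsChaos : ℕ → MvPolynomial σ ℝ → Prop
  | 0, F => ∃ c, F = MvPolynomial.C c
  | k + 1, F => numberOp F = MvPolynomial.C (k + 1 : ℝ) * F ∧
      ∀ i, IsChaos k (MvPolynomial.pderiv i F)

theorem numberOp_add (F G : MvPolynomial σ ℝ) : numberOp (F + G) = numberOp F + numberOp G := by
  simp only [numberOp, map_add, ← Finset.sum_add_distrib]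
  exact Finset.sum_congr rfl fun i _ => by ring

theorem numberOp_C_mul (c : ℝ) (F : MvPolynomial σ ℝ) :
    numberOp (MvPolynomial.C c * F) = MvPolynomial.C c * numberOp F := by
  simp only [numberOp, MvPolynomial.pderiv_C_mul, Finset.mul_sum]
  exact Finset.sum_congr rfl fun i _ => by ring

theorem IsChaos.add {k : ℕ} {F G : MvPolynomial σ ℝ} (hF : IsChaos k F) (hG : IsChaos k G) :
    IsChaos k (F + G) := by
  induction k generalizing F G with
  | zero =>
    obtain ⟨a, rfl⟩ := hF
    obtain ⟨b, rfl⟩ := hG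
    exact ⟨a + b, by simp⟩
  | succ k ih =>
    refine ⟨?_, fun i => ?_⟩
    · rw [numberOp_add, hF.1, hG.1]; ring
    · rw [map_add]; exact ih (hF.2 i) (hG.2 i)

theorem IsChaos.C_mul {k : ℕ} {F : MvPolynomial σ ℝ} (hF : IsChaos k F) (c : ℝ) :
    IsChaos k (MvPolynomial.C c * F) := by
  induction k generalizing F with
  | zero =>
    obtain ⟨a, rfl⟩ := hF
    exact ⟨c * a, by simp⟩
  | succ k ih =>
    refine ⟨?_, fun i => ?_⟩
    · rw [numberOp_C_mul, hF.1]; ring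
    · rw [MvPolynomial.pderiv_C_mul]; exact ih (hF.2 i)

theorem IsChaos.zero (k : ℕ) : IsChaos k (0 : MvPolynomial σ ℝ) := by
  induction k with
  | zero => exact ⟨0, by simp⟩
  | succ k ih => exact ⟨by simp [numberOp], fun i => by simpa using ih⟩

theorem IsChaos.sum {τ : Type*} (s : Finset τ) {k : ℕ} {F : τ → MvPolynomial σ ℝ}
    (hF : ∀ a ∈ s, IsChaos k (F a)) : IsChaos k (∑ a ∈ s, F a) := by
  classical
  induction s using Finset.induction_on with
  | empty => simpa using IsChaos.zero k
  | insert a s ha ih =>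
    rw [Finset.sum_insert ha]
    exact (hF a (Finset.mem_insert_self a s)).add
      (ih fun b hb => hF b (Finset.mem_insert_of_mem hb))

theorem IsChaos.numberOp {k : ℕ} {F : MvPolynomial σ ℝ} (hF : IsChaos k F) :
    numberOp F = MvPolynomial.C (k : ℝ) * F := by
  cases k with
  | zero => obtain ⟨a, rfl⟩ := hF; simp [_root_.numberOp]
  | succ k => rw [hF.1]; push_cast; rfl

/-- Young's inequality with the conjugate exponents `(j + 1) / j` and `j + 1`, in a form free of
roots. -/
theorem mul_pow_mul_le {a b : ℝ} (ha : 0 ≤ a) (hb : 0 ≤ b) (j : ℕ) :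
    (j + 1) * (a ^ j * b) ≤ j * a ^ (j + 1) + b ^ (j + 1) := by
  induction j with
  | zero => simp
  | succ j ih =>
    have h1 := mul_le_mul_of_nonneg_right ih hb
    have h2 : 0 ≤ ((j : ℝ) + 1) * a ^ j * (a - b) ^ 2 := by positivity
    push_cast
    have e1 : ((j : ℝ) + 1) * (a ^ j * b) * b = (j + 1) * a ^ j * b ^ 2 := by ring
    have e2 : (j * a ^ (j + 1) + b ^ (j + 1)) * b = j * a ^ (j + 1) * b + b ^ (j + 1 + 1) := by ring
    have e3 : ((j : ℝ) + 1) * a ^ j * (a - b) ^ 2 =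
      (j + 1) * a ^ (j + 1 + 1) - 2 * (j + 1) * (a ^ (j + 1) * b) + (j + 1) * a ^ j * b ^ 2 := by ring
    rw [e1, e2] at h1
    rw [e3] at h2
    have e4 : a ^ (j + 1) * b = a ^ (j + 1) * b := rfl
    nlinarith [h1, h2]

/-- The eigenvalue equation tested against `F a * N`. For `N = 1` it is the energy identity; for `N`
a power of `∑ F a ^ 2` it starts the moment estimate. -/
theorem gaussExp_sum_numberOp {τ : Type*} [Fintype τ] {k : ℕ} {F : τ → MvPolynomial σ ℝ}
    (hF : ∀ a, IsChaos k (F a)) (N : MvPolynomial σ ℝ) :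
    (k : ℝ) * gaussExp ((∑ a, F a ^ 2) * N) =
      ∑ a, ∑ i, gaussExp (MvPolynomial.pderiv i (F a * N) * MvPolynomial.pderiv i (F a)) := by
  rw [Finset.sum_mul, map_sum, Finset.mul_sum]
  refine Finset.sum_congr rfl fun a _ => ?_
  rw [← gaussExp_mul_numberOp, (hF a).numberOp, ← gaussExp_C_mul]
  congr 1
  ring

/-- Nelson's hypercontractivity for a homogeneous chaos, with values in a Euclidean space. -/
theorem gaussExp_pow_le {σ τ : Type u} [Fintype σ] [Fintype τ] {k : ℕ} {F : τ → MvPolynomial σ ℝ}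
    (hF : ∀ a, IsChaos k (F a)) (j : ℕ) :
    gaussExp ((∑ a, F a ^ 2) ^ (j + 1)) ≤
      ((2 * j + 1) ^ k * gaussExp (∑ a, F a ^ 2)) ^ (j + 1) := by
  classical
  -- The statement concerns families so that the induction can pass to the gradient, a family
  -- indexed by `τ × σ` in the chaos of order one lower.
  induction k generalizing τ with
  | zero =>
    choose c hc using hF
    simp only [hc, ← map_pow, ← map_sum, gaussExp_C, pow_zero, one_mul, le_refl]
  | succ k ih =>
    set N : MvPolynomial σ ℝ := ∑ a, F a ^ 2 with hN
    set M : MvPolynomial σ ℝ := ∑ b : τ × σ, (MvPolynomial.pderiv b.2 (F b.1)) ^ 2 with hM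
    have hNx : ∀ x, 0 ≤ MvPolynomial.eval x N := fun x => by
      rw [hN, map_sum]; exact Finset.sum_nonneg fun a _ => by rw [map_pow]; positivity
    have hMx : ∀ x, 0 ≤ MvPolynomial.eval x M := fun x => by
      rw [hM, map_sum]; exact Finset.sum_nonneg fun a _ => by rw [map_pow]; positivity
    have ihM := ih (τ := τ × σ) (F := fun b => MvPolynomial.pderiv b.2 (F b.1))
      (fun b => (hF b.1).2 b.2)
    rw [← hM] at ihM
    -- the energy identity
    have hEM : gaussExp M = (k + 1) * gaussExp N := by
      have h1 := gaussExp_sum_numberOp hF 1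
      rw [mul_one, ← hN] at h1
      push_cast at h1
      rw [h1, hM, map_sum, Fintype.sum_prod_type]
      simp only [mul_one, sq]
    have hk : (0 : ℝ) < k + 1 := by positivity
    -- integration by parts
    have hmain : (k + 1) * gaussExp (N ^ (j + 1)) ≤ (2 * j + 1) * gaussExp (N ^ j * M) := by
      have h1 := gaussExp_sum_numberOp hF (N ^ j)
      rw [← hN, ← pow_succ'] at h1
      push_cast at h1
      rw [h1, ← gaussExp_C_mul]
      simp only [← map_sum]
      apply gaussExp_mono
      intro x
      -- `2 * S i` is the `i`-th derivative of `N`; Cauchy-Schwarz bounds `∑ S i ^ 2` by `N * M`,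
      -- which controls the term where the derivative falls on `N ^ j`.
      obtain ⟨S, hS⟩ : ∃ S : σ → ℝ, S = fun i => ∑ a, MvPolynomial.eval x (F a) *
        MvPolynomial.eval x (MvPolynomial.pderiv i (F a)) := ⟨_, rfl⟩
      have hdN : ∀ i, MvPolynomial.eval x (MvPolynomial.pderiv i (N ^ j)) =
          j * MvPolynomial.eval x N ^ (j - 1) * (2 * S i) := by
        intro i
        rw [MvPolynomial.pderiv_pow, hN, map_sum, hS]
        simp only [MvPolynomial.pderiv_pow, map_mul, map_pow, map_sum, map_natCast]
        congr 1
        rw [Finset.mul_sum]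
        exact Finset.sum_congr rfl fun a _ => by norm_num; ring
      have hS2 : ∀ i, S i ^ 2 ≤ MvPolynomial.eval x N *
          ∑ a, MvPolynomial.eval x (MvPolynomial.pderiv i (F a)) ^ 2 := by
        intro i
        rw [hN, map_sum, hS]
        simp only [map_pow]
        exact Finset.sum_mul_sq_le_sq_mul_sq _ _ _
      have hMx' : MvPolynomial.eval x M =
          ∑ i, ∑ a, MvPolynomial.eval x (MvPolynomial.pderiv i (F a)) ^ 2 := by
        rw [hM, map_sum, Fintype.sum_prod_type_right]
        simp only [map_pow]
      have e1 : MvPolynomial.eval x (∑ a, ∑ i, MvPolynomial.pderiv i (F a * N ^ j) *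
          MvPolynomial.pderiv i (F a)) =
          MvPolynomial.eval x N ^ j * MvPolynomial.eval x M +
            2 * (j * MvPolynomial.eval x N ^ (j - 1) * ∑ i, S i ^ 2) := by
        rw [hMx', Finset.sum_comm, Finset.mul_sum, Finset.mul_sum, Finset.mul_sum,
          ← Finset.sum_add_distrib, map_sum]
        refine Finset.sum_congr rfl fun i _ => ?_
        simp only [map_sum, MvPolynomial.pderiv_mul, map_mul, map_add, hdN, map_pow]
        simp only [add_mul, Finset.sum_add_distrib]
        congr 1
        · rw [Finset.mul_sum]
          exact Finset.sum_congr rfl fun a _ => by ring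
        · have : S i ^ 2 = ∑ a, S i * (MvPolynomial.eval x (F a) *
            MvPolynomial.eval x (MvPolynomial.pderiv i (F a))) := by
            rw [← Finset.mul_sum, sq, hS]
          rw [this, Finset.mul_sum, Finset.mul_sum]
          exact Finset.sum_congr rfl fun a _ => by ring
      rw [e1, map_mul, MvPolynomial.eval_C, map_mul, map_pow]
      have h3 : j * MvPolynomial.eval x N ^ (j - 1) * ∑ i, S i ^ 2 ≤
          j * (MvPolynomial.eval x N ^ j * MvPolynomial.eval x M) := by
        rcases Nat.eq_zero_or_pos j with rfl | hj
        · simp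
        rw [mul_assoc]
        refine mul_le_mul_of_nonneg_left ?_ (by positivity)
        calc MvPolynomial.eval x N ^ (j - 1) * ∑ i, S i ^ 2
            ≤ MvPolynomial.eval x N ^ (j - 1) * (MvPolynomial.eval x N * MvPolynomial.eval x M) := by
              refine mul_le_mul_of_nonneg_left ?_ (pow_nonneg (hNx x) _)
              rw [hMx', Finset.mul_sum]
              exact Finset.sum_le_sum fun i _ => hS2 i
          _ = _ := by rw [← mul_assoc, ← pow_succ, Nat.sub_add_cancel hj]
      linarith
    -- Young's inequality
    set R : ℝ := (2 * j + 1) / (k + 1) with hR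
    have hR0 : 0 ≤ R := by positivity
    have hyoung : (j + 1) * gaussExp (N ^ (j + 1)) ≤
        j * gaussExp (N ^ (j + 1)) + R ^ (j + 1) * gaussExp (M ^ (j + 1)) := by
      have h1 : gaussExp (N ^ (j + 1)) ≤ R * gaussExp (N ^ j * M) := by
        rw [hR, div_mul_eq_mul_div, le_div_iff₀ hk]
        linarith
      have h2 : (j + 1) * (R * gaussExp (N ^ j * M)) ≤
          j * gaussExp (N ^ (j + 1)) + R ^ (j + 1) * gaussExp (M ^ (j + 1)) := by
        rw [← mul_assoc, ← gaussExp_C_mul, ← gaussExp_C_mul, ← gaussExp_C_mul, ← map_add]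
        apply gaussExp_mono
        intro x
        have := mul_pow_mul_le (hNx x) (mul_nonneg hR0 (hMx x)) j
        simp only [map_add, map_mul, map_pow, MvPolynomial.eval_C]
        rw [mul_pow] at this
        linarith
      have : (0 : ℝ) ≤ j + 1 := by positivity
      nlinarith
    -- Of the `j + 1` copies on the left of Young's inequality, `j` cancel against the right.
    have h3 : gaussExp (N ^ (j + 1)) ≤ R ^ (j + 1) * gaussExp (M ^ (j + 1)) := by linarith
    refine h3.trans ?_
    -- The factor `k + 1` of the energy identity cancels the denominator of `R`, so each order costs
    -- exactly one factor `2 * j + 1`.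
    calc R ^ (j + 1) * gaussExp (M ^ (j + 1))
        ≤ R ^ (j + 1) * ((2 * j + 1) ^ k * gaussExp M) ^ (j + 1) := by gcongr
      _ = _ := by
        rw [hEM, ← mul_pow, hR]
        congr 1
        field_simp
        ring

/-! ### Wick powers of linear forms -/

/-- The linear form with coefficients `a`. -/
noncomputable def linForm (a : σ → ℝ) : MvPolynomial σ ℝ :=
  ∑ i, MvPolynomial.C (a i) * MvPolynomial.X i

theorem eval_linForm (a x : σ → ℝ) : MvPolynomial.eval x (linForm a) = ∑ i, a i * x i := by
  simp [linForm]

theorem pderiv_linForm (a : σ → ℝ) (i : σ) :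
    MvPolynomial.pderiv i (linForm a) = MvPolynomial.C (a i) := by
  classical
  simp [linForm, MvPolynomial.pderiv_X, Pi.single_apply]

theorem pderiv_aeval_linForm (a : σ → ℝ) (i : σ) (p : ℝ[X]) :
    MvPolynomial.pderiv i (Polynomial.aeval (linForm a) p) =
      MvPolynomial.C (a i) * Polynomial.aeval (linForm a) (derivative p) := by
  rw [Derivation.map_aeval, pderiv_linForm, smul_eq_mul, mul_comm]

/-- The Wick power `:X^k:` of the linear form `X` with coefficients `a`. -/
noncomputable def wickForm (k : ℕ) (a : σ → ℝ) : MvPolynomial σ ℝ :=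
  Polynomial.aeval (linForm a) (wickX k (∑ i, a i ^ 2))

theorem pderiv_wickForm (k : ℕ) (a : σ → ℝ) (i : σ) :
    MvPolynomial.pderiv i (wickForm k a) = MvPolynomial.C (k * a i) * wickForm (k - 1) a := by
  rw [wickForm, pderiv_aeval_linForm, derivative_wickX, map_mul, Polynomial.aeval_C, wickForm,
    MvPolynomial.algebraMap_eq, ← mul_assoc, ← map_mul, mul_comm (a i)]

theorem wickForm_zero (a : σ → ℝ) : wickForm 0 a = 1 := by simp [wickForm]

/-- Differentiation lowers the order of a Wick power by one, and the Hermite recursion then reads as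
the eigenvalue equation of the number operator. -/
theorem isChaos_wickForm (k : ℕ) (a : σ → ℝ) : IsChaos k (wickForm k a) := by
  induction k with
  | zero => exact ⟨1, by simp [wickForm_zero]⟩
  | succ k ih =>
    refine ⟨?_, fun i => ?_⟩
    · have h1 : wickForm (k + 1) a = linForm a * wickForm k a -
          MvPolynomial.C ((∑ i, a i ^ 2) * k) * wickForm (k - 1) a := by
        rw [wickForm, wickX_succ]
        simp only [map_sub, map_mul, Polynomial.aeval_X, Polynomial.aeval_C,
          MvPolynomial.algebraMap_eq]
        rfl
      have h2 : ∀ i, MvPolynomial.X i * MvPolynomial.pderiv i (wickForm (k + 1) a) -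
          MvPolynomial.pderiv i (MvPolynomial.pderiv i (wickForm (k + 1) a)) =
          MvPolynomial.C (k + 1 : ℝ) * (MvPolynomial.C (a i) * MvPolynomial.X i * wickForm k a -
            MvPolynomial.C (a i ^ 2 * k) * wickForm (k - 1) a) := by
        intro i
        rw [pderiv_wickForm, MvPolynomial.pderiv_C_mul, Nat.add_sub_cancel, pderiv_wickForm]
        simp only [Nat.cast_add, Nat.cast_one, map_mul, map_add, map_pow]
        ring
      rw [numberOp, Finset.sum_congr rfl fun i _ => h2 i, ← Finset.mul_sum,
        Finset.sum_sub_distrib, ← Finset.sum_mul, ← Finset.sum_mul, ← map_sum, ← Finset.sum_mul,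
        h1]
      rfl
    · rw [pderiv_wickForm]
      exact ih.C_mul _

/-- Induction through the Dirichlet form: the eigenvalue gives `k + 1` on one side, the two
gradients give `(k + 1) ^ 2` and one factor of the covariance on the other. -/
theorem gaussExp_wickForm_mul (k : ℕ) (a b : σ → ℝ) :
    gaussExp (wickForm k a * wickForm k b) = k.factorial * (∑ i, a i * b i) ^ k := by
  induction k with
  | zero => rw [wickForm_zero, wickForm_zero, mul_one, ← map_one MvPolynomial.C, gaussExp_C]; simp
  | succ k ih =>
    have h1 := gaussExp_mul_numberOp (wickForm (k + 1) a) (wickForm (k + 1) b)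
    rw [(isChaos_wickForm (k + 1) b).numberOp] at h1
    have h2 : ∀ i, gaussExp (MvPolynomial.pderiv i (wickForm (k + 1) a) *
        MvPolynomial.pderiv i (wickForm (k + 1) b)) =
        (k + 1) ^ 2 * (a i * b i) * gaussExp (wickForm k a * wickForm k b) := by
      intro i
      rw [pderiv_wickForm, pderiv_wickForm, Nat.add_sub_cancel, ← gaussExp_C_mul]
      congr 1
      simp only [Nat.cast_add, Nat.cast_one, map_mul, map_add, map_pow]
      ring
    rw [Finset.sum_congr rfl fun i _ => h2 i, ← Finset.sum_mul, ← Finset.mul_sum, ih,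
      mul_left_comm, gaussExp_C_mul] at h1
    have hk : ((k + 1 : ℕ) : ℝ) ≠ 0 := by positivity
    apply mul_left_cancel₀ hk
    rw [h1, Nat.factorial_succ, pow_succ]
    push_cast
    ring

end GaussianPolynomials

open scoped MatrixOrder

/-! ### Finite-dimensional Gaussian laws -/

section GaussianLaws

variable {ι : Type*} [Fintype ι]

/-- Used twice: for the standard Gaussian density and for the product of single-spin measures in
Griffiths' inequality. -/
theorem pi_withDensity_ofReal {ρ : ι → ℝ → ℝ} (h0 : ∀ i x, 0 ≤ ρ i x)
    (hint : ∀ i, Integrable (ρ i)) :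
    Measure.pi (fun i => (volume : Measure ℝ).withDensity fun x => ENNReal.ofReal (ρ i x)) =
      (volume : Measure (ι → ℝ)).withDensity fun x => ENNReal.ofReal (∏ i, ρ i (x i)) := by
  have hfin : ∀ i, IsFiniteMeasure ((volume : Measure ℝ).withDensity fun x => ENNReal.ofReal (ρ i x)) :=
    fun i => isFiniteMeasure_withDensity_ofReal (hint i).2
  refine Measure.pi_eq fun s hs => ?_
  rw [withDensity_apply _ (MeasurableSet.univ_pi hs)]
  have h1 : ∫⁻ x in Set.univ.pi s, ENNReal.ofReal (∏ i, ρ i (x i)) =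
      ENNReal.ofReal (∫ x : ι → ℝ, ∏ i, (s i).indicator (ρ i) (x i)) := by
    rw [ofReal_integral_eq_lintegral_ofReal, ← lintegral_indicator (MeasurableSet.univ_pi hs)]
    · congr 1
      ext x
      by_cases hx : x ∈ Set.univ.pi s
      · rw [Set.indicator_of_mem hx]
        congr 1
        exact Finset.prod_congr rfl fun i _ => by rw [Set.indicator_of_mem (hx i (Set.mem_univ i))]
      · rw [Set.indicator_of_notMem hx]
        simp only [Set.mem_univ_pi, not_forall] at hx
        obtain ⟨i, hi⟩ := hx
        rw [Finset.prod_eq_zero (Finset.mem_univ i) (by simp [hi])]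
        simp
    · exact Integrable.fintype_prod (f := fun i x => (s i).indicator (ρ i) x)
        fun i => (hint i).indicator (hs i)
    · exact Eventually.of_forall fun x => Finset.prod_nonneg fun i _ =>
        Set.indicator_nonneg (fun y _ => h0 i y) _
  rw [h1, integral_fintype_prod_volume_eq_prod (𝕜 := ℝ) (fun i x => (s i).indicator (ρ i) x),
    ENNReal.ofReal_prod_of_nonneg fun i _ => integral_nonneg fun x =>
      Set.indicator_nonneg (fun y _ => h0 i y) _]
  refine Finset.prod_congr rfl fun i _ => ?_
  rw [withDensity_apply _ (hs i), integral_indicator (hs i),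
    ofReal_integral_eq_lintegral_ofReal (hint i).integrableOn (Eventually.of_forall (h0 i))]

theorem stdGaussianPi_eq_withDensity :
    stdGaussianPi ι = (volume : Measure (ι → ℝ)).withDensity
      fun x => ENNReal.ofReal (∏ i, gaussianPDFReal 0 1 (x i)) := by
  rw [← pi_withDensity_ofReal
    (fun _ => gaussianPDFReal_nonneg 0 1) (fun _ => integrable_gaussianPDFReal 0 1), stdGaussianPi]
  congr 1
  ext1 i
  rw [gaussianReal_of_var_ne_zero _ (by simp)]
  rfl

variable [DecidableEq ι]

theorem multivariateGaussian_zero_eq_map (G : Matrix ι ι ℝ) :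
    multivariateGaussian 0 G =
      (stdGaussianPi ι).map fun x => WithLp.toLp 2 (Matrix.mulVec (CFC.sqrt G) x) := by
  rw [multivariateGaussian, ← map_pi_eq_stdGaussian, Measure.map_map (by fun_prop) (by fun_prop)]
  congr 1
  ext1 x
  simp [Matrix.toEuclideanCLM_toLp]

theorem sqrt_mul_sqrt_of_posSemidef {G : Matrix ι ι ℝ} (hG : G.PosSemidef) :
    CFC.sqrt G * CFC.sqrt G = G :=
  CFC.sqrt_mul_sqrt_self G (by exact hG.nonneg)

theorem transpose_sqrt (G : Matrix ι ι ℝ) : (CFC.sqrt G).transpose = CFC.sqrt G := by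
  have h : IsSelfAdjoint (CFC.sqrt G) := (CFC.sqrt_nonneg G).isSelfAdjoint
  have h2 := h.star_eq
  rw [Matrix.star_eq_conjTranspose] at h2
  ext i j
  simpa using congrFun (congrFun h2 i) j

/-- The Gaussian measure written through its precision matrix, by the substitution `t = T x` with
`T` the square root of the covariance. The normalization stays unspecified because it cancels in
correlation functions. -/
theorem integral_multivariateGaussian_inv {B : Matrix ι ι ℝ} (hB : B.PosDef) :
    ∃ Z : ℝ, 0 < Z ∧ ∀ F : (ι → ℝ) → ℝ, Continuous F →
      ∫ t, F t.ofLp ∂multivariateGaussian 0 B⁻¹ =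
        Z * ∫ t, F t * Real.exp (-(t ⬝ᵥ B.mulVec t) / 2) := by
  set T := CFC.sqrt B⁻¹ with hT
  have hTT : T * T = B⁻¹ := sqrt_mul_sqrt_of_posSemidef hB.inv.posSemidef
  have hBu : IsUnit B.det := (Matrix.isUnit_iff_isUnit_det _).1 hB.isUnit
  have hdet : T.det ≠ 0 := by
    intro h
    have h1 := congrArg Matrix.det hTT
    rw [Matrix.det_mul, h, zero_mul] at h1
    exact hB.inv.det_pos.ne h1
  have hTu : IsUnit T.det := isUnit_iff_ne_zero.2 hdet
  have hTBT : T * B * T = 1 := by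
    have h1 : T * (T * B * T) = T := by
      rw [← mul_assoc, ← mul_assoc, hTT, Matrix.nonsing_inv_mul _ hBu, one_mul]
    calc T * B * T = T⁻¹ * (T * (T * B * T)) := by
          rw [← mul_assoc, Matrix.nonsing_inv_mul _ hTu, one_mul]
      _ = 1 := by rw [h1, Matrix.nonsing_inv_mul _ hTu]
  have hquad : ∀ x : ι → ℝ, (T.mulVec x) ⬝ᵥ B.mulVec (T.mulVec x) = x ⬝ᵥ x := by
    intro x
    rw [Matrix.mulVec_mulVec, Matrix.dotProduct_mulVec, ← Matrix.vecMul_transpose, transpose_sqrt,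
      Matrix.vecMul_vecMul, ← hT, ← mul_assoc, hTBT, Matrix.vecMul_one]
  set a : ℝ := (√(2 * Real.pi))⁻¹ with ha
  have ha0 : 0 < a := by positivity
  have hpdf : ∀ x : ι → ℝ, ∏ i, gaussianPDFReal 0 1 (x i) =
      a ^ Fintype.card ι * Real.exp (-(x ⬝ᵥ x) / 2) := by
    intro x
    simp only [gaussianPDFReal_def, NNReal.coe_one, mul_one, sub_zero]
    rw [Finset.prod_mul_distrib, Finset.prod_const, ← Real.exp_sum, Finset.card_univ]
    congr 2
    rw [← Finset.sum_div, Finset.sum_neg_distrib]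
    simp [dotProduct, sq]
  refine ⟨a ^ Fintype.card ι * |T.det⁻¹|, mul_pos (by positivity) (abs_pos.2 (inv_ne_zero hdet)), fun F hF => ?_⟩
  have hcont : Continuous fun t : ι → ℝ => F t * Real.exp (-(t ⬝ᵥ B.mulVec t) / 2) := by
    have : Continuous fun t : ι → ℝ => B.mulVec t := by fun_prop
    have h2 : Continuous fun t : ι → ℝ => t ⬝ᵥ B.mulVec t := by
      simp only [dotProduct]; fun_prop
    fun_prop
  rw [multivariateGaussian_zero_eq_map, integral_map (by fun_prop) (by
    refine Continuous.aestronglyMeasurable ?_; fun_prop), stdGaussianPi_eq_withDensity,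
    integral_withDensity_eq_integral_toReal_smul₀ (by
      refine (Measurable.ennreal_ofReal (Finset.measurable_prod _ fun i _ => ?_)).aemeasurable
      exact (measurable_gaussianPDFReal 0 1).comp (measurable_pi_apply i)) (by simp)]
  have h1 : ∀ x : ι → ℝ, (ENNReal.ofReal (∏ i, gaussianPDFReal 0 1 (x i))).toReal • F (T.mulVec x) =
      a ^ Fintype.card ι * (F (T.mulVec x) *
        Real.exp (-((T.mulVec x) ⬝ᵥ B.mulVec (T.mulVec x)) / 2)) := by
    intro x
    rw [ENNReal.toReal_ofReal (Finset.prod_nonneg fun i _ => gaussianPDFReal_nonneg _ _ _), hpdf,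
      hquad, smul_eq_mul]
    ring
  simp only [← hT]
  simp_rw [h1]
  rw [integral_const_mul]
  have h2 := integral_map (μ := (volume : Measure (ι → ℝ))) (φ := Matrix.toLin' T)
    (f := fun t : ι → ℝ => F t * Real.exp (-(t ⬝ᵥ B.mulVec t) / 2))
    (LinearMap.continuous_of_finiteDimensional _).aemeasurable hcont.aestronglyMeasurable
  rw [Real.map_matrix_volume_pi_eq_smul_volume_pi hdet, integral_smul_measure,
    ENNReal.toReal_ofReal (abs_nonneg _)] at h2
  simp only [Matrix.toLin'_apply, smul_eq_mul] at h2
  rw [← h2, mul_assoc]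

/-- A finite family of random variables on a probability space is centred Gaussian with covariance
matrix `G`. -/
structure IsGaussianFamily {Ω : Type*} [MeasurableSpace Ω] (ν : Measure Ω) (Y : ι → Ω → ℝ)
    (G : Matrix ι ι ℝ) : Prop where
  measurable : ∀ i, Measurable (Y i)
  posSemidef : G.PosSemidef
  integral_exp : ∀ t : ι → ℝ, ∫ ω, Complex.exp (Complex.I * ((∑ i, t i * Y i ω : ℝ) : ℂ)) ∂ν =
    Complex.exp (-((t ⬝ᵥ G.mulVec t : ℝ) : ℂ) / 2)

namespace IsGaussianFamily

variable {Ω : Type*} [MeasurableSpace Ω] {ν : Measure Ω} [IsProbabilityMeasure ν] {Y : ι → Ω → ℝ}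
  {G : Matrix ι ι ℝ}

theorem measurable_toLp (h : IsGaussianFamily ν Y G) :
    Measurable fun ω => WithLp.toLp 2 (fun i => Y i ω : ι → ℝ) := by
  have hm : Measurable fun ω => (fun i => Y i ω : ι → ℝ) := measurable_pi_iff.2 h.measurable
  exact (WithLp.measurable_toLp 2 _).comp hm

theorem map_eq (h : IsGaussianFamily ν Y G) :
    ν.map (fun ω => WithLp.toLp 2 fun i => Y i ω) = multivariateGaussian 0 G := by
  have hm' := h.measurable_toLp
  have : IsProbabilityMeasure (ν.map fun ω => WithLp.toLp 2 fun i => Y i ω) :=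
    Measure.isProbabilityMeasure_map hm'.aemeasurable
  apply Measure.ext_of_charFun
  ext t
  rw [charFun_multivariateGaussian h.posSemidef, charFun_apply, integral_map hm'.aemeasurable
    (by fun_prop)]
  have := h.integral_exp t.ofLp
  simp only [inner_zero_right, Complex.ofReal_zero, zero_mul, zero_sub]
  rw [← neg_div]
  rw [← this]
  congr 1
  ext ω
  rw [mul_comm]
  congr 2

theorem integral_comp (h : IsGaussianFamily ν Y G) {F : (ι → ℝ) → ℝ} (hF : Continuous F) :
    ∫ ω, F (fun i => Y i ω) ∂ν = ∫ t, F t.ofLp ∂multivariateGaussian 0 G := by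
  rw [← h.map_eq, integral_map h.measurable_toLp.aemeasurable (by
    refine Continuous.aestronglyMeasurable ?_; fun_prop)]

theorem integrable_comp_iff (h : IsGaussianFamily ν Y G) {F : (ι → ℝ) → ℝ} (hF : Continuous F) :
    Integrable (fun ω => F (fun i => Y i ω)) ν ↔
      Integrable (fun t => F t.ofLp) (multivariateGaussian 0 G) := by
  rw [← h.map_eq, integrable_map_measure (by
    refine Continuous.aestronglyMeasurable ?_; fun_prop) h.measurable_toLp.aemeasurable]
  rfl

/-- The family has the law of the square root of `G` applied to independent standard variables; its
rows supply the linear forms to be substituted. -/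
theorem integral_eval (h : IsGaussianFamily ν Y G) (p : MvPolynomial ι ℝ) :
    ∫ ω, MvPolynomial.eval (fun i => Y i ω) p ∂ν =
      gaussExp (MvPolynomial.bind₁ (fun i => linForm (CFC.sqrt G i)) p) := by
  have hc := MvPolynomial.continuous_eval p
  rw [h.integral_comp hc, multivariateGaussian_zero_eq_map, integral_map (by fun_prop) (by
    refine Continuous.aestronglyMeasurable ?_; fun_prop), gaussExp_apply]
  congr 1
  ext x
  rw [← MvPolynomial.coe_aeval_eq_eval, ← MvPolynomial.coe_aeval_eq_eval, RingHom.coe_coe,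
    RingHom.coe_coe, MvPolynomial.aeval_bind₁]
  congr 2
  ext i
  rw [← RingHom.coe_coe, MvPolynomial.coe_aeval_eq_eval, eval_linForm]
  rfl

theorem integrable_eval (h : IsGaussianFamily ν Y G) (p : MvPolynomial ι ℝ) :
    Integrable (fun ω => MvPolynomial.eval (fun i => Y i ω) p) ν := by
  have hc := MvPolynomial.continuous_eval p
  rw [h.integrable_comp_iff hc, multivariateGaussian_zero_eq_map, integrable_map_measure (by
    refine Continuous.aestronglyMeasurable ?_; fun_prop) (by fun_prop)]
  refine (integrable_eval_stdGaussianPi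
    (MvPolynomial.bind₁ (fun i => linForm (CFC.sqrt G i)) p)).congr (Eventually.of_forall fun x => ?_)
  simp only [Function.comp]
  rw [← MvPolynomial.coe_aeval_eq_eval, ← MvPolynomial.coe_aeval_eq_eval, RingHom.coe_coe,
    RingHom.coe_coe, MvPolynomial.aeval_bind₁]
  congr 2
  ext i
  rw [← RingHom.coe_coe, MvPolynomial.coe_aeval_eq_eval, eval_linForm]
  rfl

theorem sum_sqrt_mul_sqrt (h : IsGaussianFamily ν Y G) (i j : ι) :
    ∑ k, CFC.sqrt G i k * CFC.sqrt G j k = G i j := by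
  conv_rhs => rw [← sqrt_mul_sqrt_of_posSemidef h.posSemidef, Matrix.mul_apply]
  refine Finset.sum_congr rfl fun k _ => ?_
  congr 1
  conv_lhs => rw [← transpose_sqrt]
  rfl

/-- A linear combination of Wick powers of order `k` of jointly Gaussian variables, as a
polynomial. -/
noncomputable def wickSum (G : Matrix ι ι ℝ) (w : ι → ℝ) (k : ℕ) : MvPolynomial ι ℝ :=
  ∑ i, MvPolynomial.C (w i) * Polynomial.aeval (MvPolynomial.X i) (wickX k (G i i))

theorem eval_wickSum (w : ι → ℝ) (k : ℕ) (t : ι → ℝ) :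
    MvPolynomial.eval t (wickSum G w k) = ∑ i, w i * wickPow k (G i i) (t i) := by
  rw [wickSum, map_sum]
  refine Finset.sum_congr rfl fun i _ => ?_
  rw [map_mul, MvPolynomial.eval_C, ← eval_wickX, ← MvPolynomial.coe_aeval_eq_eval, RingHom.coe_coe,
    ← Polynomial.aeval_algHom_apply, MvPolynomial.aeval_X, Polynomial.coe_aeval_eq_eval]

/-- Row `i` of the square root has squared length `G i i`, which is the variance in the Wick power.
The substitution therefore lands in a homogeneous chaos. -/
theorem bind_wickSum (h : IsGaussianFamily ν Y G) (w : ι → ℝ) (k : ℕ) :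
    MvPolynomial.bind₁ (fun i => linForm (CFC.sqrt G i)) (wickSum G w k) =
      ∑ i, MvPolynomial.C (w i) * wickForm k (CFC.sqrt G i) := by
  rw [wickSum, map_sum]
  refine Finset.sum_congr rfl fun i _ => ?_
  rw [map_mul, MvPolynomial.bind₁_C_right, ← Polynomial.aeval_algHom_apply,
    MvPolynomial.bind₁_X_right, wickForm, ← h.sum_sqrt_mul_sqrt i i]
  simp only [sq]

theorem integrable_wickSum_pow (h : IsGaussianFamily ν Y G) (w : ι → ℝ) (k j : ℕ) :
    Integrable (fun ω => (∑ i, w i * wickPow k (G i i) (Y i ω)) ^ j) ν := by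
  have := h.integrable_eval (wickSum G w k ^ j)
  simpa only [map_pow, eval_wickSum] using this

theorem integral_wickSum_sq (h : IsGaussianFamily ν Y G) (w : ι → ℝ) (k : ℕ) :
    ∫ ω, (∑ i, w i * wickPow k (G i i) (Y i ω)) ^ 2 ∂ν =
      k.factorial * ∑ i, ∑ j, w i * w j * G i j ^ k := by
  have := h.integral_eval (wickSum G w k ^ 2)
  simp only [map_pow, eval_wickSum] at this
  rw [this, h.bind_wickSum, sq, Finset.sum_mul_sum, map_sum, Finset.mul_sum]
  refine Finset.sum_congr rfl fun i _ => ?_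
  rw [map_sum, Finset.mul_sum]
  refine Finset.sum_congr rfl fun j _ => ?_
  rw [show MvPolynomial.C (w i) * wickForm k (CFC.sqrt G i) *
    (MvPolynomial.C (w j) * wickForm k (CFC.sqrt G j)) = MvPolynomial.C (w i * w j) *
      (wickForm k (CFC.sqrt G i) * wickForm k (CFC.sqrt G j)) by rw [map_mul]; ring,
    gaussExp_C_mul, gaussExp_wickForm_mul, h.sum_sqrt_mul_sqrt]
  ring

/-- Hypercontractivity for sums of Wick powers. -/
theorem integral_wickSum_pow_le {ι : Type u} [Fintype ι] [DecidableEq ι] {Y : ι → Ω → ℝ}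
    {G : Matrix ι ι ℝ} (h : IsGaussianFamily ν Y G) (w : ι → ℝ) (k j : ℕ) :
    ∫ ω, (∑ i, w i * wickPow k (G i i) (Y i ω)) ^ (2 * (j + 1)) ∂ν ≤
      ((2 * j + 1) ^ k * ∫ ω, (∑ i, w i * wickPow k (G i i) (Y i ω)) ^ 2 ∂ν) ^ (j + 1) := by
  have h1 := h.integral_eval (wickSum G w k ^ (2 * (j + 1)))
  have h2 := h.integral_eval (wickSum G w k ^ 2)
  simp only [map_pow, eval_wickSum] at h1 h2
  rw [h1, h2, h.bind_wickSum]
  have := gaussExp_pow_le (τ := PUnit.{u + 1}) (F := fun _ => ∑ i, MvPolynomial.C (w i) *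
    wickForm k (CFC.sqrt G i)) (k := k)
    (fun _ => IsChaos.sum _ fun i _ => (isChaos_wickForm k _).C_mul _) j
  simpa [← pow_mul] using this

end IsGaussianFamily

end GaussianLaws

/-! ### Ginibre's inequality -/

section Ginibre

theorem integrable_add_pow_mul_sub_pow {m : Measure ℝ} [IsFiniteMeasure m]
    (hmom : ∀ k : ℕ, Integrable (fun x : ℝ => |x| ^ k) m) (a b : ℕ) :
    Integrable (fun z : ℝ × ℝ => (z.1 + z.2) ^ a * (z.1 - z.2) ^ b) (m.prod m) := by
  have h1 : Integrable (fun z : ℝ × ℝ => (2 : ℝ) ^ (a + b - 1) * (|z.1| ^ (a + b) + |z.2| ^ (a + b)))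
      (m.prod m) :=
    (((hmom (a + b)).comp_fst m).add ((hmom (a + b)).comp_snd m)).const_mul _
  refine h1.mono' (by fun_prop) (Eventually.of_forall fun z => ?_)
  rw [norm_mul, norm_pow, norm_pow, Real.norm_eq_abs, Real.norm_eq_abs]
  calc |z.1 + z.2| ^ a * |z.1 - z.2| ^ b ≤ (|z.1| + |z.2|) ^ a * (|z.1| + |z.2|) ^ b := by
        gcongr
        · exact abs_add_le _ _
        · exact abs_sub _ _
    _ = (|z.1| + |z.2|) ^ (a + b) := (pow_add _ _ _).symm
    _ ≤ _ := add_pow_le (abs_nonneg _) (abs_nonneg _) _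

/-- For even `a` and `b` the integrand is nonnegative. If `b` is odd, exchanging the two variables
changes the sign; if only `a` is odd, reflecting both does. In these cases the integral vanishes. -/
theorem integral_add_pow_mul_sub_pow_nonneg {m : Measure ℝ} [IsFiniteMeasure m]
    (hsymm : m.map Neg.neg = m) (a b : ℕ) :
    0 ≤ ∫ z : ℝ × ℝ, (z.1 + z.2) ^ a * (z.1 - z.2) ^ b ∂m.prod m := by
  rcases Nat.even_or_odd b with hb | hb
  · rcases Nat.even_or_odd a with ha | ha
    · exact integral_nonneg fun z => mul_nonneg (ha.pow_nonneg _) (hb.pow_nonneg _)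
    · have hp : MeasurePreserving (Neg.neg : ℝ → ℝ) m m := ⟨measurable_neg, hsymm⟩
      have hpp := hp.prod hp
      have h1 := hpp.integral_comp (MeasurableEmbedding.prodMap (MeasurableEquiv.neg ℝ).measurableEmbedding
        (MeasurableEquiv.neg ℝ).measurableEmbedding) (fun z : ℝ × ℝ => (z.1 + z.2) ^ a * (z.1 - z.2) ^ b)
      have h2 : ∀ z : ℝ × ℝ, ((Prod.map Neg.neg Neg.neg z).1 + (Prod.map Neg.neg Neg.neg z).2) ^ a *
          ((Prod.map Neg.neg Neg.neg z).1 - (Prod.map Neg.neg Neg.neg z).2) ^ b =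
          -((z.1 + z.2) ^ a * (z.1 - z.2) ^ b) := by
        intro z
        simp only [Prod.map_fst, Prod.map_snd]
        rw [show -z.1 + -z.2 = -(z.1 + z.2) by ring, show -z.1 - -z.2 = -(z.1 - z.2) by ring,
          ha.neg_pow, hb.neg_pow]
        ring
      simp only [h2, integral_neg] at h1
      linarith
  · have h1 := integral_prod_swap (μ := m) (ν := m)
      (fun z : ℝ × ℝ => (z.1 + z.2) ^ a * (z.1 - z.2) ^ b)
    have h2 : ∀ z : ℝ × ℝ, (z.swap.1 + z.swap.2) ^ a * (z.swap.1 - z.swap.2) ^ b =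
        -((z.1 + z.2) ^ a * (z.1 - z.2) ^ b) := by
      intro z
      simp only [Prod.fst_swap, Prod.snd_swap]
      rw [add_comm z.2, show z.2 - z.1 = -(z.1 - z.2) by ring, hb.neg_pow]
      ring
    simp only [h2, integral_neg] at h1
    linarith

variable {ι : Type*} [Fintype ι]

/-- The value at `(s, t)` of a polynomial with nonnegative coefficients in the variables `s + t`
and `s - t`. -/
noncomputable def ginibreEval (p : MvPolynomial (ι ⊕ ι) NNReal) (s t : ι → ℝ) : ℝ :=
  MvPolynomial.eval₂ NNReal.toRealHom (Sum.elim (s + t) (s - t)) p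

theorem ginibreEval_eq (p : MvPolynomial (ι ⊕ ι) NNReal) (s t : ι → ℝ) :
    ginibreEval p s t = ∑ d ∈ p.support, ((p.coeff d : NNReal) : ℝ) *
      ∏ i, ((s i + t i) ^ d (Sum.inl i) * (s i - t i) ^ d (Sum.inr i)) := by
  rw [ginibreEval, MvPolynomial.eval₂_eq']
  refine Finset.sum_congr rfl fun d _ => ?_
  rw [Fintype.prod_sum_type, Finset.prod_mul_distrib]
  rfl

variable {m : ι → Measure ℝ} [∀ i, IsFiniteMeasure (m i)]

/-- Each monomial in `s + t` and `s - t` factorizes over the sites, where symmetry of the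
one-dimensional measure decides the sign. -/
theorem integral_ginibreEval_nonneg (hsymm : ∀ i, (m i).map Neg.neg = m i)
    (hmom : ∀ i, ∀ k : ℕ, Integrable (fun x : ℝ => |x| ^ k) (m i))
    (p : MvPolynomial (ι ⊕ ι) NNReal) :
    Integrable (fun z : (ι → ℝ) × (ι → ℝ) => ginibreEval p z.1 z.2)
      ((Measure.pi m).prod (Measure.pi m)) ∧
    0 ≤ ∫ z : (ι → ℝ) × (ι → ℝ), ginibreEval p z.1 z.2 ∂(Measure.pi m).prod (Measure.pi m) := by
  have hmp := measurePreserving_arrowProdEquivProdArrow ℝ ℝ ι m m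
  have hI : ∀ d : ι ⊕ ι →₀ ℕ, Integrable (fun z : ι → ℝ × ℝ => ∏ i,
      (((z i).1 + (z i).2) ^ d (Sum.inl i) * ((z i).1 - (z i).2) ^ d (Sum.inr i)))
      (Measure.pi fun i => (m i).prod (m i)) := fun d =>
    Integrable.fintype_prod (f := fun i (y : ℝ × ℝ) => (y.1 + y.2) ^ d (Sum.inl i) *
      (y.1 - y.2) ^ d (Sum.inr i)) fun i => integrable_add_pow_mul_sub_pow (hmom i) _ _
  have hE : ∀ z : ι → ℝ × ℝ, ginibreEval p (MeasurableEquiv.arrowProdEquivProdArrow ℝ ℝ ι z).1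
      (MeasurableEquiv.arrowProdEquivProdArrow ℝ ℝ ι z).2 = ∑ d ∈ p.support, ((p.coeff d : NNReal) : ℝ) *
      ∏ i, (((z i).1 + (z i).2) ^ d (Sum.inl i) * ((z i).1 - (z i).2) ^ d (Sum.inr i)) := by
    intro z
    rw [ginibreEval_eq]
    rfl
  constructor
  · rw [← hmp.integrable_comp_emb (MeasurableEquiv.measurableEmbedding _)]
    simp only [Function.comp_def, hE]
    exact integrable_finsetSum _ fun d _ => (hI d).const_mul _
  · rw [← hmp.integral_comp (MeasurableEquiv.measurableEmbedding _)]
    simp only [hE]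
    rw [integral_finsetSum _ fun d _ => (hI d).const_mul _]
    refine Finset.sum_nonneg fun d _ => ?_
    rw [integral_const_mul]
    refine mul_nonneg (NNReal.coe_nonneg _) ?_
    rw [integral_fintype_prod_eq_prod (𝕜 := ℝ) (fun (i : ι) (y : ℝ × ℝ) =>
      (y.1 + y.2) ^ d (Sum.inl i) * (y.1 - y.2) ^ d (Sum.inr i))]
    exact Finset.prod_nonneg fun i _ => integral_add_pow_mul_sub_pow_nonneg (hsymm i) _ _

/-- Functions `φ` for which `φ(s) ± φ(t)` are polynomials with nonnegative coefficients in `s + t`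
and `s - t`, and `|φ(s)| ≤ φ(|s|)`. -/
structure IsGinibre (φ : (ι → ℝ) → ℝ) : Prop where
  add : ∃ p, ∀ s t, ginibreEval p s t = φ s + φ t
  sub : ∃ p, ∀ s t, ginibreEval p s t = φ s - φ t
  abs_le : ∀ s, |φ s| ≤ φ fun i => |s i|
  continuous : Continuous φ

namespace IsGinibre

variable {φ ψ : (ι → ℝ) → ℝ}

theorem abs_nonneg (hφ : IsGinibre φ) (s : ι → ℝ) : 0 ≤ φ fun i => |s i| :=
  (_root_.abs_nonneg _).trans (hφ.abs_le s)

theorem const {c : ℝ} (hc : 0 ≤ c) : IsGinibre fun _ : ι → ℝ => c where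
  add := ⟨MvPolynomial.C (2 * Real.toNNReal c), fun s t => by
    simp only [ginibreEval, MvPolynomial.eval₂_C]
    change ((2 * Real.toNNReal c : NNReal) : ℝ) = _
    rw [NNReal.coe_mul, Real.coe_toNNReal c hc]
    norm_num
    ring⟩
  sub := ⟨0, fun s t => by simp [ginibreEval]⟩
  abs_le s := (abs_of_nonneg hc).le
  continuous := continuous_const

theorem add' (hφ : IsGinibre φ) (hψ : IsGinibre ψ) : IsGinibre fun s => φ s + ψ s where
  add := by
    obtain ⟨p, hp⟩ := hφ.add
    obtain ⟨q, hq⟩ := hψ.add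
    refine ⟨p + q, fun s t => ?_⟩
    have h1 := hp s t
    have h2 := hq s t
    simp only [ginibreEval, MvPolynomial.eval₂_add] at *
    rw [h1, h2]; ring
  sub := by
    obtain ⟨p, hp⟩ := hφ.sub
    obtain ⟨q, hq⟩ := hψ.sub
    refine ⟨p + q, fun s t => ?_⟩
    have h1 := hp s t
    have h2 := hq s t
    simp only [ginibreEval, MvPolynomial.eval₂_add] at *
    rw [h1, h2]; ring
  abs_le s := (abs_add_le _ _).trans (add_le_add (hφ.abs_le s) (hψ.abs_le s))
  continuous := hφ.continuous.add hψ.continuous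

/-- The identity `2 (φψ(s) ± φψ(t)) = (φ(s) + φ(t)) (ψ(s) ± ψ(t)) + (φ(s) - φ(t)) (ψ(s) ∓ ψ(t))`
involves only nonnegative coefficients. -/
theorem mul (hφ : IsGinibre φ) (hψ : IsGinibre ψ) : IsGinibre fun s => φ s * ψ s where
  add := by
    obtain ⟨p, hp⟩ := hφ.add
    obtain ⟨q, hq⟩ := hψ.add
    obtain ⟨p', hp'⟩ := hφ.sub
    obtain ⟨q', hq'⟩ := hψ.sub
    refine ⟨MvPolynomial.C (1 / 2) * (p * q + p' * q'), fun s t => ?_⟩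
    have h1 := hp s t
    have h2 := hq s t
    have h3 := hp' s t
    have h4 := hq' s t
    simp only [ginibreEval, MvPolynomial.eval₂_add, MvPolynomial.eval₂_mul,
      MvPolynomial.eval₂_C] at *
    rw [h1, h2, h3, h4]
    change ((1 / 2 : NNReal) : ℝ) * _ = _
    push_cast
    ring
  sub := by
    obtain ⟨p, hp⟩ := hφ.add
    obtain ⟨q, hq⟩ := hψ.add
    obtain ⟨p', hp'⟩ := hφ.sub
    obtain ⟨q', hq'⟩ := hψ.sub
    refine ⟨MvPolynomial.C (1 / 2) * (p * q' + p' * q), fun s t => ?_⟩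
    have h1 := hp s t
    have h2 := hq s t
    have h3 := hp' s t
    have h4 := hq' s t
    simp only [ginibreEval, MvPolynomial.eval₂_add, MvPolynomial.eval₂_mul,
      MvPolynomial.eval₂_C] at *
    rw [h1, h2, h3, h4]
    change ((1 / 2 : NNReal) : ℝ) * _ = _
    push_cast
    ring
  abs_le s := by
    rw [abs_mul]
    exact mul_le_mul (hφ.abs_le s) (hψ.abs_le s) (_root_.abs_nonneg _) (hφ.abs_nonneg s)
  continuous := hφ.continuous.mul hψ.continuous

theorem coord (i : ι) : IsGinibre fun s : ι → ℝ => s i where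
  add := ⟨MvPolynomial.X (Sum.inl i), fun s t => by simp [ginibreEval]⟩
  sub := ⟨MvPolynomial.X (Sum.inr i), fun s t => by simp [ginibreEval]⟩
  abs_le s := le_rfl
  continuous := continuous_apply i

theorem sum {τ : Type*} (S : Finset τ) {φ : τ → (ι → ℝ) → ℝ} (h : ∀ a ∈ S, IsGinibre (φ a)) :
    IsGinibre fun s => ∑ a ∈ S, φ a s := by
  classical
  induction S using Finset.induction_on with
  | empty => simpa using const le_rfl
  | insert a S ha ih =>
    simp only [Finset.sum_insert ha]
    exact (h a (Finset.mem_insert_self a S)).add'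
      (ih fun b hb => h b (Finset.mem_insert_of_mem hb))

theorem prod {τ : Type*} (S : Finset τ) {φ : τ → (ι → ℝ) → ℝ} (h : ∀ a ∈ S, IsGinibre (φ a)) :
    IsGinibre fun s => ∏ a ∈ S, φ a s := by
  classical
  induction S using Finset.induction_on with
  | empty => simpa using const zero_le_one
  | insert a S ha ih =>
    simp only [Finset.prod_insert ha]
    exact (h a (Finset.mem_insert_self a S)).mul
      (ih fun b hb => h b (Finset.mem_insert_of_mem hb))

end IsGinibre

/-- Duplicating the variables, the difference of the two sides is the integral of `(F(s) - F(t))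
exp(H₁(s) + H₂(t))`. The exponent is half of `(H₁ + H₂)(s) + (H₁ + H₂)(t)` plus half of `(H₁ -
H₂)(s) - (H₁ - H₂)(t)`, a polynomial in `s ± t` with nonnegative coefficients. Hence each Taylor
partial sum contributes a nonnegative integral, and domination by the values at `|s|`, `|t|` allows
the limit. -/
theorem ginibre_inequality (hsymm : ∀ i, (m i).map Neg.neg = m i)
    (hmom : ∀ i, ∀ k : ℕ, Integrable (fun x : ℝ => |x| ^ k) (m i))
    {F H₁ H₂ : (ι → ℝ) → ℝ} (hF : IsGinibre F) (hH₁ : IsGinibre H₁) (hH₂ : IsGinibre H₂)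
    (hH : IsGinibre fun s => H₁ s - H₂ s)
    (hi₁ : Integrable (fun s => Real.exp (H₁ fun i => |s i|)) (Measure.pi m))
    (hi₂ : Integrable (fun s => Real.exp (H₂ fun i => |s i|)) (Measure.pi m))
    (hF₁ : Integrable (fun s => (F fun i => |s i|) * Real.exp (H₁ fun i => |s i|)) (Measure.pi m))
    (hF₂ : Integrable (fun s => (F fun i => |s i|) * Real.exp (H₂ fun i => |s i|)) (Measure.pi m)) :
    (∫ s, F s * Real.exp (H₂ s) ∂Measure.pi m) * ∫ s, Real.exp (H₁ s) ∂Measure.pi m ≤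
      (∫ s, F s * Real.exp (H₁ s) ∂Measure.pi m) * ∫ s, Real.exp (H₂ s) ∂Measure.pi m := by
  set β := Measure.pi m with hβ
  have hFc := hF.continuous
  have hc₁ := hH₁.continuous
  have hc₂ := hH₂.continuous
  obtain ⟨P, hP⟩ := hF.sub
  obtain ⟨p₁, hp₁⟩ := (hH₁.add' hH₂).add
  obtain ⟨p₂, hp₂⟩ := hH.sub
  set E : MvPolynomial (ι ⊕ ι) NNReal := MvPolynomial.C (1 / 2) * (p₁ + p₂) with hE
  have hEe : ∀ s t, ginibreEval E s t = H₁ s + H₂ t := by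
    intro s t
    have h1 := hp₁ s t
    have h2 := hp₂ s t
    simp only [ginibreEval, hE, MvPolynomial.eval₂_add, MvPolynomial.eval₂_mul,
      MvPolynomial.eval₂_C] at *
    rw [h1, h2]
    change ((1 / 2 : NNReal) : ℝ) * _ = _
    push_cast
    ring
  set X : ℕ → (ι → ℝ) × (ι → ℝ) → ℝ := fun n z =>
    (F z.1 - F z.2) * ∑ k ∈ Finset.range n, (H₁ z.1 + H₂ z.2) ^ k / k.factorial with hX
  have hXg : ∀ n, 0 ≤ ∫ z, X n z ∂β.prod β := by
    intro n
    have := (integral_ginibreEval_nonneg hsymm hmom (P * ∑ k ∈ Finset.range n,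
      MvPolynomial.C ((k.factorial : NNReal)⁻¹) * E ^ k)).2
    convert this using 3 with z
    have h1 := hP z.1 z.2
    have h2 := hEe z.1 z.2
    simp only [ginibreEval, MvPolynomial.eval₂_mul, MvPolynomial.eval₂_sum, MvPolynomial.eval₂_C,
      MvPolynomial.eval₂_pow] at *
    rw [h1, h2, hX]
    simp only
    congr 1
    refine Finset.sum_congr rfl fun k _ => ?_
    change _ = (((k.factorial : NNReal)⁻¹ : NNReal) : ℝ) * _
    push_cast
    rw [div_eq_inv_mul]
  -- the dominating function
  set A : (ι → ℝ) → ℝ := fun s => Real.exp (H₁ fun i => |s i|) with hA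
  set B : (ι → ℝ) → ℝ := fun s => Real.exp (H₂ fun i => |s i|) with hB
  have hdom : Integrable (fun z : (ι → ℝ) × (ι → ℝ) =>
      ((F fun i => |z.1 i|) * A z.1) * B z.2 + A z.1 * ((F fun i => |z.2 i|) * B z.2)) (β.prod β) :=
    (hF₁.mul_prod hi₂).add (hi₁.mul_prod hF₂)
  have hlim : Tendsto (fun n => ∫ z, X n z ∂β.prod β) atTop
      (𝓝 (∫ z : (ι → ℝ) × (ι → ℝ), (F z.1 - F z.2) * Real.exp (H₁ z.1 + H₂ z.2) ∂β.prod β)) := by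
    refine tendsto_integral_of_dominated_convergence _ (fun n => ?_) hdom (fun n => ?_) ?_
    · refine Continuous.aestronglyMeasurable ?_
      simp only [hX]
      fun_prop
    · refine Eventually.of_forall fun z => ?_
      simp only [hX, Real.norm_eq_abs, abs_mul]
      have h1 : |F z.1 - F z.2| ≤ (F fun i => |z.1 i|) + (F fun i => |z.2 i|) :=
        (abs_sub _ _).trans (add_le_add (hF.abs_le _) (hF.abs_le _))
      have h2 : |∑ k ∈ Finset.range n, (H₁ z.1 + H₂ z.2) ^ k / (k.factorial : ℝ)| ≤ A z.1 * B z.2 := by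
        rw [hA, hB]
        simp only
        rw [← Real.exp_add]
        have h3 : |H₁ z.1 + H₂ z.2| ≤ (H₁ fun i => |z.1 i|) + (H₂ fun i => |z.2 i|) :=
          (abs_add_le _ _).trans (add_le_add (hH₁.abs_le _) (hH₂.abs_le _))
        calc _ ≤ ∑ k ∈ Finset.range n, |H₁ z.1 + H₂ z.2| ^ k / (k.factorial : ℝ) := by
              refine (Finset.abs_sum_le_sum_abs _ _).trans (le_of_eq ?_)
              refine Finset.sum_congr rfl fun k _ => ?_
              rw [abs_div, abs_pow, Nat.abs_cast]
          _ ≤ Real.exp |H₁ z.1 + H₂ z.2| := Real.sum_le_exp_of_nonneg (abs_nonneg _) n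
          _ ≤ _ := Real.exp_le_exp.2 h3
      calc _ ≤ ((F fun i => |z.1 i|) + (F fun i => |z.2 i|)) * (A z.1 * B z.2) :=
            mul_le_mul h1 h2 (abs_nonneg _) (add_nonneg (hF.abs_nonneg _) (hF.abs_nonneg _))
        _ = _ := by ring
    · refine Eventually.of_forall fun z => ?_
      simp only [hX]
      refine Tendsto.const_mul _ ?_
      have := (NormedSpace.expSeries_div_hasSum_exp (H₁ z.1 + H₂ z.2)).tendsto_sum_nat
      rwa [← Real.exp_eq_exp_ℝ] at this
  have hpos := ge_of_tendsto' hlim hXg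
  -- Fubini
  have hmono : ∀ {f g : (ι → ℝ) → ℝ}, Integrable g β → Continuous f → (∀ s, |f s| ≤ g s) →
      Integrable f β := fun hg hf h =>
    hg.mono' hf.aestronglyMeasurable (Eventually.of_forall h)
  have hexp : ∀ {φ : (ι → ℝ) → ℝ}, IsGinibre φ → ∀ s, Real.exp (φ s) ≤ Real.exp (φ fun i => |s i|) :=
    fun hφ s => Real.exp_le_exp.2 ((le_abs_self _).trans (hφ.abs_le s))
  have e₁ : Integrable (fun s => Real.exp (H₁ s)) β := hmono hi₁ (by fun_prop) fun s => by
    rw [abs_of_pos (Real.exp_pos _)]; exact hexp hH₁ s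
  have e₂ : Integrable (fun s => Real.exp (H₂ s)) β := hmono hi₂ (by fun_prop) fun s => by
    rw [abs_of_pos (Real.exp_pos _)]; exact hexp hH₂ s
  have f₁ : Integrable (fun s => F s * Real.exp (H₁ s)) β := hmono hF₁ (by fun_prop) fun s => by
    rw [abs_mul, abs_of_pos (Real.exp_pos _)]
    exact mul_le_mul (hF.abs_le s) (hexp hH₁ s) (Real.exp_pos _).le (hF.abs_nonneg s)
  have f₂ : Integrable (fun s => F s * Real.exp (H₂ s)) β := hmono hF₂ (by fun_prop) fun s => by
    rw [abs_mul, abs_of_pos (Real.exp_pos _)]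
    exact mul_le_mul (hF.abs_le s) (hexp hH₂ s) (Real.exp_pos _).le (hF.abs_nonneg s)
  have hfin : ∫ z : (ι → ℝ) × (ι → ℝ), (F z.1 - F z.2) * Real.exp (H₁ z.1 + H₂ z.2) ∂β.prod β =
      (∫ s, F s * Real.exp (H₁ s) ∂β) * (∫ s, Real.exp (H₂ s) ∂β) -
        (∫ s, Real.exp (H₁ s) ∂β) * ∫ s, F s * Real.exp (H₂ s) ∂β := by
    rw [← integral_prod_mul, ← integral_prod_mul, ← integral_sub (f₁.mul_prod e₂) (e₁.mul_prod f₂)]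
    congr 1
    ext z
    rw [Real.exp_add]
    ring
  rw [hfin] at hpos
  linarith

end Ginibre

/-! ### The second Griffiths inequality for ferromagnetic Gaussian measures -/

section Griffiths

theorem integrable_exp_abs_sub_sq (b L : ℝ) {c : ℝ} (hc : 0 < c) :
    Integrable fun x : ℝ => Real.exp (b + L * |x| - c * x ^ 2) := by
  have h1 : Integrable fun x : ℝ => Real.exp (b + L ^ 2 / (2 * c)) * Real.exp (-(c / 2) * x ^ 2) :=
    (integrable_exp_neg_mul_sq (by positivity)).const_mul _
  refine h1.mono' (by fun_prop) (Eventually.of_forall fun x => ?_)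
  rw [Real.norm_eq_abs, abs_of_pos (Real.exp_pos _), ← Real.exp_add, Real.exp_le_exp]
  have h2 : L ^ 2 / (2 * c) - L * |x| + c / 2 * x ^ 2 = (L - c * |x|) ^ 2 / (2 * c) := by
    rw [← sq_abs x]; field_simp; ring
  have h3 : 0 ≤ (L - c * |x|) ^ 2 / (2 * c) := by positivity
  linarith

variable {ι : Type*} [Fintype ι] [DecidableEq ι]

/-- With `R` the square root of `B`, write `t = R⁻¹ (R t)` and apply Cauchy-Schwarz: the squared
Frobenius norm of `R⁻¹` is the constant. The added `1` covers an empty index set. -/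
theorem Matrix.PosDef.exists_pos_mul_sum_sq_le {B : Matrix ι ι ℝ} (hB : B.PosDef) :
    ∃ c : ℝ, 0 < c ∧ ∀ t : ι → ℝ, c * ∑ i, t i ^ 2 ≤ t ⬝ᵥ B.mulVec t := by
  set R := CFC.sqrt B with hR
  have hRR : R * R = B := sqrt_mul_sqrt_of_posSemidef hB.posSemidef
  have hRu : IsUnit R.det := by
    refine isUnit_iff_ne_zero.2 fun h => ?_
    have h1 := congrArg Matrix.det hRR
    rw [Matrix.det_mul, h, zero_mul] at h1
    exact hB.det_pos.ne h1
  set K : ℝ := ∑ i, ∑ j, R⁻¹ i j ^ 2 with hK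
  have hK0 : 0 ≤ K := Finset.sum_nonneg fun i _ => Finset.sum_nonneg fun j _ => sq_nonneg _
  refine ⟨(K + 1)⁻¹, by positivity, fun t => ?_⟩
  have h1 : t ⬝ᵥ B.mulVec t = ∑ i, R.mulVec t i ^ 2 := by
    rw [← hRR, ← Matrix.mulVec_mulVec, Matrix.dotProduct_mulVec, ← Matrix.mulVec_transpose,
      hR, transpose_sqrt]
    simp [dotProduct, sq]
  have h2 : ∑ i, t i ^ 2 ≤ K * ∑ i, R.mulVec t i ^ 2 := by
    have h3 : t = R⁻¹.mulVec (R.mulVec t) := by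
      rw [Matrix.mulVec_mulVec, Matrix.nonsing_inv_mul _ hRu, Matrix.one_mulVec]
    conv_lhs => rw [h3]
    rw [hK, Finset.sum_mul]
    exact Finset.sum_le_sum fun i _ => Finset.sum_mul_sq_le_sq_mul_sq _ _ _
  have h4 : 0 ≤ ∑ i, R.mulVec t i ^ 2 := Finset.sum_nonneg fun i _ => sq_nonneg _
  rw [h1, inv_mul_le_iff₀ (by positivity)]
  linarith

/-- The off-diagonal part of the Gaussian exponent, together with a linear term. -/
noncomputable def pairInteraction (B : Matrix ι ι ℝ) (h : ι → ℝ) (t : ι → ℝ) : ℝ :=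
  (∑ i, ∑ j, (if i = j then 0 else -(B i j) / 2) * (t i * t j)) + ∑ i, h i * t i

theorem isGinibre_pairInteraction {B : Matrix ι ι ℝ} {h : ι → ℝ} (hB : ∀ i j, i ≠ j → B i j ≤ 0)
    (hh : ∀ i, 0 ≤ h i) : IsGinibre (pairInteraction B h) := by
  refine (IsGinibre.sum _ fun i _ => IsGinibre.sum _ fun j _ => ?_).add'
    (IsGinibre.sum _ fun i _ => (IsGinibre.const (hh i)).mul (IsGinibre.coord i))
  refine (IsGinibre.const ?_).mul ((IsGinibre.coord i).mul (IsGinibre.coord j))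
  split_ifs with hij
  · exact le_rfl
  · linarith [hB i j hij]

theorem pairInteraction_eq (B : Matrix ι ι ℝ) (h t : ι → ℝ) :
    pairInteraction B h t = -(t ⬝ᵥ B.mulVec t) / 2 + ∑ i, B i i * t i ^ 2 / 2 + ∑ i, h i * t i := by
  rw [pairInteraction]
  congr 1
  have h1 : ∑ i, B i i * t i ^ 2 / 2 =
      ∑ i, ∑ j, (if i = j then B i j * (t i * t j) / 2 else 0) := by
    refine Finset.sum_congr rfl fun i _ => ?_
    simp [sq]
  have h2 : -(t ⬝ᵥ B.mulVec t) / 2 = ∑ i, ∑ j, -(B i j * (t i * t j) / 2) := by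
    simp only [dotProduct, Matrix.mulVec, Finset.mul_sum, Finset.sum_neg_distrib, neg_div,
      Finset.sum_div]
    congr 1
    exact Finset.sum_congr rfl fun i _ => Finset.sum_congr rfl fun j _ => by ring
  rw [h1, h2, ← Finset.sum_add_distrib]
  refine Finset.sum_congr rfl fun i _ => ?_
  rw [← Finset.sum_add_distrib]
  refine Finset.sum_congr rfl fun j _ => ?_
  split_ifs <;> ring

/-- The weight of a single-spin interaction `V` with an external field `h`. -/
noncomputable def spinWeight (V : ι → ℝ → ℝ) (h t : ι → ℝ) : ℝ :=
  Real.exp (-∑ i, (V i (t i) - h i * t i))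

variable {V : ι → ℝ → ℝ} {h : ι → ℝ}

theorem continuous_spinWeight (hVc : ∀ i, Continuous (V i)) : Continuous (spinWeight V h) := by
  unfold spinWeight
  fun_prop

/-- **Griffiths' second inequality**: the correlation functions of a ferromagnetic Gaussian
measure, perturbed by even single-spin interactions and a nonnegative external field, increase
with the couplings. -/
theorem griffiths_second {B₁ B₂ : Matrix ι ι ℝ} (h₁ : B₁.PosDef) (h₂ : B₂.PosDef)
    (hdiag : ∀ i, B₁ i i = B₂ i i) (hle : ∀ i j, B₁ i j ≤ B₂ i j)
    (hneg : ∀ i j, i ≠ j → B₂ i j ≤ 0) (hVc : ∀ i, Continuous (V i))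
    (hVe : ∀ i x, V i (-x) = V i x) {b : ℝ} (hVb : ∀ i x, -b ≤ V i x) (hh : ∀ i, 0 ≤ h i)
    {r : ℕ} {f : Fin r → ι → ℝ} (hf : ∀ k i, 0 ≤ f k i) :
    (∫ t : EuclideanSpace ℝ ι, (∏ k, ∑ i, f k i * t i) * spinWeight V h t.ofLp
        ∂multivariateGaussian 0 B₂⁻¹) *
      ∫ t : EuclideanSpace ℝ ι, spinWeight V h t.ofLp ∂multivariateGaussian 0 B₁⁻¹ ≤
    (∫ t : EuclideanSpace ℝ ι, (∏ k, ∑ i, f k i * t i) * spinWeight V h t.ofLp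
        ∂multivariateGaussian 0 B₁⁻¹) *
      ∫ t : EuclideanSpace ℝ ι, spinWeight V h t.ofLp ∂multivariateGaussian 0 B₂⁻¹ := by
  -- The diagonal of the quadratic form is absorbed into the single-spin density. It is common to
  -- `B₁` and `B₂`, so one even product measure serves both theories.
  set ρ : ι → ℝ → ℝ := fun i x => Real.exp (-V i x - B₁ i i / 2 * x ^ 2) with hρ
  have hρ0 : ∀ i x, 0 ≤ ρ i x := fun i x => (Real.exp_pos _).le
  have hρc : ∀ i, Continuous (ρ i) := fun i => by have := hVc i; simp only [hρ]; fun_prop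
  have hdpos : ∀ i, 0 < B₁ i i / 2 := fun i => half_pos h₁.diag_pos
  have hρle : ∀ i (k : ℕ) x, |x| ^ k * ρ i x ≤
      k.factorial * Real.exp (b + 1 * |x| - B₁ i i / 2 * x ^ 2) := by
    intro i k x
    have h3 : |x| ^ k ≤ k.factorial * Real.exp |x| := by
      have := Real.pow_div_factorial_le_exp |x| (abs_nonneg x) k
      rwa [div_le_iff₀ (by positivity), mul_comm] at this
    calc |x| ^ k * ρ i x ≤ (k.factorial * Real.exp |x|) * Real.exp (b - B₁ i i / 2 * x ^ 2) := by
          refine mul_le_mul h3 (Real.exp_le_exp.2 ?_) (hρ0 i x) (by positivity)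
          linarith [hVb i x]
      _ = _ := by rw [mul_assoc, ← Real.exp_add]; ring_nf
  have hρmom : ∀ i (k : ℕ), Integrable fun x => |x| ^ k * ρ i x := by
    intro i k
    refine ((integrable_exp_abs_sub_sq b 1 (hdpos i)).const_mul (k.factorial : ℝ)).mono'
      (by have := hρc i; exact Continuous.aestronglyMeasurable (by fun_prop))
      (Eventually.of_forall fun x => ?_)
    rw [Real.norm_eq_abs, abs_of_nonneg (mul_nonneg (by positivity) (hρ0 i x))]
    exact hρle i k x
  have hρint : ∀ i, Integrable (ρ i) := fun i => by simpa using hρmom i 0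
  set m : ι → Measure ℝ := fun i => (volume : Measure ℝ).withDensity fun x => ENNReal.ofReal (ρ i x)
    with hm
  have hmfin : ∀ i, IsFiniteMeasure (m i) := fun i => isFiniteMeasure_withDensity_ofReal (hρint i).2
  have hρm : ∀ i, Measurable fun x => ENNReal.ofReal (ρ i x) := fun i => by
    have := (hρc i).measurable; fun_prop
  have hmom : ∀ i, ∀ k : ℕ, Integrable (fun x : ℝ => |x| ^ k) (m i) := by
    intro i k
    rw [hm]
    rw [integrable_withDensity_iff (hρm i) (Eventually.of_forall fun x => ENNReal.ofReal_lt_top)]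
    simpa only [ENNReal.toReal_ofReal (hρ0 i _)] using hρmom i k
  have hsymm : ∀ i, (m i).map Neg.neg = m i := by
    intro i
    ext s hs
    rw [Measure.map_apply measurable_neg hs, withDensity_apply _ (measurable_neg hs),
      withDensity_apply _ hs, ← lintegral_indicator (measurable_neg hs), ← lintegral_indicator hs,
      ← lintegral_neg_eq_self]
    congr 1
    ext x
    have hρe : ρ i (-x) = ρ i x := by simp only [hρ, hVe, neg_sq]
    by_cases hx : x ∈ s
    · rw [Set.indicator_of_mem (show -x ∈ Neg.neg ⁻¹' s by rwa [Set.mem_preimage, neg_neg]),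
        Set.indicator_of_mem hx, hρe]
    · rw [Set.indicator_of_notMem (show -x ∉ Neg.neg ⁻¹' s by rwa [Set.mem_preimage, neg_neg]),
        Set.indicator_of_notMem hx]
  have hβ : Measure.pi m = (volume : Measure (ι → ℝ)).withDensity
      fun x => ENNReal.ofReal (∏ i, ρ i (x i)) := pi_withDensity_ofReal hρ0 hρint
  have hprod0 : ∀ t : ι → ℝ, 0 ≤ ∏ i, ρ i (t i) := fun t => Finset.prod_nonneg fun i _ => hρ0 _ _
  have hprodm : Measurable fun t : ι → ℝ => ENNReal.ofReal (∏ i, ρ i (t i)) := by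
    refine ENNReal.measurable_ofReal.comp (Continuous.measurable ?_)
    exact continuous_finsetProd _ fun i _ => (hρc i).comp (continuous_apply i)
  have hβint : ∀ {Φ : (ι → ℝ) → ℝ}, ∫ t, Φ t ∂Measure.pi m = ∫ t, Φ t * ∏ i, ρ i (t i) := by
    intro Φ
    rw [hβ, integral_withDensity_eq_integral_toReal_smul₀ hprodm.aemeasurable (by simp)]
    congr 1
    ext t
    rw [ENNReal.toReal_ofReal (hprod0 t), smul_eq_mul, mul_comm]
  have hβi : ∀ {Φ : (ι → ℝ) → ℝ}, Integrable Φ (Measure.pi m) ↔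
      Integrable fun t => Φ t * ∏ i, ρ i (t i) := by
    intro Φ
    rw [hβ, integrable_withDensity_iff hprodm (Eventually.of_forall fun x => ENNReal.ofReal_lt_top)]
    simp only [ENNReal.toReal_ofReal (hprod0 _)]
  have hwt : ∀ {B : Matrix ι ι ℝ}, (∀ i, B₁ i i = B i i) → ∀ t : ι → ℝ,
      Real.exp (pairInteraction B h t) * ∏ i, ρ i (t i) =
        spinWeight V h t * Real.exp (-(t ⬝ᵥ B.mulVec t) / 2) := by
    intro B hd t
    rw [hρ, ← Real.exp_sum, ← Real.exp_add, spinWeight, ← Real.exp_add, pairInteraction_eq]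
    congr 1
    simp only [hd, Finset.sum_sub_distrib, Finset.sum_neg_distrib]
    have : ∑ i, B i i / 2 * t i ^ 2 = ∑ i, B i i * t i ^ 2 / 2 :=
      Finset.sum_congr rfl fun i _ => by ring
    rw [this]
    ring
  set F : (ι → ℝ) → ℝ := fun t => ∏ k, ∑ i, f k i * t i with hF
  have hFg : IsGinibre F := IsGinibre.prod _ fun k _ => IsGinibre.sum _ fun i _ =>
    (IsGinibre.const (hf k i)).mul (IsGinibre.coord i)
  have hFexp : ∀ s : ι → ℝ, (F fun i => |s i|) ≤ Real.exp (∑ i, (∑ k, f k i) * |s i|) := by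
    intro s
    have : ∑ i, (∑ k, f k i) * |s i| = ∑ k, ∑ i, f k i * |s i| := by
      rw [Finset.sum_comm]
      exact Finset.sum_congr rfl fun i _ => Finset.sum_mul _ _ _
    rw [this, Real.exp_sum, hF]
    refine Finset.prod_le_prod (fun k _ => Finset.sum_nonneg fun i _ =>
      mul_nonneg (hf k i) (abs_nonneg _)) fun k _ => ?_
    linarith [Real.add_one_le_exp (∑ i, f k i * |s i|)]
  -- At `|s|` the off-diagonal terms all have the bad sign, and `ρ` alone does not control them.
  -- Recombined with the diagonal they form the quadratic form of `B` at `|s|`, which is coercive.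
  have hdom : ∀ {B : Matrix ι ι ℝ}, B.PosDef → (∀ i, B₁ i i = B i i) →
      ∀ {Φ : (ι → ℝ) → ℝ}, Continuous Φ → (∀ s, 0 ≤ Φ s) →
      (∀ s, Φ s ≤ Real.exp (∑ i, (∑ k, f k i) * |s i|)) →
      Integrable (fun s => Φ s * Real.exp (pairInteraction B h fun i => |s i|)) (Measure.pi m) := by
    intro B hB hd Φ hΦ hΦ0 hΦle
    rw [hβi]
    obtain ⟨c, hc, hcB⟩ := hB.exists_pos_mul_sum_sq_le
    have hI : Integrable fun s : ι → ℝ => ∏ i,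
        Real.exp (b + (∑ k, f k i + h i) * |s i| - c / 2 * s i ^ 2) :=
      Integrable.fintype_prod (f := fun i x =>
        Real.exp (b + (∑ k, f k i + h i) * |x| - c / 2 * x ^ 2))
        fun i => integrable_exp_abs_sub_sq _ _ (half_pos hc)
    have hpc : Continuous (pairInteraction B h) := by unfold pairInteraction; fun_prop
    refine hI.mono' (Continuous.aestronglyMeasurable ?_) (Eventually.of_forall fun s => ?_)
    · fun_prop
    · have e1 : ∏ i, ρ i (s i) = ∏ i, ρ i |s i| := by
        refine Finset.prod_congr rfl fun i _ => ?_
        simp only [hρ, sq_abs]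
        rcases abs_choice (s i) with h3 | h3 <;> rw [h3]
        rw [hVe]
      rw [Real.norm_eq_abs, e1, mul_assoc, hwt hd, spinWeight, abs_of_nonneg (mul_nonneg (hΦ0 s)
        (mul_nonneg (Real.exp_pos _).le (Real.exp_pos _).le)), ← Real.exp_add]
      calc _ ≤ Real.exp (∑ i, (∑ k, f k i) * |s i|) *
            Real.exp ((∑ i, (b + h i * |s i|)) - c / 2 * ∑ i, s i ^ 2) := by
            refine mul_le_mul (hΦle s) (Real.exp_le_exp.2 ?_) (Real.exp_pos _).le (Real.exp_pos _).le
            have h3 := hcB fun i => |s i|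
            simp only [sq_abs] at h3
            have h4 : -∑ i, (V i |s i| - h i * |s i|) ≤ ∑ i, (b + h i * |s i|) := by
              rw [← Finset.sum_neg_distrib]
              exact Finset.sum_le_sum fun i _ => by linarith [hVb i |s i|]
            linarith
        _ = _ := by
            rw [← Real.exp_add, ← Real.exp_sum]
            congr 1
            rw [Finset.mul_sum, ← Finset.sum_sub_distrib, ← Finset.sum_add_distrib]
            exact Finset.sum_congr rfl fun i _ => by ring
  have hdom1 : ∀ {B : Matrix ι ι ℝ}, B.PosDef → (∀ i, B₁ i i = B i i) →
      Integrable (fun s => Real.exp (pairInteraction B h fun i => |s i|)) (Measure.pi m) := by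
    intro B hB hd
    have := hdom hB hd (Φ := fun _ => 1) continuous_const (fun _ => zero_le_one) (fun s => by
      rw [← Real.exp_zero, Real.exp_le_exp]
      exact Finset.sum_nonneg fun i _ => mul_nonneg (Finset.sum_nonneg fun k _ => hf k i)
        (abs_nonneg _))
    simpa using this
  have hdomF : ∀ {B : Matrix ι ι ℝ}, B.PosDef → (∀ i, B₁ i i = B i i) →
      Integrable (fun s => (F fun i => |s i|) * Real.exp (pairInteraction B h fun i => |s i|))
        (Measure.pi m) := fun hB hd =>
    hdom hB hd (Φ := fun s => F fun i => |s i|) (by have := hFg.continuous; fun_prop)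
      (fun s => hFg.abs_nonneg s) hFexp
  have hneg₁ : ∀ i j, i ≠ j → B₁ i j ≤ 0 := fun i j hij => (hle i j).trans (hneg i j hij)
  -- The external fields cancel, and the difference is the pair interaction of `B₁ - B₂`, whose
  -- entries are nonpositive.
  have hdiff : IsGinibre fun s => pairInteraction B₁ h s - pairInteraction B₂ h s := by
    have h3 := isGinibre_pairInteraction (B := B₁ - B₂) (h := 0)
      (fun i j _ => by simpa using hle i j) (fun _ => le_rfl)
    convert h3 using 2 with s
    simp only [pairInteraction, Matrix.sub_apply, Pi.zero_apply, zero_mul, Finset.sum_const_zero,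
      add_zero, add_sub_add_right_eq_sub, ← Finset.sum_sub_distrib]
    refine Finset.sum_congr rfl fun i _ => Finset.sum_congr rfl fun j _ => ?_
    split_ifs <;> ring
  have main := ginibre_inequality hsymm hmom hFg (isGinibre_pairInteraction hneg₁ hh)
    (isGinibre_pairInteraction hneg hh) hdiff (hdom1 h₁ fun _ => rfl) (hdom1 h₂ hdiag)
    (hdomF h₁ fun _ => rfl) (hdomF h₂ hdiag)
  obtain ⟨Z₁, hZ₁, hG₁⟩ := integral_multivariateGaussian_inv h₁
  obtain ⟨Z₂, hZ₂, hG₂⟩ := integral_multivariateGaussian_inv h₂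
  have hwc := continuous_spinWeight (h := h) hVc
  have hFw : Continuous fun t => F t * spinWeight V h t := hFg.continuous.mul hwc
  rw [hG₁ _ hwc, hG₂ _ hwc, hG₁ _ hFw, hG₂ _ hFw]
  simp only [hβint, mul_assoc, hwt hdiag, hwt fun _ => rfl] at main
  simp only [mul_assoc]
  have hZ : 0 ≤ Z₁ * Z₂ := by positivity
  have := mul_le_mul_of_nonneg_left main hZ
  calc _ = _ := by ring
    _ ≤ _ := this
    _ = _ := by ring

end Griffiths

/-! ### Finite-dimensional division algebras over `ℚ_p` -/

section Coordinates

variable (p : ℕ) [Fact p.Prime] {K : Type*} [DivisionRing K] [Algebra ℚ_[p] K]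
  [FiniteDimensional ℚ_[p] K]

/-- The sup norm of the coordinates in a fixed basis. -/
noncomputable def coordNorm (x : K) : ℝ := ‖(Module.finBasis ℚ_[p] K).equivFun x‖

theorem coordNorm_nonneg (x : K) : 0 ≤ coordNorm p x := norm_nonneg _

theorem coordNorm_pos {x : K} (hx : x ≠ 0) : 0 < coordNorm p x :=
  norm_pos_iff.2 (by simpa using hx)

theorem coordNorm_smul (c : ℚ_[p]) (x : K) : coordNorm p (c • x) = ‖c‖ * coordNorm p x := by
  rw [coordNorm, map_smul, norm_smul, coordNorm]

theorem coordNorm_add_le (x y : K) :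
    coordNorm p (x + y) ≤ max (coordNorm p x) (coordNorm p y) := by
  rw [coordNorm, map_add, pi_norm_le_iff_of_nonneg (le_max_of_le_left (coordNorm_nonneg p x))]
  intro i
  refine (Padic.nonarchimedean _ _).trans (max_le_max ?_ ?_)
  · exact norm_le_pi_norm ((Module.finBasis ℚ_[p] K).equivFun x) i
  · exact norm_le_pi_norm ((Module.finBasis ℚ_[p] K).equivFun y) i

theorem coordNorm_sum_le {τ : Type*} (s : Finset τ) (x : τ → K) {M : ℝ} (hM : 0 ≤ M)
    (h : ∀ i ∈ s, coordNorm p (x i) ≤ M) : coordNorm p (∑ i ∈ s, x i) ≤ M := by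
  classical
  induction s using Finset.induction_on with
  | empty => simpa [coordNorm] using hM
  | insert a s ha ih =>
    rw [Finset.sum_insert ha]
    exact (coordNorm_add_le p _ _).trans (max_le (h a (Finset.mem_insert_self a s))
      (ih fun b hb => h b (Finset.mem_insert_of_mem hb)))

theorem exists_smul_eq_coordNorm_one {x : K} (hx : x ≠ 0) :
    ∃ c : ℚ_[p], ∃ y : K, ‖c‖ = coordNorm p x ∧ coordNorm p y = 1 ∧ x = c • y := by
  set v := (Module.finBasis ℚ_[p] K).equivFun x with hv
  have hv0 : v ≠ 0 := by simpa [hv] using hx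
  obtain ⟨i0, hi0⟩ : ∃ i, v i ≠ 0 := by
    by_contra h
    push Not at h
    exact hv0 (funext h)
  have : Nonempty (Fin (Module.finrank ℚ_[p] K)) := ⟨i0⟩
  obtain ⟨i, hi⟩ := Finite.exists_max fun i => ‖v i‖
  have hnorm : ‖v i‖ = ‖v‖ :=
    le_antisymm (norm_le_pi_norm v i) ((pi_norm_le_iff_of_nonneg (norm_nonneg _)).2 hi)
  have hvi : v i ≠ 0 := by
    rw [← norm_ne_zero_iff, hnorm, norm_ne_zero_iff]
    exact hv0
  refine ⟨v i, (v i)⁻¹ • x, hnorm, ?_, ?_⟩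
  · rw [coordNorm_smul, norm_inv, hnorm]
    exact inv_mul_cancel₀ (norm_ne_zero_iff.2 hv0)
  · rw [smul_smul, mul_inv_cancel₀ hvi, one_smul]

variable [TopologicalSpace K] [T2Space K] [IsTopologicalAddGroup K] [ContinuousSMul ℚ_[p] K]

/-- The coordinate homeomorphism. -/
noncomputable def coordHomeo (K : Type*) [DivisionRing K] [Algebra ℚ_[p] K]
    [FiniteDimensional ℚ_[p] K] [TopologicalSpace K] [T2Space K] [IsTopologicalAddGroup K]
    [ContinuousSMul ℚ_[p] K] : K ≃ₜ (Fin (Module.finrank ℚ_[p] K) → ℚ_[p]) :=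
  (Module.finBasis ℚ_[p] K).equivFun.toContinuousLinearEquiv.toHomeomorph

theorem coordHomeo_apply (x : K) : coordHomeo p K x = (Module.finBasis ℚ_[p] K).equivFun x := rfl

theorem continuous_coordNorm : Continuous (coordNorm p : K → ℝ) :=
  (coordHomeo p K).continuous.norm

theorem isCompact_coordNorm_le (R : ℝ) : IsCompact {x : K | coordNorm p x ≤ R} := by
  have h : {x : K | coordNorm p x ≤ R} = coordHomeo p K ⁻¹' Metric.closedBall 0 R := by
    ext x; simp [coordNorm, coordHomeo_apply]
  rw [h]
  exact (coordHomeo p K).isCompact_preimage.2 (isCompact_closedBall 0 R)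

theorem isCompact_coordNorm_eq : IsCompact {x : K | coordNorm p x = 1} :=
  (isCompact_coordNorm_le p 1).of_isClosed_subset
    (isClosed_singleton.preimage (continuous_coordNorm p)) fun _ hx => le_of_eq hx

theorem locallyCompactSpace_of_padic (K : Type*) [DivisionRing K] [Algebra ℚ_[p] K]
    [FiniteDimensional ℚ_[p] K] [TopologicalSpace K] [T2Space K] [IsTopologicalAddGroup K]
    [ContinuousSMul ℚ_[p] K] : LocallyCompactSpace K :=
  (coordHomeo p K).isClosedEmbedding.locallyCompactSpace

theorem secondCountableTopology_of_padic (K : Type*) [DivisionRing K] [Algebra ℚ_[p] K]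
    [FiniteDimensional ℚ_[p] K] [TopologicalSpace K] [T2Space K] [IsTopologicalAddGroup K]
    [ContinuousSMul ℚ_[p] K] : SecondCountableTopology K :=
  (coordHomeo p K).secondCountableTopology

theorem continuousMul_of_padic (K : Type*) [DivisionRing K] [Algebra ℚ_[p] K]
    [FiniteDimensional ℚ_[p] K] [TopologicalSpace K] [T2Space K] [IsTopologicalAddGroup K]
    [ContinuousSMul ℚ_[p] K] : ContinuousMul K := by
  constructor
  set b := Module.finBasis ℚ_[p] K
  have h : (fun z : K × K => z.1 * z.2) = fun z => ∑ i, b.equivFun z.1 i • (b i * z.2) := by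
    ext z
    conv_lhs => rw [← b.sum_equivFun z.1, Finset.sum_mul]
    exact Finset.sum_congr rfl fun i _ => smul_mul_assoc _ _ _
  rw [h]
  refine continuous_finsetSum _ fun i _ => ?_
  have h1 : Continuous fun z : K × K => b.equivFun z.1 i :=
    (continuous_apply i).comp ((coordHomeo p K).continuous.comp continuous_fst)
  have h2 : Continuous fun y : K => b i * y :=
    (LinearMap.mulLeft ℚ_[p] (b i)).continuous_of_finiteDimensional
  exact h1.smul (h2.comp continuous_snd)

/-- A continuous positive homogeneous function is comparable with a power of the norm. -/
theorem exists_coordNorm_bounds {φ : K → ℝ} {k : ℕ} (hc : Continuous φ)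
    (hs : ∀ (c : ℚ_[p]) (x : K), φ (c • x) = ‖c‖ ^ k * φ x) (hpos : ∀ x, x ≠ 0 → 0 < φ x)
    (hk : k ≠ 0) :
    ∃ a b : ℝ, 0 < a ∧ 0 < b ∧ ∀ x, a * coordNorm p x ^ k ≤ φ x ∧ φ x ≤ b * coordNorm p x ^ k := by
  have hy0 : ∀ y : K, coordNorm p y = 1 → y ≠ 0 := by
    rintro y hy rfl
    simp [coordNorm] at hy
  have hne : {x : K | coordNorm p x = 1}.Nonempty := by
    obtain ⟨_, y, _, hy, _⟩ := exists_smul_eq_coordNorm_one p (one_ne_zero (α := K))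
    exact ⟨y, hy⟩
  obtain ⟨y₁, hy₁, h₁⟩ := (isCompact_coordNorm_eq p).exists_isMinOn hne hc.continuousOn
  obtain ⟨y₂, hy₂, h₂⟩ := (isCompact_coordNorm_eq p).exists_isMaxOn hne hc.continuousOn
  refine ⟨φ y₁, φ y₂, hpos _ (hy0 _ hy₁), hpos _ (hy0 _ hy₂), fun x => ?_⟩
  by_cases hx : x = 0
  · have h0 : φ 0 = 0 := by
      have := hs 0 0
      rw [zero_smul, norm_zero, zero_pow hk, zero_mul] at this
      exact this
    subst hx
    simp [coordNorm, h0, hk]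
  · obtain ⟨c, y, hcx, hy, rfl⟩ := exists_smul_eq_coordNorm_one p hx
    rw [hs, ← hcx, mul_comm _ (‖c‖ ^ k), mul_comm _ (‖c‖ ^ k)]
    exact ⟨mul_le_mul_of_nonneg_left (h₁ hy) (by positivity),
      mul_le_mul_of_nonneg_left (h₂ hy) (by positivity)⟩

end Coordinates

/-! ### The absolute value of a division algebra is non-archimedean -/

section AbsoluteValue

variable {p : ℕ} [Fact p.Prime] {K : Type*} [DivisionRing K] [Algebra ℚ_[p] K]

theorem absK_nonneg (x : K) : 0 ≤ absK p x := norm_nonneg _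

@[simp] theorem absK_one : absK p (1 : K) = 1 := by simp [absK]

theorem absK_mul (x y : K) : absK p (x * y) = absK p x * absK p y := by simp [absK]

theorem absK_pow (x : K) (k : ℕ) : absK p (x ^ k) = absK p x ^ k := by simp [absK]

theorem absK_neg (x : K) : absK p (-x) = absK p x := by
  have h : absK p (-1 : K) ^ 2 = 1 := by rw [← absK_pow]; simp
  have h1 : absK p (-1 : K) = 1 :=
    (pow_eq_one_iff_of_nonneg (absK_nonneg _) two_ne_zero).1 h
  rw [← neg_one_mul, absK_mul, h1, one_mul]

theorem absK_sub_comm (x y : K) : absK p (x - y) = absK p (y - x) := by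
  rw [← absK_neg, neg_sub]

theorem absK_smul (c : ℚ_[p]) (x : K) :
    absK p (c • x) = ‖c‖ ^ Module.finrank ℚ_[p] K * absK p x := by
  rw [Algebra.smul_def, absK_mul, absK, Algebra.norm_algebraMap, norm_pow]

variable [FiniteDimensional ℚ_[p] K]

@[simp] theorem absK_zero : absK p (0 : K) = 0 := by simp [absK]

theorem absK_eq_zero {x : K} : absK p x = 0 ↔ x = 0 := by simp [absK]

theorem absK_pos {x : K} (hx : x ≠ 0) : 0 < absK p x :=
  (absK_nonneg x).lt_of_ne fun h => hx (absK_eq_zero.1 h.symm)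

theorem absK_inv (x : K) : absK p x⁻¹ = (absK p x)⁻¹ := by
  by_cases hx : x = 0
  · simp [hx]
  · have h := absK_mul (p := p) x x⁻¹
    rw [mul_inv_cancel₀ hx, absK_one] at h
    exact (inv_eq_of_mul_eq_one_right h.symm).symm

theorem absK_zpow (x : K) (k : ℤ) : absK p (x ^ k) = absK p x ^ k := by
  cases k with
  | ofNat k => simp [absK_pow]
  | negSucc k => rw [zpow_negSucc, zpow_negSucc, absK_inv, absK_pow]

variable [TopologicalSpace K] [T2Space K] [IsTopologicalAddGroup K] [ContinuousSMul ℚ_[p] K]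

theorem continuous_absK : Continuous (absK p : K → ℝ) := by
  classical
  set b := Module.finBasis ℚ_[p] K
  have h : (absK p : K → ℝ) = fun x => ‖(Algebra.leftMulMatrix b x).det‖ := by
    ext x
    rw [absK, Algebra.norm_eq_matrix_det b]
  rw [h]
  refine Continuous.norm (Continuous.matrix_det ?_)
  exact (Algebra.leftMulMatrix b).toLinearMap.continuous_of_finiteDimensional

theorem exists_absK_bounds : ∃ a b : ℝ, 0 < a ∧ 0 < b ∧ ∀ x : K,
    a * coordNorm p x ^ Module.finrank ℚ_[p] K ≤ absK p x ∧
      absK p x ≤ b * coordNorm p x ^ Module.finrank ℚ_[p] K :=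
  exists_coordNorm_bounds p continuous_absK absK_smul (fun _ hx => absK_pos hx)
    Module.finrank_pos.ne'

/-- The powers of `z` are bounded in coordinates, and binomial coefficients have `p`-adic norm at
most one. By the binomial formula all powers of `1 + z` are bounded together, and multiplicativity
forces `absK p (1 + z) ≤ 1`. -/
theorem absK_one_add_le {z : K} (hz : absK p z ≤ 1) : absK p (1 + z) ≤ 1 := by
  obtain ⟨a, b, ha, hb, hab⟩ := exists_absK_bounds (p := p) (K := K)
  set n := Module.finrank ℚ_[p] K with hn
  have hn0 : n ≠ 0 := Module.finrank_pos.ne'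
  have hM1 : ∀ i : ℕ, coordNorm p (z ^ i) ≤ 1 + a⁻¹ := by
    intro i
    have h1 : a * coordNorm p (z ^ i) ^ n ≤ 1 :=
      ((hab _).1).trans (by rw [absK_pow]; exact pow_le_one₀ (absK_nonneg z) hz)
    by_contra! hcon
    have h2 : 1 ≤ coordNorm p (z ^ i) := by
      have : 0 < a⁻¹ := inv_pos.2 ha
      linarith
    have h3 : coordNorm p (z ^ i) ≤ coordNorm p (z ^ i) ^ n := le_self_pow₀ h2 hn0
    have h4 : a * a⁻¹ < a * coordNorm p (z ^ i) ^ n :=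
      mul_lt_mul_of_pos_left (by linarith) ha
    rw [mul_inv_cancel₀ ha.ne'] at h4
    linarith
  set M : ℝ := 1 + a⁻¹ with hM
  have hM0 : 0 ≤ M := by positivity
  have hbd : ∀ k : ℕ, absK p (1 + z) ^ k ≤ b * M ^ n := by
    intro k
    rw [← absK_pow]
    refine (hab _).2.trans (mul_le_mul_of_nonneg_left (pow_le_pow_left₀ (coordNorm_nonneg p _) ?_ n)
      hb.le)
    rw [add_comm, (Commute.one_right z).add_pow]
    refine coordNorm_sum_le p _ _ hM0 fun i _ => ?_
    have : z ^ i * 1 ^ (k - i) * (k.choose i : K) = ((k.choose i : ℕ) : ℚ_[p]) • z ^ i := by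
      rw [one_pow, mul_one, Algebra.smul_def, map_natCast, Nat.cast_comm]
    rw [this, coordNorm_smul]
    have h1 : ‖((k.choose i : ℕ) : ℚ_[p])‖ ≤ 1 := by
      exact_mod_cast Padic.norm_int_le_one (p := p) (k.choose i : ℤ)
    calc _ ≤ 1 * coordNorm p (z ^ i) := by
          gcongr
          exact coordNorm_nonneg p _
      _ ≤ M := by rw [one_mul]; exact hM1 i
  by_contra! hcon
  obtain ⟨k, hk⟩ := pow_unbounded_of_one_lt (b * M ^ n) hcon
  linarith [hbd k]

theorem absK_add_le_max (x y : K) : absK p (x + y) ≤ max (absK p x) (absK p y) := by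
  wlog h : absK p y ≤ absK p x generalizing x y
  · rw [add_comm, max_comm]
    exact this y x (le_of_not_ge h)
  rw [max_eq_left h]
  by_cases hx : x = 0
  · subst hx
    rw [absK_zero] at h
    rw [zero_add, absK_zero]
    exact h
  · have e : x + y = x * (1 + x⁻¹ * y) := by rw [mul_add, mul_one, mul_inv_cancel_left₀ hx]
    rw [e, absK_mul]
    refine mul_le_of_le_one_right (absK_nonneg x) (absK_one_add_le ?_)
    rw [absK_mul, absK_inv, inv_mul_le_iff₀ (absK_pos hx), mul_one]
    exact h

theorem isCompact_absK_le (R : ℝ) : IsCompact {x : K | absK p x ≤ R} := by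
  obtain ⟨a, b, ha, hb, hab⟩ := exists_absK_bounds (p := p) (K := K)
  have hn0 : Module.finrank ℚ_[p] K ≠ 0 := Module.finrank_pos.ne'
  refine (isCompact_coordNorm_le p (1 + R / a)).of_isClosed_subset
    (isClosed_Iic.preimage continuous_absK) fun x hx => ?_
  simp only [Set.mem_ofPred_eq] at hx ⊢
  by_contra! hcon
  have hR : 0 ≤ R := (absK_nonneg x).trans hx
  have h2 : 1 ≤ coordNorm p x := by
    have : 0 ≤ R / a := by positivity
    linarith
  have h3 := le_self_pow₀ h2 hn0
  have h4 : a * (R / a) < a * coordNorm p x ^ Module.finrank ℚ_[p] K :=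
    mul_lt_mul_of_pos_left (by linarith) ha
  rw [mul_div_cancel₀ _ ha.ne'] at h4
  linarith [(hab x).1]

theorem Padic.exists_fin_norm_sub_lt_one {x : ℚ_[p]} (hx : ‖x‖ ≤ 1) :
    ∃ r : Fin p, ‖x - ((r : ℕ) : ℚ_[p])‖ < 1 := by
  let y : ℤ_[p] := ⟨x, hx⟩
  refine ⟨⟨PadicInt.zmodRepr y, PadicInt.zmodRepr_lt_p _⟩, ?_⟩
  have h := PadicInt.norm_sub_zmodRepr_lt_one y
  rw [PadicInt.norm_def] at h
  push_cast at h
  exact h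

theorem Padic.fin_eq_of_norm_sub_lt_one {r s : Fin p}
    (h : ‖((r : ℕ) : ℚ_[p]) - ((s : ℕ) : ℚ_[p])‖ < 1) : r = s := by
  have h1 : ‖(((r : ℕ) - (s : ℕ) : ℤ) : ℚ_[p])‖ < 1 := by push_cast; exact h
  rw [Padic.norm_intCast_lt_one_iff] at h1
  obtain ⟨k, hk⟩ := h1
  have hr := r.2
  have hs := s.2
  have hp0 : (0 : ℤ) < p := by exact_mod_cast (Fact.out : p.Prime).pos
  have : k = 0 := by
    by_contra hk0
    rcases lt_or_gt_of_ne hk0 with h | h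
    · have : (p : ℤ) * k ≤ p * (-1) := mul_le_mul_of_nonneg_left (by omega) hp0.le
      omega
    · have : (p : ℤ) * 1 ≤ p * k := mul_le_mul_of_nonneg_left (by omega) hp0.le
      omega
  subst this
  ext
  omega

/-- The factor by which multiplication by `p` changes Haar measure. -/
theorem measure_coordNorm_smul [MeasurableSpace K] [BorelSpace K] (μ : Measure K)
    [μ.IsAddHaarMeasure] :
    (p : ENNReal) ^ Module.finrank ℚ_[p] K *
      μ ((fun x : K => (p : ℚ_[p]) • x) '' {x : K | coordNorm p x ≤ 1}) =
        μ {x : K | coordNorm p x ≤ 1} := by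
  classical
  set b := Module.finBasis ℚ_[p] K with hb
  set Z : Set K := {x : K | coordNorm p x ≤ 1} with hZ
  set pZ : Set K := (fun x : K => (p : ℚ_[p]) • x) '' Z with hpZ
  have hp0 : (p : ℚ_[p]) ≠ 0 := by exact_mod_cast (Fact.out : p.Prime).ne_zero
  have hmem : ∀ x : K, x ∈ Z ↔ ∀ i, ‖b.equivFun x i‖ ≤ 1 := fun x => by
    change ‖b.equivFun x‖ ≤ 1 ↔ _
    exact pi_norm_le_iff_of_nonneg zero_le_one
  have hmem' : ∀ x : K, x ∈ pZ ↔ ∀ i, ‖b.equivFun x i‖ < 1 := by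
    intro x
    have h1 : x ∈ pZ ↔ (p : ℚ_[p])⁻¹ • x ∈ Z := by
      constructor
      · rintro ⟨y, hy, rfl⟩
        simpa only [smul_smul, inv_mul_cancel₀ hp0, one_smul] using hy
      · intro h
        exact ⟨_, h, by simp only [smul_smul, mul_inv_cancel₀ hp0, one_smul]⟩
    rw [h1, hmem]
    refine forall_congr' fun i => ?_
    have hpp : (0 : ℝ) < p := by exact_mod_cast (Fact.out : p.Prime).pos
    -- The value group is discrete, so norm at most `p⁻¹` means norm less than one. The cosets of
    -- `pZ` in `Z` are thus indexed by vectors of digits, `p ^ n` in number.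
    have h2 := Padic.norm_lt_pow_iff_norm_le_pow_sub_one (b.equivFun x i) 0
    rw [zpow_zero, zero_sub, zpow_neg_one] at h2
    rw [map_smul, Pi.smul_apply, smul_eq_mul, norm_mul, norm_inv, Padic.norm_p, inv_inv, h2]
    rw [← le_div_iff₀' hpp, one_div]
  have hsub : ∀ x y : ℚ_[p], ‖x‖ < 1 → ‖y‖ < 1 → ‖x - y‖ < 1 := fun x y hx hy => by
    rw [sub_eq_add_neg]
    exact (Padic.nonarchimedean _ _).trans_lt (max_lt hx (by rwa [norm_neg]))
  set v : (Fin (Module.finrank ℚ_[p] K) → Fin p) → K := fun r => b.equivFun.symm fun i => ((r i : ℕ) : ℚ_[p]) with hv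
  have hvi : ∀ r i, b.equivFun (v r) i = ((r i : ℕ) : ℚ_[p]) := fun r i => by
    rw [hv, LinearEquiv.apply_symm_apply]
  have hshift : ∀ r x, x ∈ (fun x => v r + x) '' pZ ↔
      ∀ i, ‖b.equivFun x i - ((r i : ℕ) : ℚ_[p])‖ < 1 := by
    intro r x
    have : x ∈ (fun x => v r + x) '' pZ ↔ x - v r ∈ pZ := by
      constructor
      · rintro ⟨y, hy, rfl⟩
        simpa using hy
      · exact fun h => ⟨_, h, by simp⟩
    rw [this, hmem']
    refine forall_congr' fun i => ?_
    rw [map_sub, Pi.sub_apply, hvi]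
  have hcover : Z = ⋃ r : Fin (Module.finrank ℚ_[p] K) → Fin p, (fun x => v r + x) '' pZ := by
    ext x
    rw [hmem, Set.mem_iUnion]
    constructor
    · intro hx
      choose r hr using fun i => Padic.exists_fin_norm_sub_lt_one (hx i)
      exact ⟨r, (hshift r x).2 hr⟩
    · rintro ⟨r, hr⟩ i
      have h1 : ‖((r i : ℕ) : ℚ_[p])‖ ≤ 1 := by
        exact_mod_cast Padic.norm_int_le_one (p := p) (r i : ℤ)
      have h2 := Padic.nonarchimedean (b.equivFun x i - ((r i : ℕ) : ℚ_[p])) ((r i : ℕ) : ℚ_[p])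
      rw [sub_add_cancel] at h2
      exact h2.trans (max_le ((hshift r x).1 hr i).le h1)
  have hdisj : Pairwise fun r s : Fin (Module.finrank ℚ_[p] K) → Fin p =>
      Disjoint ((fun x => v r + x) '' pZ) ((fun x => v s + x) '' pZ) := by
    intro r s hrs
    refine Set.disjoint_left.2 fun x hr hs => hrs (funext fun i => ?_)
    refine Padic.fin_eq_of_norm_sub_lt_one ?_
    have := hsub _ _ ((hshift s x).1 hs i) ((hshift r x).1 hr i)
    rwa [sub_sub_sub_cancel_left] at this
  have hcpt : IsCompact pZ := (isCompact_coordNorm_le p 1).image (continuous_const_smul _)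
  rw [hcover, measure_iUnion hdisj fun r => (hcpt.image (continuous_const_add _)).measurableSet]
  simp only [Set.image_add_left, measure_preimage_add, tsum_fintype, Finset.sum_const,
    Finset.card_univ, Fintype.card_pi, Fintype.card_fin, Finset.prod_const, nsmul_eq_mul,
    Nat.cast_pow]

end AbsoluteValue

/-! ### Balls and Haar measure -/

namespace PadicModel

instance isAddHaarMeasure_vol {p : ℕ} [Fact p.Prime] {K : Type*} [DivisionRing K]
    [Algebra ℚ_[p] K] [TopologicalSpace K] [MeasurableSpace K] (D : PadicModel p K) :
    D.vol.IsAddHaarMeasure := D.isAddHaar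

section Balls

variable {p : ℕ} [Fact p.Prime] {K : Type*} [DivisionRing K] [Algebra ℚ_[p] K]
  [FiniteDimensional ℚ_[p] K] [TopologicalSpace K] [T2Space K] [IsTopologicalAddGroup K]
  [ContinuousSMul ℚ_[p] K] [MeasurableSpace K] [BorelSpace K] (D : PadicModel p K)

theorem absK_algebraMap_p :
    absK p (algebraMap ℚ_[p] K p) = ((p : ℝ)⁻¹) ^ Module.finrank ℚ_[p] K := by
  rw [absK, Algebra.norm_algebraMap, norm_pow, Padic.norm_p]

theorem algebraMap_p_ne_zero : algebraMap ℚ_[p] K p ≠ 0 := by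
  have : (p : ℚ_[p]) ≠ 0 := by exact_mod_cast (Fact.out : p.Prime).ne_zero
  exact (_root_.map_ne_zero _).2 this

theorem absK_algebraMap_p_lt_one : absK p (algebraMap ℚ_[p] K p) < 1 := by
  rw [absK_algebraMap_p]
  have : (1 : ℝ) < p := by exact_mod_cast (Fact.out : p.Prime).one_lt
  exact pow_lt_one₀ (by positivity) (inv_lt_one_of_one_lt₀ this) Module.finrank_pos.ne'

theorem absK_β_pos : 0 < absK p D.β :=
  (absK_pos algebraMap_p_ne_zero).trans_le (D.β_max _ absK_algebraMap_p_lt_one)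

theorem β_ne_zero : D.β ≠ 0 := fun h => by simpa [h] using D.absK_β_pos

theorem one_lt_q : 1 < D.q := (one_lt_inv₀ D.absK_β_pos).2 D.β_lt_one

theorem q_pos : 0 < D.q := one_pos.trans D.one_lt_q

theorem absK_β_zpow (k : ℤ) : absK p (D.β ^ k) = D.q ^ (-k) := by
  rw [absK_zpow, q, inv_zpow', neg_neg]

theorem exists_absK_eq_zpow {x : K} (hx : x ≠ 0) : ∃ k : ℤ, absK p x = D.q ^ k := by
  obtain ⟨k, hk₁, hk₂⟩ := exists_mem_Ico_zpow (absK_pos (p := p) hx) D.one_lt_q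
  refine ⟨k, le_antisymm ?_ hk₁⟩
  have h0 : absK p (x * D.β ^ (k + 1)) = absK p x * D.q ^ (-(k + 1)) := by
    rw [absK_mul, absK_β_zpow]
  have h1 : absK p (x * D.β ^ (k + 1)) < 1 := by
    rw [h0, zpow_neg, ← div_eq_mul_inv, div_lt_one (zpow_pos D.q_pos _)]
    exact hk₂
  have h2 := D.β_max _ h1
  rw [h0, zpow_neg, ← div_eq_mul_inv, div_le_iff₀ (zpow_pos D.q_pos _),
    zpow_add_one₀ D.q_pos.ne', mul_comm, mul_assoc] at h2
  have h3 : D.q * absK p D.β = 1 := inv_mul_cancel₀ D.absK_β_pos.ne'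
  calc absK p x ≤ D.q ^ k * (D.q * absK p D.β) := by linarith
    _ = D.q ^ k := by rw [h3, mul_one]

/-- Because all nonzero values are powers of `q`, balls are both open and closed, and points outside
a ball lie outside the next larger open one. -/
theorem absK_lt_zpow_iff (x : K) (k : ℤ) : absK p x < D.q ^ (k + 1) ↔ absK p x ≤ D.q ^ k := by
  constructor
  · intro h
    by_cases hx : x = 0
    · rw [hx, absK_zero]
      exact (zpow_pos D.q_pos k).le
    · obtain ⟨j, hj⟩ := D.exists_absK_eq_zpow hx
      rw [hj] at h ⊢
      rw [zpow_lt_zpow_iff_right₀ D.one_lt_q] at h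
      rw [zpow_le_zpow_iff_right₀ D.one_lt_q]
      omega
  · exact fun h => h.trans_lt (zpow_lt_zpow_right₀ D.one_lt_q (by omega))

theorem mem_ball {l : ℤ} {c x : K} : x ∈ D.ball l c ↔ absK p (x - c) ≤ D.q ^ l := Iff.rfl

theorem mem_ball_self (l : ℤ) (c : K) : c ∈ D.ball l c := by
  rw [mem_ball, sub_self, absK_zero]
  exact (zpow_pos D.q_pos l).le

theorem mem_ball_zero {l : ℤ} {x : K} : x ∈ D.ball l 0 ↔ absK p x ≤ D.q ^ l := by
  rw [mem_ball, sub_zero]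

theorem mem_ball_iff_sub {l : ℤ} {c x : K} : x ∈ D.ball l c ↔ x - c ∈ D.ball l 0 := by
  rw [mem_ball_zero, mem_ball]

theorem mem_ball_comm {l : ℤ} {c x : K} : x ∈ D.ball l c ↔ c ∈ D.ball l x := by
  rw [mem_ball, mem_ball, absK_sub_comm]

theorem mem_ball_trans {l : ℤ} {x y z : K} (h : x ∈ D.ball l y) (h' : y ∈ D.ball l z) :
    x ∈ D.ball l z := by
  rw [mem_ball] at *
  rw [← sub_add_sub_cancel x y z]
  exact (absK_add_le_max _ _).trans (max_le h h')

theorem ball_eq_of_mem {l : ℤ} {c d : K} (h : c ∈ D.ball l d) : D.ball l c = D.ball l d :=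
  Set.ext fun _ => ⟨fun hx => D.mem_ball_trans hx h,
    fun hx => D.mem_ball_trans hx (D.mem_ball_comm.1 h)⟩

theorem ball_subset_ball {l l' : ℤ} (h : l ≤ l') (c : K) : D.ball l c ⊆ D.ball l' c :=
  fun _ hx => le_trans hx (zpow_le_zpow_right₀ D.one_lt_q.le h)

theorem add_mem_ball_zero {l : ℤ} {x y : K} (hx : x ∈ D.ball l 0) (hy : y ∈ D.ball l 0) :
    x + y ∈ D.ball l 0 := by
  rw [mem_ball_zero] at *
  exact (absK_add_le_max _ _).trans (max_le hx hy)

theorem neg_mem_ball_zero {l : ℤ} {x : K} : -x ∈ D.ball l 0 ↔ x ∈ D.ball l 0 := by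
  rw [mem_ball_zero, mem_ball_zero, absK_neg]

theorem ball_disjoint {l : ℤ} {c d : K} (h : D.q ^ l < absK p (c - d)) :
    Disjoint (D.ball l c) (D.ball l d) :=
  Set.disjoint_left.2 fun _ hc hd =>
    not_le.2 h (D.mem_ball.1 (D.mem_ball_trans (D.mem_ball_comm.1 hc) hd))

theorem isCompact_ball (l : ℤ) (c : K) : IsCompact (D.ball l c) := by
  have : D.ball l c = (fun x => c + x) '' {x : K | absK p x ≤ D.q ^ l} := by
    ext x
    simp [mem_ball, sub_eq_neg_add]
  rw [this]
  exact (isCompact_absK_le _).image (continuous_const_add c)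

theorem isOpen_ball (l : ℤ) (c : K) : IsOpen (D.ball l c) := by
  have : D.ball l c = (fun x => absK p (x - c)) ⁻¹' Set.Iio (D.q ^ (l + 1)) := by
    ext x
    simp [mem_ball, absK_lt_zpow_iff]
  rw [this]
  exact isOpen_Iio.preimage (continuous_absK.comp (continuous_sub_right c))

theorem isClosed_ball (l : ℤ) (c : K) : IsClosed (D.ball l c) := (D.isCompact_ball l c).isClosed

theorem measurableSet_ball (l : ℤ) (c : K) : MeasurableSet (D.ball l c) :=
  (D.isOpen_ball l c).measurableSet

theorem iUnion_ball_zero : ⋃ k : ℕ, D.ball k 0 = Set.univ := by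
  refine Set.eq_univ_of_forall fun x => Set.mem_iUnion.2 ?_
  obtain ⟨k, hk⟩ := pow_unbounded_of_one_lt (absK p x) D.one_lt_q
  exact ⟨k, by rw [mem_ball_zero, zpow_natCast]; exact hk.le⟩

/-- Balls form a basis of neighbourhoods. -/
theorem exists_ball_subset {U : Set K} (hU : IsOpen U) {x : K} (hx : x ∈ U) :
    ∃ k : ℕ, D.ball (-(k : ℤ)) x ⊆ U := by
  by_contra! hcon
  have h1 : ∀ k : ℕ, (D.ball (-(k : ℤ)) x ∩ Uᶜ).Nonempty := fun k => by
    obtain ⟨y, hy, hyU⟩ := Set.not_subset.1 (hcon k)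
    exact ⟨y, hy, hyU⟩
  obtain ⟨y, hy⟩ := IsCompact.nonempty_iInter_of_sequence_nonempty_isCompact_isClosed
    (fun k : ℕ => D.ball (-(k : ℤ)) x ∩ Uᶜ)
    (fun k => Set.inter_subset_inter_left _ (D.ball_subset_ball (by push_cast; omega) x)) h1
    ((D.isCompact_ball _ x).inter_right hU.isClosed_compl)
    fun k => (D.isClosed_ball _ x).inter hU.isClosed_compl
  rw [Set.mem_iInter] at hy
  have hyx : y = x := by
    by_contra hne
    have h0 := absK_pos (p := p) (sub_ne_zero.2 hne)
    obtain ⟨k, hk⟩ := exists_pow_lt_of_lt_one h0 (inv_lt_one_of_one_lt₀ D.one_lt_q)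
    have := (hy k).1
    rw [mem_ball, zpow_neg, zpow_natCast, ← inv_pow] at this
    linarith
  exact (hy 0).2 (hyx ▸ hx)

/-! ### The absolute value as the modulus of Haar measure -/

section Haar

open scoped Pointwise

variable [LocallyCompactSpace K] [SecondCountableTopology K] [ContinuousMul K]
  [TopologicalSpace.MetrizableSpace K]

theorem vol_ball_zero_zero : D.vol (D.ball 0 0) = 1 := by
  rw [← D.vol_unitBall]
  congr 1
  ext x
  simp [mem_ball]

/-- Both sides are multiplicative and trivial on elements of absolute value one, which preserve the
unit ball. As every unit is a power of `β` times such an element, one value decides. It is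
computable at `p` by counting cosets; `p` is a nonzero power of `β` up to a unit, and the value at
`β` follows by taking a root. -/
theorem distribHaarChar_eq_absK (D : PadicModel p K) (u : Kˣ) : (distribHaarChar K u : ℝ) = absK p (u : K) := by
  have hunit : ∀ u : Kˣ, absK p (u : K) = 1 → distribHaarChar K u = 1 := by
    intro u hu
    refine distribHaarChar_eq_of_measure_smul_eq_mul (μ := D.vol) (s := D.ball 0 0)
      (by simp [vol_ball_zero_zero]) (by simp [vol_ball_zero_zero]) ?_
    rw [ENNReal.coe_one, one_mul]
    congr 1
    ext x
    rw [Set.mem_smul_set_iff_inv_smul_mem, mem_ball_zero, mem_ball_zero, Units.smul_def,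
      smul_eq_mul, absK_mul, Units.val_inv_eq_inv_val, absK_inv, hu, inv_one, one_mul]
  set b : Kˣ := Units.mk0 D.β D.β_ne_zero with hb
  have hdec : ∀ u : Kˣ, ∃ k : ℤ, ∃ v : Kˣ, absK p (v : K) = 1 ∧ u = b ^ k * v := by
    intro u
    obtain ⟨k, hk⟩ := D.exists_absK_eq_zpow u.ne_zero
    refine ⟨-k, (b ^ (-k))⁻¹ * u, ?_, by group⟩
    rw [Units.val_mul, absK_mul, hk, ← zpow_neg, neg_neg, Units.val_zpow_eq_zpow_val, hb,
      Units.val_mk0, absK_β_zpow, ← zpow_add₀ D.q_pos.ne', neg_add_cancel, zpow_zero]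
  have hp : (distribHaarChar K (Units.mk0 (algebraMap ℚ_[p] K p) algebraMap_p_ne_zero) : ℝ) =
      absK p (algebraMap ℚ_[p] K p) := by
    have hZ := isCompact_coordNorm_le (K := K) p 1
    have hZ0 : D.vol {x : K | coordNorm p x ≤ 1} ≠ 0 := by
      refine (IsOpen.measure_pos D.vol (U := {x : K | coordNorm p x < 1})
        (isOpen_Iio.preimage (continuous_coordNorm p)) ⟨0, by simp [coordNorm]⟩).ne' ∘ fun h => ?_
      exact measure_mono_null (fun x (hx : coordNorm p x < 1) => hx.le) h
    have h := measure_coordNorm_smul (p := p) D.vol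
    have h2 := distribHaarChar_eq_of_measure_smul_eq_mul (μ := D.vol) hZ0 hZ.measure_lt_top.ne
      (g := Units.mk0 (algebraMap ℚ_[p] K p) algebraMap_p_ne_zero)
      (r := ((p : NNReal)⁻¹) ^ Module.finrank ℚ_[p] K) (by
        have e : (Units.mk0 (algebraMap ℚ_[p] K p) algebraMap_p_ne_zero) •
            {x : K | coordNorm p x ≤ 1} =
            (fun x : K => (p : ℚ_[p]) • x) '' {x : K | coordNorm p x ≤ 1} := by
          refine Set.image_congr fun x _ => ?_
          change algebraMap ℚ_[p] K p * x = (p : ℚ_[p]) • x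
          rw [Algebra.smul_def]
        rw [e]
        have hpp : (p : ENNReal) ≠ 0 := by exact_mod_cast (Fact.out : p.Prime).ne_zero
        have hp0 : (p : NNReal) ≠ 0 := by exact_mod_cast (Fact.out : p.Prime).ne_zero
        rw [← h, ← mul_assoc, ENNReal.coe_pow, ENNReal.coe_inv hp0, ENNReal.coe_natCast,
          ← mul_pow, ENNReal.inv_mul_cancel hpp (ENNReal.natCast_ne_top p), one_pow, one_mul])
    rw [h2, absK_algebraMap_p]
    push_cast
    rfl
  have hβ : (distribHaarChar K b : ℝ) = absK p D.β := by
    obtain ⟨k, v, hv, hkv⟩ := hdec (Units.mk0 (algebraMap ℚ_[p] K p) algebraMap_p_ne_zero)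
    have h1 : algebraMap ℚ_[p] K p = D.β ^ k * v := by
      have := congrArg (Units.val) hkv
      simpa [hb] using this
    have h2 := hp
    rw [hkv, map_mul, hunit v hv, mul_one, map_zpow, h1, absK_mul, hv, mul_one, absK_zpow] at h2
    have hk : k ≠ 0 := by
      rintro rfl
      have h3 := absK_algebraMap_p_lt_one (p := p) (K := K)
      rw [h1, zpow_zero, one_mul, hv] at h3
      exact lt_irrefl _ h3
    push_cast at h2
    exact (zpow_left_inj₀ NNReal.zero_le_coe (absK_nonneg _) hk).1 h2
  obtain ⟨k, v, hv, rfl⟩ := hdec u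
  rw [map_mul, hunit v hv, mul_one, map_zpow, Units.val_mul, absK_mul, hv, mul_one,
    Units.val_zpow_eq_zpow_val, absK_zpow]
  push_cast
  rw [hβ, hb, Units.val_mk0]

theorem vol_ball (l : ℤ) (c : K) : D.vol (D.ball l c) = ENNReal.ofReal (D.q ^ l) := by
  have h0 : D.ball l c = (fun x => c + x) '' D.ball l 0 := by
    ext x
    simp [mem_ball, sub_eq_neg_add]
  rw [h0, Set.image_add_left, measure_preimage_add]
  set u : Kˣ := Units.mk0 (D.β ^ (-l)) (zpow_ne_zero _ D.β_ne_zero) with hu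
  have hu' : absK p (u : K) = D.q ^ l := by rw [hu, Units.val_mk0, absK_β_zpow, neg_neg]
  have h1 : D.ball l 0 = u • D.ball 0 0 := by
    ext x
    rw [Set.mem_smul_set_iff_inv_smul_mem, mem_ball_zero, mem_ball_zero, Units.smul_def,
      smul_eq_mul, absK_mul, Units.val_inv_eq_inv_val, absK_inv, hu', zpow_zero,
      inv_mul_le_iff₀ (zpow_pos D.q_pos l), mul_one]
  rw [h1, ← distribHaarChar_mul D.vol u, vol_ball_zero_zero, mul_one, ← hu',
    ← D.distribHaarChar_eq_absK u, ENNReal.ofReal_coe_nnreal]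

theorem vol_real_ball (l : ℤ) (c : K) : D.vol.real (D.ball l c) = D.q ^ l := by
  rw [measureReal_def, vol_ball, ENNReal.toReal_ofReal (zpow_pos D.q_pos l).le]

end Haar

end Balls

end PadicModel

/-! ### Anisotropic quadratic forms and the symbol -/

section QuadraticForm

variable {p : ℕ} [Fact p.Prime]

/-- Hensel's lemma for `X² - (1 - z)` at `1`: the derivative there is `2`, a unit for odd `p`. -/
theorem Padic.exists_sq_eq_one_sub (hp : p ≠ 2) {z : ℚ_[p]} (hz : ‖z‖ < 1) :
    ∃ s : ℚ_[p], s ^ 2 = 1 - z := by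
  let w : ℤ_[p] := ⟨z, hz.le⟩
  have h2 : ‖(2 : ℤ_[p])‖ = 1 := by
    have h3 : ¬ ‖((2 : ℤ) : ℤ_[p])‖ < 1 := by
      rw [PadicInt.norm_int_lt_one_iff_dvd]
      intro h
      have h4 : p ∣ 2 := by exact_mod_cast h
      exact hp ((Nat.prime_dvd_prime_iff_eq Fact.out Nat.prime_two).1 h4)
    push_cast at h3
    exact le_antisymm (PadicInt.norm_le_one _) (not_lt.1 h3)
  obtain ⟨s, hs, -⟩ := hensels_lemma (p := p) (R := ℤ_[p])
    (F := (X ^ 2 - C (1 - w) : ℤ_[p][X])) (a := 1) (by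
      have h5 : ‖w‖ < 1 := by rw [PadicInt.norm_def]; exact hz
      have h8 : ‖(1 + 1 : ℤ_[p])‖ = 1 := by rw [one_add_one_eq_two]; exact h2
      simpa [h8] using h5)
  refine ⟨s, ?_⟩
  have h6 : s ^ 2 = 1 - w := by
    simpa [sub_eq_zero] using hs
  have h7 := congrArg (fun t : ℤ_[p] => (t : ℚ_[p])) h6
  push_cast at h7
  exact h7

variable {M : Type*} [AddCommGroup M] [Module ℚ_[p] M]

/-- An anisotropic quadratic form satisfies the strong triangle inequality. -/
theorem QuadraticMap.Anisotropic.norm_add_le_max (hp : p ≠ 2) {h : QuadraticForm ℚ_[p] M}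
    (hh : h.Anisotropic) (x y : M) : ‖h (x + y)‖ ≤ max ‖h x‖ ‖h y‖ := by
  -- If the polar form `b` exceeded `h x` in norm, the discriminant `b² - 4 h(x) h(y)` would be `b²`
  -- times a square, and `h` would vanish at `x + t y` for a root `t`. Anisotropy then makes `x` a
  -- multiple of `y`, where `b² = 4 h(x) h(y)`, contradicting the size of `b`.
  have key : ∀ x y : M, ‖h y‖ ≤ ‖h x‖ → ‖QuadraticMap.polar h x y‖ ≤ ‖h x‖ := by
    intro x y hle
    by_contra! hcon
    set b := QuadraticMap.polar h x y with hb
    have hb0 : b ≠ 0 := norm_pos_iff.1 ((norm_nonneg _).trans_lt hcon)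
    have hy : y ≠ 0 := by
      rintro rfl
      exact hb0 (by simp [hb])
    have hhy : h y ≠ 0 := fun h0 => hy (hh y h0)
    have h4 : ‖(4 : ℚ_[p])‖ ≤ 1 := by exact_mod_cast Padic.norm_int_le_one (p := p) 4
    have hz : ‖4 * h x * h y / b ^ 2‖ < 1 := by
      rw [norm_div, norm_mul, norm_mul, norm_pow, div_lt_one (by positivity)]
      calc ‖(4 : ℚ_[p])‖ * ‖h x‖ * ‖h y‖ ≤ 1 * ‖h x‖ * ‖h x‖ := by gcongr
        _ < ‖b‖ ^ 2 := by nlinarith [norm_nonneg (h x)]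
    obtain ⟨s, hs⟩ := Padic.exists_sq_eq_one_sub hp hz
    have hs' : b ^ 2 * s ^ 2 = b ^ 2 - 4 * h x * h y := by
      rw [hs, mul_sub, mul_one, mul_div_cancel₀ _ (pow_ne_zero 2 hb0)]
    have two : (2 : ℚ_[p]) ≠ 0 := two_ne_zero
    set t := (-b + b * s) / (2 * h y) with ht
    have ht' : 2 * h y * t = -b + b * s := by
      rw [ht]; field_simp
    have hroot : h (x + t • y) = 0 := by
      rw [QuadraticMap.map_add h, QuadraticMap.map_smul, QuadraticMap.polar_smul_right, ← hb,
        smul_eq_mul, smul_eq_mul]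
      have : 4 * h y * (h x + t * t * h y + t * b) = 0 := by
        have h1 : (2 * h y * t + b) ^ 2 = b ^ 2 * s ^ 2 := by rw [ht']; ring
        rw [hs'] at h1
        linear_combination h1
      exact (mul_eq_zero.1 this).resolve_left (mul_ne_zero (by norm_num) hhy)
    have hxy : x = (-t) • y := by
      have := hh _ hroot
      rw [neg_smul]
      exact eq_neg_of_add_eq_zero_left this
    have hbt : b = -(2 * t * h y) := by
      rw [hb, hxy, QuadraticMap.polar_smul_left, QuadraticMap.polar_self, smul_eq_mul, nsmul_eq_mul]
      push_cast; ring
    have hxt : h x = t * t * h y := by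
      rw [hxy, QuadraticMap.map_smul, smul_eq_mul]; ring
    have hbb : b ^ 2 = 4 * h x * h y := by rw [hbt, hxt]; ring
    rw [← hbb, div_self (pow_ne_zero 2 hb0), norm_one] at hz
    exact lt_irrefl _ hz
  wlog hle : ‖h y‖ ≤ ‖h x‖ generalizing x y
  · rw [add_comm, max_comm]
    exact this y x (le_of_not_ge hle)
  rw [max_eq_left hle, QuadraticMap.map_add h]
  exact (Padic.nonarchimedean _ _).trans (max_le ((Padic.nonarchimedean _ _).trans
    (max_le le_rfl hle)) (key x y hle))

end QuadraticForm

namespace PadicModel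

section Symbol

variable {p : ℕ} [Fact p.Prime] {K : Type*} [DivisionRing K] [Algebra ℚ_[p] K]
  [FiniteDimensional ℚ_[p] K] [TopologicalSpace K] [T2Space K] [IsTopologicalAddGroup K]
  [ContinuousSMul ℚ_[p] K] [MeasurableSpace K] [BorelSpace K] (D : PadicModel p K)

theorem continuous_h : Continuous D.h := by
  set b := Module.finBasis ℚ_[p] K
  have h2 : ∀ x, D.h x = 2⁻¹ * QuadraticMap.polarBilin D.h x x := fun x => by
    rw [QuadraticMap.polarBilin_apply_apply, QuadraticMap.polar_self, nsmul_eq_mul]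
    push_cast
    rw [inv_mul_cancel_left₀ two_ne_zero]
  have h3 : ∀ x, QuadraticMap.polarBilin D.h x x =
      ∑ i, b.equivFun x i * QuadraticMap.polarBilin D.h (b i) x := fun x => by
    have h5 := congrArg (fun y => QuadraticMap.polarBilin D.h y x) (b.sum_equivFun x)
    simp only [map_sum, LinearMap.sum_apply, map_smul, LinearMap.smul_apply, smul_eq_mul] at h5
    exact h5.symm
  have h4 : (D.h : K → ℚ_[p]) =
      fun x => 2⁻¹ * ∑ i, b.equivFun x i * QuadraticMap.polarBilin D.h (b i) x :=
    funext fun x => by rw [h2, h3]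
  rw [h4]
  refine continuous_const.mul (g := fun x => ∑ i, b.equivFun x i *
    QuadraticMap.polarBilin D.h (b i) x) (continuous_finsetSum _ fun i _ => Continuous.mul ?_ ?_)
  · exact (continuous_apply i).comp (coordHomeo p K).continuous
  · exact (QuadraticMap.polarBilin D.h (b i)).continuous_of_finiteDimensional

theorem exists_h_bounds : ∃ a b : ℝ, 0 < a ∧ 0 < b ∧ ∀ x : K,
    a * coordNorm p x ^ 2 ≤ ‖D.h x‖ ∧ ‖D.h x‖ ≤ b * coordNorm p x ^ 2 := by
  refine exists_coordNorm_bounds p D.continuous_h.norm (fun c x => ?_) (fun x hx => ?_) two_ne_zero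
  · rw [QuadraticMap.map_smul, smul_eq_mul, norm_mul, norm_mul, sq]
  · exact norm_pos_iff.2 fun h0 => hx (D.anisotropic x h0)

theorem α_pos : 0 < D.α :=
  (half_pos (Nat.cast_pos.2 Module.finrank_pos)).trans_le D.le_α

theorem symbol_nonneg (ξ : K) : 0 ≤ D.symbol ξ := Real.rpow_nonneg (norm_nonneg _) _

theorem continuous_symbol : Continuous D.symbol :=
  D.continuous_h.norm.rpow_const fun _ => Or.inr D.α_pos.le

theorem symbol_neg (ξ : K) : D.symbol (-ξ) = D.symbol ξ := by
  rw [symbol, QuadraticMap.map_neg, symbol]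

/-- Together with evenness this makes the sublevel sets of the symbol subgroups, which is the source
of the sign of the kernel. -/
theorem symbol_add_le (hp : p ≠ 2) {ξ η : K} {t : ℝ} (hξ : D.symbol ξ ≤ t)
    (hη : D.symbol η ≤ t) : D.symbol (ξ + η) ≤ t := by
  rcases le_max_iff.1 (D.anisotropic.norm_add_le_max hp ξ η) with h | h
  · exact (Real.rpow_le_rpow (norm_nonneg _) h D.α_pos.le).trans hξ
  · exact (Real.rpow_le_rpow (norm_nonneg _) h D.α_pos.le).trans hη

/-- The symbol is locally constant outside `0`, uniformly with respect to dilations. -/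
theorem exists_symbol_add_eq (hp : p ≠ 2) : ∃ i : ℕ, ∀ ξ η : K, ξ ≠ 0 →
    absK p η ≤ D.q ^ (-(i : ℤ)) * absK p ξ → D.symbol (ξ + η) = D.symbol ξ := by
  obtain ⟨a, b, ha, hb, hN⟩ := exists_absK_bounds (p := p) (K := K)
  obtain ⟨a', b', ha', hb', hh⟩ := D.exists_h_bounds
  -- With this `ε`, `coordNorm η ≤ ε * coordNorm ξ` forces `‖h η‖ < ‖h ξ‖`; the integer `i`
  -- expresses the same smallness through `absK`.
  obtain ⟨ε, hε, hεb⟩ : ∃ ε : ℝ, 0 < ε ∧ b' * ε ^ 2 < a' := by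
    refine ⟨√(a' / (2 * b')), by positivity, ?_⟩
    rw [Real.sq_sqrt (by positivity)]
    field_simp
    norm_num
  set n := Module.finrank ℚ_[p] K with hn
  have hn0 : n ≠ 0 := Module.finrank_pos.ne'
  obtain ⟨i, hi⟩ := exists_pow_lt_of_lt_one (show 0 < ε ^ n * a / b by positivity)
    (inv_lt_one_of_one_lt₀ D.one_lt_q)
  refine ⟨i, fun ξ η hξ hle => ?_⟩
  have h1 : coordNorm p η ≤ ε * coordNorm p ξ := by
    refine le_of_pow_le_pow_left₀ hn0 (mul_nonneg hε.le (coordNorm_nonneg p ξ)) ?_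
    have h2 : a * coordNorm p η ^ n ≤ ε ^ n * a / b * (b * coordNorm p ξ ^ n) := by
      refine ((hN η).1.trans hle).trans (mul_le_mul ?_ (hN ξ).2 (absK_nonneg _) (by positivity))
      rw [zpow_neg, zpow_natCast, ← inv_pow]
      exact hi.le
    rw [mul_pow]
    have h3 : ε ^ n * a / b * (b * coordNorm p ξ ^ n) = a * (ε ^ n * coordNorm p ξ ^ n) := by
      field_simp
    rw [h3] at h2
    exact le_of_mul_le_mul_left h2 ha
  have hlt : ‖D.h η‖ < ‖D.h ξ‖ := by
    have h0 := coordNorm_pos p hξ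
    calc ‖D.h η‖ ≤ b' * coordNorm p η ^ 2 := (hh η).2
      _ ≤ b' * (ε * coordNorm p ξ) ^ 2 := by
          gcongr
          exact coordNorm_nonneg p η
      _ = b' * ε ^ 2 * coordNorm p ξ ^ 2 := by ring
      _ < a' * coordNorm p ξ ^ 2 := by gcongr
      _ ≤ ‖D.h ξ‖ := (hh ξ).1
  -- In a non-archimedean sum the strictly larger term determines the norm.
  have heq : ‖D.h (ξ + η)‖ = ‖D.h ξ‖ := by
    refine le_antisymm ((D.anisotropic.norm_add_le_max hp ξ η).trans (max_le le_rfl hlt.le)) ?_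
    have h4 := D.anisotropic.norm_add_le_max hp (ξ + η) (-η)
    rw [add_neg_cancel_right, QuadraticMap.map_neg] at h4
    exact (le_max_iff.1 h4).resolve_right (not_le.2 hlt)
  rw [symbol, symbol, heq]

/-- The symbol is comparable with `absK ξ ^ (2α/n)`, and `α ≥ n/2` makes the exponent at least one.
At the borderline exponent every momentum shell still contributes a bounded amount to the variance.
-/
theorem exists_symbol_ge : ∃ c : ℝ, 0 < c ∧ ∀ ξ : K, 1 ≤ absK p ξ →
    c * absK p ξ ≤ D.symbol ξ := by
  obtain ⟨a, b, ha, hb, hN⟩ := exists_absK_bounds (p := p) (K := K)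
  obtain ⟨a', b', ha', hb', hh⟩ := D.exists_h_bounds
  set n := Module.finrank ℚ_[p] K with hn
  have hn0 : (0 : ℝ) < n := Nat.cast_pos.2 Module.finrank_pos
  have hα := D.α_pos
  set s : ℝ := 2 * D.α / n with hs
  have hs1 : 1 ≤ s := by
    rw [hs, le_div_iff₀ hn0]
    have := D.le_α
    linarith
  refine ⟨a' ^ D.α * (b⁻¹) ^ s, by positivity, fun ξ hξ => ?_⟩
  have h0 := coordNorm_nonneg p ξ
  have h1 : absK p ξ ≤ absK p ξ ^ s := by
    conv_lhs => rw [← Real.rpow_one (absK p ξ)]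
    exact Real.rpow_le_rpow_of_exponent_le hξ hs1
  have h2 : b⁻¹ * absK p ξ ≤ coordNorm p ξ ^ n := by
    rw [inv_mul_le_iff₀ hb]
    exact (hN ξ).2
  calc a' ^ D.α * (b⁻¹) ^ s * absK p ξ ≤ a' ^ D.α * (b⁻¹) ^ s * absK p ξ ^ s := by gcongr
    _ = a' ^ D.α * (b⁻¹ * absK p ξ) ^ s := by
        rw [Real.mul_rpow (by positivity) (absK_nonneg _), mul_assoc]
    _ ≤ a' ^ D.α * (coordNorm p ξ ^ n) ^ s := by
        have := absK_nonneg (p := p) ξ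
        gcongr
    _ = (a' * coordNorm p ξ ^ 2) ^ D.α := by
        rw [Real.mul_rpow ha'.le (by positivity), ← Real.rpow_natCast, ← Real.rpow_natCast,
          ← Real.rpow_mul h0, ← Real.rpow_mul h0, hs]
        congr 2
        push_cast
        field_simp
    _ ≤ D.symbol ξ := Real.rpow_le_rpow (by positivity) (hh ξ).1 hα.le

end Symbol

end PadicModel

/-! ### Step functions and the Fourier transform -/

namespace PadicModel

section Steps

variable {p : ℕ} [Fact p.Prime] {K : Type*} [DivisionRing K] [Algebra ℚ_[p] K]
  [FiniteDimensional ℚ_[p] K] [TopologicalSpace K] [T2Space K] [IsTopologicalAddGroup K]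
  [ContinuousSMul ℚ_[p] K] [MeasurableSpace K] [BorelSpace K] (D : PadicModel p K)

/-- The function is constant on the balls of radius `q^j`. -/
def IsStep (j : ℤ) {E : Type*} (f : K → E) : Prop := ∀ x y, x ∈ D.ball j y → f x = f y

/-- The balls of radius `q^j` with centres in `C` are disjoint. -/
def Separated (j : ℤ) (C : Finset K) : Prop := ∀ c ∈ C, ∀ d ∈ C, c ≠ d → D.q ^ j < absK p (c - d)

variable {D}

theorem IsStep.mono {j j' : ℤ} {E : Type*} {f : K → E} (hf : D.IsStep j f) (h : j' ≤ j) :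
    D.IsStep j' f := fun x y hxy => hf x y (D.ball_subset_ball h y hxy)

theorem IsStep.comp {j : ℤ} {E F : Type*} {f : K → E} (hf : D.IsStep j f) (g : E → F) :
    D.IsStep j fun x => g (f x) := fun x y hxy => congrArg g (hf x y hxy)

theorem IsStep.isLocallyConstant {j : ℤ} {E : Type*} {f : K → E} (hf : D.IsStep j f) :
    IsLocallyConstant f :=
  (IsLocallyConstant.iff_exists_open f).2 fun x =>
    ⟨D.ball j x, D.isOpen_ball j x, D.mem_ball_self j x, fun y hy => hf y x hy⟩

theorem mem_region {j : ℤ} {C : Finset K} {x : K} :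
    x ∈ D.region j C ↔ ∃ c ∈ C, x ∈ D.ball j c := by simp [region]

theorem mem_region_of_mem {j : ℤ} {C : Finset K} {c : K} (hc : c ∈ C) : c ∈ D.region j C :=
  mem_region.2 ⟨c, hc, D.mem_ball_self j c⟩

theorem ball_subset_region {j j' : ℤ} (h : j' ≤ j) {C : Finset K} {x : K}
    (hx : x ∈ D.region j C) : D.ball j' x ⊆ D.region j C := by
  obtain ⟨c, hc, hxc⟩ := mem_region.1 hx
  exact fun y hy => mem_region.2 ⟨c, hc, D.mem_ball_trans (D.ball_subset_ball h x hy) hxc⟩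

theorem region_mono {j : ℤ} {C C' : Finset K} (h : C ⊆ C') : D.region j C ⊆ D.region j C' :=
  Set.biUnion_subset_biUnion_left h

variable (D) in
theorem isCompact_region (j : ℤ) (C : Finset K) : IsCompact (D.region j C) :=
  C.isCompact_biUnion fun c _ => D.isCompact_ball j c

variable (D) in
theorem isOpen_region (j : ℤ) (C : Finset K) : IsOpen (D.region j C) :=
  isOpen_biUnion fun c _ => D.isOpen_ball j c

/-- A locally constant function with compact support is a step function. -/
theorem exists_isStep {E : Type*} [Zero E] {U : Set K} (hU : IsCompact U) {f : K → E}
    (hf : IsLocallyConstant f) (h0 : ∀ x, x ∉ U → f x = 0) :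
    ∃ k : ℕ, D.IsStep (-(k : ℤ)) f := by
  have h1 : ∀ x : K, ∃ k : ℕ, ∀ y ∈ D.ball (-(k : ℤ)) x, f y = f x := fun x => by
    obtain ⟨V, hV, hxV, hVf⟩ := hf.exists_open x
    obtain ⟨k, hk⟩ := D.exists_ball_subset hV hxV
    exact ⟨k, fun y hy => hVf y (hk hy)⟩
  choose k hk using h1
  obtain ⟨s, hs⟩ := hU.elim_finite_subcover (fun x => D.ball (-(k x : ℤ)) x)
    (fun x => D.isOpen_ball _ x) fun x _ => Set.mem_iUnion.2 ⟨x, D.mem_ball_self _ x⟩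
  have key : ∀ x y, x ∈ U → y ∈ D.ball (-((s.sup k : ℕ) : ℤ)) x → f y = f x := by
    intro x y hx hy
    obtain ⟨z, hz⟩ := Set.mem_iUnion.1 (hs hx)
    obtain ⟨hzs, hxz⟩ := Set.mem_iUnion.1 hz
    have hle : k z ≤ s.sup k := Finset.le_sup hzs
    rw [hk z x hxz, hk z y (D.mem_ball_trans (D.ball_subset_ball (by omega) x hy) hxz)]
  refine ⟨s.sup k, fun x y hxy => ?_⟩
  by_cases hx : x ∈ U
  · exact (key x y hx (D.mem_ball_comm.1 hxy)).symm
  by_cases hy : y ∈ U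
  · exact key y x hy hxy
  · rw [h0 x hx, h0 y hy]

theorem exists_isStep_le {E : Type*} [Zero E] {U : Set K} (hU : IsCompact U) {f : K → E}
    (hf : IsLocallyConstant f) (h0 : ∀ x, x ∉ U → f x = 0) (l : ℤ) :
    ∃ j ≤ l, D.IsStep j f := by
  obtain ⟨k, hk⟩ := exists_isStep (D := D) hU hf h0
  exact ⟨min l (-(k : ℤ)), min_le_left _ _, hk.mono (min_le_right _ _)⟩

theorem IsStep.eq_sum_indicator {j : ℤ} {C : Finset K} (hC : D.Separated j C) {E : Type*}
    [AddCommMonoid E] {f : K → E} (hf : D.IsStep j f) (h0 : ∀ x, x ∉ D.region j C → f x = 0)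
    (x : K) : f x = ∑ c ∈ C, (D.ball j c).indicator (fun _ => f c) x := by
  classical
  by_cases hx : x ∈ D.region j C
  · obtain ⟨c, hc, hxc⟩ := mem_region.1 hx
    rw [Finset.sum_eq_single_of_mem c hc, Set.indicator_of_mem hxc, hf x c hxc]
    intro d hd hdc
    refine Set.indicator_of_notMem (fun hxd => ?_) _
    exact (Set.disjoint_left.1 (D.ball_disjoint (hC c hc d hd hdc.symm))) hxc hxd
  · rw [h0 x hx, Finset.sum_eq_zero]
    intro c hc
    exact Set.indicator_of_notMem (fun hxc => hx (mem_region.2 ⟨c, hc, hxc⟩)) _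

/-- Integral of a step function against another function. -/
theorem IsStep.integral_mul {j : ℤ} {C : Finset K} (hC : D.Separated j C) {𝕜 : Type*} [RCLike 𝕜]
    {f : K → 𝕜} (hf : D.IsStep j f) (h0 : ∀ x, x ∉ D.region j C → f x = 0) {G : K → 𝕜}
    (hG : ∀ c ∈ C, IntegrableOn G (D.ball j c) D.vol) :
    ∫ x, f x * G x ∂D.vol = ∑ c ∈ C, f c * ∫ x in D.ball j c, G x ∂D.vol := by
  have h1 : (fun x => f x * G x) =
      fun x => ∑ c ∈ C, (D.ball j c).indicator (fun x => f c * G x) x := by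
    ext x
    rw [hf.eq_sum_indicator hC h0 x, Finset.sum_mul]
    refine Finset.sum_congr rfl fun c _ => ?_
    by_cases hx : x ∈ D.ball j c <;> simp [hx]
  rw [h1, integral_finsetSum _ fun c hc =>
    (show IntegrableOn (fun x => f c * G x) (D.ball j c) D.vol from
      (hG c hc).const_mul (f c)).integrable_indicator (D.measurableSet_ball j c)]
  refine Finset.sum_congr rfl fun c _ => ?_
  rw [integral_indicator (D.measurableSet_ball j c), integral_const_mul]

variable (D)

/-- The ball of radius `q^j` about `0` as a subgroup. -/
def ballGroup (j : ℤ) : AddSubgroup K where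
  carrier := D.ball j 0
  add_mem' := D.add_mem_ball_zero
  zero_mem' := D.mem_ball_self j 0
  neg_mem' := D.neg_mem_ball_zero.2

/-- A representative of the ball of radius `q^j` about `x`. -/
noncomputable def rep (j : ℤ) (x : K) : K := (QuotientAddGroup.mk x : K ⧸ D.ballGroup j).out

theorem rep_mem_ball (j : ℤ) (x : K) : D.rep j x ∈ D.ball j x := by
  have h : (QuotientAddGroup.mk x : K ⧸ D.ballGroup j) = QuotientAddGroup.mk (D.rep j x) :=
    (Quotient.out_eq' (QuotientAddGroup.mk x : K ⧸ D.ballGroup j)).symm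
  rw [QuotientAddGroup.eq] at h
  rw [mem_ball_iff_sub, sub_eq_neg_add]
  exact h

theorem rep_eq_of_mem {j : ℤ} {x y : K} (h : x ∈ D.ball j y) : D.rep j x = D.rep j y := by
  rw [rep, rep]
  congr 1
  rw [QuotientAddGroup.eq, ← sub_eq_neg_add]
  exact D.mem_ball_iff_sub.1 (D.mem_ball_comm.1 h)

theorem finite_rep_image (j : ℤ) {U : Set K} (hU : IsCompact U) : (D.rep j '' U).Finite := by
  obtain ⟨s, hs⟩ := hU.elim_finite_subcover (fun x => D.ball j x)
    (fun x => D.isOpen_ball _ x) fun x _ => Set.mem_iUnion.2 ⟨x, D.mem_ball_self _ x⟩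
  refine (s.finite_toSet.image (D.rep j)).subset ?_
  rintro _ ⟨x, hx, rfl⟩
  obtain ⟨z, hz⟩ := Set.mem_iUnion.1 (hs hx)
  obtain ⟨hzs, hxz⟩ := Set.mem_iUnion.1 hz
  exact ⟨z, hzs, (D.rep_eq_of_mem hxz).symm⟩

open Classical in
/-- Centres of the balls of radius `q^j` that make up the compact set `U`. -/
noncomputable def centers (j : ℤ) (U : Set K) : Finset K :=
  if h : (D.rep j '' U).Finite then h.toFinset else ∅

variable {D}

theorem mem_centers {j : ℤ} {U : Set K} (hU : IsCompact U) {c : K} :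
    c ∈ D.centers j U ↔ ∃ x ∈ U, D.rep j x = c := by
  rw [centers, dif_pos (D.finite_rep_image j hU), Set.Finite.mem_toFinset, Set.mem_image]

theorem separated_centers {j : ℤ} {U : Set K} (hU : IsCompact U) :
    D.Separated j (D.centers j U) := by
  intro c hc d hd hcd
  obtain ⟨x, hx, rfl⟩ := (mem_centers hU).1 hc
  obtain ⟨y, hy, rfl⟩ := (mem_centers hU).1 hd
  by_contra! hcon
  have h1 : D.rep j x ∈ D.ball j (D.rep j y) := hcon
  refine hcd (D.rep_eq_of_mem ?_)
  exact D.mem_ball_trans (D.mem_ball_comm.1 (D.rep_mem_ball j x))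
    (D.mem_ball_trans h1 (D.rep_mem_ball j y))

theorem region_centers {j : ℤ} {U : Set K} (hU : IsCompact U)
    (hUj : ∀ x ∈ U, D.ball j x ⊆ U) : D.region j (D.centers j U) = U := by
  ext x
  rw [mem_region]
  constructor
  · rintro ⟨c, hc, hxc⟩
    obtain ⟨y, hy, rfl⟩ := (mem_centers hU).1 hc
    exact hUj y hy (D.mem_ball_trans hxc (D.rep_mem_ball j y))
  · exact fun hx => ⟨_, (mem_centers hU).2 ⟨x, hx, rfl⟩, D.mem_ball_comm.1 (D.rep_mem_ball j x)⟩

/-- Representatives are chosen for balls, independently of the set they fill. Nested regions thus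
give nested lattices at every cutoff. -/
theorem centers_mono {j : ℤ} {U V : Set K} (hU : IsCompact U) (hV : IsCompact V) (h : U ⊆ V) :
    D.centers j U ⊆ D.centers j V := fun _ hc => by
  obtain ⟨x, hx, rfl⟩ := (mem_centers hU).1 hc
  exact (mem_centers hV).2 ⟨x, h hx, rfl⟩

end Steps

/-! ### Fourier transform and inversion for step functions -/

section Fourier

variable {p : ℕ} [Fact p.Prime] {K : Type*} [DivisionRing K] [Algebra ℚ_[p] K]
  [FiniteDimensional ℚ_[p] K] [TopologicalSpace K] [T2Space K] [IsTopologicalAddGroup K]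
  [ContinuousSMul ℚ_[p] K] [MeasurableSpace K] [BorelSpace K]
  [LocallyCompactSpace K] [SecondCountableTopology K] [ContinuousMul K]
  [TopologicalSpace.MetrizableSpace K] (D : PadicModel p K)

theorem conj_χ (x : K) : (starRingEnd ℂ) (D.χ x : ℂ) = D.χ (-x) := by
  rw [AddChar.map_neg_eq_inv, Circle.coe_inv_eq_conj]

theorem χ_add (x y : K) : (D.χ (x + y) : ℂ) = D.χ x * D.χ y := by
  rw [AddChar.map_add_eq_mul, Circle.coe_mul]

theorem continuous_χ_mul_left (ξ : K) : Continuous fun x => (D.χ (ξ * x) : ℂ) :=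
  continuous_subtype_val.comp (D.continuous_χ.comp (continuous_const_mul ξ))

theorem continuous_χ_mul_right (x : K) : Continuous fun ξ => (D.χ (ξ * x) : ℂ) :=
  continuous_subtype_val.comp (D.continuous_χ.comp (continuous_mul_const x))

theorem χ_mul_eq_one {l : ℤ} {x y : K} (hx : x ∈ D.ball l 0) (hy : y ∈ D.ball (-l) 0) :
    D.χ (x * y) = 1 := by
  refine D.χ_trivial _ ?_
  rw [mem_ball_zero] at hx hy
  rw [absK_mul]
  calc absK p x * absK p y ≤ D.q ^ l * D.q ^ (-l) :=
        mul_le_mul hx hy (absK_nonneg _) (zpow_pos D.q_pos l).le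
    _ = 1 := by rw [← zpow_add₀ D.q_pos.ne', add_neg_cancel, zpow_zero]

/-- A character that is not trivial on a compact open subgroup has integral zero there. -/
theorem integral_char_eq_zero {S : Set K} {ψ : K → ℂ} {x₀ : K} (hadd : ∀ x, ψ (x₀ + x) = ψ x₀ * ψ x)
    (hS : ∀ x, x₀ + x ∈ S ↔ x ∈ S) (hSm : MeasurableSet S) (hx₀ : ψ x₀ ≠ 1) :
    ∫ x in S, ψ x ∂D.vol = 0 := by
  have h1 : ∫ x in S, ψ x ∂D.vol = ψ x₀ * ∫ x in S, ψ x ∂D.vol := by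
    rw [← integral_indicator hSm, ← integral_const_mul,
      ← integral_add_left_eq_self (S.indicator ψ) x₀]
    refine integral_congr_ae (Eventually.of_forall fun x => ?_)
    by_cases hx : x ∈ S
    · simp only [Set.indicator_of_mem hx, Set.indicator_of_mem ((hS x).2 hx), hadd]
    · simp only [Set.indicator_of_notMem hx, Set.indicator_of_notMem (mt (hS x).1 hx), mul_zero]
  have h2 : (ψ x₀ - 1) * ∫ x in S, ψ x ∂D.vol = 0 := by
    rw [sub_mul, one_mul, ← h1, sub_self]
  exact (mul_eq_zero.1 h2).resolve_left (sub_ne_zero.2 hx₀)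

theorem add_mem_ball_zero_iff {l : ℤ} {x y : K} (hx : x ∈ D.ball l 0) :
    x + y ∈ D.ball l 0 ↔ y ∈ D.ball l 0 := by
  refine ⟨fun h => ?_, D.add_mem_ball_zero hx⟩
  simpa using D.add_mem_ball_zero (D.neg_mem_ball_zero.2 hx) h

theorem exists_absK_eq_inv_mul {l : ℤ} {ξ : K} (hξ : ξ ∉ D.ball (-l) 0) {y : K}
    (hy : absK p y ≤ (absK p D.β)⁻¹) : ξ ≠ 0 ∧ (absK p ξ)⁻¹ * absK p y ≤ D.q ^ l := by
  have h0 : ξ ≠ 0 := by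
    rintro rfl
    exact hξ (D.mem_ball_self _ 0)
  refine ⟨h0, ?_⟩
  rw [mem_ball_zero, ← D.absK_lt_zpow_iff, not_lt, zpow_add_one₀ D.q_pos.ne', zpow_neg] at hξ
  rw [inv_mul_le_iff₀ (absK_pos h0)]
  have hq := zpow_pos D.q_pos l
  calc absK p y ≤ D.q := hy
    _ = (D.q ^ l)⁻¹ * D.q * D.q ^ l := by field_simp
    _ ≤ _ := by gcongr

/-- Orthogonality of characters. For `ξ` outside the dual ball, rank zero supplies `y` of absolute
value at most `q` with `χ(y) ≠ 1`, and `ξ⁻¹ y` lies in the ball of integration. -/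
theorem integral_χ_ball (l : ℤ) (ξ : K) :
    ∫ x in D.ball l 0, (D.χ (ξ * x) : ℂ) ∂D.vol =
      (D.ball (-l) 0).indicator (fun _ => ((D.q ^ l : ℝ) : ℂ)) ξ := by
  by_cases hξ : ξ ∈ D.ball (-l) 0
  · rw [Set.indicator_of_mem hξ, setIntegral_congr_fun (D.measurableSet_ball l 0)
      (g := fun _ => (1 : ℂ)), setIntegral_const, vol_real_ball]
    · simp
    · intro x hx
      simp only
      rw [D.χ_mul_eq_one hξ (by rwa [neg_neg]), Circle.coe_one]
  · rw [Set.indicator_of_notMem hξ]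
    obtain ⟨y, hy, hy1⟩ := D.χ_nontrivial
    obtain ⟨h0, hle⟩ := D.exists_absK_eq_inv_mul hξ hy
    have hmem : ξ⁻¹ * y ∈ D.ball l 0 := by
      rw [mem_ball_zero, absK_mul, absK_inv]
      exact hle
    refine D.integral_char_eq_zero (x₀ := ξ⁻¹ * y) (fun x => ?_)
      (fun x => D.add_mem_ball_zero_iff hmem) (D.measurableSet_ball l 0) ?_
    · rw [mul_add, χ_add]
    · rw [mul_inv_cancel_left₀ h0]
      exact fun h => hy1 (Circle.coe_eq_one.1 h)

/-- As `K` may be noncommutative, integration over the left factor needs its own argument, with the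
shift `z y⁻¹`. -/
theorem integral_χ_ball' (l : ℤ) (y : K) :
    ∫ ξ in D.ball l 0, (D.χ (ξ * y) : ℂ) ∂D.vol =
      (D.ball (-l) 0).indicator (fun _ => ((D.q ^ l : ℝ) : ℂ)) y := by
  by_cases hy : y ∈ D.ball (-l) 0
  · rw [Set.indicator_of_mem hy, setIntegral_congr_fun (D.measurableSet_ball l 0)
      (g := fun _ => (1 : ℂ)), setIntegral_const, vol_real_ball]
    · simp
    · intro x hx
      simp only
      rw [D.χ_mul_eq_one hx hy, Circle.coe_one]
  · rw [Set.indicator_of_notMem hy]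
    obtain ⟨z, hz, hz1⟩ := D.χ_nontrivial
    obtain ⟨h0, hle⟩ := D.exists_absK_eq_inv_mul hy hz
    have hmem : z * y⁻¹ ∈ D.ball l 0 := by
      rw [mem_ball_zero, absK_mul, absK_inv, mul_comm]
      exact hle
    refine D.integral_char_eq_zero (x₀ := z * y⁻¹) (fun x => ?_)
      (fun x => D.add_mem_ball_zero_iff hmem) (D.measurableSet_ball l 0) ?_
    · rw [add_mul, χ_add]
    · rw [inv_mul_cancel_right₀ h0]
      exact fun h => hz1 (Circle.coe_eq_one.1 h)

/-- Integration over a ball with arbitrary centre. -/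
theorem setIntegral_ball {E : Type*} [NormedAddCommGroup E] [NormedSpace ℝ E] (l : ℤ) (c : K)
    (F : K → E) : ∫ x in D.ball l c, F x ∂D.vol = ∫ x in D.ball l 0, F (c + x) ∂D.vol := by
  rw [← integral_indicator (D.measurableSet_ball l c),
    ← integral_indicator (D.measurableSet_ball l 0),
    ← integral_add_left_eq_self ((D.ball l c).indicator F) c]
  refine integral_congr_ae (Eventually.of_forall fun x => ?_)
  have h : c + x ∈ D.ball l c ↔ x ∈ D.ball l 0 := by
    rw [D.mem_ball_iff_sub, add_sub_cancel_left]
  by_cases hx : x ∈ D.ball l 0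
  · simp only [Set.indicator_of_mem hx, Set.indicator_of_mem (h.2 hx)]
  · simp only [Set.indicator_of_notMem hx, Set.indicator_of_notMem (mt h.1 hx)]

theorem integrableOn_ball {E : Type*} [NormedAddCommGroup E] {F : K → E} (hF : Continuous F)
    (l : ℤ) (c : K) : IntegrableOn F (D.ball l c) D.vol :=
  hF.continuousOn.integrableOn_compact (D.isCompact_ball l c)

variable {D}

theorem IsStep.fourier_eq {j : ℤ} {C : Finset K} (hC : D.Separated j C) {f : K → ℂ}
    (hf : D.IsStep j f) (h0 : ∀ x, x ∉ D.region j C → f x = 0) (ξ : K) :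
    D.fourier f ξ = (D.ball (-j) 0).indicator
      (fun ξ => ((D.q ^ j : ℝ) : ℂ) * ∑ c ∈ C, f c * D.χ (ξ * c)) ξ := by
  have h1 : D.fourier f ξ = ∫ x, f x * D.χ (ξ * x) ∂D.vol := by
    rw [fourier]
    simp only [mul_comm]
  rw [h1, hf.integral_mul hC h0 fun c _ => D.integrableOn_ball (D.continuous_χ_mul_left ξ) j c]
  have h2 : ∀ c, ∫ x in D.ball j c, (D.χ (ξ * x) : ℂ) ∂D.vol =
      D.χ (ξ * c) * (D.ball (-j) 0).indicator (fun _ => ((D.q ^ j : ℝ) : ℂ)) ξ := by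
    intro c
    rw [setIntegral_ball, ← integral_χ_ball, ← integral_const_mul]
    refine integral_congr_ae (Eventually.of_forall fun x => ?_)
    simp only
    rw [mul_add, χ_add]
  simp only [h2]
  by_cases hξ : ξ ∈ D.ball (-j) 0
  · simp only [Set.indicator_of_mem hξ]
    rw [Finset.mul_sum]
    exact Finset.sum_congr rfl fun c _ => by ring
  · simp [Set.indicator_of_notMem hξ]

/-- Fourier inversion for step functions. -/
theorem IsStep.fourier_inversion {i : ℤ} {E : Finset K} (hE : D.Separated i E) {ψ : K → ℂ}
    (hψ : D.IsStep i ψ) (h0 : ∀ x, x ∉ D.region i E → ψ x = 0) :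
    D.fourier (fun y => ∫ ξ, (starRingEnd ℂ) (D.χ (ξ * y) : ℂ) * ψ ξ ∂D.vol) = ψ := by
  have hq := (zpow_pos D.q_pos i).ne'
  have h1 : ∀ y, ∫ ξ, (starRingEnd ℂ) (D.χ (ξ * y) : ℂ) * ψ ξ ∂D.vol =
      ∑ η ∈ E, ψ η * (D.χ (-(η * y)) *
        (D.ball (-i) 0).indicator (fun _ => ((D.q ^ i : ℝ) : ℂ)) y) := by
    intro y
    have h2 : ∀ ξ, (starRingEnd ℂ) (D.χ (ξ * y) : ℂ) = D.χ (ξ * (-y)) := fun ξ => by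
      rw [conj_χ, mul_neg]
    simp only [h2, mul_comm _ (ψ _)]
    rw [hψ.integral_mul hE h0 fun c _ => D.integrableOn_ball (D.continuous_χ_mul_right (-y)) i c]
    refine Finset.sum_congr rfl fun η _ => ?_
    congr 1
    rw [setIntegral_ball]
    simp only [add_mul, χ_add]
    rw [integral_const_mul, integral_χ_ball', mul_neg]
    congr 1
    by_cases hy : y ∈ D.ball (-i) 0
    · rw [Set.indicator_of_mem hy, Set.indicator_of_mem (D.neg_mem_ball_zero.2 hy)]
    · rw [Set.indicator_of_notMem hy, Set.indicator_of_notMem (mt D.neg_mem_ball_zero.1 hy)]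
  ext ξ
  rw [fourier]
  simp only [h1]
  have h3 : ∀ y, (D.χ (ξ * y) : ℂ) * ∑ η ∈ E, ψ η * (D.χ (-(η * y)) *
        (D.ball (-i) 0).indicator (fun _ => ((D.q ^ i : ℝ) : ℂ)) y) =
      ∑ η ∈ E, (D.ball (-i) 0).indicator
        (fun y => ψ η * ((D.q ^ i : ℝ) : ℂ) * D.χ ((ξ - η) * y)) y := by
    intro y
    rw [Finset.mul_sum]
    refine Finset.sum_congr rfl fun η _ => ?_
    by_cases hy : y ∈ D.ball (-i) 0
    · rw [Set.indicator_of_mem hy, Set.indicator_of_mem hy, sub_mul, sub_eq_add_neg, χ_add]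
      ring
    · rw [Set.indicator_of_notMem hy, Set.indicator_of_notMem hy, mul_zero, mul_zero, mul_zero]
  simp only [h3]
  rw [integral_finsetSum]
  · rw [hψ.eq_sum_indicator hE h0 ξ]
    refine Finset.sum_congr rfl fun η _ => ?_
    rw [integral_indicator (D.measurableSet_ball _ 0), integral_const_mul, integral_χ_ball,
      neg_neg]
    have h4 : ξ - η ∈ D.ball i 0 ↔ ξ ∈ D.ball i η := D.mem_ball_iff_sub.symm
    by_cases hξ : ξ ∈ D.ball i η
    · rw [Set.indicator_of_mem hξ, Set.indicator_of_mem (h4.2 hξ), mul_assoc, ← Complex.ofReal_mul,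
        ← zpow_add₀ D.q_pos.ne', add_neg_cancel, zpow_zero, Complex.ofReal_one, mul_one]
    · rw [Set.indicator_of_notMem hξ, Set.indicator_of_notMem (mt h4.1 hξ), mul_zero]
  · intro η _
    refine IntegrableOn.integrable_indicator ?_ (D.measurableSet_ball _ 0)
    exact D.integrableOn_ball (continuous_const.mul (D.continuous_χ_mul_left (ξ - η))) _ _

end Fourier

end PadicModel

/-! ### Multipliers on step functions and the resolvent -/

namespace PadicModel

section Kernel

variable {p : ℕ} [Fact p.Prime] {K : Type*} [DivisionRing K] [Algebra ℚ_[p] K]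
  [FiniteDimensional ℚ_[p] K] [TopologicalSpace K] [T2Space K] [IsTopologicalAddGroup K]
  [ContinuousSMul ℚ_[p] K] [MeasurableSpace K] [BorelSpace K]
  [LocallyCompactSpace K] [SecondCountableTopology K] [ContinuousMul K]
  [TopologicalSpace.MetrizableSpace K] (D : PadicModel p K)

/-- The Fourier transform of the function `b`, cut off to the ball of radius `q^{-j}`. -/
noncomputable def kern (b : K → ℝ) (j : ℤ) (y : K) : ℝ :=
  ∫ ξ in D.ball (-j) 0, b ξ * (D.χ (ξ * y) : ℂ).re ∂D.vol

theorem ofReal_kern {b : K → ℝ} (hb : Continuous b) (hb' : ∀ ξ, b (-ξ) = b ξ) (j : ℤ) (y : K) :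
    (D.kern b j y : ℂ) = ∫ ξ in D.ball (-j) 0, (b ξ : ℂ) * D.χ (ξ * y) ∂D.vol := by
  set F : K → ℂ := fun ξ => (b ξ : ℂ) * D.χ (ξ * y) with hF
  have hFc : Continuous F :=
    (Complex.continuous_ofReal.comp hb).mul (D.continuous_χ_mul_right y)
  have hFn : ∀ ξ, F (-ξ) = (starRingEnd ℂ) (F ξ) := fun ξ => by
    rw [hF]
    simp only
    rw [RingHom.map_mul, Complex.conj_ofReal, conj_χ, hb', neg_mul]
  have h1 : (starRingEnd ℂ) (∫ ξ in D.ball (-j) 0, F ξ ∂D.vol) =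
      ∫ ξ in D.ball (-j) 0, F ξ ∂D.vol := by
    rw [← integral_conj, ← integral_indicator (D.measurableSet_ball _ 0),
      ← integral_indicator (D.measurableSet_ball _ 0), ← integral_neg_eq_self]
    refine integral_congr_ae (Eventually.of_forall fun ξ => ?_)
    by_cases hξ : ξ ∈ D.ball (-j) 0
    · simp only [Set.indicator_of_mem hξ, Set.indicator_of_mem (D.neg_mem_ball_zero.2 hξ), hFn,
        Complex.conj_conj]
    · simp only [Set.indicator_of_notMem hξ,
        Set.indicator_of_notMem (mt D.neg_mem_ball_zero.1 hξ)]
  rw [← Complex.conj_eq_iff_re.1 h1]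
  congr 1
  rw [kern]
  have h2 := integral_re (𝕜 := ℂ) (D.integrableOn_ball hFc (-j) 0)
  have h3 : ∀ ξ, b ξ * (D.χ (ξ * y) : ℂ).re = RCLike.re (F ξ) := fun ξ => by
    simp [hF]
  simp only [h3]
  exact h2

theorem kern_neg (b : K → ℝ) (j : ℤ) (y : K) : D.kern b j (-y) = D.kern b j y := by
  rw [kern, kern]
  congr 1
  ext ξ
  rw [mul_neg, ← conj_χ, Complex.conj_re]

theorem kern_sub_comm (b : K → ℝ) (j : ℤ) (x y : K) :
    D.kern b j (x - y) = D.kern b j (y - x) := by rw [← kern_neg, neg_sub]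

theorem isStep_kern (b : K → ℝ) (j : ℤ) : D.IsStep j (D.kern b j) := by
  intro x y hxy
  rw [kern, kern]
  refine setIntegral_congr_fun (D.measurableSet_ball _ 0) fun ξ hξ => ?_
  have h1 : x = y + (x - y) := by abel
  have h2 : (D.χ (ξ * x) : ℂ) = D.χ (ξ * y) := by
    conv_lhs => rw [h1]
    have h3 : D.χ (ξ * (x - y)) = 1 :=
      D.χ_mul_eq_one hξ (by rw [neg_neg]; exact D.mem_ball_iff_sub.1 hxy)
    rw [mul_add, χ_add, h3, Circle.coe_one, mul_one]
  simp only [h2]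

theorem kern_sub_of_mem {b : K → ℝ} {j : ℤ} {x x' : K} (h : x ∈ D.ball j x') (y : K) :
    D.kern b j (y - x) = D.kern b j (y - x') := by
  refine D.isStep_kern b j _ _ ?_
  rw [mem_ball, sub_sub_sub_cancel_left, absK_sub_comm]
  exact h

/-- The easy direction of Bochner's theorem: the quadratic form of a Fourier transform is an
integral of squares against the symbol, which yields positivity of the precision matrix. -/
theorem integral_kern_quadratic {b : K → ℝ} (hb : Continuous b) (j : ℤ) {ι : Type*}
    (s : Finset ι) (c : ι → K) (u : ι → ℝ) :
    ∑ i ∈ s, ∑ k ∈ s, u i * u k * D.kern b j (c i - c k) =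
      ∫ ξ in D.ball (-j) 0, b ξ * Complex.normSq (∑ i ∈ s, (u i : ℂ) * D.χ (ξ * c i)) ∂D.vol := by
  have hint : ∀ y, IntegrableOn (fun ξ => b ξ * (D.χ (ξ * y) : ℂ).re) (D.ball (-j) 0) D.vol :=
    fun y => D.integrableOn_ball
      (hb.mul (Complex.continuous_re.comp (D.continuous_χ_mul_right y))) _ _
  have h1 : ∀ ξ, b ξ * Complex.normSq (∑ i ∈ s, (u i : ℂ) * D.χ (ξ * c i)) =
      ∑ i ∈ s, ∑ k ∈ s, u i * u k * (b ξ * (D.χ (ξ * (c i - c k)) : ℂ).re) := by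
    intro ξ
    have h2 : Complex.normSq (∑ i ∈ s, (u i : ℂ) * D.χ (ξ * c i)) =
        ∑ i ∈ s, ∑ k ∈ s, u i * u k * (D.χ (ξ * (c i - c k)) : ℂ).re := by
      have h3 : ((Complex.normSq (∑ i ∈ s, (u i : ℂ) * D.χ (ξ * c i)) : ℝ) : ℂ) =
          ∑ i ∈ s, ∑ k ∈ s, ((u i * u k : ℝ) : ℂ) * (D.χ (ξ * (c i - c k)) : ℂ) := by
        rw [← Complex.mul_conj, map_sum, Finset.sum_mul_sum]
        refine Finset.sum_congr rfl fun i _ => Finset.sum_congr rfl fun k _ => ?_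
        rw [RingHom.map_mul, Complex.conj_ofReal, conj_χ, mul_sub, sub_eq_add_neg, χ_add]
        push_cast
        ring
      have h4 := congrArg Complex.re h3
      rw [Complex.ofReal_re] at h4
      rw [h4, Complex.re_sum]
      refine Finset.sum_congr rfl fun i _ => ?_
      rw [Complex.re_sum]
      exact Finset.sum_congr rfl fun k _ => Complex.re_ofReal_mul _ _
    rw [h2, Finset.mul_sum]
    refine Finset.sum_congr rfl fun i _ => ?_
    rw [Finset.mul_sum]
    exact Finset.sum_congr rfl fun k _ => by ring
  simp only [h1]
  rw [integral_finsetSum _ fun i _ => integrable_finsetSum _ fun k _ => (hint _).const_mul _]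
  refine Finset.sum_congr rfl fun i _ => ?_
  rw [integral_finsetSum _ fun k _ => (hint _).const_mul _]
  refine Finset.sum_congr rfl fun k _ => ?_
  rw [integral_const_mul, kern]

/-- The kernel of the elliptic operator is nonpositive off the diagonal. -/
theorem kern_symbol_nonpos (hp : p ≠ 2) {j : ℤ} {y : K} (hy : y ∉ D.ball j 0) :
    D.kern D.symbol j y ≤ 0 := by
  set H := D.ball (-j) 0 with hH
  have hHm : MeasurableSet H := D.measurableSet_ball _ 0
  set r : K → ℝ := fun ξ => (D.χ (ξ * y) : ℂ).re with hr
  have hrc : Continuous r := Complex.continuous_re.comp (D.continuous_χ_mul_right y)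
  have hr1 : ∀ ξ, |r ξ| ≤ 1 := fun ξ =>
    (Complex.abs_re_le_norm _).trans (by rw [Circle.norm_coe])
  obtain ⟨M, hM⟩ := (D.isCompact_ball (-j) 0).exists_bound_of_continuousOn
    D.continuous_symbol.continuousOn
  have hM0 : 0 ≤ M := (norm_nonneg _).trans (hM 0 (D.mem_ball_self _ 0))
  have hMa : ∀ ξ ∈ H, D.symbol ξ ≤ M := fun ξ hξ => (le_abs_self _).trans (hM ξ hξ)
  have hr0 : ∫ ξ in H, r ξ ∂D.vol = 0 := by
    have h1 := integral_re (𝕜 := ℂ) (D.integrableOn_ball (D.continuous_χ_mul_right y) (-j) 0)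
    rw [integral_χ_ball', neg_neg, Set.indicator_of_notMem hy] at h1
    simpa using h1
  -- Since `y` is off the diagonal, the character has integral zero over `H`, and the symbol may be
  -- replaced by its difference with the bound `M`.
  have hker : D.kern D.symbol j y = -∫ ξ in H, (M - D.symbol ξ) * r ξ ∂D.vol := by
    have h1 : ∀ ξ, (M - D.symbol ξ) * r ξ = M * r ξ - D.symbol ξ * r ξ := fun ξ => by ring
    simp only [h1]
    rw [integral_sub, integral_const_mul, hr0, mul_zero, zero_sub, neg_neg, kern]
    · exact D.integrableOn_ball (continuous_const.mul hrc) _ _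
    · exact D.integrableOn_ball (D.continuous_symbol.mul hrc) _ _
  rw [hker, neg_nonpos]
  -- Layer-cake decomposition: on `H`, `M - a(ξ)` is the integral over `t` in `(0, M]` of the
  -- indicator of `a(ξ) < t`.
  set Φ : K → ℝ → ℝ := fun ξ t => (Set.Ioi (D.symbol ξ)).indicator (fun _ => r ξ) t with hΦ
  have h2 : ∫ ξ in H, (M - D.symbol ξ) * r ξ ∂D.vol =
      ∫ ξ in H, ∫ t in Set.Ioc 0 M, Φ ξ t ∂volume ∂D.vol := by
    refine setIntegral_congr_fun hHm fun ξ hξ => ?_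
    simp only [hΦ]
    rw [integral_indicator measurableSet_Ioi, Measure.restrict_restrict measurableSet_Ioi,
      setIntegral_const, Set.inter_comm, Set.Ioc_inter_Ioi, sup_of_le_right (D.symbol_nonneg ξ),
      Real.volume_real_Ioc_of_le (hMa ξ hξ), smul_eq_mul]
  have hfin : IsFiniteMeasure (D.vol.restrict H) :=
    ⟨by rw [Measure.restrict_apply_univ]; exact (D.isCompact_ball _ 0).measure_lt_top⟩
  have hΦm : Measurable (Function.uncurry Φ) := by
    have : Function.uncurry Φ = {z : K × ℝ | D.symbol z.1 < z.2}.indicator fun z => r z.1 := by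
      ext ⟨ξ, t⟩
      simp only [Function.uncurry, hΦ, Set.indicator_apply]
      rfl
    rw [this]
    exact (hrc.measurable.comp measurable_fst).indicator
      (measurableSet_lt (D.continuous_symbol.measurable.comp measurable_fst) measurable_snd)
  rw [h2, integral_integral_swap]
  · refine setIntegral_nonneg measurableSet_Ioc fun t ht => ?_
    have hSm : MeasurableSet (H ∩ {ξ | D.symbol ξ < t}) :=
      hHm.inter (measurableSet_lt D.continuous_symbol.measurable measurable_const)
    have h3 : ∫ ξ in H, Φ ξ t ∂D.vol = ∫ ξ in H ∩ {ξ | D.symbol ξ < t}, r ξ ∂D.vol := by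
      rw [← integral_indicator hSm, ← integral_indicator hHm]
      refine integral_congr_ae (Eventually.of_forall fun ξ => ?_)
      simp only [hΦ, Set.indicator_apply, Set.mem_Ioi]
      by_cases h1 : ξ ∈ H <;> by_cases h2 : D.symbol ξ < t <;> simp [h1, h2]
    rw [h3]
    -- `H ∩ {a < t}` is a subgroup when nonempty. The integral of the character over it is its
    -- volume if the character is trivial there, and zero otherwise.
    by_cases htriv : ∀ ξ ∈ H ∩ {ξ | D.symbol ξ < t}, D.χ (ξ * y) = 1
    · refine setIntegral_nonneg hSm fun ξ hξ => ?_
      simp [hr, htriv ξ hξ]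
    · push Not at htriv
      obtain ⟨ξ₀, ⟨hξ₀, hξ₀t⟩, hne⟩ := htriv
      have h4 := D.integral_char_eq_zero (S := H ∩ {ξ | D.symbol ξ < t})
        (ψ := fun ξ => (D.χ (ξ * y) : ℂ)) (x₀ := ξ₀) (fun x => by rw [add_mul, χ_add]) (fun x => by
          refine and_congr (D.add_mem_ball_zero_iff hξ₀) ?_
          have hlt : ∀ {u v : K}, D.symbol u < t → D.symbol v < t → D.symbol (u + v) < t :=
            fun {u v} hu hv => (D.symbol_add_le hp (le_max_left _ _) (le_max_right _ _)).trans_lt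
              (max_lt hu hv)
          refine ⟨fun h => ?_, fun h => hlt hξ₀t h⟩
          have h5 : D.symbol (-ξ₀) < t := by rw [symbol_neg]; exact hξ₀t
          have h6 := hlt h5 h
          rwa [neg_add_cancel_left] at h6) hSm (fun h => hne (Circle.coe_eq_one.1 h))
      have h7 := integral_re (𝕜 := ℂ) ((D.integrableOn_ball (D.continuous_χ_mul_right y) (-j)
        0).mono_set (Set.inter_subset_left (t := {ξ | D.symbol ξ < t})))
      rw [h4] at h7
      exact le_of_eq (by simpa using h7.symm)
  · refine Integrable.mono' (g := fun _ => (1 : ℝ)) (integrable_const _)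
      hΦm.aestronglyMeasurable (Eventually.of_forall ?_)
    rintro ⟨ξ, t⟩
    simp only [Function.uncurry, hΦ]
    refine (norm_indicator_le_norm_self _ _).trans ?_
    exact hr1 ξ

variable {D}

theorem IsStep.multiplier_eq {b : K → ℝ} (hb : Continuous b) (hb' : ∀ ξ, b (-ξ) = b ξ) {j : ℤ}
    {C : Finset K} (hC : D.Separated j C) {f : K → ℝ} (hf : D.IsStep j f)
    (h0 : ∀ x, x ∉ D.region j C → f x = 0) (x : K) :
    D.multiplier b (fun y => (f y : ℂ)) x =
      ((D.q ^ j * ∑ c ∈ C, f c * D.kern b j (c - x) : ℝ) : ℂ) := by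
  have hf' : D.IsStep j (fun y => (f y : ℂ)) := hf.comp _
  rw [multiplier]
  have h1 : ∀ ξ, (starRingEnd ℂ) (D.χ (ξ * x) : ℂ) *
      ((b ξ : ℂ) * D.fourier (fun y => (f y : ℂ)) ξ) = (D.ball (-j) 0).indicator (fun ξ =>
        ∑ c ∈ C, ((D.q ^ j * f c : ℝ) : ℂ) * ((b ξ : ℂ) * D.χ (ξ * (c - x)))) ξ := by
    intro ξ
    rw [hf'.fourier_eq hC (fun x hx => by rw [h0 x hx, Complex.ofReal_zero])]
    by_cases hξ : ξ ∈ D.ball (-j) 0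
    · rw [Set.indicator_of_mem hξ, Set.indicator_of_mem hξ, Finset.mul_sum, Finset.mul_sum,
        Finset.mul_sum]
      refine Finset.sum_congr rfl fun c _ => ?_
      rw [conj_χ, mul_sub, sub_eq_add_neg, χ_add]
      push_cast
      ring
    · rw [Set.indicator_of_notMem hξ, Set.indicator_of_notMem hξ, mul_zero, mul_zero]
  simp only [h1]
  rw [integral_indicator (D.measurableSet_ball _ 0), integral_finsetSum]
  · rw [Finset.mul_sum, Complex.ofReal_sum]
    refine Finset.sum_congr rfl fun c _ => ?_
    rw [integral_const_mul, ← D.ofReal_kern hb hb']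
    push_cast
    ring
  · intro c _
    refine Integrable.const_mul ?_ _
    exact D.integrableOn_ball ((Complex.continuous_ofReal.comp hb).mul
      (D.continuous_χ_mul_right _)) _ _

variable (D)

variable [DecidableEq K]

/-- The matrix of `𝔸 + m²` on the step functions of scale `j`. -/
noncomputable def precision (j : ℤ) (C : Finset K) : Matrix C C ℝ :=
  Matrix.of fun c d => D.q ^ j * D.kern D.symbol j ((c : K) - d) + if c = d then D.m ^ 2 else 0

theorem precision_apply (j : ℤ) (C : Finset K) (c d : C) : D.precision j C c d =
    D.q ^ j * D.kern D.symbol j ((c : K) - d) + if c = d then D.m ^ 2 else 0 := rfl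

theorem posDef_precision (j : ℤ) (C : Finset K) : (D.precision j C).PosDef := by
  refine Matrix.PosDef.of_dotProduct_mulVec_pos ?_ fun x hx => ?_
  · ext c d
    rw [Matrix.conjTranspose_apply, star_trivial, precision_apply, precision_apply, kern_sub_comm]
    simp only [eq_comm]
  · have h1 : star x ⬝ᵥ (D.precision j C).mulVec x =
        D.q ^ j * (∑ c : C, ∑ d : C, x c * x d * D.kern D.symbol j ((c : K) - d)) +
          D.m ^ 2 * ∑ c : C, x c ^ 2 := by
      simp only [star_trivial, dotProduct, Matrix.mulVec, precision_apply, add_mul, ite_mul,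
        zero_mul, Finset.sum_add_distrib, mul_add, Finset.sum_ite_eq, Finset.mem_univ, if_true]
      congr 1
      · rw [Finset.mul_sum]
        refine Finset.sum_congr rfl fun c _ => ?_
        rw [Finset.mul_sum, Finset.mul_sum]
        exact Finset.sum_congr rfl fun d _ => by ring
      · rw [Finset.mul_sum]
        exact Finset.sum_congr rfl fun c _ => by ring
    rw [h1, D.integral_kern_quadratic D.continuous_symbol j Finset.univ (fun c : C => (c : K)) x]
    obtain ⟨c, hc⟩ := Function.ne_iff.1 hx
    refine add_pos_of_nonneg_of_pos (mul_nonneg (zpow_pos D.q_pos j).le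
      (integral_nonneg fun ξ => mul_nonneg (D.symbol_nonneg ξ) (Complex.normSq_nonneg _)))
      (mul_pos (pow_pos D.m_pos 2) ?_)
    exact Finset.sum_pos' (fun i _ => sq_nonneg _) ⟨c, Finset.mem_univ c, sq_pos_of_ne_zero hc⟩

theorem precision_nonpos (hp : p ≠ 2) {j : ℤ} {C : Finset K} (hC : D.Separated j C) {c d : C}
    (hcd : c ≠ d) : D.precision j C c d ≤ 0 := by
  rw [precision_apply, if_neg hcd, add_zero]
  refine mul_nonpos_of_nonneg_of_nonpos (zpow_pos D.q_pos j).le (D.kern_symbol_nonpos hp ?_)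
  rw [mem_ball_zero, not_le]
  exact hC c c.2 d d.2 fun h => hcd (Subtype.ext h)

variable {D}

/-- `𝔸 + m²` acts on step functions through the precision matrix. -/
theorem IsStep.opA_add_eq {j : ℤ} {C : Finset K} (hC : D.Separated j C) {u : K → ℝ}
    (hu : D.IsStep j u) (h0 : ∀ x, x ∉ D.region j C → u x = 0) {x : K} {c : C}
    (hx : x ∈ D.ball j c) :
    D.opA (fun y => (u y : ℂ)) x + (D.m : ℂ) ^ 2 * (u x : ℂ) =
      (((D.precision j C).mulVec (fun d : C => u d) c : ℝ) : ℂ) := by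
  rw [opA, hu.multiplier_eq D.continuous_symbol D.symbol_neg hC h0, hu x c hx]
  have h1 : (D.precision j C).mulVec (fun d : C => u d) c =
      D.q ^ j * ∑ d ∈ C, u d * D.kern D.symbol j (d - x) + D.m ^ 2 * u c := by
    simp only [dotProduct, Matrix.mulVec, precision_apply, add_mul, ite_mul,
        zero_mul, Finset.sum_add_distrib, Finset.sum_ite_eq, Finset.mem_univ, if_true]
    congr 1
    rw [Finset.mul_sum, ← Finset.sum_coe_sort C]
    refine Finset.sum_congr rfl fun d _ => ?_
    rw [D.kern_sub_of_mem hx, D.kern_sub_comm _ _ (c : K)]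
    ring
  rw [h1]
  push_cast
  ring

/-- The step function with prescribed values at the centres. -/
noncomputable def stepFun (D : PadicModel p K) (j : ℤ) (C : Finset K) (v : C → ℝ) (x : K) : ℝ :=
  ∑ c : C, (D.ball j c).indicator (fun _ => v c) x

theorem isStep_stepFun (j : ℤ) (C : Finset K) (v : C → ℝ) : D.IsStep j (D.stepFun j C v) := by
  intro x y hxy
  refine Finset.sum_congr rfl fun c _ => ?_
  have h : x ∈ D.ball j c ↔ y ∈ D.ball j c :=
    ⟨fun h => D.mem_ball_trans (D.mem_ball_comm.1 hxy) h, fun h => D.mem_ball_trans hxy h⟩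
  by_cases hy : y ∈ D.ball j c
  · rw [Set.indicator_of_mem hy, Set.indicator_of_mem (h.2 hy)]
  · rw [Set.indicator_of_notMem hy, Set.indicator_of_notMem (mt h.1 hy)]

theorem stepFun_of_notMem {j : ℤ} {C : Finset K} (v : C → ℝ) {x : K} (hx : x ∉ D.region j C) :
    D.stepFun j C v x = 0 :=
  Finset.sum_eq_zero fun c _ => Set.indicator_of_notMem
    (fun hxc => hx (mem_region.2 ⟨c, c.2, hxc⟩)) _

theorem stepFun_apply {j : ℤ} {C : Finset K} (hC : D.Separated j C) (v : C → ℝ) (c : C) :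
    D.stepFun j C v c = v c := by
  rw [stepFun, Finset.sum_eq_single_of_mem c (Finset.mem_univ c),
    Set.indicator_of_mem (D.mem_ball_self j c)]
  intro d _ hdc
  refine Set.indicator_of_notMem (fun hcd => ?_) _
  exact not_le.2 (hC c c.2 d d.2 fun h => hdc (Subtype.ext h.symm)) hcd

theorem IsStep.mem_testFun {j : ℤ} {U : Set K} {f : K → ℝ} (hf : D.IsStep j f)
    (h0 : ∀ x, x ∉ U → f x = 0) : f ∈ TestFun U := ⟨hf.isLocallyConstant, h0⟩

theorem IsStep.eq_of_centers {j : ℤ} {C : Finset K} {f g : K → ℝ} (hf : D.IsStep j f)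
    (hg : D.IsStep j g) (hf0 : ∀ x, x ∉ D.region j C → f x = 0)
    (hg0 : ∀ x, x ∉ D.region j C → g x = 0) (h : ∀ c ∈ C, f c = g c) : f = g := by
  ext x
  by_cases hx : x ∈ D.region j C
  · obtain ⟨c, hc, hxc⟩ := mem_region.1 hx
    rw [hf x c hxc, hg x c hxc, h c hc]
  · rw [hf0 x hx, hg0 x hx]

/-- `𝔸_U + m²` is injective on test functions, so the resolvent is characterized by its equation. -/
theorem resolvent_eq {l : ℤ} {C : Finset K} {f u : K → ℝ} (hu : u ∈ TestFun (D.region l C))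
    (h : ∀ x ∈ D.region l C, D.opA (fun y => (u y : ℂ)) x + (D.m : ℂ) ^ 2 * (u x : ℂ) =
      (f x : ℂ)) : D.resolvent (D.region l C) f = u := by
  have hex : ∃ u ∈ TestFun (D.region l C), ∀ x ∈ D.region l C,
      D.opA (fun y => (u y : ℂ)) x + (D.m : ℂ) ^ 2 * (u x : ℂ) = (f x : ℂ) := ⟨u, hu, h⟩
  rw [resolvent, dif_pos hex]
  obtain ⟨hv, hv'⟩ := hex.choose_spec
  set v := hex.choose
  set U := D.region l C with hU
  have hUc : IsCompact U := D.isCompact_region l C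
  -- The chosen solution and `u` are both step functions on some common finer scale, where the
  -- positive definite precision matrix is injective.
  obtain ⟨j₁, hj₁, hs₁⟩ := exists_isStep_le (D := D) hUc hu.1 hu.2 l
  obtain ⟨j, hj, hs₂⟩ := exists_isStep_le (D := D) hUc hv.1 hv.2 j₁
  have hs₁ := hs₁.mono hj
  have hUj : D.region j (D.centers j U) = U :=
    region_centers hUc fun x hx => ball_subset_region (hj.trans hj₁) hx
  have hsep : D.Separated j (D.centers j U) := separated_centers hUc
  have hu0 : ∀ x, x ∉ D.region j (D.centers j U) → u x = 0 := by rw [hUj]; exact hu.2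
  have hv0 : ∀ x, x ∉ D.region j (D.centers j U) → v x = 0 := by rw [hUj]; exact hv.2
  refine hs₂.eq_of_centers hs₁ hv0 hu0 fun c hc => ?_
  have h1 : (D.precision j (D.centers j U)).mulVec (fun d => v d) =
      (D.precision j (D.centers j U)).mulVec fun d => u d := by
    ext d
    have hd : (d : K) ∈ U := hUj.subset (mem_region_of_mem d.2)
    have h2 := hs₂.opA_add_eq hsep hv0 (D.mem_ball_self j (d : K))
    have h3 := hs₁.opA_add_eq hsep hu0 (D.mem_ball_self j (d : K))
    rw [hv' d hd] at h2
    rw [h d hd] at h3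
    exact_mod_cast h2.symm.trans h3
  have h2 := Matrix.mulVec_injective_of_isUnit (D.posDef_precision j _).isUnit h1
  exact congrFun h2 ⟨c, hc⟩

/-- `𝔸_U + m²` preserves step functions of a given scale, so the finite linear system solves the
equation exactly and not just approximately. -/
theorem IsStep.resolvent_eq {j : ℤ} {C : Finset K} (hC : D.Separated j C) {f : K → ℝ}
    (hf : D.IsStep j f) : D.resolvent (D.region j C) f =
      D.stepFun j C ((D.precision j C)⁻¹.mulVec fun c => f c) := by
  have hs := isStep_stepFun (D := D) j C ((D.precision j C)⁻¹.mulVec fun c => f c)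
  have h0 : ∀ x, x ∉ D.region j C →
      D.stepFun j C ((D.precision j C)⁻¹.mulVec fun c => f c) x = 0 :=
    fun x hx => stepFun_of_notMem _ hx
  refine PadicModel.resolvent_eq (hs.mem_testFun h0) fun x hx => ?_
  obtain ⟨c, hc, hxc⟩ := mem_region.1 hx
  rw [hs.opA_add_eq hC h0 (c := ⟨c, hc⟩) hxc, hf x c hxc]
  simp only [stepFun_apply hC]
  rw [Matrix.mulVec_mulVec, Matrix.mul_nonsing_inv _
    ((Matrix.isUnit_iff_isUnit_det _).1 (D.posDef_precision j C).isUnit), Matrix.one_mulVec]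

theorem IsStep.integral_mul_step {j : ℤ} {C : Finset K} (hC : D.Separated j C) {f g : K → ℝ}
    (hf : D.IsStep j f) (h0 : ∀ x, x ∉ D.region j C → f x = 0) (hg : D.IsStep j g) :
    ∫ x, f x * g x ∂D.vol = D.q ^ j * ∑ c ∈ C, f c * g c := by
  rw [hf.integral_mul hC h0, Finset.mul_sum]
  · refine Finset.sum_congr rfl fun c _ => ?_
    rw [setIntegral_congr_fun (D.measurableSet_ball j c) (g := fun _ => g c) (fun x hx => hg x c hx),
      setIntegral_const, vol_real_ball, smul_eq_mul]
    ring
  · exact fun c _ => D.integrableOn_ball hg.isLocallyConstant.continuous j c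

theorem IsStep.greenForm_eq {j : ℤ} {C : Finset K} (hC : D.Separated j C) {f g : K → ℝ}
    (hf : D.IsStep j f) (h0 : ∀ x, x ∉ D.region j C → f x = 0) (hg : D.IsStep j g) :
    D.greenForm (D.region j C) f g =
      D.q ^ j * ∑ c : C, ∑ d : C, f c * (D.precision j C)⁻¹ c d * g d := by
  rw [greenForm, hg.resolvent_eq hC, hf.integral_mul_step hC h0 (isStep_stepFun j C _),
    ← Finset.sum_coe_sort C]
  congr 1
  refine Finset.sum_congr rfl fun c _ => ?_
  rw [stepFun_apply hC, Matrix.mulVec, dotProduct, Finset.mul_sum]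
  exact Finset.sum_congr rfl fun d _ => by ring

theorem isStep_e (l : ℤ) (c : K) : D.IsStep l (D.e l c) := by
  intro x y hxy
  have h : x ∈ D.ball l c ↔ y ∈ D.ball l c :=
    ⟨fun h => D.mem_ball_trans (D.mem_ball_comm.1 hxy) h, fun h => D.mem_ball_trans hxy h⟩
  by_cases hy : y ∈ D.ball l c
  · rw [e, Set.indicator_of_mem hy, Set.indicator_of_mem (h.2 hy)]
  · rw [e, Set.indicator_of_notMem hy, Set.indicator_of_notMem (mt h.1 hy)]

theorem e_apply {l : ℤ} {C : Finset K} (hC : D.Separated l C) (c d : C) :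
    D.e l c d = if d = c then (√(D.q ^ l))⁻¹ else 0 := by
  split_ifs with h
  · rw [h, e, Set.indicator_of_mem (D.mem_ball_self l c)]
  · rw [e, Set.indicator_of_notMem]
    exact fun hcd => not_le.2 (hC d d.2 c c.2 fun h' => h (Subtype.ext h')) hcd

/-- The normalization of the indicators in `L²` exactly cancels the volume factor `q^l` of the Green
form. -/
theorem covMatrix_eq {l : ℤ} {C : Finset K} (hC : D.Separated l C) :
    D.covMatrix l C = (D.precision l C)⁻¹ := by
  ext c d
  have hq := zpow_pos D.q_pos l
  rw [covMatrix, Matrix.of_apply, (isStep_e l (c : K)).greenForm_eq hC (fun x hx => ?_)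
    (isStep_e l (d : K))]
  · simp only [e_apply hC, ite_mul, zero_mul, mul_ite, mul_zero, Finset.sum_ite_eq',
      Finset.mem_univ, if_true]
    rw [mul_right_comm, ← mul_inv, Real.mul_self_sqrt hq.le, ← mul_assoc, mul_inv_cancel₀ hq.ne',
      one_mul]
  · exact Set.indicator_of_notMem (fun h => hx (mem_region.2 ⟨c, c.2, h⟩)) _

end Kernel

end PadicModel

/-! ### The free covariance and its comparison with the Dirichlet covariance -/

namespace PadicModel

section Covariance

variable {p : ℕ} [Fact p.Prime] {K : Type*} [DivisionRing K] [Algebra ℚ_[p] K]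
  [FiniteDimensional ℚ_[p] K] [TopologicalSpace K] [T2Space K] [IsTopologicalAddGroup K]
  [ContinuousSMul ℚ_[p] K] [MeasurableSpace K] [BorelSpace K]
  [LocallyCompactSpace K] [SecondCountableTopology K] [ContinuousMul K]
  [TopologicalSpace.MetrizableSpace K] [DecidableEq K] (D : PadicModel p K)

/-- The symbol of the free covariance. -/
noncomputable def propagator (ξ : K) : ℝ := (D.symbol ξ + D.m ^ 2)⁻¹

theorem symbol_add_pos (ξ : K) : 0 < D.symbol ξ + D.m ^ 2 :=
  add_pos_of_nonneg_of_pos (D.symbol_nonneg ξ) (pow_pos D.m_pos 2)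

theorem propagator_pos (ξ : K) : 0 < D.propagator ξ := inv_pos.2 (D.symbol_add_pos ξ)

theorem continuous_propagator : Continuous D.propagator :=
  (D.continuous_symbol.add continuous_const).inv₀ fun ξ => (D.symbol_add_pos ξ).ne'

theorem propagator_neg (ξ : K) : D.propagator (-ξ) = D.propagator ξ := by
  rw [propagator, symbol_neg, propagator]

/-- The free covariance with momentum cutoff `q^κ`. -/
noncomputable def freeKern (κ : ℕ) (y : K) : ℝ := D.kern D.propagator (-(κ : ℤ)) y

theorem isStep_freeKern (κ : ℕ) : D.IsStep (-(κ : ℤ)) (D.freeKern κ) := D.isStep_kern _ _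

theorem freeKern_sub_comm (κ : ℕ) (x y : K) : D.freeKern κ (x - y) = D.freeKern κ (y - x) :=
  D.kern_sub_comm _ _ _ _

theorem isStep_comp_sub {j : ℤ} {E : Type*} {f : K → E} (hf : D.IsStep j f) (x : K) :
    D.IsStep j fun y => f (x - y) := by
  intro y y' h
  refine hf _ _ ?_
  rw [mem_ball, sub_sub_sub_cancel_left, absK_sub_comm]
  exact h

theorem kern_zero_eq (b : K → ℝ) (j : ℤ) : D.kern b j 0 = ∫ ξ in D.ball (-j) 0, b ξ ∂D.vol := by
  simp [kern]

theorem kern_propagator_zero_nonneg (j : ℤ) : 0 ≤ D.kern D.propagator j 0 := by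
  rw [kern_zero_eq]
  exact integral_nonneg fun ξ => (D.propagator_pos ξ).le

theorem freeKern_zero_nonneg (κ : ℕ) : 0 ≤ D.freeKern κ 0 := D.kern_propagator_zero_nonneg _

theorem separated_singleton (j : ℤ) (c : K) : D.Separated j {c} := by
  intro a ha b hb hab
  rw [Finset.mem_singleton] at ha hb
  exact absurd (ha.trans hb.symm) hab

theorem region_singleton (j : ℤ) (c : K) : D.region j {c} = D.ball j c := by simp [region]

theorem isStep_indicator_ball {E : Type*} [Zero E] (j : ℤ) (c : K) (s : E) :
    D.IsStep j ((D.ball j c).indicator fun _ => s) := by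
  intro x y hxy
  have h : x ∈ D.ball j c ↔ y ∈ D.ball j c :=
    ⟨fun h => D.mem_ball_trans (D.mem_ball_comm.1 hxy) h, fun h => D.mem_ball_trans hxy h⟩
  by_cases hy : y ∈ D.ball j c
  · rw [Set.indicator_of_mem hy, Set.indicator_of_mem (h.2 hy)]
  · rw [Set.indicator_of_notMem hy, Set.indicator_of_notMem (mt h.1 hy)]

theorem indicator_ball_of_notMem {E : Type*} [Zero E] {j : ℤ} {c x : K} (s : E)
    (hx : x ∉ D.region j {c}) : (D.ball j c).indicator (fun _ => s) x = 0 :=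
  Set.indicator_of_notMem (by rwa [region_singleton] at hx) _

theorem isStep_deltaFun (κ : ℕ) (x : K) : D.IsStep (-(κ : ℤ)) (D.deltaFun κ x) :=
  D.isStep_indicator_ball _ _ _

theorem multiplier_indicator {b : K → ℝ} (hb : Continuous b) (hb' : ∀ ξ, b (-ξ) = b ξ) (j : ℤ)
    (c : K) (s : ℝ) (x : K) :
    D.multiplier b (fun y => (((D.ball j c).indicator (fun _ => s) y : ℝ) : ℂ)) x =
      ((D.q ^ j * (s * D.kern b j (c - x)) : ℝ) : ℂ) := by
  have h := (D.isStep_indicator_ball j c s).multiplier_eq hb hb' (D.separated_singleton j c)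
    (fun x hx => D.indicator_ball_of_notMem s hx) x
  rw [Finset.sum_singleton, Set.indicator_of_mem (D.mem_ball_self j c)] at h
  exact h

/-- The free variance does not see the centre. The Wick polynomials are therefore the same function
at all sites and for both regions. -/
theorem freeVariance_indicator (j : ℤ) (c : K) (s : ℝ) :
    D.freeVariance ((D.ball j c).indicator fun _ => s) =
      D.q ^ j * s * (D.q ^ j * s) * D.kern D.propagator j 0 := by
  have h1 : ∀ x, (((D.ball j c).indicator (fun _ => s) x : ℝ) : ℂ) *
      D.multiplier D.propagator (fun y => (((D.ball j c).indicator (fun _ => s) y : ℝ) : ℂ)) x =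
      (((D.ball j c).indicator (fun _ => s) x * (D.q ^ j * (s * D.kern D.propagator j (c - x))) :
        ℝ) : ℂ) := fun x => by
    rw [D.multiplier_indicator D.continuous_propagator D.propagator_neg]
    push_cast
    ring
  rw [freeVariance]
  change (∫ x, _ * D.multiplier D.propagator
    (fun y => (((D.ball j c).indicator (fun _ => s) y : ℝ) : ℂ)) x ∂D.vol).re = _
  simp only [h1]
  rw [integral_complex_ofReal, Complex.ofReal_re,
    (D.isStep_indicator_ball j c s).integral_mul_step (D.separated_singleton j c)
      (fun x hx => D.indicator_ball_of_notMem s hx)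
      (((D.isStep_comp_sub (D.isStep_kern D.propagator j) c)).comp fun t => D.q ^ j * (s * t)),
    Finset.sum_singleton, Set.indicator_of_mem (D.mem_ball_self j c), sub_self]
  ring

theorem q_zpow_neg_mul (κ : ℕ) : D.q ^ (-(κ : ℤ)) * D.q ^ κ = 1 := by
  rw [← zpow_natCast, ← zpow_add₀ D.q_pos.ne', neg_add_cancel, zpow_zero]

theorem freeVariance_deltaFun (κ : ℕ) (x : K) :
    D.freeVariance (D.deltaFun κ x) = D.freeKern κ 0 := by
  rw [deltaFun, freeVariance_indicator, q_zpow_neg_mul, one_mul, one_mul, freeKern]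

theorem freeVariance_e_nonneg (l : ℤ) (c : K) : 0 ≤ D.freeVariance (D.e l c) := by
  rw [e, freeVariance_indicator]
  exact mul_nonneg (mul_self_nonneg _) (D.kern_propagator_zero_nonneg l)

/-- Integration against an approximate delta function. -/
theorem integral_deltaFun_mul {κ : ℕ} {F : K → ℝ} (hF : D.IsStep (-(κ : ℤ)) F) (x : K) :
    ∫ y, D.deltaFun κ x y * F y ∂D.vol = F x := by
  rw [(D.isStep_deltaFun κ x).integral_mul_step (D.separated_singleton _ x)
    (fun y hy => D.indicator_ball_of_notMem _ hy) hF, Finset.sum_singleton, deltaFun,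
    Set.indicator_of_mem (D.mem_ball_self _ x), ← mul_assoc, q_zpow_neg_mul, one_mul]

/-- The Fourier transform of `δ_κ` is the cutoff at `q^κ`, so smearing removes the higher momenta of
the finer kernel. The proof evaluates one multiplier on `δ_κ`, seen as a step function on each of
the two scales. -/
theorem integral_deltaFun_mul_freeKern {κ κ' : ℕ} (h : κ ≤ κ') (x y : K) :
    ∫ z, D.deltaFun κ x z * D.freeKern κ' (y - z) ∂D.vol = D.freeKern κ (y - x) := by
  have hle : -(κ' : ℤ) ≤ -(κ : ℤ) := by omega
  have hB : IsCompact (D.ball (-(κ : ℤ)) x) := D.isCompact_ball _ x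
  have hsep : D.Separated (-(κ' : ℤ)) (D.centers (-(κ' : ℤ)) (D.ball (-(κ : ℤ)) x)) :=
    separated_centers hB
  have hreg : D.region (-(κ' : ℤ)) (D.centers (-(κ' : ℤ)) (D.ball (-(κ : ℤ)) x)) =
      D.ball (-(κ : ℤ)) x :=
    region_centers hB fun z hz w hw => D.mem_ball_trans (D.ball_subset_ball hle z hw) hz
  have hs := (D.isStep_deltaFun κ x).mono hle
  have h0 : ∀ z, z ∉ D.region (-(κ' : ℤ)) (D.centers (-(κ' : ℤ)) (D.ball (-(κ : ℤ)) x)) →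
      D.deltaFun κ x z = 0 := fun z hz => by
    rw [hreg] at hz
    exact Set.indicator_of_notMem hz _
  have h1 := hs.multiplier_eq D.continuous_propagator D.propagator_neg hsep h0 y
  have h2 := D.multiplier_indicator D.continuous_propagator D.propagator_neg (-(κ : ℤ)) x
    (D.q ^ κ) y
  rw [hs.integral_mul_step hsep h0 (D.isStep_comp_sub (D.isStep_freeKern κ') y)]
  have h3 : D.q ^ (-(κ' : ℤ)) * ∑ c ∈ D.centers (-(κ' : ℤ)) (D.ball (-(κ : ℤ)) x),
      D.deltaFun κ x c * D.kern D.propagator (-(κ' : ℤ)) (c - y) =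
      D.q ^ (-(κ : ℤ)) * (D.q ^ κ * D.kern D.propagator (-(κ : ℤ)) (x - y)) := by
    exact_mod_cast h1.symm.trans h2
  rw [← mul_assoc, q_zpow_neg_mul, one_mul] at h3
  rw [freeKern_sub_comm, freeKern, ← h3]
  congr 1
  refine Finset.sum_congr rfl fun c _ => ?_
  rw [freeKern_sub_comm, freeKern]

/-- The momentum shell. -/
def shell (κ : ℕ) : Set K := D.ball ((κ + 1 : ℕ) : ℤ) 0 \ D.ball (κ : ℤ) 0

theorem measurableSet_shell (κ : ℕ) : MeasurableSet (D.shell κ) :=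
  (D.measurableSet_ball _ 0).diff (D.measurableSet_ball _ 0)

theorem ball_nat_subset_succ (κ : ℕ) : D.ball (κ : ℤ) 0 ⊆ D.ball ((κ + 1 : ℕ) : ℤ) 0 :=
  D.ball_subset_ball (by push_cast; omega) 0

theorem integral_shell {E : Type*} [NormedAddCommGroup E] [NormedSpace ℝ E] {F : K → E}
    (hF : Continuous F) (κ : ℕ) : ∫ ξ in D.shell κ, F ξ ∂D.vol =
      ∫ ξ in D.ball ((κ + 1 : ℕ) : ℤ) 0, F ξ ∂D.vol - ∫ ξ in D.ball (κ : ℤ) 0, F ξ ∂D.vol :=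
  setIntegral_sdiff (D.measurableSet_ball _ 0) (D.integrableOn_ball hF _ 0) (D.ball_nat_subset_succ κ)

/-- The variance of the regularized free field grows at most linearly in the cutoff exponent. -/
theorem exists_freeKern_zero_le : ∃ A : ℝ, 0 ≤ A ∧ ∀ κ : ℕ, D.freeKern κ 0 ≤ A * (1 + κ) := by
  obtain ⟨c, hc, hsym⟩ := D.exists_symbol_ge
  -- On the shell the propagator is at most `1 / (c q^(κ+1))` and the volume at most `q^(κ+1)`, so
  -- each shell adds at most `c⁻¹`.
  have hstep : ∀ κ : ℕ, D.freeKern (κ + 1) 0 - D.freeKern κ 0 ≤ c⁻¹ := by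
    intro κ
    have hq := zpow_pos D.q_pos ((κ + 1 : ℕ) : ℤ)
    rw [freeKern, freeKern, kern_zero_eq, kern_zero_eq, neg_neg, neg_neg,
      ← D.integral_shell D.continuous_propagator]
    have hb : ∀ ξ ∈ D.shell κ, ‖D.propagator ξ‖ ≤ (c * D.q ^ ((κ + 1 : ℕ) : ℤ))⁻¹ := by
      intro ξ hξ
      rw [Real.norm_of_nonneg (D.propagator_pos ξ).le, propagator]
      have h1 : D.q ^ ((κ + 1 : ℕ) : ℤ) ≤ absK p ξ := by
        have := hξ.2
        rw [mem_ball_zero, ← D.absK_lt_zpow_iff, not_lt] at this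
        exact_mod_cast this
      have h2 : 1 ≤ absK p ξ := by
        refine le_trans ?_ h1
        rw [zpow_natCast]
        exact one_le_pow₀ D.one_lt_q.le
      refine inv_anti₀ (by positivity) ?_
      have := hsym ξ h2
      nlinarith [sq_nonneg D.m]
    have h3 := norm_setIntegral_le_of_norm_le_const (μ := D.vol) (s := D.shell κ)
      ((measure_mono Set.sdiff_subset).trans_lt (D.isCompact_ball _ 0).measure_lt_top) hb
    refine (le_abs_self _).trans (h3.trans ?_)
    have h4 : D.vol.real (D.shell κ) ≤ D.q ^ ((κ + 1 : ℕ) : ℤ) := by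
      rw [← D.vol_real_ball _ 0]
      exact measureReal_mono Set.sdiff_subset (D.isCompact_ball _ 0).measure_lt_top.ne
    calc _ ≤ (c * D.q ^ ((κ + 1 : ℕ) : ℤ))⁻¹ * D.q ^ ((κ + 1 : ℕ) : ℤ) := by gcongr
      _ = c⁻¹ := by
        rw [mul_inv, mul_assoc, inv_mul_cancel₀ hq.ne', mul_one]
  have h0 := D.freeKern_zero_nonneg 0
  refine ⟨D.freeKern 0 0 + c⁻¹, by positivity, fun κ => ?_⟩
  induction κ with
  | zero =>
    have : 0 < c⁻¹ := inv_pos.2 hc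
    push_cast
    linarith
  | succ k ih =>
    have := hstep k
    push_cast
    linarith

/-- The response of the free field to the difference of two approximate delta functions. -/
noncomputable def shellKern (κ : ℕ) (y : K) : ℝ := D.freeKern (κ + 1) y - D.freeKern κ y

theorem isStep_shellKern (κ : ℕ) : D.IsStep (-((κ + 1 : ℕ) : ℤ)) (D.shellKern κ) := by
  intro x y hxy
  rw [shellKern, shellKern, D.isStep_freeKern (κ + 1) x y hxy,
    (D.isStep_freeKern κ).mono (j' := -((κ + 1 : ℕ) : ℤ)) (by push_cast; omega) x y hxy]

theorem ofReal_shellKern (κ : ℕ) (y : K) : (D.shellKern κ y : ℂ) =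
    ∫ ξ in D.shell κ, (D.propagator ξ : ℂ) * D.χ (ξ * y) ∂D.vol := by
  rw [D.integral_shell (F := fun ξ => (D.propagator ξ : ℂ) * D.χ (ξ * y))
    ((Complex.continuous_ofReal.comp D.continuous_propagator).mul (D.continuous_χ_mul_right y)),
    shellKern, Complex.ofReal_sub, freeKern, freeKern,
    D.ofReal_kern D.continuous_propagator D.propagator_neg,
    D.ofReal_kern D.continuous_propagator D.propagator_neg, neg_neg, neg_neg]

variable {D}

/-- `i` is a range such that the symbol is constant on the balls of relative radius `q^{-i}`. -/
def IsRange (D : PadicModel p K) (i : ℕ) : Prop :=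
  ∀ ξ η : K, ξ ≠ 0 → absK p η ≤ D.q ^ (-(i : ℤ)) * absK p ξ → D.symbol (ξ + η) = D.symbol ξ

theorem propagator_shell_add {i : ℕ} (hi : D.IsRange i) {κ : ℕ} {ξ η : K}
    (hξ : ξ ∈ D.shell κ) (hη : η ∈ D.ball ((κ : ℤ) - i) 0) :
    D.propagator (ξ + η) = D.propagator ξ := by
  have hξ0 : ξ ≠ 0 := by
    rintro rfl
    exact hξ.2 (D.mem_ball_self _ 0)
  rw [propagator, hi ξ η hξ0, propagator]
  rw [mem_ball_zero] at hη
  have h1 : D.q ^ (κ : ℤ) ≤ absK p ξ := by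
    have := hξ.2
    rw [mem_ball_zero, not_le] at this
    exact this.le
  refine hη.trans ?_
  rw [sub_eq_neg_add, zpow_add₀ D.q_pos.ne']
  have := zpow_pos D.q_pos (-(i : ℤ))
  gcongr

theorem add_mem_shell_iff {κ : ℕ} {ξ η : K} (hη : η ∈ D.ball (κ : ℤ) 0) :
    η + ξ ∈ D.shell κ ↔ ξ ∈ D.shell κ :=
  and_congr (D.add_mem_ball_zero_iff (D.ball_nat_subset_succ κ hη))
    (not_congr (D.add_mem_ball_zero_iff hη))

/-- The response is localized. -/
theorem shellKern_eq_zero {i : ℕ} (hi : D.IsRange i) {κ : ℕ} {y : K}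
    (hy : y ∉ D.ball (-((κ : ℤ) - i)) 0) : D.shellKern κ y = 0 := by
  obtain ⟨z, hz, hz1⟩ := D.χ_nontrivial
  obtain ⟨h0, hle⟩ := D.exists_absK_eq_inv_mul hy hz
  have hmem : z * y⁻¹ ∈ D.ball ((κ : ℤ) - i) 0 := by
    rw [mem_ball_zero, absK_mul, absK_inv, mul_comm]
    exact hle
  have hmem' : z * y⁻¹ ∈ D.ball (κ : ℤ) 0 := D.ball_subset_ball (by omega) 0 hmem
  set F : K → ℂ := (D.shell κ).indicator fun ξ => (D.propagator ξ : ℂ) * D.χ (ξ * y) with hF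
  -- The shift by `z y⁻¹` is small enough to preserve the shell and the propagator, but multiplies
  -- the character by `χ(z) ≠ 1`; hence the integral vanishes.
  have hadd : ∀ ξ, F (z * y⁻¹ + ξ) = D.χ z * F ξ := by
    intro ξ
    by_cases hξ : ξ ∈ D.shell κ
    · rw [hF, Set.indicator_of_mem hξ, Set.indicator_of_mem ((add_mem_shell_iff hmem').2 hξ),
        add_comm, propagator_shell_add hi hξ hmem, add_mul, χ_add, inv_mul_cancel_right₀ h0]
      ring
    · rw [hF, Set.indicator_of_notMem hξ,
        Set.indicator_of_notMem (mt (add_mem_shell_iff hmem').1 hξ), mul_zero]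
  have h1 : (D.shellKern κ y : ℂ) = ∫ ξ, F ξ ∂D.vol := by
    rw [ofReal_shellKern, hF, integral_indicator (D.measurableSet_shell κ)]
  have h2 : ∫ ξ, F ξ ∂D.vol = D.χ z * ∫ ξ, F ξ ∂D.vol := by
    conv_lhs => rw [← integral_add_left_eq_self F (z * y⁻¹)]
    simp only [hadd, integral_const_mul]
  have h3 : ((D.χ z : ℂ) - 1) * ∫ ξ, F ξ ∂D.vol = 0 := by
    rw [sub_mul, one_mul, ← h2, sub_self]
  rw [← h1] at h3
  have h4 := (mul_eq_zero.1 h3).resolve_left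
    (sub_ne_zero.2 fun h => hz1 (Circle.coe_eq_one.1 h))
  exact_mod_cast h4

theorem fourier_shellKern {i : ℕ} (hi : D.IsRange i) (κ : ℕ) (x : K) :
    D.fourier (fun y => (D.shellKern κ (x - y) : ℂ)) =
      (D.shell κ).indicator fun ξ => (D.propagator ξ : ℂ) * D.χ (ξ * x) := by
  set ψ : K → ℂ := (D.shell κ).indicator fun ξ => (D.propagator ξ : ℂ) * D.χ (ξ * x) with hψ
  obtain ⟨n, hn⟩ : ∃ n : ℕ, x ∈ D.ball n 0 := by
    have := D.iUnion_ball_zero ▸ Set.mem_univ x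
    exact Set.mem_iUnion.1 this
  -- The first bound makes the propagator constant on balls of radius `q^j`, the second the
  -- character `ξ ↦ χ(ξ x)`.
  set j : ℤ := min ((κ : ℤ) - i) (-n) with hj
  have hjκ : j ≤ (κ : ℤ) - i := min_le_left _ _
  have hjn : j ≤ -(n : ℤ) := min_le_right _ _
  have hs : D.IsStep j ψ := by
    intro ξ ξ' h
    have hη : ξ - ξ' ∈ D.ball j 0 := D.mem_ball_iff_sub.1 h
    have e1 : ξ = (ξ - ξ') + ξ' := (sub_add_cancel _ _).symm
    have hηκ : ξ - ξ' ∈ D.ball (κ : ℤ) 0 := D.ball_subset_ball (by omega) 0 hη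
    have hiff : ξ ∈ D.shell κ ↔ ξ' ∈ D.shell κ := by
      conv_lhs => rw [e1]
      exact add_mem_shell_iff hηκ
    by_cases hξ' : ξ' ∈ D.shell κ
    · rw [hψ, Set.indicator_of_mem hξ', Set.indicator_of_mem (hiff.2 hξ')]
      have h2 : D.propagator ξ = D.propagator ξ' := by
        rw [e1, add_comm]
        exact propagator_shell_add hi hξ' (D.ball_subset_ball hjκ 0 hη)
      have h3 : D.χ ((ξ - ξ') * x) = 1 :=
        D.χ_mul_eq_one (l := -(n : ℤ)) (D.ball_subset_ball hjn 0 hη) (by rwa [neg_neg])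
      have h4 : (D.χ (ξ * x) : ℂ) = D.χ (ξ' * x) := by
        conv_lhs => rw [e1]
        rw [add_mul, χ_add, h3, Circle.coe_one, one_mul]
      rw [h2, h4]
    · rw [hψ, Set.indicator_of_notMem hξ', Set.indicator_of_notMem (mt hiff.1 hξ')]
  have hB := D.isCompact_ball ((κ + 1 : ℕ) : ℤ) 0
  have hreg : D.region j (D.centers j (D.ball ((κ + 1 : ℕ) : ℤ) 0)) =
      D.ball ((κ + 1 : ℕ) : ℤ) 0 :=
    region_centers hB fun z hz w hw =>
      D.mem_ball_trans (D.ball_subset_ball (by push_cast; omega) z hw) hz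
  have h0 : ∀ ξ, ξ ∉ D.region j (D.centers j (D.ball ((κ + 1 : ℕ) : ℤ) 0)) → ψ ξ = 0 := by
    intro ξ hξ
    rw [hreg] at hξ
    exact Set.indicator_of_notMem (fun h => hξ h.1) _
  rw [← hs.fourier_inversion (separated_centers hB) h0]
  congr 1
  ext y
  rw [ofReal_shellKern, ← integral_indicator (D.measurableSet_shell κ)]
  refine integral_congr_ae (Eventually.of_forall fun ξ => ?_)
  simp only [hψ]
  by_cases hξ : ξ ∈ D.shell κ
  · rw [Set.indicator_of_mem hξ, Set.indicator_of_mem hξ, conj_χ, mul_sub, sub_eq_add_neg, χ_add]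
    ring
  · rw [Set.indicator_of_notMem hξ, Set.indicator_of_notMem hξ, mul_zero]

theorem integral_shell_χ (κ : ℕ) (x y : K) :
    ∫ ξ in D.shell κ, (D.χ (ξ * (x - y)) : ℂ) ∂D.vol =
      ((D.deltaFun (κ + 1) x y - D.deltaFun κ x y : ℝ) : ℂ) := by
  have h1 : ∀ k : ℕ, ∫ ξ in D.ball (k : ℤ) 0, (D.χ (ξ * (x - y)) : ℂ) ∂D.vol =
      (D.deltaFun k x y : ℂ) := by
    intro k
    have hiff : x - y ∈ D.ball (-(k : ℤ)) 0 ↔ y ∈ D.ball (-(k : ℤ)) x := by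
      rw [← D.mem_ball_iff_sub, D.mem_ball_comm]
    rw [integral_χ_ball', deltaFun]
    by_cases h : y ∈ D.ball (-(k : ℤ)) x
    · rw [Set.indicator_of_mem h, Set.indicator_of_mem (hiff.2 h), zpow_natCast]
    · rw [Set.indicator_of_notMem h, Set.indicator_of_notMem (mt hiff.1 h), Complex.ofReal_zero]
  rw [D.integral_shell (D.continuous_χ_mul_right _), h1, h1, Complex.ofReal_sub]

/-- In Fourier space `a + m²` cancels the propagator and leaves the indicator of the shell, the
transform of a difference of two approximate deltas. -/
theorem opA_shellKern {i : ℕ} (hi : D.IsRange i) (κ : ℕ) (x y : K) :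
    D.opA (fun y => (D.shellKern κ (x - y) : ℂ)) y + (D.m : ℂ) ^ 2 * (D.shellKern κ (x - y) : ℂ) =
      ((D.deltaFun (κ + 1) x y - D.deltaFun κ x y : ℝ) : ℂ) := by
  have h1 : D.opA (fun y => (D.shellKern κ (x - y) : ℂ)) y =
      ∫ ξ in D.shell κ, ((D.symbol ξ * D.propagator ξ : ℝ) : ℂ) * D.χ (ξ * (x - y)) ∂D.vol := by
    rw [opA, multiplier, fourier_shellKern hi, ← integral_indicator (D.measurableSet_shell κ)]
    refine integral_congr_ae (Eventually.of_forall fun ξ => ?_)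
    simp only
    by_cases hξ : ξ ∈ D.shell κ
    · rw [Set.indicator_of_mem hξ, Set.indicator_of_mem hξ, conj_χ, mul_sub, sub_eq_add_neg, χ_add]
      push_cast
      ring
    · rw [Set.indicator_of_notMem hξ, Set.indicator_of_notMem hξ, mul_zero, mul_zero]
  have hint : ∀ b : K → ℝ, Continuous b → IntegrableOn
      (fun ξ => (b ξ : ℂ) * D.χ (ξ * (x - y))) (D.shell κ) D.vol := fun b hb =>
    (D.integrableOn_ball ((Complex.continuous_ofReal.comp hb).mul
      (D.continuous_χ_mul_right _)) _ _).mono_set Set.sdiff_subset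
  rw [h1, ofReal_shellKern, ← integral_const_mul, ← integral_add
    (hint (fun ξ => D.symbol ξ * D.propagator ξ)
      (D.continuous_symbol.mul D.continuous_propagator))
    ((hint _ D.continuous_propagator).const_mul _), ← integral_shell_χ]
  refine integral_congr_ae (Eventually.of_forall fun ξ => ?_)
  simp only
  have h2 : ((D.symbol ξ * D.propagator ξ : ℝ) : ℂ) + (D.m : ℂ) ^ 2 * (D.propagator ξ : ℂ) = 1 := by
    have : D.symbol ξ * D.propagator ξ + D.m ^ 2 * D.propagator ξ = 1 := by
      rw [← add_mul, propagator, mul_inv_cancel₀ (D.symbol_add_pos ξ).ne']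
    exact_mod_cast this
  rw [← mul_assoc, ← add_mul, h2, one_mul]

/-- For `κ` this large, the ball of radius `q^{i-κ}` about `x` containing the free response lies
inside the region. The solution on all of `K` is then already a test function on the region, hence
the Dirichlet solution. -/
theorem resolvent_delta_sub {i : ℕ} (hi : D.IsRange i) {l : ℤ} {C : Finset K}
    {κ : ℕ} (hκ : (i : ℤ) - l ≤ κ) {x : K} (hx : x ∈ D.region l C) :
    D.resolvent (D.region l C) (fun y => D.deltaFun (κ + 1) x y - D.deltaFun κ x y) =
      fun y => D.shellKern κ (x - y) := by
  refine resolvent_eq ?_ fun y _ => opA_shellKern hi κ x y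
  refine IsStep.mem_testFun (D.isStep_comp_sub (D.isStep_shellKern κ) x) fun y hy => ?_
  refine shellKern_eq_zero hi fun h => hy (ball_subset_region (j' := -((κ : ℤ) - i)) (by omega) hx ?_)
  rw [D.mem_ball_comm, D.mem_ball_iff_sub]
  exact h

end Covariance

end PadicModel

/-! ### The Dirichlet covariance and its dependence on the cutoff -/

namespace PadicModel

section Green

variable {p : ℕ} [Fact p.Prime] {K : Type*} [DivisionRing K] [Algebra ℚ_[p] K]
  [FiniteDimensional ℚ_[p] K] [TopologicalSpace K] [T2Space K] [IsTopologicalAddGroup K]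
  [ContinuousSMul ℚ_[p] K] [MeasurableSpace K] [BorelSpace K]
  [LocallyCompactSpace K] [SecondCountableTopology K] [ContinuousMul K]
  [TopologicalSpace.MetrizableSpace K] [DecidableEq K] {D : PadicModel p K}

theorem IsStep.add {j : ℤ} {f g : K → ℝ} (hf : D.IsStep j f) (hg : D.IsStep j g) :
    D.IsStep j (f + g) := fun x y h => by
  rw [Pi.add_apply, Pi.add_apply, hf x y h, hg x y h]

theorem IsStep.smul {j : ℤ} {f : K → ℝ} (hf : D.IsStep j f) (a : ℝ) :
    D.IsStep j (a • f) := fun x y h => by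
  rw [Pi.smul_apply, Pi.smul_apply, hf x y h]

variable (D) in
theorem region_centers_region {l j : ℤ} (hj : j ≤ l) (C : Finset K) :
    D.region j (D.centers j (D.region l C)) = D.region l C :=
  region_centers (D.isCompact_region l C) fun _ hx => ball_subset_region hj hx

variable (D) in
theorem separated_centers_region (l j : ℤ) (C : Finset K) :
    D.Separated j (D.centers j (D.region l C)) := separated_centers (D.isCompact_region l C)

theorem exists_common_scale {l : ℤ} {C : Finset K} {ι : Type*} [Finite ι]
    (f : ι → TestFun (D.region l C)) : ∃ j ≤ l, ∀ i, D.IsStep j (f i : K → ℝ) := by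
  have := Fintype.ofFinite ι
  choose j hj hs using fun i => exists_isStep_le (D := D) (D.isCompact_region l C) (f i).2.1
    (f i).2.2 l
  obtain ⟨M, hM⟩ := (Set.finite_range j).bddBelow
  exact ⟨min l M, min_le_left _ _, fun i => (hs i).mono ((min_le_right _ _).trans
    (hM ⟨i, rfl⟩))⟩

theorem greenForm_eq_centers {l j : ℤ} (hj : j ≤ l) {C : Finset K}
    {f g : K → ℝ} (hf : D.IsStep j f) (h0 : ∀ x, x ∉ D.region l C → f x = 0)
    (hg : D.IsStep j g) : D.greenForm (D.region l C) f g =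
      D.q ^ j * ∑ c : D.centers j (D.region l C), ∑ d : D.centers j (D.region l C),
        f c * (D.precision j (D.centers j (D.region l C)))⁻¹ c d * g d := by
  have h := hf.greenForm_eq (D.separated_centers_region l j C)
    (by rw [region_centers_region D hj]; exact h0) hg
  rw [region_centers_region D hj] at h
  exact h

/-- The covariance of the Dirichlet field as a bilinear form on test functions. -/
noncomputable def greenBilin (D : PadicModel p K) (l : ℤ) (C : Finset K) :
    LinearMap.BilinForm ℝ (TestFun (D.region l C)) :=
  LinearMap.mk₂ ℝ (fun f g => D.greenForm (D.region l C) f g)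
    -- Linearity is read off on a common scale, where the Green form is a matrix expression; nothing
    -- need be known about the resolvent as a choice.
    (fun f f' g => by
      obtain ⟨j, hj, hs⟩ := exists_common_scale ![f, f', g]
      have h1 : D.IsStep j (f : K → ℝ) := hs 0
      have h2 : D.IsStep j (f' : K → ℝ) := hs 1
      have h3 : D.IsStep j (g : K → ℝ) := hs 2
      rw [greenForm_eq_centers hj h1 f.2.2 h3, greenForm_eq_centers hj h2 f'.2.2 h3,
        greenForm_eq_centers hj (f := ((f + f' : TestFun _) : K → ℝ)) (h1.add h2) (f + f').2.2 h3,
        ← mul_add]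
      simp only [← Finset.sum_add_distrib, Submodule.coe_add, Pi.add_apply, add_mul])
    (fun a f g => by
      obtain ⟨j, hj, hs⟩ := exists_common_scale ![f, g]
      have h1 : D.IsStep j (f : K → ℝ) := hs 0
      have h3 : D.IsStep j (g : K → ℝ) := hs 1
      rw [greenForm_eq_centers hj h1 f.2.2 h3,
        greenForm_eq_centers hj (f := ((a • f : TestFun _) : K → ℝ)) (h1.smul a) (a • f).2.2 h3,
        smul_eq_mul, mul_left_comm]
      simp only [Finset.mul_sum, Submodule.coe_smul, Pi.smul_apply, smul_eq_mul, mul_assoc])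
    (fun f g g' => by
      obtain ⟨j, hj, hs⟩ := exists_common_scale ![f, g, g']
      have h1 : D.IsStep j (f : K → ℝ) := hs 0
      have h2 : D.IsStep j (g : K → ℝ) := hs 1
      have h3 : D.IsStep j (g' : K → ℝ) := hs 2
      rw [greenForm_eq_centers hj h1 f.2.2 h2, greenForm_eq_centers hj h1 f.2.2 h3,
        greenForm_eq_centers hj (g := ((g + g' : TestFun _) : K → ℝ)) h1 f.2.2 (h2.add h3),
        ← mul_add]
      simp only [← Finset.sum_add_distrib, Submodule.coe_add, Pi.add_apply, mul_add])
    (fun a f g => by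
      obtain ⟨j, hj, hs⟩ := exists_common_scale ![f, g]
      have h1 : D.IsStep j (f : K → ℝ) := hs 0
      have h3 : D.IsStep j (g : K → ℝ) := hs 1
      rw [greenForm_eq_centers hj h1 f.2.2 h3,
        greenForm_eq_centers hj (g := ((a • g : TestFun _) : K → ℝ)) h1 f.2.2 (h3.smul a),
        smul_eq_mul, mul_left_comm]
      simp only [Finset.mul_sum, Submodule.coe_smul, Pi.smul_apply, smul_eq_mul, mul_assoc,
        mul_left_comm])

theorem greenBilin_apply (l : ℤ) (C : Finset K) (f g : TestFun (D.region l C)) :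
    D.greenBilin l C f g = D.greenForm (D.region l C) f g := rfl

theorem greenBilin_comm (l : ℤ) (C : Finset K) (f g : TestFun (D.region l C)) :
    D.greenBilin l C f g = D.greenBilin l C g f := by
  obtain ⟨j, hj, hs⟩ := exists_common_scale ![f, g]
  have h1 : D.IsStep j (f : K → ℝ) := hs 0
  have h2 : D.IsStep j (g : K → ℝ) := hs 1
  rw [greenBilin_apply, greenBilin_apply, greenForm_eq_centers hj h1 f.2.2 h2,
    greenForm_eq_centers hj h2 g.2.2 h1, Finset.sum_comm]
  congr 1
  refine Finset.sum_congr rfl fun c _ => Finset.sum_congr rfl fun d _ => ?_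
  have h3 := (D.posDef_precision j (D.centers j (D.region l C))).inv.isHermitian.apply c d
  rw [star_trivial] at h3
  rw [h3]
  ring

theorem greenBilin_self_pos (l : ℤ) (C : Finset K) {f : TestFun (D.region l C)} (hf : f ≠ 0) :
    0 < D.greenBilin l C f f := by
  obtain ⟨j, hj, hs⟩ := exists_common_scale ![f]
  have h1 : D.IsStep j (f : K → ℝ) := hs 0
  rw [greenBilin_apply, greenForm_eq_centers hj h1 f.2.2 h1]
  refine mul_pos (zpow_pos D.q_pos j) ?_
  set E := D.centers j (D.region l C)
  have hne : (fun c : E => (f : K → ℝ) c) ≠ 0 := by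
    intro h
    refine hf (Subtype.ext ?_)
    refine h1.eq_of_centers (g := 0) (fun _ _ _ => rfl) (C := E) ?_ (fun _ _ => rfl)
      fun c hc => congrFun h ⟨c, hc⟩
    rw [region_centers_region D hj]
    exact f.2.2
  have h2 := (D.posDef_precision j E).inv.dotProduct_mulVec_pos hne
  simp only [star_trivial, dotProduct, Matrix.mulVec, Finset.mul_sum] at h2
  simpa only [mul_assoc] using h2

theorem greenBilin_self_nonneg (l : ℤ) (C : Finset K) (f : TestFun (D.region l C)) :
    0 ≤ D.greenBilin l C f f := by
  by_cases hf : f = 0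
  · simp [hf]
  · exact (greenBilin_self_pos l C hf).le

theorem deltaFun_mem {κ : ℕ} {l : ℤ} (hκ : -(κ : ℤ) ≤ l) {C : Finset K} {x : K}
    (hx : x ∈ D.region l C) : D.deltaFun κ x ∈ TestFun (D.region l C) :=
  (D.isStep_deltaFun κ x).mem_testFun fun _ hy =>
    Set.indicator_of_notMem (fun h => hy (ball_subset_region hκ hx h)) _

theorem deltaFun_of_mem {κ : ℕ} {x y : K} (h : x ∈ D.ball (-(κ : ℤ)) y) :
    D.deltaFun κ x = D.deltaFun κ y := by
  rw [deltaFun, deltaFun, D.ball_eq_of_mem h]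

theorem integrable_deltaFun_mul (κ : ℕ) (x : K) {F : K → ℝ} (hF : Continuous F) :
    Integrable (fun y => D.deltaFun κ x y * F y) D.vol := by
  have h : (fun y => D.deltaFun κ x y * F y) =
      (D.ball (-(κ : ℤ)) x).indicator fun y => D.q ^ κ * F y := by
    ext y
    by_cases hy : y ∈ D.ball (-(κ : ℤ)) x
    · rw [deltaFun, Set.indicator_of_mem hy, Set.indicator_of_mem hy]
    · rw [deltaFun, Set.indicator_of_notMem hy, Set.indicator_of_notMem hy, zero_mul]
  rw [h]
  exact (D.integrableOn_ball (continuous_const.mul hF) _ _).integrable_indicator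
    (D.measurableSet_ball _ _)

variable {i : ℕ} (hi : D.IsRange i) {l : ℤ} {C : Finset K}
include hi

theorem greenForm_delta_sub {κ : ℕ} (hκ : (i : ℤ) - l ≤ κ) {x : K} (hx : x ∈ D.region l C)
    {f : K → ℝ} (hf : f ∈ TestFun (D.region l C)) :
    D.greenForm (D.region l C) f (D.deltaFun (κ + 1) x) -
      D.greenForm (D.region l C) f (D.deltaFun κ x) = ∫ y, f y * D.shellKern κ (x - y) ∂D.vol := by
  have h1 := deltaFun_mem (D := D) (κ := κ + 1) (by push_cast; omega) hx
  have h2 := deltaFun_mem (D := D) (κ := κ) (by omega) hx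
  have h3 := ((D.greenBilin l C) ⟨f, hf⟩).map_sub ⟨_, h1⟩ ⟨_, h2⟩
  rw [greenBilin_apply, greenBilin_apply, greenBilin_apply] at h3
  rw [← h3, greenForm]
  have h4 := resolvent_delta_sub hi hκ hx
  have h5 : (((⟨_, h1⟩ : TestFun (D.region l C)) - ⟨_, h2⟩ : TestFun (D.region l C)) : K → ℝ) =
      fun y => D.deltaFun (κ + 1) x y - D.deltaFun κ x y := rfl
  rw [h5, h4]

/-- By symmetry the change of the Dirichlet variance is the sum of the pairings of the response with
`δ_{κ+1}` and with `δ_κ`. The first is the change of the free variance; the second vanishes, because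
the response has no momenta below the shell. -/
theorem greenForm_delta_succ {κ : ℕ} (hκ : (i : ℤ) - l ≤ κ) {x : K} (hx : x ∈ D.region l C) :
    D.greenForm (D.region l C) (D.deltaFun (κ + 1) x) (D.deltaFun (κ + 1) x) - D.freeKern (κ + 1) 0 =
      D.greenForm (D.region l C) (D.deltaFun κ x) (D.deltaFun κ x) - D.freeKern κ 0 := by
  have h1 := deltaFun_mem (D := D) (κ := κ + 1) (by push_cast; omega) hx
  have h2 := deltaFun_mem (D := D) (κ := κ) (by omega) hx
  have h3 := greenForm_delta_sub hi hκ hx h1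
  have h4 := greenForm_delta_sub hi hκ hx h2
  have h5 := greenBilin_comm l C ⟨_, h1⟩ ⟨_, h2⟩
  rw [greenBilin_apply, greenBilin_apply] at h5
  have h6 : ∫ y, D.deltaFun (κ + 1) x y * D.shellKern κ (x - y) ∂D.vol =
      D.freeKern (κ + 1) 0 - D.freeKern κ 0 := by
    rw [D.integral_deltaFun_mul (D.isStep_comp_sub (D.isStep_shellKern κ) x), sub_self, shellKern]
  have hc : ∀ k, Continuous fun y => D.freeKern k (x - y) := fun k =>
    (D.isStep_comp_sub (D.isStep_freeKern k) x).isLocallyConstant.continuous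
  have h7 : ∫ y, D.deltaFun κ x y * D.shellKern κ (x - y) ∂D.vol = 0 := by
    simp only [shellKern, mul_sub]
    rw [integral_sub (integrable_deltaFun_mul κ x (hc _)) (integrable_deltaFun_mul κ x (hc _)),
      D.integral_deltaFun_mul_freeKern (Nat.le_succ κ), D.integral_deltaFun_mul_freeKern le_rfl,
      sub_self]
  simp only at h5
  linarith

/-- The difference of the Dirichlet and the free variances does not depend on the cutoff. -/
theorem greenForm_delta_self {κ₀ κ : ℕ} (hκ₀ : (i : ℤ) - l ≤ κ₀) (hκ : κ₀ ≤ κ) {x : K}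
    (hx : x ∈ D.region l C) :
    D.greenForm (D.region l C) (D.deltaFun κ x) (D.deltaFun κ x) - D.freeKern κ 0 =
      D.greenForm (D.region l C) (D.deltaFun κ₀ x) (D.deltaFun κ₀ x) - D.freeKern κ₀ 0 := by
  induction κ, hκ using Nat.le_induction with
  | base => rfl
  | succ k hk ih => rw [greenForm_delta_succ hi (by omega) hx, ih]

/-- The covariances at separated points do not depend on the cutoff. -/
theorem greenForm_delta_of_notMem {κ κ' : ℕ} (hκ : (i : ℤ) - l ≤ κ) (hκ' : κ ≤ κ') {x y : K}
    (hx : x ∈ D.region l C) (hy : y ∈ D.region l C) (hxy : y ∉ D.ball (-((κ : ℤ) - i)) x) :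
    D.greenForm (D.region l C) (D.deltaFun κ' y) (D.deltaFun (κ + 1) x) =
      D.greenForm (D.region l C) (D.deltaFun κ' y) (D.deltaFun κ x) := by
  have h1 := deltaFun_mem (D := D) (κ := κ') (by omega) hy
  have h2 := greenForm_delta_sub hi hκ hx h1
  have h3 : ∫ z, D.deltaFun κ' y z * D.shellKern κ (x - z) ∂D.vol = 0 := by
    -- The supports of `δ_κ'` about `y` and of the response about `x` are disjoint.
    refine integral_eq_zero_of_ae (Eventually.of_forall fun z => ?_)
    by_cases hz : z ∈ D.ball (-(κ' : ℤ)) y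
    · simp only [Pi.zero_apply]
      rw [shellKern_eq_zero hi, mul_zero]
      intro h
      rw [← D.mem_ball_iff_sub, D.mem_ball_comm] at h
      exact hxy (D.mem_ball_trans (D.ball_subset_ball (by omega) z (D.mem_ball_comm.1 hz)) h)
    · simp only [Pi.zero_apply]
      rw [deltaFun, Set.indicator_of_notMem hz, zero_mul]
  linarith

end Green

/-! ### Finite-dimensional distributions of the Dirichlet field -/

section Field

variable {p : ℕ} [Fact p.Prime] {K : Type*} [DivisionRing K] [Algebra ℚ_[p] K]
  [FiniteDimensional ℚ_[p] K] [TopologicalSpace K] [T2Space K] [IsTopologicalAddGroup K]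
  [ContinuousSMul ℚ_[p] K] [MeasurableSpace K] [BorelSpace K]
  [LocallyCompactSpace K] [SecondCountableTopology K] [ContinuousMul K]
  [TopologicalSpace.MetrizableSpace K] [DecidableEq K] {D : PadicModel p K}

theorem _root_.Distr.measurable_apply {U : Set K} (f : TestFun U) :
    Measurable fun φ : Distr U => φ f :=
  Measurable.of_comap_le (le_iSup (fun f : TestFun U =>
    MeasurableSpace.comap (fun φ : Distr U => φ f) inferInstance) f)

theorem _root_.Distr.eval_of_mem {U : Set K} (φ : Distr U) {f : K → ℝ} (hf : f ∈ TestFun U) :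
    φ.eval f = φ ⟨f, hf⟩ := dif_pos hf

theorem _root_.Distr.measurable_eval {U : Set K} (f : K → ℝ) :
    Measurable fun φ : Distr U => φ.eval f := by
  by_cases hf : f ∈ TestFun U
  · simp only [Distr.eval_of_mem _ hf]
    exact Distr.measurable_apply _
  · simp only [Distr.eval, dif_neg hf]
    exact measurable_const

/-- The values of the Dirichlet field on finitely many test functions are jointly Gaussian. -/
theorem IsDirichletField.isGaussianFamily {l : ℤ} {C : Finset K}
    {ν : Measure (Distr (D.region l C))} (hν : D.IsDirichletField (D.region l C) ν) {ι : Type*}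
    [Fintype ι] [DecidableEq ι] (F : ι → K → ℝ) (hF : ∀ i, F i ∈ TestFun (D.region l C)) :
    IsGaussianFamily ν (fun i (φ : Distr (D.region l C)) => φ.eval (F i))
      (Matrix.of fun i k => D.greenForm (D.region l C) (F i) (F k)) := by
  set F' : ι → TestFun (D.region l C) := fun i => ⟨F i, hF i⟩ with hF'
  have hquad : ∀ t : ι → ℝ, t ⬝ᵥ (Matrix.of fun i k => D.greenForm (D.region l C)
      (F i) (F k)).mulVec t = D.greenBilin l C (∑ i, t i • F' i) (∑ i, t i • F' i) := by
    intro t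
    simp only [map_sum, LinearMap.sum_apply, map_smul, LinearMap.smul_apply, smul_eq_mul,
      greenBilin_apply, dotProduct, Matrix.mulVec, Matrix.of_apply, Finset.mul_sum]
    rw [Finset.sum_comm]
    exact Finset.sum_congr rfl fun i _ => Finset.sum_congr rfl fun k _ => by ring
  refine ⟨fun i => Distr.measurable_eval _, ?_, fun t => ?_⟩
  · refine Matrix.PosSemidef.of_dotProduct_mulVec_nonneg ?_ fun t => ?_
    · ext i k
      rw [Matrix.conjTranspose_apply, star_trivial, Matrix.of_apply, Matrix.of_apply]
      exact greenBilin_comm l C (F' k) (F' i)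
    · rw [star_trivial, hquad]
      exact greenBilin_self_nonneg l C _
  · rw [hquad, greenBilin_apply, ← hν.2]
    congr 1
    ext φ
    simp only [map_sum, map_smul, smul_eq_mul, Distr.eval_of_mem _ (hF _)]
    rfl

end Field

end PadicModel

/-! ### Integrability and marginals of Gaussian measures -/

section Gaussian

variable {ι : Type*} [Fintype ι] [DecidableEq ι]

theorem integrable_exp_norm_multivariateGaussian (G : Matrix ι ι ℝ) (A M : ℝ) :
    Integrable (fun t : EuclideanSpace ℝ ι => A * Real.exp (M * ‖t‖)) (multivariateGaussian 0 G) := by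
  obtain ⟨c, hc, hint⟩ := IsGaussian.exists_integrable_exp_sq (multivariateGaussian (0 :
    EuclideanSpace ℝ ι) G)
  refine Integrable.const_mul ?_ A
  refine (hint.const_mul (Real.exp (M ^ 2 / (4 * c)))).mono' (by fun_prop)
    (Eventually.of_forall fun t => ?_)
  rw [Real.norm_of_nonneg (Real.exp_pos _).le, ← Real.exp_add, Real.exp_le_exp]
  have h : M ^ 2 / (4 * c) + c * ‖t‖ ^ 2 - M * ‖t‖ = (M - 2 * c * ‖t‖) ^ 2 / (4 * c) := by
    field_simp
    ring
  have h2 : 0 ≤ (M - 2 * c * ‖t‖) ^ 2 / (4 * c) := by positivity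
  linarith

theorem abs_sum_mul_le_norm (f : ι → ℝ) (t : EuclideanSpace ℝ ι) :
    |∑ i, f i * t i| ≤ (∑ i, |f i|) * ‖t‖ := by
  rw [Finset.sum_mul]
  refine (Finset.abs_sum_le_sum_abs _ _).trans (Finset.sum_le_sum fun i _ => ?_)
  rw [abs_mul]
  exact mul_le_mul_of_nonneg_left (PiLp.norm_apply_le t i) (abs_nonneg _)

/-- Polynomially bounded functions of the field times the weight are integrable. -/
theorem integrable_prod_mul_spinWeight (G : Matrix ι ι ℝ) {V : ι → ℝ → ℝ} {h : ι → ℝ}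
    (hVc : ∀ i, Continuous (V i)) {b : ℝ} (hVb : ∀ i x, -b ≤ V i x) {r : ℕ}
    (f : Fin r → ι → ℝ) :
    Integrable (fun t : EuclideanSpace ℝ ι => (∏ k, ∑ i, f k i * t i) * spinWeight V h t.ofLp)
      (multivariateGaussian 0 G) := by
  have hcont := continuous_spinWeight (h := h) hVc
  refine (integrable_exp_norm_multivariateGaussian G (Real.exp (Fintype.card ι * b))
    ((∑ k, ∑ i, |f k i|) + ∑ i, |h i|)).mono' ?_ (Eventually.of_forall fun t => ?_)
  · refine Continuous.aestronglyMeasurable ?_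
    fun_prop
  rw [norm_mul, norm_prod, spinWeight, Real.norm_of_nonneg (Real.exp_pos _).le]
  have h1 : ∏ k, ‖∑ i, f k i * t i‖ ≤ Real.exp ((∑ k, ∑ i, |f k i|) * ‖t‖) := by
    rw [Finset.sum_mul, Real.exp_sum]
    refine Finset.prod_le_prod (fun k _ => norm_nonneg _) fun k _ => ?_
    refine (abs_sum_mul_le_norm (f k) t).trans ?_
    have := Real.add_one_le_exp ((∑ i, |f k i|) * ‖t‖)
    linarith
  have h2 : -∑ i, (V i (t i) - h i * t i) ≤ Fintype.card ι * b + (∑ i, |h i|) * ‖t‖ := by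
    rw [Finset.sum_sub_distrib]
    have h3 := (le_abs_self _).trans (abs_sum_mul_le_norm h t)
    have h4 : ∑ _i : ι, -b ≤ ∑ i, V i (t i) := Finset.sum_le_sum fun i _ => hVb i _
    rw [Finset.sum_const, Finset.card_univ, nsmul_eq_mul] at h4
    linarith
  calc _ ≤ Real.exp ((∑ k, ∑ i, |f k i|) * ‖t‖) *
        Real.exp (Fintype.card ι * b + (∑ i, |h i|) * ‖t‖) := by
        refine mul_le_mul h1 (Real.exp_le_exp.2 h2) (Real.exp_pos _).le (Real.exp_pos _).le
    _ = _ := by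
      rw [← Real.exp_add, ← Real.exp_add]
      congr 1
      ring

theorem integrable_spinWeight (G : Matrix ι ι ℝ) {V : ι → ℝ → ℝ} {h : ι → ℝ}
    (hVc : ∀ i, Continuous (V i)) {b : ℝ} (hVb : ∀ i x, -b ≤ V i x) :
    Integrable (fun t : EuclideanSpace ℝ ι => spinWeight V h t.ofLp)
      (multivariateGaussian 0 G) := by
  simpa using integrable_prod_mul_spinWeight G hVc hVb (fun k : Fin 0 => k.elim0) (h := h)

theorem integral_spinWeight_pos (G : Matrix ι ι ℝ) {V : ι → ℝ → ℝ} {h : ι → ℝ}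
    (hVc : ∀ i, Continuous (V i)) {b : ℝ} (hVb : ∀ i x, -b ≤ V i x) :
    0 < ∫ t : EuclideanSpace ℝ ι, spinWeight V h t.ofLp ∂multivariateGaussian 0 G :=
  integral_exp_pos (integrable_spinWeight G hVc hVb)

variable {κ : Type*} [Fintype κ] [DecidableEq κ]

theorem sum_extend_mul {e : κ → ι} (he : Function.Injective e) (v : κ → ℝ) (x : ι → ℝ) :
    ∑ i, Function.extend e v (0 : ι → ℝ) i * x i = ∑ k, v k * x (e k) := by
  symm
  refine Fintype.sum_of_injective e he _ _ (fun i hi => ?_) fun k => ?_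
  · rw [Function.extend_apply' v (0 : ι → ℝ) i (by simpa using hi), Pi.zero_apply, zero_mul]
  · rw [he.extend_apply]

/-- If a block of coordinates decouples, its marginal is given by the corresponding block of the
precision matrix. -/
theorem isGaussianFamily_of_decoupled {B : Matrix ι ι ℝ} (hB : B.PosDef) {A : Matrix κ κ ℝ}
    (hA : A.PosDef) {e : κ → ι} (he : Function.Injective e)
    (h : ∀ v : κ → ℝ, B.mulVec (Function.extend e v (0 : ι → ℝ)) = Function.extend e (A.mulVec v) (0 : ι → ℝ)) :
    IsGaussianFamily (multivariateGaussian 0 B⁻¹) (fun k (t : EuclideanSpace ℝ ι) => t (e k))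
      A⁻¹ := by
  refine ⟨fun k => by fun_prop, hA.inv.posSemidef, fun t => ?_⟩
  have hA' : IsUnit A.det := (Matrix.isUnit_iff_isUnit_det _).1 hA.isUnit
  have hB' : IsUnit B.det := (Matrix.isUnit_iff_isUnit_det _).1 hB.isUnit
  -- Extension by zero intertwines `A` with `B`, hence also their inverses, which are the
  -- covariances.
  have h1 : B⁻¹.mulVec (Function.extend e t (0 : ι → ℝ)) = Function.extend e (A⁻¹.mulVec t) (0 : ι → ℝ) := by
    have h2 := h (A⁻¹.mulVec t)
    rw [Matrix.mulVec_mulVec, Matrix.mul_nonsing_inv _ hA', Matrix.one_mulVec] at h2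
    rw [← h2, Matrix.mulVec_mulVec, Matrix.nonsing_inv_mul _ hB', Matrix.one_mulVec]
  have h3 := charFun_multivariateGaussian (μ := (0 : EuclideanSpace ℝ ι)) hB.inv.posSemidef
    (WithLp.toLp 2 (Function.extend e t (0 : ι → ℝ)))
  rw [charFun_apply] at h3
  have h4 : (WithLp.toLp 2 (Function.extend e t (0 : ι → ℝ))).ofLp = Function.extend e t (0 : ι → ℝ) := rfl
  have h5 : Function.extend e t (0 : ι → ℝ) ⬝ᵥ B⁻¹.mulVec (Function.extend e t (0 : ι → ℝ)) =
      t ⬝ᵥ A⁻¹.mulVec t := by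
    rw [h1, dotProduct, sum_extend_mul he]
    simp only [he.extend_apply]
    rfl
  simp only [inner_zero_right, h5] at h3
  have h6 : ∀ x : EuclideanSpace ℝ ι,
      inner ℝ x (WithLp.toLp 2 (Function.extend e t (0 : ι → ℝ))) = ∑ k, t k * x (e k) := by
    intro x
    rw [PiLp.inner_apply, ← sum_extend_mul he t x.ofLp]
    refine Finset.sum_congr rfl fun i _ => ?_
    simp
  simp only [h6] at h3
  simpa [mul_comm, neg_div] using h3

end Gaussian

/-! ### Monotonicity of lattice correlations in the set of sites -/

namespace PadicModel

section Lattice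

variable {p : ℕ} [Fact p.Prime] {K : Type*} [DivisionRing K] [Algebra ℚ_[p] K]
  [FiniteDimensional ℚ_[p] K] [TopologicalSpace K] [T2Space K] [IsTopologicalAddGroup K]
  [ContinuousSMul ℚ_[p] K] [MeasurableSpace K] [BorelSpace K]
  [LocallyCompactSpace K] [SecondCountableTopology K] [ContinuousMul K]
  [TopologicalSpace.MetrizableSpace K] [DecidableEq K] (D : PadicModel p K)

/-- The precision matrix for `C'` with all couplings outside `C` removed. -/
noncomputable def decoupled (j : ℤ) (C C' : Finset K) : Matrix C' C' ℝ :=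
  Matrix.of fun c d => if (c : K) ∈ C ∧ (d : K) ∈ C then D.precision j C' c d
    else if c = d then D.precision j C' c c else 0

variable {D} {j : ℤ} {C C' : Finset K} (hCC' : C ⊆ C')

/-- The inclusion of index sets. -/
def inclC (hCC' : C ⊆ C') (c : C) : C' := ⟨c, hCC' c.2⟩

theorem inclC_injective : Function.Injective (inclC hCC') := fun _ _ h =>
  Subtype.ext (congrArg (fun z : C' => (z : K)) h)

theorem notMem_range_inclC {c : C'} (hc : (c : K) ∉ C) : c ∉ Set.range (inclC hCC') := by
  rintro ⟨d, rfl⟩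
  exact hc d.2

theorem sum_inclC {F : C' → ℝ} (hF : ∀ c : C', (c : K) ∉ C → F c = 0) :
    ∑ c, F c = ∑ c : C, F (inclC hCC' c) := by
  symm
  refine Fintype.sum_of_injective _ (inclC_injective hCC') _ _ (fun c hc => hF c fun h => ?_)
    fun _ => rfl
  exact hc ⟨⟨c, h⟩, rfl⟩

/-- An entry of the precision matrix depends on its two sites alone, not on the region, so the block
of `C` inside the matrix of `C'` is the matrix of `C`. -/
theorem decoupled_mulVec_of_mem (t : C' → ℝ) (c : C) :
    (D.decoupled j C C').mulVec t (inclC hCC' c) =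
      (D.precision j C).mulVec (fun d => t (inclC hCC' d)) c := by
  rw [Matrix.mulVec, dotProduct, sum_inclC hCC']
  · refine Finset.sum_congr rfl fun d _ => ?_
    change _ = D.precision j C c d * t (inclC hCC' d)
    rw [decoupled, Matrix.of_apply, if_pos ⟨c.2, d.2⟩, precision_apply, precision_apply]
    simp only [(inclC_injective hCC').eq_iff]
    rfl
  · intro d hd
    rw [decoupled, Matrix.of_apply, if_neg fun h => hd h.2, if_neg, zero_mul]
    rintro rfl
    exact hd c.2

theorem decoupled_mulVec_of_notMem (t : C' → ℝ) {c : C'} (hc : (c : K) ∉ C) :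
    (D.decoupled j C C').mulVec t c = D.precision j C' c c * t c := by
  rw [Matrix.mulVec, dotProduct, Finset.sum_eq_single_of_mem c (Finset.mem_univ c)]
  · rw [decoupled, Matrix.of_apply, if_neg fun h => hc h.1, if_pos rfl]
  · intro d _ hdc
    rw [decoupled, Matrix.of_apply, if_neg fun h => hc h.1, if_neg hdc.symm, zero_mul]

include hCC' in
-- The form is that of `precision j C` on the sites of `C` plus a positive diagonal form on the
-- others.
theorem posDef_decoupled : (D.decoupled j C C').PosDef := by
  have hdiag : ∀ c, 0 < D.precision j C' c c := fun c => (D.posDef_precision j C').diag_pos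
  refine Matrix.PosDef.of_dotProduct_mulVec_pos ?_ fun t ht => ?_
  · ext c d
    rw [Matrix.conjTranspose_apply, star_trivial, decoupled, Matrix.of_apply, Matrix.of_apply]
    have h := (D.posDef_precision j C').isHermitian.apply c d
    rw [star_trivial] at h
    by_cases hcd : c = d
    · rw [hcd]
    · rw [if_neg hcd, if_neg (Ne.symm hcd)]
      by_cases h1 : (c : K) ∈ C ∧ (d : K) ∈ C
      · rw [if_pos h1, if_pos h1.symm, h]
      · rw [if_neg h1, if_neg fun h2 => h1 h2.symm]
  · rw [star_trivial]
    set t' : C → ℝ := fun d => t (inclC hCC' d) with ht'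
    have h1 : t ⬝ᵥ (D.decoupled j C C').mulVec t = t' ⬝ᵥ (D.precision j C).mulVec t' +
        ∑ c : C', if (c : K) ∈ C then 0 else D.precision j C' c c * t c ^ 2 := by
      have h2 : ∀ c : C', t c * (D.decoupled j C C').mulVec t c =
          (if (c : K) ∈ C then t c * (D.decoupled j C C').mulVec t c else 0) +
            if (c : K) ∈ C then 0 else D.precision j C' c c * t c ^ 2 := by
        intro c
        split_ifs with hc
        · rw [add_zero]
        · rw [decoupled_mulVec_of_notMem t hc]
          ring
      rw [dotProduct, Finset.sum_congr rfl fun c _ => h2 c, Finset.sum_add_distrib]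
      congr 1
      rw [sum_inclC hCC' fun c hc => if_neg hc]
      refine Finset.sum_congr rfl fun c _ => ?_
      rw [if_pos (show ((inclC hCC' c : C') : K) ∈ C from c.2), decoupled_mulVec_of_mem hCC' t c]
    rw [h1]
    have h3 : 0 ≤ ∑ c : C', if (c : K) ∈ C then 0 else D.precision j C' c c * t c ^ 2 :=
      Finset.sum_nonneg fun c _ => by
        split_ifs
        · exact le_rfl
        · exact mul_nonneg (hdiag c).le (sq_nonneg _)
    by_cases h4 : t' = 0
    · obtain ⟨c, hc⟩ := Function.ne_iff.1 ht
      have hcC : (c : K) ∉ C := fun h => hc (congrFun h4 ⟨c, h⟩)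
      refine add_pos_of_nonneg_of_pos (by simp [h4]) (Finset.sum_pos' (fun c _ => ?_)
        ⟨c, Finset.mem_univ c, ?_⟩)
      · split_ifs
        · exact le_rfl
        · exact mul_nonneg (hdiag c).le (sq_nonneg _)
      · rw [if_neg hcC]
        exact mul_pos (hdiag c) (sq_pos_of_ne_zero hc)
    · have h5 := (D.posDef_precision j C).dotProduct_mulVec_pos h4
      rw [star_trivial] at h5
      linarith

/-- Correlation functions of a lattice theory increase with the set of sites. -/
theorem lattice_correlation_le (hp : p ≠ 2) (hC' : D.Separated j C') (hCC' : C ⊆ C') {s : ℝ}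
    (hs : 0 < s) {V : K → ℝ → ℝ} {h : K → ℝ} (hVc : ∀ c, Continuous (V c))
    (hVe : ∀ c x, V c (-x) = V c x) {b : ℝ} (hVb : ∀ c x, -b ≤ V c x) (hh : ∀ c, 0 ≤ h c)
    {r : ℕ} {f : Fin r → K → ℝ} (hf : ∀ k c, 0 ≤ f k c)
    (hV0 : ∀ c ∈ C', c ∉ C → ∀ x, V c x = 0) (hh0 : ∀ c ∈ C', c ∉ C → h c = 0)
    (hf0 : ∀ k, ∀ c ∈ C', c ∉ C → f k c = 0) :
    (∫ t : EuclideanSpace ℝ C, (∏ k, ∑ c : C, f k c * t c) *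
        spinWeight (fun c : C => V c) (fun c : C => h c) t.ofLp
        ∂multivariateGaussian 0 (s • D.precision j C)⁻¹) /
      (∫ t : EuclideanSpace ℝ C, spinWeight (fun c : C => V c) (fun c : C => h c) t.ofLp
        ∂multivariateGaussian 0 (s • D.precision j C)⁻¹) ≤
    (∫ t : EuclideanSpace ℝ C', (∏ k, ∑ c : C', f k c * t c) *
        spinWeight (fun c : C' => V c) (fun c : C' => h c) t.ofLp
        ∂multivariateGaussian 0 (s • D.precision j C')⁻¹) /
      (∫ t : EuclideanSpace ℝ C', spinWeight (fun c : C' => V c) (fun c : C' => h c) t.ofLp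
        ∂multivariateGaussian 0 (s • D.precision j C')⁻¹) := by
  -- The scale `s` accommodates both normalizations of the spins: `1` for the lattice fields,
  -- `q^{-κ}` for the fields smeared with approximate deltas.
  have hp₁ : (s • D.precision j C').PosDef := (D.posDef_precision j C').smul hs
  have hp₂ : (s • D.decoupled j C C').PosDef := (posDef_decoupled hCC').smul hs
  have hp₃ : (s • D.precision j C).PosDef := (D.posDef_precision j C).smul hs
  have hsep : ∀ c d : C', c ≠ d → D.precision j C' c d ≤ 0 := fun c d hcd =>
    D.precision_nonpos hp hC' hcd
  have hG := isGaussianFamily_of_decoupled hp₂ hp₃ (inclC_injective hCC') fun v => by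
    ext c
    rw [Matrix.smul_mulVec, Matrix.smul_mulVec, Pi.smul_apply]
    by_cases hc : (c : K) ∈ C
    · have hce : c = inclC hCC' ⟨c, hc⟩ := rfl
      rw [hce, decoupled_mulVec_of_mem, (inclC_injective hCC').extend_apply, Pi.smul_apply]
      congr 2
      ext d
      rw [(inclC_injective hCC').extend_apply]
    · rw [decoupled_mulVec_of_notMem _ hc, Function.extend_apply' _ _ _
        (by simpa using notMem_range_inclC hCC' hc), Function.extend_apply' _ _ _
        (by simpa using notMem_range_inclC hCC' hc)]
      simp
  -- The full matrix and the decoupled one have equal diagonals, and the couplings that were removed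
  -- are nonpositive.
  have key := griffiths_second hp₁ hp₂ (V := fun c : C' => V c) (h := fun c : C' => h c)
    (f := fun k (c : C') => f k c) (b := b) (fun c => ?_) (fun c d => ?_) (fun c d hcd => ?_)
    (fun c => hVc c) (fun c x => hVe c x) (fun c x => hVb c x) (fun c => hh c) (fun k c => hf k c)
  rotate_left
  · rw [Matrix.smul_apply, Matrix.smul_apply, decoupled, Matrix.of_apply, if_pos rfl, ite_self]
  · rw [Matrix.smul_apply, Matrix.smul_apply, smul_eq_mul, smul_eq_mul]
    refine mul_le_mul_of_nonneg_left ?_ hs.le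
    rw [decoupled, Matrix.of_apply]
    split_ifs with h1 h2
    · exact le_rfl
    · rw [h2]
    · exact hsep c d h2
  · rw [Matrix.smul_apply, smul_eq_mul]
    refine mul_nonpos_of_nonneg_of_nonpos hs.le ?_
    rw [decoupled, Matrix.of_apply, if_neg hcd]
    split_ifs
    · exact hsep c d hcd
    · exact le_rfl
  -- Potential, field and observables vanish off `C`, so the decoupled expectations involve only the
  -- marginal on `C`.
  have hw : ∀ t : EuclideanSpace ℝ C', spinWeight (fun c : C' => V c) (fun c : C' => h c) t.ofLp =
      spinWeight (fun c : C => V c) (fun c : C => h c) fun c => t (inclC hCC' c) := by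
    intro t
    rw [spinWeight, spinWeight, sum_inclC hCC']
    · rfl
    · intro c hc
      rw [hV0 c c.2 hc, hh0 c c.2 hc, zero_mul, sub_zero]
  have hfs : ∀ (t : EuclideanSpace ℝ C') k, ∑ c : C', f k c * t c =
      ∑ c : C, f k c * t (inclC hCC' c) := by
    intro t k
    rw [sum_inclC hCC']
    · rfl
    · intro c hc
      rw [hf0 k c c.2 hc, zero_mul]
  have hwc := continuous_spinWeight (V := fun c : C => V c) (h := fun c : C => h c) fun c => hVc c
  have e1 : ∫ t : EuclideanSpace ℝ C', spinWeight (fun c : C' => V c) (fun c : C' => h c) t.ofLp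
        ∂multivariateGaussian 0 (s • D.decoupled j C C')⁻¹ =
      ∫ t : EuclideanSpace ℝ C, spinWeight (fun c : C => V c) (fun c : C => h c) t.ofLp
        ∂multivariateGaussian 0 (s • D.precision j C)⁻¹ := by
    simp only [hw]
    exact hG.integral_comp hwc
  have e2 : ∫ t : EuclideanSpace ℝ C', (∏ k, ∑ c : C', f k c * t c) *
        spinWeight (fun c : C' => V c) (fun c : C' => h c) t.ofLp
        ∂multivariateGaussian 0 (s • D.decoupled j C C')⁻¹ =
      ∫ t : EuclideanSpace ℝ C, (∏ k, ∑ c : C, f k c * t c) *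
        spinWeight (fun c : C => V c) (fun c : C => h c) t.ofLp
        ∂multivariateGaussian 0 (s • D.precision j C)⁻¹ := by
    simp only [hw, hfs]
    exact hG.integral_comp (F := fun t => (∏ k, ∑ c : C, f k c * t c) *
      spinWeight (fun c : C => V c) (fun c : C => h c) t) (by fun_prop)
  rw [e1, e2] at key
  rw [div_le_div_iff₀
    (integral_spinWeight_pos (V := fun c : C => V c) _ (fun c => hVc c) fun c x => hVb c x)
    (integral_spinWeight_pos (V := fun c : C' => V c) _ (fun c => hVc c) fun c x => hVb c x)]
  exact key

end Lattice

end PadicModel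

/-! ### Existence of the Gaussian field -/

/-- Gram-Schmidt orthogonalization of a spanning sequence with respect to a positive definite
form. -/
theorem LinearMap.BilinForm.exists_diagonalization {V : Type*} [AddCommGroup V] [Module ℝ V]
    (B : LinearMap.BilinForm ℝ V) (hsymm : ∀ x y, B x y = B y x) (hpos : ∀ x, x ≠ 0 → 0 < B x x)
    (v : ℕ → V) (hv : Submodule.span ℝ (Set.range v) = ⊤) :
    ∃ e : ℕ → V, ∀ f, ∃ N : ℕ, (∀ n, N ≤ n → B (e n) f = 0) ∧
      B f f = ∑ n ∈ Finset.range N, B (e n) f ^ 2 := by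
  let core : InnerProductSpace.Core ℝ V :=
    { inner := fun x y => B x y
      conj_inner_symm := fun x y => hsymm y x
      re_inner_nonneg := fun x => by
        by_cases hx : x = 0
        · simp [hx]
        · exact (hpos x hx).le
      add_left := fun x y z => by simp
      smul_left := fun x y r => by simp
      definite := fun x hx => by
        by_contra h
        exact (hpos x h).ne' hx }
  let : NormedAddCommGroup V := core.toNormedAddCommGroup
  let : InnerProductSpace ℝ V := InnerProductSpace.ofCore core.toCore
  have hin : ∀ x y : V, inner ℝ x y = B x y := fun x y => rfl
  set e := InnerProductSpace.gramSchmidtNormed ℝ v with he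
  have horth : ∀ n k, n ≠ k → B (e n) (e k) = 0 := by
    intro n k hnk
    rw [← hin, he, InnerProductSpace.gramSchmidtNormed, InnerProductSpace.gramSchmidtNormed,
      real_inner_smul_left, real_inner_smul_right,
      InnerProductSpace.gramSchmidt_orthogonal ℝ v hnk, mul_zero, mul_zero]
  -- The sequence may be linearly dependent; normalized Gram-Schmidt then returns zero, so each
  -- squared length is `0` or `1`.
  have hidem : ∀ n, B (e n) (e n) ^ 2 = B (e n) (e n) := by
    intro n
    by_cases h0 : e n = 0
    · simp [h0]
    · have h1 : ‖e n‖ = 1 := InnerProductSpace.gramSchmidtNormed_unit_length' h0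
      have h2 : B (e n) (e n) = 1 := by
        rw [← hin, real_inner_self_eq_norm_sq, h1, one_pow]
      rw [h2, one_pow]
  have hspan : Submodule.span ℝ (Set.range e) = ⊤ := by
    rw [he, InnerProductSpace.span_gramSchmidtNormed_range, InnerProductSpace.span_gramSchmidt, hv]
  refine ⟨e, fun f => ?_⟩
  have hf : f ∈ Submodule.span ℝ (Set.range e) := hspan ▸ Submodule.mem_top
  obtain ⟨c, hc⟩ := Finsupp.mem_span_range_iff_exists_finsupp.1 hf
  obtain ⟨N, hN⟩ := c.support.exists_nat_subset_range
  have hfe : f = ∑ n ∈ Finset.range N, c n • e n := by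
    rw [← hc, Finsupp.sum]
    refine Finset.sum_subset hN fun n _ hn => ?_
    rw [Finsupp.notMem_support_iff.1 hn, zero_smul]
  have hBk : ∀ k, B (e k) f = if k ∈ Finset.range N then c k * B (e k) (e k) else 0 := by
    intro k
    rw [hfe, map_sum]
    simp only [map_smul, smul_eq_mul]
    split_ifs with hk
    · rw [Finset.sum_eq_single_of_mem k hk]
      intro n _ hnk
      rw [horth k n hnk.symm, mul_zero]
    · refine Finset.sum_eq_zero fun n hn => ?_
      rw [horth k n (fun h => hk (h ▸ hn)), mul_zero]
  refine ⟨N, fun n hn => ?_, ?_⟩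
  · rw [hBk, if_neg (by simpa using hn)]
  · have h1 : B f f = ∑ n ∈ Finset.range N, c n * B (e n) f := by
      conv_lhs => arg 2; rw [hfe]
      rw [map_sum]
      refine Finset.sum_congr rfl fun n _ => ?_
      rw [map_smul, smul_eq_mul, hsymm]
    rw [h1]
    refine Finset.sum_congr rfl fun n hn => ?_
    rw [hBk, if_pos hn, mul_pow, hidem]
    ring

theorem integral_exp_sum_infinitePi_gaussian (N : ℕ) (a : ℕ → ℝ) :
    ∫ ω, Complex.exp (Complex.I * ((∑ n ∈ Finset.range N, a n * ω n : ℝ) : ℂ))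
      ∂(Measure.infinitePi fun _ : ℕ => gaussianReal 0 1) =
      Complex.exp (-((∑ n ∈ Finset.range N, a n ^ 2 : ℝ) : ℂ) / 2) := by
  obtain ⟨F, hF⟩ : ∃ F : (Finset.range N → ℝ) → ℂ, F = fun x =>
    ∏ n : Finset.range N, Complex.exp (Complex.I * ((a n * x n : ℝ) : ℂ)) := ⟨_, rfl⟩
  have h1 : ∀ ω : ℕ → ℝ, Complex.exp (Complex.I * ((∑ n ∈ Finset.range N, a n * ω n : ℝ) : ℂ)) =
      F ((Finset.range N).restrict ω) := by
    intro ω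
    rw [hF, Complex.ofReal_sum, Finset.mul_sum, Complex.exp_sum]
    exact (Finset.prod_coe_sort (Finset.range N)
      fun n => Complex.exp (Complex.I * ((a n * ω n : ℝ) : ℂ))).symm
  simp only [h1]
  refine (integral_restrict_infinitePi (X := fun _ : ℕ => ℝ) (s := Finset.range N) (f := F)
      (fun _ : ℕ => gaussianReal 0 1) (by
      rw [hF]
      refine Continuous.aestronglyMeasurable ?_
      fun_prop)).trans ?_
  rw [hF,
    integral_fintype_prod_eq_prod (fun (n : Finset.range N) (x : ℝ) =>
      Complex.exp (Complex.I * ((a n * x : ℝ) : ℂ)))]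
  have h2 : ∀ n : ℕ, ∫ x, Complex.exp (Complex.I * ((a n * x : ℝ) : ℂ)) ∂gaussianReal 0 1 =
      Complex.exp (-((a n ^ 2 : ℝ) : ℂ) / 2) := by
    intro n
    have h3 := charFun_gaussianReal (μ := 0) (v := 1) (a n)
    rw [charFun_apply_real] at h3
    rw [← show Complex.exp _ = Complex.exp (-((a n ^ 2 : ℝ) : ℂ) / 2) from ?_, ← h3]
    · congr 1
      ext x
      push_cast
      ring_nf
    · push_cast
      ring_nf
  simp only [h2]
  rw [Finset.prod_coe_sort (Finset.range N)
    fun n => Complex.exp (-((a n ^ 2 : ℝ) : ℂ) / 2), ← Complex.exp_sum]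
  congr 1
  push_cast
  rw [neg_div, Finset.sum_div, ← Finset.sum_neg_distrib]
  exact Finset.sum_congr rfl fun n _ => by rw [neg_div]

namespace PadicModel

section Existence

variable {p : ℕ} [Fact p.Prime] {K : Type*} [DivisionRing K] [Algebra ℚ_[p] K]
  [FiniteDimensional ℚ_[p] K] [TopologicalSpace K] [T2Space K] [IsTopologicalAddGroup K]
  [ContinuousSMul ℚ_[p] K] [MeasurableSpace K] [BorelSpace K]
  [LocallyCompactSpace K] [SecondCountableTopology K] [ContinuousMul K]
  [TopologicalSpace.MetrizableSpace K] [DecidableEq K] (D : PadicModel p K)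

variable {D} in
theorem IsStep.eq_sum_deltaFun {κ : ℕ} {C : Finset K} (hC : D.Separated (-(κ : ℤ)) C) {f : K → ℝ}
    (hf : D.IsStep (-(κ : ℤ)) f) (h0 : ∀ x, x ∉ D.region (-(κ : ℤ)) C → f x = 0) :
    f = ∑ c ∈ C, (f c * D.q ^ (-(κ : ℤ))) • D.deltaFun κ c := by
  ext x
  rw [hf.eq_sum_indicator hC h0 x, Finset.sum_apply]
  refine Finset.sum_congr rfl fun c _ => ?_
  rw [Pi.smul_apply, smul_eq_mul, deltaFun]
  by_cases hx : x ∈ D.ball (-(κ : ℤ)) c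
  · rw [Set.indicator_of_mem hx, Set.indicator_of_mem hx, mul_assoc, q_zpow_neg_mul, mul_one]
  · rw [Set.indicator_of_notMem hx, Set.indicator_of_notMem hx, mul_zero]

/-- Every test function is a finite combination of approximate deltas at the centres of some scale,
and these form a countable family. -/
theorem exists_spanning_sequence (l : ℤ) (C : Finset K) :
    ∃ v : ℕ → TestFun (D.region l C), Submodule.span ℝ (Set.range v) = ⊤ := by
  set U := D.region l C with hU
  set S : Set (TestFun U) := insert 0 (⋃ κ : ℕ, ⋃ c ∈ D.centers (-(κ : ℤ)) U,
    {f : TestFun U | (f : K → ℝ) = D.deltaFun κ c}) with hS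
  have hcount : S.Countable := by
    refine Set.Countable.insert 0 (Set.countable_iUnion fun κ => ?_)
    refine (D.centers (-(κ : ℤ)) U).countable_toSet.biUnion fun c _ => ?_
    refine Set.Subsingleton.countable fun f hf g hg => Subtype.ext ?_
    exact Eq.trans hf (Eq.symm hg)
  obtain ⟨v, hv⟩ := hcount.exists_eq_range ⟨0, Set.mem_insert _ _⟩
  refine ⟨v, ?_⟩
  rw [← hv, eq_top_iff]
  rintro f -
  obtain ⟨k, hk⟩ := exists_isStep (D := D) (D.isCompact_region l C) f.2.1 f.2.2
  set κ : ℕ := max k l.natAbs with hκ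
  have hκl : -(κ : ℤ) ≤ l := by omega
  have hs : D.IsStep (-(κ : ℤ)) (f : K → ℝ) := hk.mono (by omega)
  have h1 := hs.eq_sum_deltaFun (D.separated_centers_region l (-(κ : ℤ)) C)
    (by rw [region_centers_region D hκl]; exact f.2.2)
  have hmem : ∀ c ∈ D.centers (-(κ : ℤ)) U, D.deltaFun κ c ∈ TestFun U := fun c hc =>
    deltaFun_mem hκl (by
      have := mem_region_of_mem (D := D) (j := -(κ : ℤ)) hc
      rwa [hU, region_centers_region D hκl] at this)
  have h2 : f = ∑ c : D.centers (-(κ : ℤ)) U, ((f : K → ℝ) c * D.q ^ (-(κ : ℤ))) •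
      (⟨D.deltaFun κ c, hmem c c.2⟩ : TestFun U) := by
    refine Subtype.ext ?_
    rw [Submodule.coe_sum]
    conv_lhs => rw [h1]
    rw [← Finset.sum_coe_sort]
    rfl
  rw [h2]
  refine Submodule.sum_mem _ fun c _ => Submodule.smul_mem _ _ (Submodule.subset_span ?_)
  refine Set.mem_insert_of_mem _ (Set.mem_iUnion.2 ⟨κ, Set.mem_iUnion₂.2 ⟨c, c.2, rfl⟩⟩)

/-- The field is the series with independent standard Gaussian coefficients along the
orthonormalized sequence. Each test function meets only finitely many terms, so a linear functional
is obtained for every choice of coefficients, without exceptional null sets. -/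
theorem exists_isDirichletField (l : ℤ) (C : Finset K) :
    ∃ ν : Measure (Distr (D.region l C)), D.IsDirichletField (D.region l C) ν := by
  obtain ⟨v, hv⟩ := D.exists_spanning_sequence l C
  obtain ⟨e, he⟩ := (D.greenBilin l C).exists_diagonalization (greenBilin_comm l C)
    (fun f hf => greenBilin_self_pos l C hf) v hv
  choose N hN hB using he
  have hfin : ∀ (ω : ℕ → ℝ) (f : TestFun (D.region l C)),
      (Function.support fun n => D.greenBilin l C (e n) f * ω n) ⊆ Finset.range (N f) := by
    intro ω f n hn
    by_contra h
    refine hn ?_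
    simp only
    rw [hN f n (by simpa using h), zero_mul]
  let Φ : (ℕ → ℝ) → Distr (D.region l C) := fun ω =>
    { toFun := fun f => ∑ᶠ n, D.greenBilin l C (e n) f * ω n
      map_add' := fun f g => by
        rw [← finsum_add_distrib ((Finset.finite_toSet _).subset (hfin ω f))
          ((Finset.finite_toSet _).subset (hfin ω g))]
        exact finsum_congr fun n => by rw [map_add, add_mul]
      map_smul' := fun a f => by
        rw [RingHom.id_apply, smul_eq_mul, mul_finsum' _ _ ((Finset.finite_toSet _).subset (hfin ω f))]
        exact finsum_congr fun n => by rw [map_smul, smul_eq_mul, mul_assoc] }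
  have hΦ : ∀ ω f, Φ ω f = ∑ n ∈ Finset.range (N f), D.greenBilin l C (e n) f * ω n := fun ω f =>
    finsum_eq_sum_of_support_subset _ (hfin ω f)
  have hmeas : Measurable Φ := by
    rw [measurable_iff_comap_le]
    rw [show (Distr.instMeasurableSpace (D.region l C)) = ⨆ f : TestFun (D.region l C),
      MeasurableSpace.comap (fun φ : Distr (D.region l C) => φ f) inferInstance from rfl,
      MeasurableSpace.comap_iSup]
    refine iSup_le fun f => ?_
    rw [MeasurableSpace.comap_comp, ← measurable_iff_comap_le]
    have : (fun φ : Distr (D.region l C) => φ f) ∘ Φ =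
        fun ω => ∑ n ∈ Finset.range (N f), D.greenBilin l C (e n) f * ω n := funext fun ω => hΦ ω f
    rw [this]
    fun_prop
  refine ⟨(Measure.infinitePi fun _ : ℕ => gaussianReal 0 1).map Φ,
    Measure.isProbabilityMeasure_map hmeas.aemeasurable, fun f => ?_⟩
  rw [integral_map hmeas.aemeasurable (by
    refine Measurable.aestronglyMeasurable ?_
    exact Complex.measurable_exp.comp (measurable_const.mul
      (Complex.measurable_ofReal.comp (Distr.measurable_apply f))))]
  simp only [hΦ]
  rw [integral_exp_sum_infinitePi_gaussian, ← hB f, greenBilin_apply]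

end Existence

end PadicModel

/-! ### The lattice theory -/

theorem wickPoly_C_mul_sub (Q : ℝ[X]) (lam c t : ℝ) :
    wickPoly (Q - Polynomial.C lam * X) c t = wickPoly Q c t - lam * t := by
  rw [wickPoly_sub, wickPoly_C_mul_X]

namespace PadicModel

section LatticeTheory

variable {p : ℕ} [Fact p.Prime] {K : Type*} [DivisionRing K] [Algebra ℚ_[p] K]
  [FiniteDimensional ℚ_[p] K] [TopologicalSpace K] [T2Space K] [IsTopologicalAddGroup K]
  [ContinuousSMul ℚ_[p] K] [MeasurableSpace K] [BorelSpace K]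
  [LocallyCompactSpace K] [SecondCountableTopology K] [ContinuousMul K]
  [TopologicalSpace.MetrizableSpace K] [DecidableEq K] {D : PadicModel p K}

variable (D) in
theorem exists_bound_of_mem_testFun {l : ℤ} {C : Finset K} {g : K → ℝ}
    (hg : g ∈ TestFun (D.region l C)) : ∃ G, 0 ≤ G ∧ ∀ x, |g x| ≤ G := by
  obtain ⟨G, hG⟩ := (D.isCompact_region l C).exists_bound_of_continuousOn
    hg.1.continuous.continuousOn
  refine ⟨max G 0, le_max_right _ _, fun x => ?_⟩
  by_cases hx : x ∈ D.region l C
  · exact (hG x hx).trans (le_max_left _ _)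
  · rw [hg.2 x hx, abs_zero]
    exact le_max_right _ _

theorem Separated.mono {j : ℤ} {C C' : Finset K} (h : D.Separated j C') (hCC' : C ⊆ C') :
    D.Separated j C := fun c hc d hd => h c (hCC' hc) d (hCC' hd)

theorem Separated.eq_zero_of_notMem {l : ℤ} {C C' : Finset K} (hC' : D.Separated l C')
    (hCC' : C ⊆ C') {g : K → ℝ} (hg : g ∈ TestFun (D.region l C)) {c : K} (hc : c ∈ C')
    (hcC : c ∉ C) : g c = 0 := by
  refine hg.2 c fun h => ?_
  obtain ⟨d, hd, hcd⟩ := D.mem_region.1 h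
  have h1 : c ≠ d := fun h2 => hcC (h2 ▸ hd)
  exact (hC' c hc d (hCC' hd) h1).not_ge hcd

theorem latticeMeasure_eq {l : ℤ} {C : Finset K} (hC : D.Separated l C) :
    D.latticeMeasure l C = multivariateGaussian 0 ((1 : ℝ) • D.precision l C)⁻¹ := by
  rw [latticeMeasure, covMatrix_eq hC, one_smul]
  -- Only the decidability instances differ.
  congr!

/-- Wick ordering leaves the linear term alone: it becomes the external field, and the even part `Q`
becomes the single-spin potential. -/
theorem latticeWeight_eq (l : ℤ) (C : Finset K) (Q : ℝ[X]) (lam : ℝ) (g : K → ℝ)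
    (t : EuclideanSpace ℝ C) :
    D.latticeWeight l C (Q - Polynomial.C lam * X) g t =
      spinWeight (fun c : C => fun x => g c * wickPoly Q (D.freeVariance (D.e l c)) x)
        (fun c : C => g c * lam) t.ofLp := by
  rw [latticeWeight, spinWeight]
  simp only [wickPoly_C_mul_sub, mul_sub, mul_assoc]

theorem mul_wickPoly_ge {Q : ℝ[X]} {A : ℝ} {k : ℕ} (hA : 0 ≤ A)
    (hQ : ∀ c, 0 ≤ c → ∀ t, -(A * (1 + c) ^ k) ≤ wickPoly Q c t) {w G c : ℝ} (hw : 0 ≤ w)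
    (hG : w ≤ G) (hc : 0 ≤ c) (t : ℝ) : -(G * (A * (1 + c) ^ k)) ≤ w * wickPoly Q c t := by
  have h1 : 0 ≤ A * (1 + c) ^ k := by positivity
  calc -(G * (A * (1 + c) ^ k)) ≤ w * -(A * (1 + c) ^ k) := by
        rw [mul_neg]
        exact neg_le_neg (mul_le_mul_of_nonneg_right hG h1)
    _ ≤ _ := mul_le_mul_of_nonneg_left (hQ c hc t) hw

theorem exists_latticePotential_ge {Q : ℝ[X]} (hQ_even : ∀ k, Odd k → Q.coeff k = 0)
    (hQ_lead : 0 < Q.leadingCoeff) {l : ℤ} {C : Finset K} {g : K → ℝ}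
    (hg : g ∈ TestFun (D.region l C)) (hg0 : ∀ x, 0 ≤ g x) :
    ∃ b, ∀ c x, -b ≤ g c * wickPoly Q (D.freeVariance (D.e l c)) x := by
  obtain ⟨A, k, hA, hQ⟩ := exists_wickPoly_ge (natDegree_even_of_even hQ_even hQ_lead) hQ_lead
  obtain ⟨G, hG0, hG⟩ := exists_bound_of_mem_testFun D hg
  refine ⟨G * (A * (1 + D.freeVariance (D.e l 0)) ^ k), fun c x => ?_⟩
  have : D.freeVariance (D.e l c) = D.freeVariance (D.e l 0) := by
    rw [e, e, freeVariance_indicator, freeVariance_indicator]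
  rw [this]
  exact mul_wickPoly_ge hA hQ (hg0 c) ((le_abs_self _).trans (hG c)) (D.freeVariance_e_nonneg l 0) x

theorem latticeConverges {Q : ℝ[X]} (hQ_even : ∀ k, Odd k → Q.coeff k = 0)
    (hQ_lead : 0 < Q.leadingCoeff) (lam : ℝ) {l : ℤ} {C C' : Finset K} (hC : D.Separated l C)
    {g : K → ℝ} (hg : g ∈ TestFun (D.region l C')) (hg0 : ∀ x, 0 ≤ g x) {r : ℕ}
    (f : Fin r → K → ℝ) :
    D.LatticeConverges l C (Q - Polynomial.C lam * X) g f := by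
  obtain ⟨b, hb⟩ := exists_latticePotential_ge hQ_even hQ_lead hg hg0
  have hVc : ∀ c : C, Continuous fun x => g c * wickPoly Q (D.freeVariance (D.e l c)) x :=
    fun c => continuous_const.mul (continuous_wickPoly _ _)
  rw [LatticeConverges, latticeMeasure_eq hC, _root_.funext (latticeWeight_eq l C Q lam g)]
  simp only [latticeField]
  exact ⟨integrable_spinWeight ((1 : ℝ) • D.precision l C)⁻¹
      (V := fun c : C => fun x => g c * wickPoly Q (D.freeVariance (D.e l c)) x)
      (h := fun c : C => g c * lam) hVc (b := b) fun c x => hb c x,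
    integrable_prod_mul_spinWeight ((1 : ℝ) • D.precision l C)⁻¹
      (V := fun c : C => fun x => g c * wickPoly Q (D.freeVariance (D.e l c)) x)
      (h := fun c : C => g c * lam) hVc (b := b) (fun c x => hb c x) fun k (c : C) => f k c⟩

theorem latticeSchwinger_le (hp : p ≠ 2) {Q : ℝ[X]} (hQ_even : ∀ k, Odd k → Q.coeff k = 0)
    (hQ_lead : 0 < Q.leadingCoeff) {lam : ℝ} (hlam : 0 ≤ lam) {l : ℤ} {C C' : Finset K}
    (hC' : D.Separated l C') (hCC' : C ⊆ C') {g : K → ℝ} (hg : g ∈ TestFun (D.region l C))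
    (hg0 : ∀ x, 0 ≤ g x) {r : ℕ} {f : Fin r → K → ℝ} (hf : ∀ i, f i ∈ TestFun (D.region l C))
    (hf0 : ∀ i x, 0 ≤ f i x) :
    D.latticeSchwinger l C (Q - Polynomial.C lam * X) g f ≤
      D.latticeSchwinger l C' (Q - Polynomial.C lam * X) g f := by
  obtain ⟨b, hb⟩ := exists_latticePotential_ge hQ_even hQ_lead hg hg0
  rw [latticeSchwinger, latticeSchwinger, latticeMeasure_eq hC',
    latticeMeasure_eq (hC'.mono hCC')]
  simp only [latticeField, latticeWeight_eq]
  exact lattice_correlation_le hp hC' hCC' one_pos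
    (V := fun c x => g c * wickPoly Q (D.freeVariance (D.e l c)) x) (h := fun c => g c * lam)
    (fun c => continuous_const.mul (continuous_wickPoly _ _))
    (fun c x => by rw [wickPoly_neg_of_even hQ_even]) hb (fun c => mul_nonneg (hg0 c) hlam)
    hf0 (fun c hc hcC x => by rw [hC'.eq_zero_of_notMem hCC' hg hc hcC, zero_mul])
    (fun c hc hcC => by rw [hC'.eq_zero_of_notMem hCC' hg hc hcC, zero_mul])
    fun k c hc hcC => hC'.eq_zero_of_notMem hCC' (hf k) hc hcC

end LatticeTheory

end PadicModel

/-! ### Exponential bounds from moment bounds -/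

theorem tendsto_one_add_pow_mul_geometric (N : ℕ) {ρ : ℝ} (h0 : 0 < ρ) (h1 : ρ < 1) :
    Tendsto (fun n : ℕ => (1 + n : ℝ) ^ N * ρ ^ n) atTop (𝓝 0) := by
  have h := (tendsto_pow_const_mul_const_pow_of_abs_lt_one N
    (show |ρ| < 1 by rwa [abs_of_pos h0])).comp (tendsto_add_atTop_nat 1)
  have h2 := h.const_mul ρ⁻¹
  rw [mul_zero] at h2
  refine h2.congr fun n => ?_
  simp only [Function.comp_apply]
  push_cast
  rw [pow_succ ρ n, add_comm (n : ℝ) 1]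
  field_simp

theorem exists_one_add_pow_mul_geometric_le (N : ℕ) {θ τ : ℝ} (h0 : 0 < θ) (h1 : θ < τ) :
    ∃ B, 0 ≤ B ∧ ∀ n : ℕ, (1 + n : ℝ) ^ N * θ ^ n ≤ B * τ ^ n := by
  have hτ : 0 < τ := h0.trans h1
  obtain ⟨B, hB⟩ := (tendsto_one_add_pow_mul_geometric N (div_pos h0 hτ)
    ((div_lt_one hτ).2 h1)).bddAbove_range
  have hB' : ∀ n : ℕ, (1 + n : ℝ) ^ N * (θ / τ) ^ n ≤ B := fun n => hB ⟨n, rfl⟩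
  refine ⟨B, (by positivity : (0 : ℝ) ≤ (1 + (0 : ℕ)) ^ N * (θ / τ) ^ 0).trans (hB' 0), fun n => ?_⟩
  have := mul_le_mul_of_nonneg_right (hB' n) (pow_pos hτ n).le
  rwa [div_pow, mul_assoc, div_mul_cancel₀ _ (pow_pos hτ n).ne'] at this

/-- The geometric factor beats any power of the moment order, so the base is eventually at most
`e⁻¹`; the order `(n + 1) ^ (d + 2)` in the exponent then beats `exp (a (2 + n) ^ d)`. -/
theorem summable_exp_mul_pow (a B : ℝ) (ha : 0 ≤ a) (hB : 0 ≤ B) (d N : ℕ) {ρ : ℝ} (h0 : 0 < ρ)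
    (h1 : ρ < 1) : Summable fun n : ℕ => Real.exp (a * (2 + n) ^ d) *
      ((2 * ((n + 1) ^ (d + 2) : ℕ) + 1 : ℝ) ^ N * (B * ρ ^ n)) ^ ((n + 1) ^ (d + 2) + 1) := by
  have hsum : Summable fun n : ℕ => Real.exp (-1) ^ n :=
    summable_geometric_of_lt_one (Real.exp_pos _).le (Real.exp_lt_one_iff.2 (by norm_num))
  have ht : ∀ᶠ n : ℕ in atTop, 3 ^ N * B * ((1 + n : ℝ) ^ ((d + 2) * N) * ρ ^ n) ≤
      Real.exp (-1) := by
    have h := (tendsto_one_add_pow_mul_geometric ((d + 2) * N) h0 h1).const_mul (3 ^ N * B)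
    rw [mul_zero] at h
    exact (h.eventually_lt_const (Real.exp_pos _)).mono fun n hn => hn.le
  have hl : ∀ᶠ n : ℕ in atTop, a * 2 ^ d + 1 ≤ (n : ℝ) :=
    tendsto_natCast_atTop_atTop.eventually_ge_atTop _
  refine Summable.of_norm_bounded_eventually_nat hsum ?_
  filter_upwards [ht, hl] with n hn hln
  have hx : (1 : ℝ) ≤ 1 + n := by linarith [n.cast_nonneg (α := ℝ)]
  have e1 : (2 * ((n + 1) ^ (d + 2) : ℕ) + 1 : ℝ) ^ N * (B * ρ ^ n) ≤ Real.exp (-1) := by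
    refine le_trans ?_ hn
    have e2 : (2 * ((n + 1) ^ (d + 2) : ℕ) + 1 : ℝ) ≤ 3 * (1 + n) ^ (d + 2) := by
      push_cast
      have := one_le_pow₀ hx (n := d + 2)
      rw [add_comm (n : ℝ) 1]
      linarith
    calc _ ≤ (3 * (1 + n : ℝ) ^ (d + 2)) ^ N * (B * ρ ^ n) := by gcongr
      _ = _ := by rw [mul_pow, ← pow_mul]; ring
  have e0 : 0 ≤ (2 * ((n + 1) ^ (d + 2) : ℕ) + 1 : ℝ) ^ N * (B * ρ ^ n) := by positivity
  rw [Real.norm_of_nonneg (by positivity)]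
  calc _ ≤ Real.exp (a * (2 + n) ^ d) * Real.exp (-1) ^ ((n + 1) ^ (d + 2) + 1) := by gcongr
    _ = Real.exp (a * (2 + n) ^ d - (((n + 1) ^ (d + 2) + 1 : ℕ) : ℝ)) := by
      rw [← Real.exp_nat_mul, ← Real.exp_add]
      congr 1
      ring
    _ ≤ Real.exp (-1) ^ n := by
      rw [← Real.exp_nat_mul, Real.exp_le_exp]
      push_cast
      rw [add_comm (n : ℝ) 1]
      have e3 : (2 + n : ℝ) ^ d ≤ 2 ^ d * (1 + n) ^ d := by
        rw [← mul_pow]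
        refine pow_le_pow_left₀ (by positivity) ?_ d
        linarith [n.cast_nonneg (α := ℝ)]
      have e4 : (1 : ℝ) ≤ (1 + n) ^ d := one_le_pow₀ hx
      have e5 : (1 + n : ℝ) ^ (d + 2) = (1 + n) ^ d * ((1 + n) * (1 + n)) := by ring
      have e6 : a * (2 + n : ℝ) ^ d ≤ a * 2 ^ d * (1 + n) ^ d := by
        rw [mul_assoc]
        exact mul_le_mul_of_nonneg_left e3 ha
      have e7 : (1 + n : ℝ) ^ d * (a * 2 ^ d + (1 + n)) ≤ (1 + n : ℝ) ^ d * ((1 + n) * (1 + n)) := by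
        refine mul_le_mul_of_nonneg_left ?_ (by positivity)
        nlinarith
      have e8 : (1 + n : ℝ) ≤ (1 + n : ℝ) ^ d * (1 + n) := le_mul_of_one_le_left (by positivity) e4
      rw [e5]
      nlinarith

section Nelson

variable {Ω : Type*} [MeasurableSpace Ω] {ν : Measure Ω} [IsProbabilityMeasure ν]

theorem integrable_exp_neg_mul {X : Ω → ℝ} (hX : Measurable X) {b s : ℝ} (hs : 0 ≤ s)
    (hb : ∀ ω, -b ≤ X ω) : Integrable (fun ω => Real.exp (-(s * X ω))) ν := by
  refine Integrable.of_bound (C := Real.exp (s * b)) (by fun_prop) (Eventually.of_forall fun ω => ?_)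
  rw [Real.norm_of_nonneg (Real.exp_pos _).le, Real.exp_le_exp]
  have := mul_le_mul_of_nonneg_left (hb ω) hs
  linarith

/-- Nelson's argument: a sequence with polynomially growing lower bounds and geometrically small
increments has uniformly bounded exponential moments. -/
theorem exists_integral_exp_neg_le {X : ℕ → Ω → ℝ} (hX : ∀ n, Measurable (X n)) {A : ℝ}
    (hA : 0 ≤ A) {d : ℕ} (hlow : ∀ n ω, -(A * (1 + n) ^ d) ≤ X n ω) {N : ℕ} {B θ : ℝ} (hB : 0 ≤ B)
    (hθ0 : 0 < θ) (hθ : θ < 1)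
    (hint : ∀ n j : ℕ, Integrable (fun ω => (X (n + 1) ω - X n ω) ^ (2 * (j + 1))) ν)
    (hmom : ∀ n j : ℕ, ∫ ω, (X (n + 1) ω - X n ω) ^ (2 * (j + 1)) ∂ν ≤
      ((2 * j + 1) ^ N * (B * θ ^ n)) ^ (j + 1)) {s : ℝ} (hs : 0 ≤ s) :
    ∃ M, ∀ n, ∫ ω, Real.exp (-(s * X n ω)) ∂ν ≤ M := by
  -- Here `θ = ρ²` and `ρ = τ²`. Increments are compared with `τ^n`; Chebyshev's inequality costs
  -- `τ^{-2n} = ρ^{-n}`, and a factor `ρ^n` of `θ^n` remains.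
  set ρ := √θ with hρ
  have hρ0 : 0 < ρ := Real.sqrt_pos.2 hθ0
  have hρ2 : ρ ^ 2 = θ := Real.sq_sqrt hθ0.le
  have hρ1 : ρ < 1 := by rw [hρ, Real.sqrt_lt' one_pos]; simpa using hθ
  set τ := √ρ with hτ
  have hτ0 : 0 < τ := Real.sqrt_pos.2 hρ0
  have hτ2 : τ ^ 2 = ρ := Real.sq_sqrt hρ0.le
  have hτ1 : τ < 1 := by rw [hτ, Real.sqrt_lt' one_pos]; simpa using hρ1
  -- The moment order grows with `n`, faster than the exponent of the lower bound.
  set J : ℕ → ℕ := fun n => (n + 1) ^ (d + 2) with hJ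
  obtain ⟨a, ha⟩ : ∃ a : ℕ → ℝ, a = fun n : ℕ => Real.exp (s * A * (2 + n) ^ d) *
      ((2 * (J n : ℕ) + 1 : ℝ) ^ N * (B * ρ ^ n)) ^ (J n + 1) := ⟨_, rfl⟩
  have hasum : Summable a := by
    rw [ha]
    exact summable_exp_mul_pow (s * A) B (mul_nonneg hs hA) hB d N hρ0 hρ1
  have ha0 : ∀ n, 0 ≤ a n := fun n => by rw [ha]; positivity
  have hexp : ∀ n, Integrable (fun ω => Real.exp (-(s * X n ω))) ν := fun n =>
    integrable_exp_neg_mul (hX n) hs (hlow n)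
  have hstep : ∀ n, ∫ ω, Real.exp (-(s * X (n + 1) ω)) ∂ν ≤
      Real.exp (s * τ ^ n) * ∫ ω, Real.exp (-(s * X n ω)) ∂ν + a n := by
    intro n
    -- Either the increment is at most `τ^n`, and the exponential grows by a factor `exp (s τ^n)`,
    -- or the deterministic lower bound applies on a set whose indicator is bounded by a high power
    -- of the increment.
    have hpt : ∀ ω, Real.exp (-(s * X (n + 1) ω)) ≤ Real.exp (s * τ ^ n) *
        Real.exp (-(s * X n ω)) + Real.exp (s * A * (2 + n) ^ d) / (τ ^ n) ^ (2 * (J n + 1)) *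
          (X (n + 1) ω - X n ω) ^ (2 * (J n + 1)) := by
      intro ω
      by_cases h : |X (n + 1) ω - X n ω| ≤ τ ^ n
      · have h1 : Real.exp (-(s * X (n + 1) ω)) ≤ Real.exp (s * τ ^ n) *
            Real.exp (-(s * X n ω)) := by
          rw [← Real.exp_add, Real.exp_le_exp]
          have h2 := mul_le_mul_of_nonneg_left (neg_le_of_abs_le h) hs
          linarith
        have h3 : 0 ≤ Real.exp (s * A * (2 + n) ^ d) / (τ ^ n) ^ (2 * (J n + 1)) *
            (X (n + 1) ω - X n ω) ^ (2 * (J n + 1)) :=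
          mul_nonneg (by positivity) (Even.pow_nonneg (even_two_mul _) _)
        linarith
      · have h1 : (τ ^ n) ^ (2 * (J n + 1)) ≤ (X (n + 1) ω - X n ω) ^ (2 * (J n + 1)) := by
          rw [← (even_two_mul (J n + 1)).pow_abs (X (n + 1) ω - X n ω)]
          exact pow_le_pow_left₀ (by positivity) (not_le.1 h).le _
        have h2 : Real.exp (-(s * X (n + 1) ω)) ≤ Real.exp (s * A * (2 + n) ^ d) := by
          rw [Real.exp_le_exp]
          have h3 := mul_le_mul_of_nonneg_left (hlow (n + 1) ω) hs
          push_cast at h3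
          rw [show (1 + ((n : ℝ) + 1)) = 2 + n by ring] at h3
          linarith
        have h4 : 0 ≤ Real.exp (s * τ ^ n) * Real.exp (-(s * X n ω)) := by positivity
        rw [div_mul_eq_mul_div, mul_div_assoc]
        have h5 : 1 ≤ (X (n + 1) ω - X n ω) ^ (2 * (J n + 1)) / (τ ^ n) ^ (2 * (J n + 1)) :=
          (one_le_div (by positivity)).2 h1
        have h6 := le_mul_of_one_le_right (Real.exp_pos (s * A * (2 + n) ^ d)).le h5
        linarith
    have h1 : Integrable (fun ω => Real.exp (s * τ ^ n) * Real.exp (-(s * X n ω))) ν :=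
      (hexp n).const_mul _
    have h2 := (hint n (J n)).const_mul (Real.exp (s * A * (2 + n) ^ d) / (τ ^ n) ^ (2 * (J n + 1)))
    refine (integral_mono (hexp (n + 1)) (h1.add h2) hpt).trans ?_
    simp only [Pi.add_apply]
    rw [integral_add h1 h2, integral_const_mul, integral_const_mul]
    refine add_le_add_right ?_ _
    refine (mul_le_mul_of_nonneg_left (hmom n (J n)) (by positivity)).trans (le_of_eq ?_)
    rw [ha]
    simp only
    rw [div_mul_eq_mul_div, mul_div_assoc, pow_mul _ 2, ← div_pow]
    congr 2
    rw [← pow_mul, mul_comm n 2, pow_mul, hτ2, ← hρ2, ← pow_mul, mul_comm 2 n, pow_mul]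
    field_simp
  set y : ℕ → ℝ := fun n => ∫ ω, Real.exp (-(s * X n ω)) ∂ν with hy
  have hy0 : ∀ n, 0 ≤ y n := fun n => integral_nonneg fun ω => (Real.exp_pos _).le
  -- A discrete Grönwall inequality: both the exponents `s τ^k` and the errors `a k` are summable.
  have hind : ∀ n, y n ≤ Real.exp (s * ∑ k ∈ Finset.range n, τ ^ k) *
      (y 0 + ∑ k ∈ Finset.range n, a k) := by
    intro n
    induction n with
    | zero => simp
    | succ n ih =>
      rw [Finset.sum_range_succ, Finset.sum_range_succ, mul_add s, Real.exp_add]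
      set S := ∑ k ∈ Finset.range n, τ ^ k with hS
      have hS0 : 0 ≤ S := Finset.sum_nonneg fun k _ => (pow_pos hτ0 k).le
      have h1 : 1 ≤ Real.exp (s * S) * Real.exp (s * τ ^ n) := by
        rw [← Real.exp_add]
        exact Real.one_le_exp (by positivity)
      have h2 := mul_le_mul_of_nonneg_left ih (Real.exp_pos (s * τ ^ n)).le
      have h3 := le_mul_of_one_le_left (ha0 n) h1
      have h4 := hstep n
      simp only [hy] at h2 h4 ⊢
      linarith
  refine ⟨Real.exp (s * ∑' k, τ ^ k) * (y 0 + ∑' k, a k), fun n => (hind n).trans ?_⟩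
  have hτs := summable_geometric_of_lt_one hτ0.le hτ1
  refine mul_le_mul (Real.exp_le_exp.2 (mul_le_mul_of_nonneg_left
    (hτs.sum_le_tsum _ fun k _ => (pow_pos hτ0 k).le) hs))
    (add_le_add_right (hasum.sum_le_tsum _ fun k _ => ha0 k) _)
    (add_nonneg (hy0 0) (Finset.sum_nonneg fun k _ => ha0 k)) (Real.exp_pos _).le

theorem exists_tendsto_eLpNorm {X : ℕ → Ω → ℝ} (hX : ∀ n, MemLp (X n) 2 ν) {B θ : ℝ} (hB : 0 ≤ B)
    (hθ0 : 0 < θ) (hθ : θ < 1) (hmom : ∀ n : ℕ, ∫ ω, (X (n + 1) ω - X n ω) ^ 2 ∂ν ≤ B * θ ^ n) :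
    ∃ W, MemLp W 2 ν ∧ Tendsto (fun n => eLpNorm (X n - W) 2 ν) atTop (𝓝 0) := by
  have hc : CauchySeq fun n => (hX n).toLp := by
    refine cauchySeq_of_le_geometric (√θ) (√B) (by rw [Real.sqrt_lt' one_pos]; simpa using hθ)
      fun n => ?_
    rw [dist_comm, Lp.dist_def]
    have h1 := ((hX (n + 1)).sub (hX n)).eLpNorm_eq_integral_rpow_norm two_ne_zero ENNReal.ofNat_ne_top
    have h2 : eLpNorm (⇑(hX (n + 1)).toLp - ⇑(hX n).toLp) 2 ν = eLpNorm (X (n + 1) - X n) 2 ν :=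
      eLpNorm_congr_ae ((hX (n + 1)).coeFn_toLp.sub (hX n).coeFn_toLp)
    rw [h2, h1, ENNReal.toReal_ofReal (by positivity)]
    simp only [ENNReal.toReal_ofNat, Real.rpow_two, Pi.sub_apply, Real.norm_eq_abs, sq_abs]
    rw [← one_div, ← Real.sqrt_eq_rpow]
    refine (Real.sqrt_le_sqrt (hmom n)).trans (le_of_eq ?_)
    have h3 : √(θ ^ n) = √θ ^ n := by
      rw [Real.sqrt_eq_iff_mul_self_eq (by positivity) (by positivity), ← mul_pow,
        Real.mul_self_sqrt hθ0.le]
    rw [Real.sqrt_mul hB, h3]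
  obtain ⟨W, hW⟩ := cauchySeq_tendsto_of_complete hc
  refine ⟨W, Lp.memLp W, ?_⟩
  have h := (Lp.tendsto_Lp_iff_tendsto_eLpNorm' _ _).1 hW
  refine h.congr fun n => eLpNorm_congr_ae ?_
  exact (hX n).coeFn_toLp.sub EventuallyEq.rfl

/-- Separates the difference, small in `L²`, from exponentials controlled in `L⁴`. -/
theorem abs_exp_neg_sub_le (a b : ℝ) :
    |Real.exp (-a) - Real.exp (-b)| ≤ |a - b| * (Real.exp (-a) + Real.exp (-b)) := by
  have key : ∀ x y : ℝ, Real.exp (-x) - Real.exp (-y) ≤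
      |x - y| * (Real.exp (-x) + Real.exp (-y)) := by
    intro x y
    have h1 := Real.add_one_le_exp (x - y)
    have h2 : Real.exp (-y) = Real.exp (-x) * Real.exp (x - y) := by
      rw [← Real.exp_add]
      congr 1
      ring
    have h3 := mul_le_mul_of_nonneg_left h1 (Real.exp_pos (-x)).le
    have h4 := mul_le_mul_of_nonneg_right (neg_le_abs (x - y)) (Real.exp_pos (-x)).le
    have h5 := mul_nonneg (abs_nonneg (x - y)) (Real.exp_pos (-y)).le
    rw [← h2] at h3
    linarith
  refine abs_le.2 ⟨?_, key a b⟩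
  have := key b a
  rw [abs_sub_comm b a, add_comm] at this
  linarith

/-- Convergence of the expectations `∫ F e^{-X_n}`. -/
theorem tendsto_integral_mul_exp_neg {X : ℕ → Ω → ℝ} (hX : ∀ n, Measurable (X n))
    {W : Ω → ℝ} (hW : MemLp W 2 ν) (hXW : Tendsto (fun n => eLpNorm (X n - W) 2 ν) atTop (𝓝 0))
    {M : ℝ} (hint : ∀ n, Integrable (fun ω => Real.exp (-(4 * X n ω))) ν)
    (hM : ∀ n, ∫ ω, Real.exp (-(4 * X n ω)) ∂ν ≤ M) {F : Ω → ℝ} (hF : MemLp F 4 ν) :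
    Integrable (fun ω => F ω * Real.exp (-W ω)) ν ∧
      Tendsto (fun n => ∫ ω, F ω * Real.exp (-X n ω) ∂ν) atTop
        (𝓝 (∫ ω, F ω * Real.exp (-W ω) ∂ν)) := by
  have : ENNReal.HolderTriple 4 4 2 := ⟨by
    rw [← two_mul, show (4 : ENNReal) = 2 * 2 by norm_num,
      ENNReal.mul_inv (Or.inl two_ne_zero) (Or.inl ENNReal.ofNat_ne_top), ← mul_assoc,
      ENNReal.mul_inv_cancel two_ne_zero ENNReal.ofNat_ne_top, one_mul]⟩
  set E : (Ω → ℝ) → Ω → ℝ := fun Y ω => Real.exp (-Y ω) with hE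
  set Cst : ENNReal := ENNReal.ofReal (M ^ ((4 : ℝ)⁻¹)) with hCst
  have hXm : ∀ n, AEStronglyMeasurable (E (X n)) ν := fun n => by
    have := hX n
    exact (Real.measurable_exp.comp this.neg).aestronglyMeasurable
  have hWm : AEStronglyMeasurable (E W) ν :=
    (Real.continuous_exp.comp continuous_neg).comp_aestronglyMeasurable hW.1
  have hpow : ∀ Y : Ω → ℝ, ∀ ω, ‖E Y ω‖ ^ (4 : ℝ) = Real.exp (-(4 * Y ω)) := fun Y ω => by
    rw [hE, Real.norm_of_nonneg (Real.exp_pos _).le, ← Real.exp_mul]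
    congr 1
    ring
  have hXE : ∀ n, MemLp (E (X n)) 4 ν := fun n => by
    rw [← integrable_norm_rpow_iff (hXm n) (by norm_num) (by norm_num)]
    simpa only [ENNReal.toReal_ofNat, hpow] using hint n
  have hXb : ∀ n, eLpNorm (E (X n)) 4 ν ≤ Cst := fun n => by
    rw [(hXE n).eLpNorm_eq_integral_rpow_norm (by norm_num) (by norm_num)]
    simp only [ENNReal.toReal_ofNat, hpow]
    exact ENNReal.ofReal_le_ofReal (Real.rpow_le_rpow
      (integral_nonneg fun ω => (Real.exp_pos _).le) (hM n) (by norm_num))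
  -- Convergence in `L²` gives an almost surely convergent subsequence, and Fatou's lemma passes the
  -- bound on to the limit.
  have hWb : eLpNorm (E W) 4 ν ≤ Cst := by
    obtain ⟨u, -, hu⟩ := (tendstoInMeasure_of_tendsto_eLpNorm two_ne_zero
      (fun n => (hX n).aestronglyMeasurable) hW.1 hXW).exists_seq_tendsto_ae
    refine Lp.eLpNorm_le_of_ae_tendsto (u := atTop) (f := fun n => E (X (u n)))
      (Eventually.of_forall fun n => hXb (u n)) (fun n => hXm (u n)) ?_
    filter_upwards [hu] with ω hω
    exact (Real.continuous_exp.tendsto _).comp hω.neg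
  have hWE : MemLp (E W) 4 ν := ⟨hWm, hWb.trans_lt ENNReal.ofReal_lt_top⟩
  have hFX : ∀ n, Integrable (fun ω => F ω * E (X n) ω) ν := fun n =>
    ((hXE n).mul' hF (r := 2)).integrable one_le_two
  have hFW : Integrable (fun ω => F ω * E W ω) ν := (hWE.mul' hF (r := 2)).integrable one_le_two
  refine ⟨hFW, tendsto_integral_of_L1' _ hFW.aestronglyMeasurable (Eventually.of_forall hFX) ?_⟩
  -- Hölder's inequality with exponents `2`, `4`, `4`.
  have hle : ∀ n, eLpNorm ((fun ω => F ω * E (X n) ω) - fun ω => F ω * E W ω) 1 ν ≤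
      eLpNorm (X n - W) 2 ν * (eLpNorm F 4 ν * (Cst + Cst)) := by
    intro n
    have h1 : eLpNorm ((fun ω => F ω * E (X n) ω) - fun ω => F ω * E W ω) 1 ν ≤
        eLpNorm ((X n - W) • (F • (E (X n) + E W))) 1 ν := by
      refine eLpNorm_mono fun ω => ?_
      simp only [Pi.sub_apply, Pi.smul_apply', Pi.mul_apply, Pi.add_apply, smul_eq_mul]
      rw [← mul_sub, norm_mul, norm_mul, norm_mul, mul_left_comm]
      refine mul_le_mul_of_nonneg_left ?_ (norm_nonneg _)
      rw [Real.norm_of_nonneg (add_pos (Real.exp_pos _) (Real.exp_pos _)).le]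
      exact abs_exp_neg_sub_le _ _
    refine h1.trans ((eLpNorm_smul_le_mul_eLpNorm (p := 2) (q := 2) ?_ ?_).trans ?_)
    · exact hF.1.smul ((hXm n).add hWm)
    · exact (hX n).aestronglyMeasurable.sub hW.1
    · gcongr
      refine (eLpNorm_smul_le_mul_eLpNorm (p := 4) (q := 4) ((hXm n).add hWm) hF.1).trans ?_
      gcongr
      refine (eLpNorm_add_le (hXm n) hWm (by norm_num)).trans ?_
      exact add_le_add (hXb n) hWb
  refine tendsto_of_tendsto_of_tendsto_of_le_of_le tendsto_const_nhds ?_ (fun n => bot_le) hle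
  have hne : eLpNorm F 4 ν * (Cst + Cst) ≠ ⊤ :=
    ENNReal.mul_ne_top hF.2.ne (ENNReal.add_ne_top.2 ⟨ENNReal.ofReal_ne_top, ENNReal.ofReal_ne_top⟩)
  have := ENNReal.Tendsto.mul_const hXW (Or.inr hne)
  rwa [zero_mul] at this

end Nelson

/-! ### Increments of the regularized interaction -/

theorem sum_pow_two_mul_le {τ : Type*} (T : Finset τ) (z : τ → ℝ) (j : ℕ) :
    (∑ t ∈ T, z t) ^ (2 * (j + 1)) ≤ (T.card : ℝ) ^ (2 * j + 1) * ∑ t ∈ T, z t ^ (2 * (j + 1)) := by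
  rcases T.eq_empty_or_nonempty with rfl | hT
  · simp
  have hc : (0 : ℝ) < (T.card : ℝ) ^ (2 * j + 1) := pow_pos (Nat.cast_pos.2 hT.card_pos) _
  have h := pow_sum_div_card_le_sum_pow (s := T) (f := fun t => |z t|) (fun t _ => abs_nonneg _)
    (2 * j + 1)
  rw [div_le_iff₀ hc, show 2 * j + 1 + 1 = 2 * (j + 1) by ring] at h
  simp only [(even_two_mul (j + 1)).pow_abs] at h
  rw [mul_comm (_ ^ (2 * j + 1)), ← (even_two_mul (j + 1)).pow_abs (∑ t ∈ T, z t)]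
  exact (pow_le_pow_left₀ (abs_nonneg _) (Finset.abs_sum_le_sum_abs _ _) _).trans h

section Moments

variable {Ω : Type*} [MeasurableSpace Ω] {ν : Measure Ω}

theorem integrable_sum_pow {τ : Type*} {T : Finset τ} {Z : τ → Ω → ℝ}
    (hm : ∀ t ∈ T, Measurable (Z t)) (j : ℕ)
    (hint : ∀ t ∈ T, Integrable (fun ω => Z t ω ^ (2 * (j + 1))) ν) :
    Integrable (fun ω => (∑ t ∈ T, Z t ω) ^ (2 * (j + 1))) ν := by
  refine ((integrable_finsetSum T hint).const_mul ((T.card : ℝ) ^ (2 * j + 1))).mono'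
    ((Finset.measurable_fun_sum T hm).pow_const _).aestronglyMeasurable
    (Eventually.of_forall fun ω => ?_)
  rw [Real.norm_of_nonneg (Even.pow_nonneg (even_two_mul _) _)]
  exact sum_pow_two_mul_le T (fun t => Z t ω) j

theorem integral_sum_pow_le {τ : Type*} {T : Finset τ} {Z : τ → Ω → ℝ}
    (hm : ∀ t ∈ T, Measurable (Z t)) (j : ℕ)
    (hint : ∀ t ∈ T, Integrable (fun ω => Z t ω ^ (2 * (j + 1))) ν) {S : ℝ}
    (hS : ∀ t ∈ T, ∫ ω, Z t ω ^ (2 * (j + 1)) ∂ν ≤ S ^ (j + 1)) :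
    ∫ ω, (∑ t ∈ T, Z t ω) ^ (2 * (j + 1)) ∂ν ≤ ((T.card : ℝ) ^ 2 * S) ^ (j + 1) := by
  refine (integral_mono (integrable_sum_pow hm j hint) ((integrable_finsetSum T hint).const_mul
    ((T.card : ℝ) ^ (2 * j + 1))) fun ω => sum_pow_two_mul_le T (fun t => Z t ω) j).trans ?_
  rw [integral_const_mul, integral_finsetSum T hint]
  refine (mul_le_mul_of_nonneg_left (Finset.sum_le_sum hS) (by positivity)).trans (le_of_eq ?_)
  rw [Finset.sum_const, nsmul_eq_mul]
  ring

end Moments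

namespace PadicModel

section Increments

variable {p : ℕ} [Fact p.Prime] {K : Type*} [DivisionRing K] [Algebra ℚ_[p] K]
  [FiniteDimensional ℚ_[p] K] [TopologicalSpace K] [T2Space K] [IsTopologicalAddGroup K]
  [ContinuousSMul ℚ_[p] K] [MeasurableSpace K] [BorelSpace K]
  [LocallyCompactSpace K] [SecondCountableTopology K] [ContinuousMul K]
  [TopologicalSpace.MetrizableSpace K] [DecidableEq K] {D : PadicModel p K}

variable (D) in
theorem isStep_indicator_region {j l : ℤ} (hj : j ≤ l) (C : Finset K) :
    D.IsStep j ((D.region l C).indicator fun _ => (1 : ℝ)) := by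
  intro x y h
  have h1 : x ∈ D.region l C ↔ y ∈ D.region l C := by
    constructor <;> intro h2
    · exact ball_subset_region hj h2 (D.mem_ball_comm.1 h)
    · exact ball_subset_region hj h2 h
  by_cases hx : x ∈ D.region l C
  · rw [Set.indicator_of_mem hx, Set.indicator_of_mem (h1.1 hx)]
  · rw [Set.indicator_of_notMem hx, Set.indicator_of_notMem (mt h1.2 hx)]

variable (D) in
-- Counting centres in a ball is measuring its intersection with the region.
theorem sum_centers_le {j l : ℤ} (hj : j ≤ l) (C : Finset K) {j' : ℤ} (hj' : j ≤ j') (c : K) :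
    D.q ^ j * ∑ d ∈ D.centers j (D.region l C),
      (D.ball j' c).indicator (fun _ => (1 : ℝ)) d ≤ D.q ^ j' := by
  have h := (isStep_indicator_region D hj C).integral_mul_step (D.separated_centers_region l j C)
    (fun x hx => by
      rw [region_centers_region D hj] at hx
      exact Set.indicator_of_notMem hx _)
    (g := (D.ball j' c).indicator fun _ => (1 : ℝ)) (by
      have := isStep_indicator_region D hj' {c}
      rwa [region_singleton] at this)
  rw [Finset.sum_congr rfl fun d hd => by
    rw [Set.indicator_of_mem (by
      have := mem_region_of_mem (D := D) (j := j) hd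
      rwa [region_centers_region D hj] at this), one_mul]] at h
  rw [← h]
  have h2 : ∀ x, (D.region l C).indicator (fun _ => (1 : ℝ)) x *
      (D.ball j' c).indicator (fun _ => (1 : ℝ)) x ≤ (D.ball j' c).indicator (fun _ => (1 : ℝ)) x :=
    fun x => mul_le_of_le_one_left (Set.indicator_nonneg (fun _ _ => zero_le_one) x)
      (Set.indicator_le_self' (fun _ _ => zero_le_one) x)
  have h3 : Integrable ((D.ball j' c).indicator fun _ => (1 : ℝ)) D.vol :=
    (D.integrableOn_ball continuous_const j' c).integrable_indicator (D.measurableSet_ball j' c)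
  refine (integral_mono_of_nonneg (Eventually.of_forall fun x => mul_nonneg
    (Set.indicator_nonneg (fun _ _ => zero_le_one) x)
    (Set.indicator_nonneg (fun _ _ => zero_le_one) x)) h3 (Eventually.of_forall h2)).trans ?_
  exact ((integral_indicator_one (D.measurableSet_ball j' c)).trans (D.vol_real_ball j' c)).le

variable (D) in
theorem card_centers {j l : ℤ} (hj : j ≤ l) (C : Finset K) :
    D.q ^ j * ((D.centers j (D.region l C)).card : ℝ) = D.vol.real (D.region l C) := by
  have h := (isStep_indicator_region D hj C).integral_mul_step (D.separated_centers_region l j C)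
    (fun x hx => by
      rw [region_centers_region D hj] at hx
      exact Set.indicator_of_notMem hx _)
    (g := fun _ => (1 : ℝ)) (fun _ _ _ => rfl)
  rw [Finset.sum_congr rfl fun d hd => by
    rw [Set.indicator_of_mem (by
      have := mem_region_of_mem (D := D) (j := j) hd
      rwa [region_centers_region D hj] at this), one_mul]] at h
  simp only [mul_one] at h
  refine Eq.trans ?_ (h.symm.trans (integral_indicator_one (D.isOpen_region l C).measurableSet))
  simp

/-- Only the nonnegativity of the form at `f - g` and `f + g` is needed. -/
theorem abs_greenBilin_le {l : ℤ} {C : Finset K} {A : ℝ} {f g : TestFun (D.region l C)}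
    (hf : D.greenBilin l C f f ≤ A) (hg : D.greenBilin l C g g ≤ A) :
    |D.greenBilin l C f g| ≤ A := by
  have h1 := greenBilin_self_nonneg l C (f - g)
  have h2 := greenBilin_self_nonneg l C (f + g)
  have h3 := greenBilin_comm l C f g
  simp only [map_sub, map_add, LinearMap.sub_apply, LinearMap.add_apply] at h1 h2
  exact abs_le.2 ⟨by linarith, by linarith⟩

theorem abs_greenForm_pow_le {l : ℤ} {C : Finset K} {A : ℝ} {f g : K → ℝ}
    (hf : f ∈ TestFun (D.region l C)) (hg : g ∈ TestFun (D.region l C))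
    (hfA : D.greenForm (D.region l C) f f ≤ A) (hgA : D.greenForm (D.region l C) g g ≤ A) (n : ℕ) :
    |D.greenForm (D.region l C) f g ^ n| ≤ A ^ n := by
  rw [abs_pow]
  exact pow_le_pow_left₀ (abs_nonneg _)
    (abs_greenBilin_le (f := ⟨f, hf⟩) (g := ⟨g, hg⟩) hfA hgA) n

/-- A homogeneous component of the increment of the regularized interaction. -/
noncomputable def wickIncrement (D : PadicModel p K) (l : ℤ) (C : Finset K) (κ n : ℕ) (u : K → ℝ)
    (φ : Distr (D.region l C)) : ℝ :=
  ∑ c : D.centers (-((κ + 1 : ℕ) : ℤ)) (D.region l C), u c *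
    (wickPow n (D.greenForm (D.region l C) (D.deltaFun (κ + 1) c) (D.deltaFun (κ + 1) c))
        (φ.eval (D.deltaFun (κ + 1) c)) -
      wickPow n (D.greenForm (D.region l C) (D.deltaFun κ c) (D.deltaFun κ c))
        (φ.eval (D.deltaFun κ c)))

/-- The pairs of test functions in the increment. -/
noncomputable def incrementFun (D : PadicModel p K) (l : ℤ) (C : Finset K) (κ : ℕ) :
    D.centers (-((κ + 1 : ℕ) : ℤ)) (D.region l C) ⊕ D.centers (-((κ + 1 : ℕ) : ℤ)) (D.region l C) →
      K → ℝ :=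
  Sum.elim (fun c => D.deltaFun (κ + 1) c) fun c => D.deltaFun κ c

/-- The coefficients of the pairs in the increment. -/
noncomputable def incrementWeight (D : PadicModel p K) (l : ℤ) (C : Finset K) (κ : ℕ) (u : K → ℝ) :
    D.centers (-((κ + 1 : ℕ) : ℤ)) (D.region l C) ⊕ D.centers (-((κ + 1 : ℕ) : ℤ)) (D.region l C) →
      ℝ :=
  Sum.elim (fun c => u c) fun c => -u c

variable {l : ℤ} {C : Finset K} {κ : ℕ}

theorem mem_region_of_mem_centers {j : ℤ} (hj : j ≤ l) {c : K}
    (hc : c ∈ D.centers j (D.region l C)) : c ∈ D.region l C := by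
  have := mem_region_of_mem (D := D) (j := j) hc
  rwa [region_centers_region D hj] at this

theorem incrementFun_mem (hκ : -(κ : ℤ) ≤ l) (x) :
    D.incrementFun l C κ x ∈ TestFun (D.region l C) := by
  rcases x with c | c
  · exact deltaFun_mem (by push_cast; omega) (mem_region_of_mem_centers (by push_cast; omega) c.2)
  · exact deltaFun_mem hκ (mem_region_of_mem_centers (by push_cast; omega) c.2)

theorem wickIncrement_eq (n : ℕ) (u : K → ℝ) (φ : Distr (D.region l C)) :
    D.wickIncrement l C κ n u φ = ∑ x, incrementWeight D l C κ u x *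
        wickPow n ((Matrix.of fun x y => D.greenForm (D.region l C) (D.incrementFun l C κ x)
          (D.incrementFun l C κ y)) x x) (φ.eval (D.incrementFun l C κ x)) := by
  rw [Fintype.sum_sum_type, wickIncrement, ← Finset.sum_add_distrib]
  refine Finset.sum_congr rfl fun c _ => ?_
  simp only [Sum.elim_inl, Sum.elim_inr, Matrix.of_apply, incrementFun, incrementWeight]
  ring

/-- Orthogonality of Wick powers turns the second moment into a double sum of mixed second
differences of powers of the covariance. Covariances at separated points do not change with the
cutoff, so a term vanishes unless the two centres are within `q^{i-κ}` of each other; near the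
diagonal the variances bound it. -/
theorem integral_wickIncrement_sq_le {i : ℕ} (hi : D.IsRange i)
    {ν : Measure (Distr (D.region l C))} (hν : D.IsDirichletField (D.region l C) ν)
    (hκ : (i : ℤ) - l ≤ κ) {A : ℝ} (hA : ∀ x ∈ D.region l C, ∀ k ∈ Finset.Icc κ (κ + 1),
      D.greenForm (D.region l C) (D.deltaFun k x) (D.deltaFun k x) ≤ A) (hA0 : 0 ≤ A)
    {u : K → ℝ} {b : ℝ} (hu : ∀ x, |u x| ≤ D.q ^ (-((κ + 1 : ℕ) : ℤ)) * b) (n : ℕ) :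
    ∫ φ, D.wickIncrement l C κ n u φ ^ 2 ∂ν ≤
      n.factorial * (4 * b ^ 2 * A ^ n * D.vol.real (D.region l C) * D.q ^ ((i : ℤ) - κ)) := by
  have := hν.1
  have hκl : -(κ : ℤ) ≤ l := by omega
  have hκl' : -((κ + 1 : ℕ) : ℤ) ≤ l := by push_cast; omega
  set E := D.centers (-((κ + 1 : ℕ) : ℤ)) (D.region l C) with hE
  have hG := hν.isGaussianFamily (D.incrementFun l C κ) (incrementFun_mem hκl)
  simp only [wickIncrement_eq]
  rw [hG.integral_wickSum_sq]
  refine mul_le_mul_of_nonneg_left ?_ (by positivity)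
  set G := D.greenForm (D.region l C) with hGdef
  set Q := D.q ^ (-((κ + 1 : ℕ) : ℤ)) with hQ
  have hQ0 : 0 < Q := zpow_pos D.q_pos _
  have hmem : ∀ c : E, (c : K) ∈ D.region l C := fun c => mem_region_of_mem_centers hκl' c.2
  have hbr : ∀ c d : E, u c * u d * (G (D.deltaFun (κ + 1) c) (D.deltaFun (κ + 1) d) ^ n -
      G (D.deltaFun (κ + 1) c) (D.deltaFun κ d) ^ n - G (D.deltaFun κ c) (D.deltaFun (κ + 1) d) ^ n +
      G (D.deltaFun κ c) (D.deltaFun κ d) ^ n) ≤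
      Q * b * (Q * b) * (4 * A ^ n) *
        (D.ball (-((κ : ℤ) - i)) c).indicator (fun _ => (1 : ℝ)) (d : K) := by
    intro c d
    by_cases hcd : (d : K) ∈ D.ball (-((κ : ℤ) - i)) c
    · rw [Set.indicator_of_mem hcd, mul_one]
      have hb : ∀ k ∈ Finset.Icc κ (κ + 1), ∀ k' ∈ Finset.Icc κ (κ + 1),
          |G (D.deltaFun k c) (D.deltaFun k' d) ^ n| ≤ A ^ n := by
        intro k hk k' hk'
        have hk1 := (Finset.mem_Icc.1 hk).1
        have hk2 := (Finset.mem_Icc.1 hk').1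
        exact abs_greenForm_pow_le (deltaFun_mem (by omega) (hmem c))
          (deltaFun_mem (by omega) (hmem d)) (hA _ (hmem c) k hk) (hA _ (hmem d) k' hk') n
      have m1 : κ ∈ Finset.Icc κ (κ + 1) := by simp
      have m2 : κ + 1 ∈ Finset.Icc κ (κ + 1) := by simp
      refine (le_abs_self _).trans ?_
      rw [abs_mul, abs_mul]
      refine mul_le_mul (mul_le_mul (hu c) (hu d) (abs_nonneg _) ((abs_nonneg _).trans (hu c))) ?_
        (abs_nonneg _) (mul_self_nonneg _)
      have h1 := abs_le.1 (hb _ m2 _ m2)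
      have h2 := abs_le.1 (hb _ m2 _ m1)
      have h3 := abs_le.1 (hb _ m1 _ m2)
      have h4 := abs_le.1 (hb _ m1 _ m1)
      exact abs_le.2 ⟨by linarith, by linarith⟩
    · rw [Set.indicator_of_notMem hcd, mul_zero]
      have hdc : (c : K) ∉ D.ball (-((κ : ℤ) - i)) d := mt D.mem_ball_comm.1 hcd
      rw [hGdef, greenForm_delta_of_notMem hi hκ (Nat.le_succ κ) (hmem d) (hmem c) hdc,
        greenForm_delta_of_notMem hi hκ le_rfl (hmem d) (hmem c) hdc]
      simp
  have hsum : ∀ c : E, ∑ d : E, (D.ball (-((κ : ℤ) - i)) c).indicator (fun _ => (1 : ℝ)) (d : K) ≤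
      D.q ^ ((i : ℤ) - κ) / Q := by
    intro c
    rw [le_div_iff₀ hQ0, mul_comm]
    have := sum_centers_le D hκl' C (j' := -((κ : ℤ) - i)) (by push_cast; omega) c
    rw [neg_sub] at this ⊢
    rwa [← Finset.sum_coe_sort] at this
  -- The number of sites and the number of neighbours of each carry a factor `1 / Q`; both cancel
  -- against the weights `Q * b`.
  have hcard : (Fintype.card E : ℝ) = D.vol.real (D.region l C) / Q := by
    rw [eq_div_iff hQ0.ne', mul_comm, Fintype.card_coe]
    exact card_centers D hκl' C
  calc _ = ∑ c : E, ∑ d : E, u c * u d * (G (D.deltaFun (κ + 1) c) (D.deltaFun (κ + 1) d) ^ n -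
      G (D.deltaFun (κ + 1) c) (D.deltaFun κ d) ^ n - G (D.deltaFun κ c) (D.deltaFun (κ + 1) d) ^ n +
      G (D.deltaFun κ c) (D.deltaFun κ d) ^ n) := by
        rw [Fintype.sum_sum_type, ← Finset.sum_add_distrib]
        refine Finset.sum_congr rfl fun c _ => ?_
        rw [Fintype.sum_sum_type, Fintype.sum_sum_type, ← Finset.sum_add_distrib,
          ← Finset.sum_add_distrib, ← Finset.sum_add_distrib]
        refine Finset.sum_congr rfl fun d _ => ?_
        simp only [Sum.elim_inl, Sum.elim_inr, Matrix.of_apply, incrementFun, incrementWeight]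
        ring
    _ ≤ ∑ c : E, Q * b * (Q * b) * (4 * A ^ n) * (D.q ^ ((i : ℤ) - κ) / Q) := by
        refine Finset.sum_le_sum fun c _ => (Finset.sum_le_sum fun d _ => hbr c d).trans ?_
        rw [← Finset.mul_sum]
        exact mul_le_mul_of_nonneg_left (hsum c)
          (mul_nonneg (mul_self_nonneg _) (by positivity))
    _ = _ := by
        rw [Finset.sum_const, nsmul_eq_mul, Finset.card_univ, hcard]
        field_simp

theorem integrable_wickIncrement_pow {ν : Measure (Distr (D.region l C))}
    (hν : D.IsDirichletField (D.region l C) ν) (hκl : -(κ : ℤ) ≤ l) (n : ℕ) (u : K → ℝ) (k : ℕ) :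
    Integrable (fun φ => D.wickIncrement l C κ n u φ ^ k) ν := by
  have := hν.1
  simp only [wickIncrement_eq]
  exact (hν.isGaussianFamily _ (incrementFun_mem hκl)).integrable_wickSum_pow _ n k

theorem integral_wickIncrement_pow_le {ν : Measure (Distr (D.region l C))}
    (hν : D.IsDirichletField (D.region l C) ν) (hκl : -(κ : ℤ) ≤ l) (n : ℕ) (u : K → ℝ) (j : ℕ) :
    ∫ φ, D.wickIncrement l C κ n u φ ^ (2 * (j + 1)) ∂ν ≤
      ((2 * j + 1) ^ n * ∫ φ, D.wickIncrement l C κ n u φ ^ 2 ∂ν) ^ (j + 1) := by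
  have := hν.1
  simp only [wickIncrement_eq]
  exact (hν.isGaussianFamily _ (incrementFun_mem hκl)).integral_wickSum_pow_le _ n j

end Increments

end PadicModel

/-! ### Moments of the regularized interaction -/

theorem wickPow_eq_sum_wickPow (k : ℕ) (c d t : ℝ) :
    wickPow k c t = ∑ j ∈ Finset.range (k + 1), wickCoeff k j * d ^ j * wickPow (k - 2 * j) (c + d) t := by
  rw [← eval_wickX, wickX_eq_sum_wickX k c d, eval_finsetSum]
  exact Finset.sum_congr rfl fun j _ => by rw [eval_mul, eval_C, eval_wickX]

namespace PadicModel

section Interaction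

variable {p : ℕ} [Fact p.Prime] {K : Type*} [DivisionRing K] [Algebra ℚ_[p] K]
  [FiniteDimensional ℚ_[p] K] [TopologicalSpace K] [T2Space K] [IsTopologicalAddGroup K]
  [ContinuousSMul ℚ_[p] K] [MeasurableSpace K] [BorelSpace K]
  [LocallyCompactSpace K] [SecondCountableTopology K] [ContinuousMul K]
  [TopologicalSpace.MetrizableSpace K] [DecidableEq K] {D : PadicModel p K}
  {l : ℤ} {C : Finset K}

/-- The scale may be finer than the cutoff, so that the interactions at cutoffs `κ` and `κ + 1`
become sums over the same centres. -/
theorem regInteraction_eq_sum (P : ℝ[X]) {g : K → ℝ} (hg : g ∈ TestFun (D.region l C)) {κ : ℕ}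
    {j : ℤ} (hj : j ≤ l) (hjκ : j ≤ -(κ : ℤ)) (hgj : D.IsStep j g) (φ : Distr (D.region l C)) :
    D.regInteraction P g κ φ = D.q ^ j * ∑ c ∈ D.centers j (D.region l C),
      g c * wickPoly P (D.freeKern κ 0) (φ.eval (D.deltaFun κ c)) := by
  rw [regInteraction]
  simp only [freeVariance_deltaFun]
  rw [← hgj.integral_mul_step (g := fun x => wickPoly P (D.freeKern κ 0) (φ.eval (D.deltaFun κ x)))
    (D.separated_centers_region l j C) (by rw [region_centers_region D hj]; exact hg.2)
    fun x y h => by simp only [deltaFun_of_mem (D.ball_subset_ball hjκ y h)]]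
  exact integral_congr_ae (Eventually.of_forall fun x => mul_comm _ _)

theorem measurable_regInteraction (P : ℝ[X]) {g : K → ℝ} (hg : g ∈ TestFun (D.region l C)) (κ : ℕ) :
    Measurable (D.regInteraction (U := D.region l C) P g κ) := by
  obtain ⟨j, hj, hs⟩ := exists_common_scale ![(⟨g, hg⟩ : TestFun (D.region l C))]
  have h1 : D.IsStep j g := hs 0
  have h2 : D.regInteraction (U := D.region l C) P g κ = fun φ =>
      D.q ^ (min j (-(κ : ℤ))) * ∑ c ∈ D.centers (min j (-(κ : ℤ))) (D.region l C),
      g c * wickPoly P (D.freeKern κ 0) (φ.eval (D.deltaFun κ c)) :=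
    _root_.funext fun φ => regInteraction_eq_sum P hg ((min_le_left _ _).trans hj)
      (min_le_right _ _) (h1.mono (min_le_left _ _)) φ
  rw [h2]
  refine Measurable.const_mul (Finset.measurable_fun_sum _ fun c _ => Measurable.const_mul ?_ _) _
  exact (continuous_wickPoly P _).measurable.comp (Distr.measurable_eval _)

theorem memLp_regInteraction (P : ℝ[X]) {g : K → ℝ} (hg : g ∈ TestFun (D.region l C)) {κ : ℕ}
    (hκ : -(κ : ℤ) ≤ l) {ν : Measure (Distr (D.region l C))}
    (hν : D.IsDirichletField (D.region l C) ν) :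
    MemLp (D.regInteraction (U := D.region l C) P g κ) 2 ν := by
  have := hν.1
  obtain ⟨j, hj, hs⟩ := exists_common_scale ![(⟨g, hg⟩ : TestFun (D.region l C))]
  have h1 : D.IsStep j g := hs 0
  have h2 : D.regInteraction (U := D.region l C) P g κ = fun φ =>
      D.q ^ (min j (-(κ : ℤ))) * ∑ c : D.centers (min j (-(κ : ℤ))) (D.region l C),
      g c * wickPoly P (D.freeKern κ 0) (φ.eval (D.deltaFun κ c)) := by
    refine _root_.funext fun φ => ?_
    rw [regInteraction_eq_sum P hg ((min_le_left _ _).trans hj)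
      (min_le_right _ _) (h1.mono (min_le_left _ _)) φ, ← Finset.sum_coe_sort]
  have hmem : ∀ c : D.centers (min j (-(κ : ℤ))) (D.region l C),
      D.deltaFun κ c ∈ TestFun (D.region l C) := fun c =>
    deltaFun_mem hκ (mem_region_of_mem_centers ((min_le_left _ _).trans hj) c.2)
  have hG := hν.isGaussianFamily _ hmem
  rw [memLp_two_iff_integrable_sq (measurable_regInteraction P hg κ).aestronglyMeasurable, h2]
  refine (hG.integrable_eval ((MvPolynomial.C (D.q ^ (min j (-(κ : ℤ)))) *
    ∑ c : D.centers (min j (-(κ : ℤ))) (D.region l C), MvPolynomial.C (g c) *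
    Polynomial.aeval (MvPolynomial.X c) (wickPolyX P (D.freeKern κ 0))) ^ 2)).congr
      (Eventually.of_forall fun φ => ?_)
  simp only [map_pow, MvPolynomial.eval_mul, MvPolynomial.eval_C, MvPolynomial.eval_sum]
  congr 2
  refine Finset.sum_congr rfl fun c _ => ?_
  congr 1
  rw [← eval_wickPolyX, ← MvPolynomial.coe_aeval_eq_eval, RingHom.coe_coe,
    ← Polynomial.aeval_algHom_apply, MvPolynomial.aeval_X, Polynomial.coe_aeval_eq_eval]

/-- The difference of the Dirichlet and the free variances of the field at a point. -/
noncomputable def varianceShift (D : PadicModel p K) (l : ℤ) (C : Finset K) (κ₀ : ℕ) (x : K) : ℝ :=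
  D.greenForm (D.region l C) (D.deltaFun κ₀ x) (D.deltaFun κ₀ x) - D.freeKern κ₀ 0

theorem exists_varianceShift_le (l : ℤ) (C : Finset K) (κ₀ : ℕ) :
    ∃ M, 0 ≤ M ∧ ∀ x ∈ D.region l C, |D.varianceShift l C κ₀ x| ≤ M := by
  set j := min l (-(κ₀ : ℤ)) with hj
  refine ⟨∑ c ∈ D.centers j (D.region l C), |D.varianceShift l C κ₀ c|,
    Finset.sum_nonneg fun c _ => abs_nonneg _, fun x hx => ?_⟩
  rw [← region_centers_region D (min_le_left _ _ : j ≤ l), mem_region] at hx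
  obtain ⟨c, hc, hxc⟩ := hx
  have h : D.varianceShift l C κ₀ x = D.varianceShift l C κ₀ c := by
    rw [varianceShift, varianceShift, deltaFun_of_mem (D.ball_subset_ball (min_le_right _ _) c hxc)]
  rw [h]
  exact Finset.single_le_sum (f := fun c => |D.varianceShift l C κ₀ c|)
    (fun c _ => abs_nonneg _) hc

/-- The index set of the homogeneous components of the increments. -/
def incrementIndex (N : ℕ) : Finset (Σ _ : ℕ, ℕ) :=
  (Finset.range (N + 1)).sigma fun k => Finset.range (k + 1)

/-- The coefficients of the homogeneous components of the increments. -/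
noncomputable def incrementCoeff (D : PadicModel p K) (l : ℤ) (C : Finset K) (κ₀ : ℕ) (Q : ℝ[X])
    (g : K → ℝ) (κ : ℕ) (t : Σ _ : ℕ, ℕ) (x : K) : ℝ :=
  D.q ^ (-((κ + 1 : ℕ) : ℤ)) *
    (g x * (Q.coeff t.1 * (wickCoeff t.1 t.2 * D.varianceShift l C κ₀ x ^ t.2)))

/-- One shift `d` re-orders both Wick polynomials. The lower-order terms then enter with equal
coefficients, and only differences of Wick powers of equal order remain. -/
theorem mul_wickPoly_sub_eq (Q : ℝ[X]) (s a b d t t' : ℝ) :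
    s * wickPoly Q b t' - s * wickPoly Q a t = ∑ x ∈ incrementIndex Q.natDegree,
      s * (Q.coeff x.1 * (wickCoeff x.1 x.2 * d ^ x.2)) *
        (wickPow (x.1 - 2 * x.2) (b + d) t' - wickPow (x.1 - 2 * x.2) (a + d) t) := by
  rw [incrementIndex, Finset.sum_sigma, wickPoly_eq_sum_range le_rfl, wickPoly_eq_sum_range le_rfl,
    Finset.mul_sum, Finset.mul_sum, ← Finset.sum_sub_distrib]
  refine Finset.sum_congr rfl fun k _ => ?_
  rw [wickPow_eq_sum_wickPow k a d, wickPow_eq_sum_wickPow k b d, Finset.mul_sum, Finset.mul_sum,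
    Finset.mul_sum, Finset.mul_sum, ← Finset.sum_sub_distrib]
  exact Finset.sum_congr rfl fun j _ => by ring

variable {i : ℕ} (hi : D.IsRange i)
include hi

/-- Orthogonality requires Wick ordering with respect to the Dirichlet variance, whereas the
interaction is ordered with respect to the free one. Their difference is the same at both cutoffs,
so the re-ordering produces homogeneous increments. -/
theorem regInteraction_succ_sub (Q : ℝ[X]) {g : K → ℝ} (hg : g ∈ TestFun (D.region l C))
    {κ₀ κ : ℕ} (hκ₀ : (i : ℤ) - l ≤ κ₀) (hκ : κ₀ ≤ κ) (hgκ : D.IsStep (-(κ : ℤ)) g)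
    (φ : Distr (D.region l C)) :
    D.regInteraction Q g (κ + 1) φ - D.regInteraction Q g κ φ =
      ∑ t ∈ incrementIndex Q.natDegree,
        D.wickIncrement l C κ (t.1 - 2 * t.2) (D.incrementCoeff l C κ₀ Q g κ t) φ := by
  have hj : -((κ + 1 : ℕ) : ℤ) ≤ l := by push_cast; omega
  have hj' : -((κ + 1 : ℕ) : ℤ) ≤ -(κ : ℤ) := by push_cast; omega
  rw [regInteraction_eq_sum Q hg hj le_rfl (hgκ.mono hj'),
    regInteraction_eq_sum Q hg hj hj' (hgκ.mono hj'), ← mul_sub, ← Finset.sum_sub_distrib,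
    Finset.mul_sum]
  simp only [wickIncrement]
  rw [Finset.sum_comm, ← Finset.sum_coe_sort]
  refine Finset.sum_congr rfl fun c _ => ?_
  have hc : (c : K) ∈ D.region l C := mem_region_of_mem_centers hj c.2
  rw [mul_wickPoly_sub_eq Q _ _ _ (D.varianceShift l C κ₀ c), Finset.mul_sum]
  have e1 : ∀ k, κ₀ ≤ k → D.freeKern k 0 + D.varianceShift l C κ₀ c =
      D.greenForm (D.region l C) (D.deltaFun k c) (D.deltaFun k c) := fun k hk => by
    rw [varianceShift, ← greenForm_delta_self hi hκ₀ hk hc]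
    ring
  rw [e1 κ hκ, e1 (κ + 1) (by omega)]
  refine Finset.sum_congr rfl fun t _ => ?_
  rw [incrementCoeff]
  ring

/-- Moments of the increments of the regularized interaction. -/
theorem exists_increment_moment_le (Q : ℝ[X]) {g : K → ℝ} (hg : g ∈ TestFun (D.region l C))
    {κ₀ κ₁ : ℕ} (hκ₀ : (i : ℤ) - l ≤ κ₀) (hκ₁ : κ₀ ≤ κ₁) (hgκ : D.IsStep (-(κ₁ : ℤ)) g)
    {ν : Measure (Distr (D.region l C))} (hν : D.IsDirichletField (D.region l C) ν) :
    ∃ B θ, 0 ≤ B ∧ 0 < θ ∧ θ < 1 ∧ ∀ n j : ℕ,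
      Integrable (fun φ => (D.regInteraction Q g (κ₁ + (n + 1)) φ -
        D.regInteraction Q g (κ₁ + n) φ) ^ (2 * (j + 1))) ν ∧
      ∫ φ, (D.regInteraction Q g (κ₁ + (n + 1)) φ -
        D.regInteraction Q g (κ₁ + n) φ) ^ (2 * (j + 1)) ∂ν ≤
        ((2 * j + 1) ^ Q.natDegree * (B * θ ^ n)) ^ (j + 1) := by
  have := hν.1
  set N := Q.natDegree with hN
  obtain ⟨M, hM0, hM⟩ := exists_varianceShift_le (D := D) l C κ₀
  obtain ⟨A, hA0, hA⟩ := D.exists_freeKern_zero_le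
  obtain ⟨G, hG0, hG⟩ := exists_bound_of_mem_testFun D hg
  set b := ∑ t ∈ incrementIndex N, G * (|Q.coeff t.1| * (|wickCoeff t.1 t.2| * M ^ t.2)) with hb
  have hb0 : 0 ≤ b := Finset.sum_nonneg fun t _ => by positivity
  have hu : ∀ κ, ∀ t ∈ incrementIndex N, ∀ x, |D.incrementCoeff l C κ₀ Q g κ t x| ≤
      D.q ^ (-((κ + 1 : ℕ) : ℤ)) * b := by
    intro κ t ht x
    rw [incrementCoeff, abs_mul, abs_of_pos (zpow_pos D.q_pos _)]
    refine mul_le_mul_of_nonneg_left ?_ (zpow_pos D.q_pos _).le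
    by_cases hx : x ∈ D.region l C
    · refine le_trans ?_ (Finset.single_le_sum (f := fun t : (Σ _ : ℕ, ℕ) =>
        G * (|Q.coeff t.1| * (|wickCoeff t.1 t.2| * M ^ t.2))) (fun t _ => by positivity) ht)
      rw [abs_mul, abs_mul, abs_mul, abs_pow]
      have h1 := hG x
      have h2 := hM x hx
      gcongr
    · rw [hg.2 x hx, zero_mul, abs_zero]
      exact hb0
  -- The Dirichlet variance differs from the free one by a bounded amount, hence grows at most
  -- linearly as well.
  have hvar : ∀ κ, κ₀ ≤ κ → ∀ x ∈ D.region l C, ∀ k ∈ Finset.Icc κ (κ + 1),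
      D.greenForm (D.region l C) (D.deltaFun k x) (D.deltaFun k x) ≤ 1 + (A + M) * (2 + κ) := by
    intro κ hκ x hx k hk
    rw [Finset.mem_Icc] at hk
    have h1 := greenForm_delta_self hi hκ₀ (hκ.trans hk.1) hx
    have h2 := (le_abs_self _).trans (hM x hx)
    rw [varianceShift] at h2
    have h3 := hA k
    have h4 : A * (1 + k) ≤ A * (2 + κ) := by
      refine mul_le_mul_of_nonneg_left ?_ hA0
      have : (k : ℝ) ≤ κ + 1 := by exact_mod_cast hk.2
      linarith
    have h5 : M ≤ M * (2 + κ) := le_mul_of_one_le_right hM0 (by linarith [κ.cast_nonneg (α := ℝ)])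
    linarith
  have hqi0 : 0 < (D.q)⁻¹ := inv_pos.2 D.q_pos
  have hqi1 : (D.q)⁻¹ < 1 := inv_lt_one_of_one_lt₀ D.one_lt_q
  -- Any rate strictly between `q⁻¹` and `1` absorbs the polynomial growth of the variances.
  set θ := ((D.q)⁻¹ + 1) / 2 with hθ
  obtain ⟨B₀, hB₀, hB⟩ := exists_one_add_pow_mul_geometric_le N hqi0
    (show (D.q)⁻¹ < θ by rw [hθ]; linarith)
  set a := 1 + (A + M) * (2 + κ₁) with ha
  have ha1 : 1 ≤ a := by
    have : 0 ≤ (A + M) * (2 + κ₁) := by positivity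
    rw [ha]
    linarith
  set R := N.factorial * (4 * b ^ 2 * a ^ N * D.vol.real (D.region l C) * D.q ^ ((i : ℤ) - κ₁))
    with hR
  have hq0 := zpow_pos D.q_pos ((i : ℤ) - κ₁)
  have hR0 : 0 ≤ R := by
    have := measureReal_nonneg (μ := D.vol) (s := D.region l C)
    positivity
  have hsq : ∀ n : ℕ, ∀ t ∈ incrementIndex N,
      ∫ φ, D.wickIncrement l C (κ₁ + n) (t.1 - 2 * t.2)
        (D.incrementCoeff l C κ₀ Q g (κ₁ + n) t) φ ^ 2 ∂ν ≤ R * (B₀ * θ ^ n) := by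
    intro n t ht
    have htN : t.1 - 2 * t.2 ≤ N := by
      rw [incrementIndex, Finset.mem_sigma, Finset.mem_range] at ht
      omega
    have hA1 : 1 ≤ 1 + (A + M) * (2 + ((κ₁ + n : ℕ) : ℝ)) := by
      have : 0 ≤ (A + M) * (2 + ((κ₁ + n : ℕ) : ℝ)) := by positivity
      linarith
    refine (integral_wickIncrement_sq_le hi hν (by push_cast; omega)
      (hvar (κ₁ + n) (by omega)) (by linarith) (hu (κ₁ + n) t ht) _).trans ?_
    have h1 : (1 + (A + M) * (2 + ((κ₁ + n : ℕ) : ℝ))) ^ (t.1 - 2 * t.2) ≤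
        a ^ N * (1 + n) ^ N := by
      refine (pow_le_pow_right₀ hA1 htN).trans ?_
      rw [← mul_pow]
      refine pow_le_pow_left₀ (by linarith) ?_ N
      rw [ha]
      push_cast
      have h2 : 0 ≤ (A + M) * (1 + κ₁) * n := by positivity
      nlinarith [n.cast_nonneg (α := ℝ)]
    have h2 : D.q ^ ((i : ℤ) - ((κ₁ + n : ℕ) : ℤ)) = D.q ^ ((i : ℤ) - κ₁) * (D.q)⁻¹ ^ n := by
      rw [inv_pow, ← zpow_natCast, ← zpow_neg, ← zpow_add₀ D.q_pos.ne']
      congr 1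
      push_cast
      ring
    have h3 : ((t.1 - 2 * t.2).factorial : ℝ) ≤ N.factorial :=
      Nat.cast_le.2 (Nat.factorial_le htN)
    have h4 := measureReal_nonneg (μ := D.vol) (s := D.region l C)
    rw [h2]
    calc _ ≤ (N.factorial : ℝ) * (4 * b ^ 2 * (a ^ N * (1 + n) ^ N) * D.vol.real (D.region l C) *
          (D.q ^ ((i : ℤ) - κ₁) * (D.q)⁻¹ ^ n)) := by gcongr
      _ = R * ((1 + n) ^ N * (D.q)⁻¹ ^ n) := by rw [hR]; ring
      _ ≤ _ := mul_le_mul_of_nonneg_left (hB n) hR0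
  refine ⟨((incrementIndex N).card : ℝ) ^ 2 * (R * B₀), θ, by positivity, by positivity,
    by rw [hθ]; linarith, fun n j => ?_⟩
  have hκl : -((κ₁ + n : ℕ) : ℤ) ≤ l := by push_cast; omega
  have heq : ∀ φ : Distr (D.region l C), D.regInteraction Q g (κ₁ + (n + 1)) φ -
      D.regInteraction Q g (κ₁ + n) φ = ∑ t ∈ incrementIndex N,
        D.wickIncrement l C (κ₁ + n) (t.1 - 2 * t.2) (D.incrementCoeff l C κ₀ Q g (κ₁ + n) t) φ :=
    fun φ => regInteraction_succ_sub hi (κ := κ₁ + n) Q hg hκ₀ (by omega) (hgκ.mono (by push_cast; omega)) φ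
  have hmeas : ∀ t ∈ incrementIndex N, Measurable (D.wickIncrement l C (κ₁ + n) (t.1 - 2 * t.2)
      (D.incrementCoeff l C κ₀ Q g (κ₁ + n) t)) := by
    intro t _
    have hw : ∀ k c, Measurable (wickPow k c) := fun k c => by
      have : wickPow k c = fun t => (wickX k c).eval t := by
        ext t
        rw [eval_wickX]
      rw [this]
      exact (wickX k c).continuous.measurable
    refine Finset.measurable_fun_sum _ fun c _ => Measurable.const_mul (Measurable.sub ?_ ?_) _
    · exact (hw _ _).comp (Distr.measurable_eval _)
    · exact (hw _ _).comp (Distr.measurable_eval _)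
  have hint : ∀ t ∈ incrementIndex N, Integrable (fun φ => D.wickIncrement l C (κ₁ + n)
      (t.1 - 2 * t.2) (D.incrementCoeff l C κ₀ Q g (κ₁ + n) t) φ ^ (2 * (j + 1))) ν := fun t _ =>
    integrable_wickIncrement_pow hν hκl _ _ _
  simp only [heq]
  refine ⟨integrable_sum_pow hmeas j hint, (integral_sum_pow_le hmeas j hint
    (S := (2 * j + 1) ^ N * (R * (B₀ * θ ^ n))) fun t ht => ?_).trans (le_of_eq ?_)⟩
  · refine (integral_wickIncrement_pow_le hν hκl _ _ j).trans ?_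
    have h0 : 0 ≤ ∫ φ, D.wickIncrement l C (κ₁ + n) (t.1 - 2 * t.2)
        (D.incrementCoeff l C κ₀ Q g (κ₁ + n) t) φ ^ 2 ∂ν := integral_nonneg fun φ => sq_nonneg _
    have htN : t.1 - 2 * t.2 ≤ N := by
      rw [incrementIndex, Finset.mem_sigma, Finset.mem_range] at ht
      omega
    refine pow_le_pow_left₀ (mul_nonneg (by positivity) h0) (mul_le_mul ?_ (hsq n t ht) h0
      (by positivity)) _
    exact pow_le_pow_right₀ (by linarith [j.cast_nonneg (α := ℝ)]) htN
  · congr 1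
    ring

end Interaction

end PadicModel

/-! ### The interaction and convergence of the cutoff theories -/

namespace PadicModel

section Limit

variable {p : ℕ} [Fact p.Prime] {K : Type*} [DivisionRing K] [Algebra ℚ_[p] K]
  [FiniteDimensional ℚ_[p] K] [TopologicalSpace K] [T2Space K] [IsTopologicalAddGroup K]
  [ContinuousSMul ℚ_[p] K] [MeasurableSpace K] [BorelSpace K]
  [LocallyCompactSpace K] [SecondCountableTopology K] [ContinuousMul K]
  [TopologicalSpace.MetrizableSpace K] [DecidableEq K] {D : PadicModel p K}
  {l : ℤ} {C : Finset K}

theorem eval_eq_sum {κ : ℕ} (hκ : -(κ : ℤ) ≤ l) {f : K → ℝ} (hf : f ∈ TestFun (D.region l C))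
    (hfκ : D.IsStep (-(κ : ℤ)) f) (φ : Distr (D.region l C)) :
    φ.eval f = ∑ c ∈ D.centers (-(κ : ℤ)) (D.region l C),
      f c * D.q ^ (-(κ : ℤ)) * φ.eval (D.deltaFun κ c) := by
  have h1 := hfκ.eq_sum_deltaFun (D.separated_centers_region l (-(κ : ℤ)) C)
    (by rw [region_centers_region D hκ]; exact hf.2)
  have hmem : ∀ c ∈ D.centers (-(κ : ℤ)) (D.region l C), D.deltaFun κ c ∈ TestFun (D.region l C) :=
    fun c hc => deltaFun_mem hκ (mem_region_of_mem_centers hκ hc)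
  have h2 : (⟨f, hf⟩ : TestFun (D.region l C)) = ∑ c : D.centers (-(κ : ℤ)) (D.region l C),
      (f c * D.q ^ (-(κ : ℤ))) • (⟨D.deltaFun κ c, hmem c c.2⟩ : TestFun (D.region l C)) := by
    refine Subtype.ext ?_
    rw [Submodule.coe_sum]
    refine h1.trans ?_
    rw [← Finset.sum_coe_sort]
    rfl
  rw [Distr.eval_of_mem φ hf, h2, map_sum,
    ← Finset.sum_coe_sort (D.centers (-(κ : ℤ)) (D.region l C))]
  refine Finset.sum_congr rfl fun c _ => ?_
  rw [map_smul, smul_eq_mul, Distr.eval_of_mem φ (hmem c c.2)]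

/-- At cutoffs that resolve `g` the linear term is exactly `λ φ(g)`. It can then be moved to the
observable, leaving an interaction `Q` that is bounded below. -/
theorem regInteraction_sub (Q : ℝ[X]) (lam : ℝ) {g : K → ℝ} (hg : g ∈ TestFun (D.region l C))
    {κ : ℕ} (hκ : -(κ : ℤ) ≤ l) (hgκ : D.IsStep (-(κ : ℤ)) g) (φ : Distr (D.region l C)) :
    D.regInteraction (Q - Polynomial.C lam * X) g κ φ =
      D.regInteraction Q g κ φ - lam * φ.eval g := by
  rw [regInteraction_eq_sum _ hg hκ le_rfl hgκ, regInteraction_eq_sum _ hg hκ le_rfl hgκ,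
    eval_eq_sum hκ hg hgκ, Finset.mul_sum, Finset.mul_sum, Finset.mul_sum,
    ← Finset.sum_sub_distrib]
  refine Finset.sum_congr rfl fun c _ => ?_
  rw [wickPoly_C_mul_sub]
  ring

/-- The lower bound of a Wick polynomial is polynomial in the variance, and the free variance is at
most linear in the cutoff; this is the polynomial lower bound required by Nelson's argument. -/
theorem exists_regInteraction_ge {Q : ℝ[X]} (hQ_even : ∀ k, Odd k → Q.coeff k = 0)
    (hQ_lead : 0 < Q.leadingCoeff) {g : K → ℝ} (hg : g ∈ TestFun (D.region l C))
    (hg0 : ∀ x, 0 ≤ g x) {κ₁ : ℕ} (hκ₁ : -(κ₁ : ℤ) ≤ l) (hgκ : D.IsStep (-(κ₁ : ℤ)) g) :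
    ∃ A d, 0 ≤ A ∧ ∀ (n : ℕ) (φ : Distr (D.region l C)),
      -(A * (1 + n) ^ d) ≤ D.regInteraction Q g (κ₁ + n) φ := by
  obtain ⟨B, d, hB, hQ⟩ := exists_wickPoly_ge (natDegree_even_of_even hQ_even hQ_lead) hQ_lead
  obtain ⟨A, hA0, hA⟩ := D.exists_freeKern_zero_le
  obtain ⟨G, hG0, hG⟩ := exists_bound_of_mem_testFun D hg
  have hvol := measureReal_nonneg (μ := D.vol) (s := D.region l C)
  refine ⟨D.vol.real (D.region l C) * (G * (B * (1 + A * (1 + κ₁)) ^ d)), d, by positivity,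
    fun n φ => ?_⟩
  have hκ : -((κ₁ + n : ℕ) : ℤ) ≤ l := by push_cast; omega
  rw [regInteraction_eq_sum Q hg hκ le_rfl (hgκ.mono (by push_cast; omega))]
  have hv := D.freeKern_zero_nonneg (κ₁ + n)
  have h1 : ∀ c ∈ D.centers (-((κ₁ + n : ℕ) : ℤ)) (D.region l C),
      -(G * (B * (1 + D.freeKern (κ₁ + n) 0) ^ d)) ≤
      g c * wickPoly Q (D.freeKern (κ₁ + n) 0) (φ.eval (D.deltaFun (κ₁ + n) c)) := fun c _ =>
    mul_wickPoly_ge hB hQ (hg0 c) ((le_abs_self _).trans (hG c)) hv _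
  have h2 := mul_le_mul_of_nonneg_left (Finset.sum_le_sum h1)
    (zpow_pos D.q_pos (-((κ₁ + n : ℕ) : ℤ))).le
  refine le_trans ?_ h2
  rw [Finset.sum_const, nsmul_eq_mul, ← mul_assoc (D.q ^ _), card_centers D hκ, mul_neg,
    neg_le_neg_iff, mul_assoc (D.vol.real _)]
  refine mul_le_mul_of_nonneg_left ?_ hvol
  rw [mul_assoc, mul_assoc B, ← mul_pow]
  refine mul_le_mul_of_nonneg_left (mul_le_mul_of_nonneg_left (pow_le_pow_left₀ (by linarith) ?_ d)
    hB) hG0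
  have h3 := hA (κ₁ + n)
  push_cast at h3
  have h4 : 0 ≤ A * κ₁ * n := by positivity
  nlinarith [n.cast_nonneg (α := ℝ)]

/-- The observable together with the factor `exp (λ φ(g))` transferred from the interaction; `L⁴` is
what Hölder's inequality will ask for. -/
theorem IsDirichletField.memLp_prod_mul_exp {ν : Measure (Distr (D.region l C))}
    (hν : D.IsDirichletField (D.region l C) ν) {g : K → ℝ} (hg : g ∈ TestFun (D.region l C))
    (lam : ℝ) {r : ℕ} {f : Fin r → K → ℝ} (hf : ∀ i, f i ∈ TestFun (D.region l C)) :
    MemLp (fun φ : Distr (D.region l C) => (∏ i, φ.eval (f i)) * Real.exp (lam * φ.eval g)) 4 ν := by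
  have := hν.1
  have hG := hν.isGaussianFamily (fun o : Option (Fin r) => o.elim g f) (by
    rintro (_ | k)
    · exact hg
    · exact hf k)
  have hm : AEStronglyMeasurable (fun φ : Distr (D.region l C) =>
      (∏ i, φ.eval (f i)) * Real.exp (lam * φ.eval g)) ν := by
    refine Measurable.aestronglyMeasurable (Measurable.mul ?_ ?_)
    · exact Finset.measurable_fun_prod _ fun i _ => Distr.measurable_eval _
    · exact Real.measurable_exp.comp ((Distr.measurable_eval g).const_mul lam)
  rw [← integrable_norm_rpow_iff hm (by norm_num) (by norm_num)]
  have hc : Continuous fun t : Option (Fin r) → ℝ =>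
      ((∏ i, t (some i)) * Real.exp (lam * t none)) ^ 4 := by fun_prop
  have key := (hG.integrable_comp_iff hc).2 (by
    refine (integrable_exp_norm_multivariateGaussian _ 1 (4 * (r + |lam|))).mono' (by fun_prop)
      (Eventually.of_forall fun t => ?_)
    rw [norm_pow, norm_mul, norm_prod, one_mul, Real.norm_of_nonneg (Real.exp_pos _).le]
    have h1 : ∏ k, ‖t.ofLp (some k)‖ ≤ Real.exp (r * ‖t‖) := by
      rw [Real.exp_nat_mul]
      refine (Finset.prod_le_prod (fun k _ => norm_nonneg _) fun k _ =>
        (PiLp.norm_apply_le t (some k)).trans ((le_add_of_nonneg_right zero_le_one).trans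
          (Real.add_one_le_exp ‖t‖))).trans (le_of_eq ?_)
      rw [Finset.prod_const, Finset.card_univ, Fintype.card_fin]
    have h2 : lam * t.ofLp none ≤ |lam| * ‖t‖ := by
      refine (le_abs_self _).trans ?_
      rw [abs_mul]
      exact mul_le_mul_of_nonneg_left (PiLp.norm_apply_le t none) (abs_nonneg _)
    calc _ ≤ (Real.exp (r * ‖t‖) * Real.exp (|lam| * ‖t‖)) ^ 4 := by
          refine pow_le_pow_left₀ (mul_nonneg (Finset.prod_nonneg fun k _ => norm_nonneg _)
            (Real.exp_pos _).le) (mul_le_mul h1 (Real.exp_le_exp.2 h2) (Real.exp_pos _).le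
            (Real.exp_pos _).le) 4
      _ = _ := by
          rw [← Real.exp_add, ← Real.exp_nat_mul]
          congr 1
          push_cast
          ring)
  refine key.congr (Eventually.of_forall fun φ => ?_)
  simp only [Option.elim_none, Option.elim_some, ENNReal.toReal_ofNat]
  rw [show (4 : ℝ) = ((4 : ℕ) : ℝ) by norm_num, Real.rpow_natCast, Real.norm_eq_abs,
    Even.pow_abs (by decide)]

variable (D) in
theorem exists_cutoff (l : ℤ) (C : Finset K) {ι : Type*} [Finite ι] (i : ℕ) (f : ι → K → ℝ)
    (hf : ∀ k, f k ∈ TestFun (D.region l C)) : ∃ κ₁ : ℕ, (i : ℤ) - l ≤ κ₁ ∧ -(κ₁ : ℤ) ≤ l ∧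
      ∀ k, D.IsStep (-(κ₁ : ℤ)) (f k) := by
  obtain ⟨j, hj, hs⟩ := exists_common_scale (D := D) (l := l) (C := C) fun k => ⟨f k, hf k⟩
  exact ⟨(j.natAbs + l.natAbs + i), by omega, by omega,
    fun k => (hs k).mono (by omega)⟩

theorem tendsto_eLpNorm_regInteraction_iff (Q : ℝ[X]) (lam : ℝ) {g : K → ℝ}
    (hg : g ∈ TestFun (D.region l C)) {κ₁ : ℕ} (hκ₁ : -(κ₁ : ℤ) ≤ l)
    (hgκ : D.IsStep (-(κ₁ : ℤ)) g) (ν : Measure (Distr (D.region l C)))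
    (W : Distr (D.region l C) → ℝ) :
    Tendsto (fun κ => eLpNorm (D.regInteraction (Q - Polynomial.C lam * X) g κ - W) 2 ν) atTop
      (𝓝 0) ↔
    Tendsto (fun n => eLpNorm (D.regInteraction Q g (κ₁ + n) -
      fun φ => W φ + lam * φ.eval g) 2 ν) atTop (𝓝 0) := by
  rw [← tendsto_add_atTop_iff_nat κ₁]
  refine tendsto_congr fun n => ?_
  congr 1
  ext φ
  rw [Pi.sub_apply, Pi.sub_apply, add_comm n κ₁,
    regInteraction_sub Q lam hg (by push_cast; omega) (hgκ.mono (by push_cast; omega))]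
  ring

theorem IsDirichletField.memLp_eval {ν : Measure (Distr (D.region l C))}
    (hν : D.IsDirichletField (D.region l C) ν) {g : K → ℝ} (hg : g ∈ TestFun (D.region l C))
    (lam : ℝ) : MemLp (fun φ : Distr (D.region l C) => lam * φ.eval g) 2 ν := by
  have := hν.1
  have h := hν.memLp_prod_mul_exp hg 0 (f := fun _ : Fin 1 => g) fun _ => hg
  simp only [Finset.univ_unique, Finset.prod_singleton, zero_mul, Real.exp_zero, mul_one] at h
  exact (h.mono_exponent (by norm_num)).const_mul lam

variable {i : ℕ} (hi : D.IsRange i)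
include hi

theorem IsDirichletField.exists_isInteraction (Q : ℝ[X]) (lam : ℝ) {g : K → ℝ}
    (hg : g ∈ TestFun (D.region l C)) {ν : Measure (Distr (D.region l C))}
    (hν : D.IsDirichletField (D.region l C) ν) :
    ∃ W, D.IsInteraction ν (Q - Polynomial.C lam * X) g W := by
  have := hν.1
  obtain ⟨κ₁, h1, h2, h3⟩ := exists_cutoff D l C i (fun _ : Unit => g) fun _ => hg
  obtain ⟨B, θ, hB, hθ0, hθ1, hmom⟩ := exists_increment_moment_le hi Q hg h1 le_rfl (h3 ()) hν
  obtain ⟨W, hW, hlim⟩ := exists_tendsto_eLpNorm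
    (X := fun n => D.regInteraction (U := D.region l C) Q g (κ₁ + n))
    (fun n => memLp_regInteraction Q hg (by push_cast; omega) hν) hB hθ0 hθ1
    -- The second moment is the case `j = 0`, where the hypercontractive constant is one.
    fun n => by simpa using (hmom n 0).2
  refine ⟨fun φ => W φ - lam * φ.eval g, hW.sub (hν.memLp_eval hg lam), ?_⟩
  rw [tendsto_eLpNorm_regInteraction_iff Q lam hg h2 (h3 ())]
  simpa only [sub_add_cancel] using hlim

theorem IsDirichletField.tendsto_integral {Q : ℝ[X]} (hQ_even : ∀ k, Odd k → Q.coeff k = 0)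
    (hQ_lead : 0 < Q.leadingCoeff) (lam : ℝ) {g : K → ℝ} (hg : g ∈ TestFun (D.region l C))
    (hg0 : ∀ x, 0 ≤ g x) {ν : Measure (Distr (D.region l C))}
    (hν : D.IsDirichletField (D.region l C) ν) {W : Distr (D.region l C) → ℝ}
    (hW : D.IsInteraction ν (Q - Polynomial.C lam * X) g W)
    {r : ℕ} {f : Fin r → K → ℝ} (hf : ∀ i, f i ∈ TestFun (D.region l C)) :
    Integrable (fun φ => (∏ i, φ.eval (f i)) * Real.exp (-W φ)) ν ∧
    Tendsto (fun κ => ∫ φ, (∏ i, φ.eval (f i)) *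
      Real.exp (-D.regInteraction (Q - Polynomial.C lam * X) g κ φ) ∂ν) atTop
      (𝓝 (∫ φ, (∏ i, φ.eval (f i)) * Real.exp (-W φ) ∂ν)) := by
  have := hν.1
  obtain ⟨κ₁, h1, h2, h3⟩ := exists_cutoff D l C i (fun _ : Unit => g) fun _ => hg
  obtain ⟨B, θ, hB, hθ0, hθ1, hmom⟩ := exists_increment_moment_le hi Q hg h1 le_rfl (h3 ()) hν
  obtain ⟨A, d, hA, hlow⟩ := exists_regInteraction_ge hQ_even hQ_lead hg hg0 h2 (h3 ())
  have hmeas : ∀ n, Measurable (D.regInteraction (U := D.region l C) Q g (κ₁ + n)) := fun n =>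
    measurable_regInteraction Q hg _
  -- Exponential moments of order `4` match the `L⁴` bound of the observable.
  obtain ⟨M, hM⟩ := exists_integral_exp_neg_le hmeas hA hlow hB hθ0 hθ1
    (fun n j => (hmom n j).1) (fun n j => (hmom n j).2) (s := 4) (by norm_num)
  have key := tendsto_integral_mul_exp_neg hmeas (hW.1.add (hν.memLp_eval hg lam))
    ((tendsto_eLpNorm_regInteraction_iff Q lam hg h2 (h3 ()) ν W).1 hW.2)
    (fun n => integrable_exp_neg_mul (hmeas n) (by norm_num) (hlow n)) hM
    (hν.memLp_prod_mul_exp hg lam hf)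
  have e1 : ∀ φ : Distr (D.region l C), (∏ i, φ.eval (f i)) * Real.exp (lam * φ.eval g) *
      Real.exp (-(W φ + lam * φ.eval g)) = (∏ i, φ.eval (f i)) * Real.exp (-W φ) := fun φ => by
    rw [mul_assoc, ← Real.exp_add]
    congr 2
    ring
  have e2 : ∀ n, ∀ φ : Distr (D.region l C), (∏ i, φ.eval (f i)) * Real.exp (lam * φ.eval g) *
      Real.exp (-D.regInteraction Q g (κ₁ + n) φ) = (∏ i, φ.eval (f i)) *
        Real.exp (-D.regInteraction (Q - Polynomial.C lam * X) g (κ₁ + n) φ) := fun n φ => by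
    rw [regInteraction_sub Q lam hg (by push_cast; omega) ((h3 ()).mono (by push_cast; omega)),
      mul_assoc, ← Real.exp_add]
    congr 2
    ring
  simp only [Pi.add_apply, e1, e2] at key
  refine ⟨key.1, ?_⟩
  rw [← tendsto_add_atTop_iff_nat κ₁]
  simpa only [add_comm _ κ₁] using key.2

theorem IsDirichletField.schwingerConverges {Q : ℝ[X]} (hQ_even : ∀ k, Odd k → Q.coeff k = 0)
    (hQ_lead : 0 < Q.leadingCoeff) (lam : ℝ) {g : K → ℝ} (hg : g ∈ TestFun (D.region l C))
    (hg0 : ∀ x, 0 ≤ g x) {ν : Measure (Distr (D.region l C))}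
    (hν : D.IsDirichletField (D.region l C) ν) {W : Distr (D.region l C) → ℝ}
    (hW : D.IsInteraction ν (Q - Polynomial.C lam * X) g W)
    {r : ℕ} {f : Fin r → K → ℝ} (hf : ∀ i, f i ∈ TestFun (D.region l C)) :
    SchwingerConverges ν W f ∧
    Tendsto (fun κ => schwinger ν (D.regInteraction (Q - Polynomial.C lam * X) g κ) f) atTop
      (𝓝 (schwinger ν W f)) := by
  have := hν.1
  have h1 := hν.tendsto_integral hi hQ_even hQ_lead lam hg hg0 hW hf
  -- The partition function is the case of no observables.
  have h2 := hν.tendsto_integral hi hQ_even hQ_lead lam hg hg0 hW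
    (f := fun k : Fin 0 => k.elim0) fun k => k.elim0
  simp only [Finset.univ_eq_empty, Finset.prod_empty, one_mul] at h2
  exact ⟨⟨h2.1, h1.1⟩, h1.2.div h2.2 (integral_exp_pos h2.1).ne'⟩

end Limit

end PadicModel

/-! ### Comparison of the cutoff theories -/

namespace PadicModel

section Comparison

variable {p : ℕ} [Fact p.Prime] {K : Type*} [DivisionRing K] [Algebra ℚ_[p] K]
  [FiniteDimensional ℚ_[p] K] [TopologicalSpace K] [T2Space K] [IsTopologicalAddGroup K]
  [ContinuousSMul ℚ_[p] K] [MeasurableSpace K] [BorelSpace K]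
  [LocallyCompactSpace K] [SecondCountableTopology K] [ContinuousMul K]
  [TopologicalSpace.MetrizableSpace K] [DecidableEq K] {D : PadicModel p K}
  {l : ℤ} {C : Finset K}

theorem deltaFun_center {κ : ℕ} {E : Finset K} (hE : D.Separated (-(κ : ℤ)) E) (c d : E) :
    D.deltaFun κ c d = if d = c then D.q ^ κ else 0 := by
  rw [deltaFun]
  split_ifs with h
  · rw [h, Set.indicator_of_mem (D.mem_ball_self _ _)]
  · rw [Set.indicator_of_notMem]
    exact fun hm => (hE d d.2 c c.2 fun h' => h (Subtype.ext h')).not_ge hm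

/-- Approximate deltas have integral one instead of `L²` norm one, which rescales the precision
matrix by `q^{-κ}`. -/
theorem greenForm_deltaFun {κ : ℕ} (hκ : -(κ : ℤ) ≤ l) :
    (Matrix.of fun c d : D.centers (-(κ : ℤ)) (D.region l C) =>
      D.greenForm (D.region l C) (D.deltaFun κ c) (D.deltaFun κ d)) =
      (D.q ^ (-(κ : ℤ)) • D.precision (-(κ : ℤ)) (D.centers (-(κ : ℤ)) (D.region l C)))⁻¹ := by
  have hE := D.separated_centers_region l (-(κ : ℤ)) C
  have hdet : IsUnit (D.precision (-(κ : ℤ)) (D.centers (-(κ : ℤ)) (D.region l C))).det :=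
    (Matrix.isUnit_iff_isUnit_det _).1 (D.posDef_precision _ _).isUnit
  have hq : IsUnit (D.q ^ (-(κ : ℤ))) := (zpow_pos D.q_pos _).ne'.isUnit
  have hinv : (D.q ^ (-(κ : ℤ)) • D.precision (-(κ : ℤ)) (D.centers (-(κ : ℤ)) (D.region l C)))⁻¹ =
      D.q ^ κ • (D.precision (-(κ : ℤ)) (D.centers (-(κ : ℤ)) (D.region l C)))⁻¹ := by
    refine Matrix.inv_eq_right_inv ?_
    rw [Matrix.smul_mul, Matrix.mul_smul, smul_smul, q_zpow_neg_mul, one_smul,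
      Matrix.mul_nonsing_inv _ hdet]
  rw [hinv]
  ext c d
  have hc := deltaFun_mem (D := D) hκ (mem_region_of_mem_centers hκ c.2)
  rw [Matrix.of_apply, greenForm_eq_centers hκ (D.isStep_deltaFun κ c) hc.2 (D.isStep_deltaFun κ d)]
  simp only [deltaFun_center hE, ite_mul, zero_mul, mul_ite, mul_zero, Finset.sum_ite_eq',
    Finset.mem_univ, if_true]
  rw [Matrix.smul_apply, smul_eq_mul, ← mul_assoc, ← mul_assoc, q_zpow_neg_mul, one_mul, mul_comm]

/-- At a cutoff resolving all the data the half-Dirichlet theory is exactly a lattice theory: the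
interaction and the observables are functions of the field smeared with the approximate deltas at
the centres. -/
theorem IsDirichletField.schwinger_regInteraction {ν : Measure (Distr (D.region l C))}
    (hν : D.IsDirichletField (D.region l C) ν) (Q : ℝ[X]) (lam : ℝ) {g : K → ℝ}
    (hg : g ∈ TestFun (D.region l C)) {κ : ℕ} (hκ : -(κ : ℤ) ≤ l) (hgκ : D.IsStep (-(κ : ℤ)) g)
    {r : ℕ} {f : Fin r → K → ℝ} (hf : ∀ i, f i ∈ TestFun (D.region l C))
    (hfκ : ∀ i, D.IsStep (-(κ : ℤ)) (f i)) {E : Finset K}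
    (hE : E = D.centers (-(κ : ℤ)) (D.region l C)) :
    schwinger ν (D.regInteraction (Q - Polynomial.C lam * X) g κ) f =
    (∫ t : EuclideanSpace ℝ E, (∏ k, ∑ c : E, f k c * D.q ^ (-(κ : ℤ)) * t c) *
        spinWeight (fun c : E => fun x => D.q ^ (-(κ : ℤ)) * g c * wickPoly Q (D.freeKern κ 0) x)
          (fun c : E => D.q ^ (-(κ : ℤ)) * g c * lam) t.ofLp
        ∂multivariateGaussian 0 (D.q ^ (-(κ : ℤ)) • D.precision (-(κ : ℤ)) E)⁻¹) /
      (∫ t : EuclideanSpace ℝ E,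
        spinWeight (fun c : E => fun x => D.q ^ (-(κ : ℤ)) * g c * wickPoly Q (D.freeKern κ 0) x)
          (fun c : E => D.q ^ (-(κ : ℤ)) * g c * lam) t.ofLp
        ∂multivariateGaussian 0 (D.q ^ (-(κ : ℤ)) • D.precision (-(κ : ℤ)) E)⁻¹) := by
  have := hν.1
  subst hE
  set E := D.centers (-(κ : ℤ)) (D.region l C) with hE
  have hG := hν.isGaussianFamily (fun c : E => D.deltaFun κ c) fun c =>
    deltaFun_mem hκ (mem_region_of_mem_centers hκ c.2)
  rw [greenForm_deltaFun hκ] at hG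
  have hwc := continuous_spinWeight
    (V := fun c : E => fun x => D.q ^ (-(κ : ℤ)) * g c * wickPoly Q (D.freeKern κ 0) x)
    (h := fun c : E => D.q ^ (-(κ : ℤ)) * g c * lam)
    fun c => continuous_const.mul (continuous_wickPoly _ _)
  have e1 : ∀ φ : Distr (D.region l C),
      Real.exp (-D.regInteraction (Q - Polynomial.C lam * X) g κ φ) =
      spinWeight (fun c : E => fun x => D.q ^ (-(κ : ℤ)) * g c * wickPoly Q (D.freeKern κ 0) x)
        (fun c : E => D.q ^ (-(κ : ℤ)) * g c * lam) fun c => φ.eval (D.deltaFun κ c) := fun φ => by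
    rw [regInteraction_eq_sum _ hg hκ le_rfl hgκ, spinWeight, Finset.mul_sum,
      ← Finset.sum_coe_sort]
    congr 2
    refine Finset.sum_congr rfl fun c _ => ?_
    rw [wickPoly_C_mul_sub]
    ring
  have e2 : ∀ (φ : Distr (D.region l C)) k, φ.eval (f k) =
      ∑ c : E, f k c * D.q ^ (-(κ : ℤ)) * φ.eval (D.deltaFun κ c) := fun φ k => by
    rw [eval_eq_sum hκ (hf k) (hfκ k), ← Finset.sum_coe_sort]
  rw [schwinger]
  simp only [e1, e2]
  congr 1
  · exact hG.integral_comp (F := fun t => (∏ k, ∑ c : E, f k c * D.q ^ (-(κ : ℤ)) * t c) *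
      spinWeight (fun c : E => fun x => D.q ^ (-(κ : ℤ)) * g c * wickPoly Q (D.freeKern κ 0) x)
        (fun c : E => D.q ^ (-(κ : ℤ)) * g c * lam) t) (by fun_prop)
  · exact hG.integral_comp hwc

theorem testFun_mono {U U' : Set K} (h : U ⊆ U') {f : K → ℝ} (hf : f ∈ TestFun U) :
    f ∈ TestFun U' := ⟨hf.1, fun x hx => hf.2 x fun hx' => hx (h hx')⟩

/-- Ordering with respect to the free measure is essential: the variance `freeKern κ 0` in the
potential is common to both regions, whereas the Dirichlet variances differ. -/
theorem schwinger_regInteraction_le (hp : p ≠ 2) {Q : ℝ[X]}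
    (hQ_even : ∀ k, Odd k → Q.coeff k = 0) (hQ_lead : 0 < Q.leadingCoeff) {lam : ℝ}
    (hlam : 0 ≤ lam) {C' : Finset K} (hCC' : C ⊆ C') {ν : Measure (Distr (D.region l C))}
    (hν : D.IsDirichletField (D.region l C) ν) {ν' : Measure (Distr (D.region l C'))}
    (hν' : D.IsDirichletField (D.region l C') ν') {g : K → ℝ}
    (hg : g ∈ TestFun (D.region l C)) (hg0 : ∀ x, 0 ≤ g x) {κ : ℕ} (hκ : -(κ : ℤ) ≤ l)
    (hgκ : D.IsStep (-(κ : ℤ)) g) {r : ℕ} {f : Fin r → K → ℝ}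
    (hf : ∀ i, f i ∈ TestFun (D.region l C)) (hf0 : ∀ i x, 0 ≤ f i x)
    (hfκ : ∀ i, D.IsStep (-(κ : ℤ)) (f i)) :
    schwinger ν (D.regInteraction (Q - Polynomial.C lam * X) g κ) f ≤
      schwinger ν' (D.regInteraction (Q - Polynomial.C lam * X) g κ) f := by
  have hreg : D.region l C ⊆ D.region l C' := region_mono hCC'
  rw [hν.schwinger_regInteraction Q lam hg hκ hgκ hf hfκ rfl,
    hν'.schwinger_regInteraction Q lam (testFun_mono hreg hg) hκ hgκ
      (fun k => testFun_mono hreg (hf k)) hfκ rfl]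
  obtain ⟨B, d, hB, hQ⟩ := exists_wickPoly_ge (natDegree_even_of_even hQ_even hQ_lead) hQ_lead
  obtain ⟨G, hG0, hG⟩ := exists_bound_of_mem_testFun D hg
  have hq := zpow_pos D.q_pos (-(κ : ℤ))
  have hEE := centers_mono (D := D) (j := -(κ : ℤ)) (D.isCompact_region l C)
    (D.isCompact_region l C') hreg
  have hout : ∀ u ∈ TestFun (D.region l C), ∀ c, c ∈ D.centers (-(κ : ℤ)) (D.region l C') →
      c ∉ D.centers (-(κ : ℤ)) (D.region l C) → u c = 0 := fun u hu c hc hcE => by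
    have hu' : u ∈ TestFun (D.region (-(κ : ℤ)) (D.centers (-(κ : ℤ)) (D.region l C))) := by
      rwa [region_centers_region D hκ]
    exact (D.separated_centers_region l (-(κ : ℤ)) C').eq_zero_of_notMem hEE hu' hc hcE
  exact lattice_correlation_le hp (D.separated_centers_region l (-(κ : ℤ)) C') hEE hq
    (V := fun c x => D.q ^ (-(κ : ℤ)) * g c * wickPoly Q (D.freeKern κ 0) x)
    (h := fun c => D.q ^ (-(κ : ℤ)) * g c * lam)
    (f := fun k c => f k c * D.q ^ (-(κ : ℤ)))
    (fun c => continuous_const.mul (continuous_wickPoly _ _))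
    (fun c x => by rw [wickPoly_neg_of_even hQ_even])
    (fun c x => mul_wickPoly_ge hB hQ (mul_nonneg hq.le (hg0 c))
      (mul_le_mul_of_nonneg_left ((le_abs_self _).trans (hG c)) hq.le) (D.freeKern_zero_nonneg κ) x)
    (fun c => mul_nonneg (mul_nonneg hq.le (hg0 c)) hlam)
    (fun k c => mul_nonneg (hf0 k c) hq.le)
    (fun c hc hcE x => by rw [hout g hg c hc hcE, mul_zero, zero_mul])
    (fun c hc hcE => by rw [hout g hg c hc hcE, mul_zero, zero_mul])
    fun k c hc hcE => by rw [hout (f k) (hf k) c hc hcE, zero_mul]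

theorem schwinger_le (hp : p ≠ 2) {i : ℕ} (hi : D.IsRange i) {Q : ℝ[X]}
    (hQ_even : ∀ k, Odd k → Q.coeff k = 0) (hQ_lead : 0 < Q.leadingCoeff) {lam : ℝ}
    (hlam : 0 ≤ lam) {C' : Finset K} (hCC' : C ⊆ C') {ν : Measure (Distr (D.region l C))}
    (hν : D.IsDirichletField (D.region l C) ν) {ν' : Measure (Distr (D.region l C'))}
    (hν' : D.IsDirichletField (D.region l C') ν') {g : K → ℝ}
    (hg : g ∈ TestFun (D.region l C)) (hg0 : ∀ x, 0 ≤ g x) {r : ℕ} {f : Fin r → K → ℝ}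
    (hf : ∀ i, f i ∈ TestFun (D.region l C)) (hf0 : ∀ i x, 0 ≤ f i x)
    {W : Distr (D.region l C) → ℝ} (hW : D.IsInteraction ν (Q - Polynomial.C lam * X) g W)
    {W' : Distr (D.region l C') → ℝ} (hW' : D.IsInteraction ν' (Q - Polynomial.C lam * X) g W') :
    schwinger ν W f ≤ schwinger ν' W' f := by
  have hreg : D.region l C ⊆ D.region l C' := region_mono hCC'
  -- One cutoff must resolve `g` and all the observables, which `Option (Fin r)` collects in a
  -- single family.
  obtain ⟨κ₁, -, h2, h3⟩ := exists_cutoff D l C i (fun o : Option (Fin r) => o.elim g f) (by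
    rintro (_ | k)
    · exact hg
    · exact hf k)
  refine le_of_tendsto_of_tendsto
    (hν.schwingerConverges hi hQ_even hQ_lead lam hg hg0 hW hf).2
    (hν'.schwingerConverges hi hQ_even hQ_lead lam (testFun_mono hreg hg) hg0 hW'
      fun k => testFun_mono hreg (hf k)).2 ?_
  filter_upwards [eventually_ge_atTop κ₁] with κ hκ
  exact schwinger_regInteraction_le hp hQ_even hQ_lead hlam hCC' hν hν' hg hg0 (by omega)
    ((h3 none).mono (by omega)) hf hf0 fun k => (h3 (some k)).mono (by omega)

end Comparison

end PadicModel

theorem theorem4p2 (p : ℕ) [Fact p.Prime] (hp : p ≠ 2)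
    (K : Type*) [DivisionRing K] [Algebra ℚ_[p] K] [FiniteDimensional ℚ_[p] K]
    [TopologicalSpace K] [T2Space K] [IsTopologicalAddGroup K] [ContinuousSMul ℚ_[p] K]
    [MeasurableSpace K] [BorelSpace K]
    (D : PadicModel p K)
    (Q : ℝ[X]) (hQ_even : ∀ k, Odd k → Q.coeff k = 0) (hQ_lead : 0 < Q.leadingCoeff)
    (lam : ℝ) (hlam : 0 ≤ lam) (P : ℝ[X]) (hP : P = Q - Polynomial.C lam * X)
    (l : ℤ) (C C' : Finset K)
    (hC' : ∀ c ∈ C', ∀ d ∈ C', c ≠ d → D.q ^ l < absK p (c - d)) (hCC' : C ⊆ C')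
    (g : K → ℝ) (hg : g ∈ TestFun (D.region l C)) (hg_nonneg : ∀ x, 0 ≤ g x)
    (r : ℕ) (f : Fin r → K → ℝ) (hf : ∀ i, f i ∈ TestFun (D.region l C))
    (hf_nonneg : ∀ i x, 0 ≤ f i x) :
    -- the lattice approximations
    (D.LatticeConverges l C P g f ∧ D.LatticeConverges l C' P g f ∧
      D.latticeSchwinger l C P g f ≤ D.latticeSchwinger l C' P g f) ∧
    -- the half-Dirichlet Schwinger functions
    (∃ ν : Measure (Distr (D.region l C)), D.IsDirichletField (D.region l C) ν) ∧
    (∃ ν' : Measure (Distr (D.region l C')), D.IsDirichletField (D.region l C') ν') ∧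
    ∀ (ν : Measure (Distr (D.region l C))) (ν' : Measure (Distr (D.region l C'))),
      D.IsDirichletField (D.region l C) ν → D.IsDirichletField (D.region l C') ν' →
      (∃ W, D.IsInteraction ν P g W) ∧ (∃ W', D.IsInteraction ν' P g W') ∧
      ∀ W W', D.IsInteraction ν P g W → D.IsInteraction ν' P g W' →
        SchwingerConverges ν W f ∧ SchwingerConverges ν' W' f ∧
        schwinger ν W f ≤ schwinger ν' W' f := by
  classical
  -- The topological properties of `K` are inherited from its coordinate space over `ℚ_[p]`.
  have := locallyCompactSpace_of_padic p K
  have := secondCountableTopology_of_padic p K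
  have := continuousMul_of_padic p K
  have : TopologicalSpace.MetrizableSpace K := (coordHomeo p K).isEmbedding.metrizableSpace
  have hC'' : D.Separated l C' := hC'
  subst hP
  refine ⟨⟨PadicModel.latticeConverges hQ_even hQ_lead lam (hC''.mono hCC') hg hg_nonneg f,
    PadicModel.latticeConverges hQ_even hQ_lead lam hC'' hg hg_nonneg f,
    PadicModel.latticeSchwinger_le hp hQ_even hQ_lead hlam hC'' hCC' hg hg_nonneg hf hf_nonneg⟩,
    D.exists_isDirichletField l C, D.exists_isDirichletField l C', ?_⟩
  intro ν ν' hν hν'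
  obtain ⟨i, hi⟩ := D.exists_symbol_add_eq hp
  have hreg : D.region l C ⊆ D.region l C' := PadicModel.region_mono hCC'
  have hg' : g ∈ TestFun (D.region l C') := PadicModel.testFun_mono hreg hg
  refine ⟨hν.exists_isInteraction hi Q lam hg, hν'.exists_isInteraction hi Q lam hg',
    fun W W' hW hW' => ⟨?_, ?_, ?_⟩⟩
  · exact (hν.schwingerConverges hi hQ_even hQ_lead lam hg hg_nonneg hW hf).1
  · exact (hν'.schwingerConverges hi hQ_even hQ_lead lam hg' hg_nonneg hW'
      fun k => PadicModel.testFun_mono hreg (hf k)).1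
  · exact PadicModel.schwinger_le hp hi hQ_even hQ_lead hlam hCC' hν hν' hg hg_nonneg hf hf_nonneg
      hW hW'
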